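/- Let $G$ be one of the classical direct limit groups $GL(\infty;\mathbb{D})$, $SL(\infty;\mathbb{D})$ ($\mathbb{D}=\mathbb{R},\mathbb{C},\mathbb{H}$), $U(p,q)$, $SU(p,q)$, $SO(p,q)$, $Spin(p,q)$, $Sp(p,q)$ with $0\le p,q\le\infty$ and $p+q=\infty$, $SO(\infty;\mathbb{C})$, $Spin(\infty;\mathbb{C})$, $Sp(\infty;\mathbb{C})$, $SO^*(2\infty)$, $Sp(\infty;\mathbb{R})$, or the direct limit of the identity components of the finite-dimensional groups defining one of these, with its direct limit topology. Let $V=\mathbb{D}^{(\infty)}$ be its countable-dimensional defining space, paired with $W=\mathbb{D}^{(\infty)}$ (for the groups of a form, including the spin groups, $W$ is identified with $V$ by the form). An expression $G=\varinjlim G_n$ corresponding to $V=\varinjlim V_n$ is given by increasing sequences of finite-dimensional subspaces $V_n\subset V$ and $W_n\subset W$, nondegenerately paired (with $W_n=V_n$ under the identification in the case of a form), such that $\bigcup V_n=V$ and $\bigcup W_n=W$. For the linear groups $G_n$ consists of the $g\in G$ with $g-1\in V_n\otimes W_n$, i.e. it is the classical group of $V_n$, extended by the identity on $W_n^\perp$;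 for the spin groups $G_n=Spin(V_n)$. In the identity component versions $G_n$ is replaced by its identity component. A Cartan involution $\theta_n$ of $G_n$ is a continuous involutive (possibly trivial) automorphism whose fixed point set is a maximal compact subgroup of $G_n$. A subgroup $K\subset G$ is called maximal lim-compact if there are such an expression $G=\varinjlim G_n$ and Cartan involutions $\theta_n$ of $G_n$ with $\theta_{n+1}|_{G_n}=\theta_n$ for all $n$, such that $K=G^\theta=\bigcup_n G_n^{\theta_n}$, where $\theta=\varinjlim\theta_n$. Then any two maximal lim-compact subgroups $K,K'$ of $G$ (possibly coming from different expressions of $G$) are conjugate under ${\rm Aut}(G)$: there is an automorphism $\gamma$ of the group $G$, continuous with continuous inverse for the direct limit topology, such that $\gamma(K)=K'$. -/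

import Mathlib

open scoped Quaternion

noncomputable section

namespace LimGroups

/-! ### Direct limit groups, Cartan involutions and maximal lim-compact subgroups -/

/-- A container for the data of a direct limit group: an ambient group `A`, a set `Idx` of
finite-dimensional pieces, the group `Γ i` of the piece `i` (with the topology induced by that
of `A`), and the predicate saying which sequences of pieces are increasing and exhaust
everything.  It is only ever used for the explicit systems constructed below. -/
structure LimSystem where
  A : Type
  [grp : Group A]
  [top : TopologicalSpace A]
  Idx : Type
  Γ : Idx → Subgroup A
  exhausts : (ℕ → Idx) → Prop

attribute [instance] LimSystem.grp LimSystem.top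

/-- The direct limit group `G`, realized as the union of the (directed) family of the groups of
all finite-dimensional pieces. -/
def LimSystem.G (S : LimSystem) : Subgroup S.A := ⨆ i, S.Γ i

/-- The direct limit topology of `G`: a set is open iff its intersection with the group of each
finite-dimensional piece is open there. -/
@[reducible] def LimSystem.limTop (S : LimSystem) : TopologicalSpace S.G :=
  ⨆ i, TopologicalSpace.coinduced
    (Subgroup.inclusion (le_iSup S.Γ i) : S.Γ i → S.G) inferInstance

/-- The identity component of a subgroup `H` of a group with a topology.  (For the Lie groups
`H` below the identity component is a subgroup, so that taking the subgroup generated by it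
changes nothing.) -/
def idComponent {A : Type} [Group A] [TopologicalSpace A] (H : Subgroup A) : Subgroup A :=
  Subgroup.closure (connectedComponentIn (H : Set A) 1)

/-- The same system with each finite-dimensional group replaced by its identity component. -/
def LimSystem.connected (S : LimSystem) : LimSystem where
  A := S.A
  Idx := S.Idx
  Γ i := idComponent (S.Γ i)
  exhausts := S.exhausts

/-- `K` is a maximal compact subgroup of `H`. -/
def IsMaximalCompact {A : Type} [Group A] [TopologicalSpace A] (H K : Subgroup A) : Prop :=
  K ≤ H ∧ IsCompact (K : Set A) ∧
    ∀ K₁ : Subgroup A, K₁ ≤ H → IsCompact (K₁ : Set A) → K ≤ K₁ → K₁ = K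

/-- The fixed point group of an automorphism of a subgroup `H`, as a subgroup of the ambient
group. -/
def fixedPoints {A : Type} [Group A] {H : Subgroup A} (θ : H ≃* H) : Subgroup A :=
  (θ.toMonoidHom.eqLocus (MonoidHom.id H)).map H.subtype

/-- A Cartan involution of `H`: a continuous involutive automorphism whose fixed point set is a
maximal compact subgroup. -/
def IsCartanInvolution {A : Type} [Group A] [TopologicalSpace A] {H : Subgroup A}
    (θ : H ≃* H) : Prop :=
  Continuous θ ∧ (∀ g, θ (θ g) = g) ∧ IsMaximalCompact H (fixedPoints θ)

/-- A subgroup `K` of `G` is maximal lim-compact if there are an expression `G = lim Gₙ` and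
Cartan involutions `θₙ` of `Gₙ` with `θₙ₊₁ = θₙ` on `Gₙ`, such that `K` is the union of the fixed
point groups of the `θₙ`, i.e. the fixed point group of the involution `θ = lim θₙ`. -/
def IsMaximalLimCompact (S : LimSystem) (K : Subgroup S.G) : Prop :=
  ∃ (L : ℕ → S.Idx) (θ : ∀ n, S.Γ (L n) ≃* S.Γ (L n)),
    S.exhausts L ∧
    (∀ n, IsCartanInvolution (θ n)) ∧
    (∀ (n : ℕ) (g : S.Γ (L n)) (h : S.Γ (L (n + 1))), (h : S.A) = g →
      (θ (n + 1) h : S.A) = θ n g) ∧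
    ∀ g : S.G, g ∈ K ↔ ∃ n, (g : S.A) ∈ fixedPoints (θ n)

/-! ### Finite-dimensional pieces of `V` -/

section Linear

variable (D : Type) [DivisionRing D]

/-- The space `V = D^(∞)` of finitely supported sequences (a left vector space over `D`). -/
abbrev V : Type := ℕ →₀ D

variable {D}

/-- The pairing of `V` with its restricted dual `W = D^(∞)` (row vectors with column vectors). -/
def pair (x w : V D) : D := x.sum fun i a => a * w i

/-- The form on `V` with matrix `h`, sesquilinear for `σ`:
`(x, y) ↦ ∑ i j, xᵢ hᵢⱼ σ(yⱼ)`. -/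
def form (h : ℕ → ℕ → D) (σ : D → D) (x y : V D) : D :=
  x.sum fun i a => y.sum fun j b => a * h i j * σ b

/-- A finite-dimensional piece of the space `V` with the form `B`: a pair of subspaces
`V₁ ⊆ V`, `W₁ ⊆ W` of finite dimension on which the pairing is nondegenerate.  It is recorded by
`V₁` and by the annihilator `C = W₁^⊥ ⊆ V`; that `V₁` and `W₁` are nondegenerately paired means
`V = V₁ ⊕ C`.  If there is a form `B ≠ 0`, then `W₁` has to correspond to `V₁` under the
identification of `V` and `W` given by `B`, that is, `C` is the orthogonal space of `V₁` (and so
`V₁` is nondegenerate).  Where no form is present, `B = 0` and this condition is void. -/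
structure Piece (B : V D → V D → D) where
  V₁ : Submodule D (V D)
  C : Submodule D (V D)
  finite : Module.Finite D V₁
  closed : ∃ s : Finset (V D), ∀ x, x ∈ C ↔ ∀ w ∈ s, pair x w = 0
  isCompl : IsCompl V₁ C
  orth : ∀ x ∈ V₁, ∀ y ∈ C, B x y = 0

/-- The sequence `(Vₙ, Wₙ)` is increasing, with `V = ⋃ Vₙ` and `W = ⋃ Wₙ`. -/
def Piece.Exhausts {B : V D → V D → D} (L : ℕ → Piece B) : Prop :=
  (∀ n, (L n).V₁ ≤ (L (n + 1)).V₁) ∧ (∀ n, (L (n + 1)).C ≤ (L n).C) ∧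
    (∀ x, ∃ n, x ∈ (L n).V₁) ∧ ∀ w, ∃ n, ∀ x ∈ (L n).C, pair x w = 0

/-! ### The linear groups -/

/-- `g` comes from the `N × N` matrices: `g - 1` has range in the span of the first `N` basis
vectors and kills all the others. -/
def IsBlock (N : ℕ) (g : V D ≃ₗ[D] V D) : Prop :=
  (∀ x j, N ≤ j → g x j = x j) ∧ ∀ x : V D, (∀ i < N, x i = 0) → g x = x

/-- The upper left `N × N` block of `g`; rows are the images of the basis vectors. -/
def block (N : ℕ) (g : V D ≃ₗ[D] V D) : Matrix (Fin N) (Fin N) D :=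
  Matrix.of fun i j => g (Finsupp.single (i : ℕ) 1) j

/-- The determinant of the `N × N` block of `g`, after `D` is embedded in the complex
`r × r` matrices by `ρ`. -/
def blockDet {r : ℕ} (ρ : D →+* Matrix (Fin r) (Fin r) ℂ) (N : ℕ) (g : V D ≃ₗ[D] V D) : ℂ :=
  (Matrix.compRingEquiv (Fin N) (Fin r) ℂ (ρ.mapMatrix (block N g))).det

theorem block_one (N : ℕ) : block N (1 : V D ≃ₗ[D] V D) = 1 := by
  ext i j
  simp [block, Matrix.one_apply, Finsupp.single_apply, Fin.ext_iff]

theorem block_mul {N : ℕ} (g h : V D ≃ₗ[D] V D) (hh : IsBlock N h) :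
    block N (g * h) = block N h * block N g := by
  ext i k
  have key : h (Finsupp.single (i : ℕ) 1) =
      ∑ j : Fin N, (h (Finsupp.single (i : ℕ) 1) j) • (Finsupp.single (j : ℕ) (1 : D) : V D) := by
    ext m
    rw [Finsupp.finsetSum_apply]
    by_cases hm : m < N
    · rw [Finset.sum_eq_single (⟨m, hm⟩ : Fin N)]
      · simp
      · intro b _ hb
        have : (b : ℕ) ≠ m := fun e => hb (Fin.ext e)
        simp [this]
      · simp
    · rw [hh.1 _ _ (not_lt.1 hm), Finset.sum_eq_zero]
      · have : (i : ℕ) ≠ m := fun e => hm (e ▸ i.2)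
        simp [this]
      · intro b _
        have : (b : ℕ) ≠ m := fun e => hm (e ▸ b.2)
        simp [this]
  have e : (g * h) (Finsupp.single (i : ℕ) 1) = g (h (Finsupp.single (i : ℕ) 1)) := rfl
  simp only [block, Matrix.of_apply, Matrix.mul_apply]
  rw [e, key, map_sum, Finsupp.finsetSum_apply]
  refine Finset.sum_congr rfl fun j _ => ?_
  rw [map_smul, Finsupp.smul_apply, smul_eq_mul, ← key]

theorem blockDet_mul {r : ℕ} (ρ : D →+* Matrix (Fin r) (Fin r) ℂ) {N : ℕ}
    (g h : V D ≃ₗ[D] V D) (hh : IsBlock N h) :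
    blockDet ρ N (g * h) = blockDet ρ N h * blockDet ρ N g := by
  simp only [blockDet, block_mul g h hh, map_mul, Matrix.det_mul]

theorem blockDet_one {r : ℕ} (ρ : D →+* Matrix (Fin r) (Fin r) ℂ) (N : ℕ) :
    blockDet ρ N 1 = 1 := by
  simp only [blockDet, block_one, map_one, Matrix.det_one]

theorem IsBlock.mul {N : ℕ} {g h : V D ≃ₗ[D] V D} (hg : IsBlock N g) (hh : IsBlock N h) :
    IsBlock N (g * h) := by
  refine ⟨fun x j hj => ?_, fun x hx => ?_⟩
  · change g (h x) j = _
    rw [hg.1 _ _ hj, hh.1 _ _ hj]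
  · change g (h x) = _
    rw [hh.2 _ hx, hg.2 _ hx]

theorem IsBlock.inv {N : ℕ} {g : V D ≃ₗ[D] V D} (hg : IsBlock N g) : IsBlock N g⁻¹ := by
  refine ⟨fun x j hj => ?_, fun x hx => ?_⟩
  · have := hg.1 (g.symm x) j hj
    rw [g.apply_symm_apply] at this
    exact this.symm
  · change g.symm x = x
    rw [LinearEquiv.symm_apply_eq, hg.2 _ hx]

/-- The infinite-dimensional classical group in `GL(∞; D)` (the union of the groups `GL(N; D)`
under `g ↦ diag(g, 1)`) that preserves the form with matrix `h` and, if `special` is `true`, has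
determinant `1`. -/
def linearGroup {r : ℕ} (ρ : D →+* Matrix (Fin r) (Fin r) ℂ) (h : ℕ → ℕ → D) (σ : D → D)
    (special : Bool) : Subgroup (V D ≃ₗ[D] V D) where
  carrier := {g | (∀ᶠ N in Filter.atTop, IsBlock N g ∧ (special = true → blockDet ρ N g = 1)) ∧
    ∀ x y, form h σ (g x) (g y) = form h σ x y}
  one_mem' := by
    refine ⟨Filter.Eventually.of_forall fun N => ⟨⟨fun _ _ _ => rfl, fun _ _ => rfl⟩, fun _ =>
      blockDet_one ρ N⟩, fun _ _ => rfl⟩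
  mul_mem' := by
    rintro a b ⟨ha, ha'⟩ ⟨hb, hb'⟩
    refine ⟨?_, fun x y => (ha' (b x) (b y)).trans (hb' x y)⟩
    filter_upwards [ha, hb] with N h1 h2
    refine ⟨h1.1.mul h2.1, fun hs => ?_⟩
    rw [blockDet_mul ρ a b h2.1, h1.2 hs, h2.2 hs, one_mul]
  inv_mem' := by
    rintro a ⟨ha, ha'⟩
    refine ⟨?_, fun x y => ?_⟩
    · filter_upwards [ha] with N h1
      refine ⟨h1.1.inv, fun hs => ?_⟩
      have := blockDet_mul ρ a a⁻¹ h1.1.inv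
      rwa [mul_inv_cancel, blockDet_one, h1.2 hs, mul_one, eq_comm] at this
    · have := ha' (a.symm x) (a.symm y)
      rw [a.apply_symm_apply, a.apply_symm_apply] at this
      exact this.symm

/-- The linear automorphisms of `V` that come from the piece `(V₁, W₁)`: those `g` for which
`g - 1` has range in `V₁` and vanishes on `W₁^⊥`, i.e. `g - 1 ∈ V₁ ⊗ W₁`. -/
def Piece.stab {B : V D → V D → D} (L : Piece B) : Subgroup (V D ≃ₗ[D] V D) where
  carrier := {g | (∀ x, g x - x ∈ L.V₁) ∧ ∀ x ∈ L.C, g x = x}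
  one_mem' := ⟨fun x => by simp, fun _ _ => rfl⟩
  mul_mem' := by
    rintro a b ⟨ha, ha'⟩ ⟨hb, hb'⟩
    refine ⟨fun x => ?_, fun x hx => ?_⟩
    · have := L.V₁.add_mem (ha (b x)) (hb x)
      rwa [sub_add_sub_cancel] at this
    · change a (b x) = x
      rw [hb' x hx, ha' x hx]
  inv_mem' := by
    rintro a ⟨ha, ha'⟩
    refine ⟨fun x => ?_, fun x hx => ?_⟩
    · have := L.V₁.neg_mem (ha (a.symm x))
      rwa [a.apply_symm_apply, neg_sub] at this
    · change a.symm x = x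
      rw [LinearEquiv.symm_apply_eq, ha' x hx]

/-- The topology on the linear automorphisms of `V` given by the matrix entries.  On the group of
a finite-dimensional piece it is the usual topology of a finite-dimensional matrix group. -/
@[reducible] def entryTop [TopologicalSpace D] : TopologicalSpace (V D ≃ₗ[D] V D) :=
  TopologicalSpace.induced
    (fun g => fun i j : ℕ => g (Finsupp.single i 1) j) inferInstance

/-- The direct system of a linear group: its finite-dimensional groups are those of all pieces of
`V`. -/
def linearSystem [TopologicalSpace D] {r : ℕ} (ρ : D →+* Matrix (Fin r) (Fin r) ℂ)
    (h : ℕ → ℕ → D) (σ : D → D) (special : Bool) : LimSystem where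
  A := V D ≃ₗ[D] V D
  top := entryTop
  Idx := Piece (form h σ)
  Γ L := linearGroup ρ h σ special ⊓ L.stab
  exhausts := Piece.Exhausts

/-- The diagonal matrix with the entries `d i`. -/
def diag (d : ℕ → D) (i j : ℕ) : D := if i = j then d i else 0

/-- The matrix of the standard symplectic form `∑ k, (x₂ₖ y₂ₖ₊₁ - x₂ₖ₊₁ y₂ₖ)`. -/
def symplectic (i j : ℕ) : D :=
  if Even i ∧ j = i + 1 then 1 else if Even j ∧ i = j + 1 then -1 else 0

end Linear

/-! ### The spin groups -/

section Spin

variable {F : Type} [Field F]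

/-- The quadratic form `∑ i, dᵢ xᵢ²` on `V`. -/
def quad (d : ℕ → F) : QuadraticForm F (V F) :=
  LinearMap.BilinMap.toQuadraticMap
    (Finsupp.linearCombination F fun i => d i • (Finsupp.lapply i : V F →ₗ[F] F))

/-- The topology on the units of an algebra over `F` that is induced by all the linear
functionals of the algebra.  On a finite-dimensional subspace it is the usual topology. -/
@[reducible] def dualTop {E : Type} [Ring E] [Algebra F E] [TopologicalSpace F] : TopologicalSpace Eˣ :=
  ⨅ f : Module.Dual F E, TopologicalSpace.induced (fun u : Eˣ => f (u : E)) inferInstance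

/-- The spin group of the nondegenerate finite-dimensional subspace `V₁` of `V`, inside the units
of the Clifford algebra of `V`: the elements of the spin group that lie in the Clifford algebra
of `V₁`, i.e. in the subalgebra generated by `V₁`. -/
def spinOfPiece (d : ℕ → F) (L : Piece (form (diag d) id)) :
    Subgroup (CliffordAlgebra (quad d))ˣ where
  carrier := {u | (u : CliffordAlgebra (quad d)) ∈ spinGroup (quad d) ∧
    (u : CliffordAlgebra (quad d)) ∈
      Algebra.adjoin F (CliffordAlgebra.ι (quad d) '' (L.V₁ : Set (V F)))}
  one_mem' := ⟨Submonoid.one_mem _, Subalgebra.one_mem _⟩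
  mul_mem' := by
    rintro a b ⟨ha, ha'⟩ ⟨hb, hb'⟩
    exact ⟨Submonoid.mul_mem _ ha hb, Subalgebra.mul_mem _ ha' hb'⟩
  inv_mem' := by
    rintro a ⟨ha, ha'⟩
    have e : ((a⁻¹ : (CliffordAlgebra (quad d))ˣ) : CliffordAlgebra (quad d)) =
        star (a : CliffordAlgebra (quad d)) :=
      Units.inv_eq_of_mul_eq_one_right (spinGroup.mul_star_self_of_mem ha)
    refine ⟨e ▸ spinGroup.star_mem ha, ?_⟩
    change ((a⁻¹ : (CliffordAlgebra (quad d))ˣ) : CliffordAlgebra (quad d)) ∈ _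
    rw [e]
    clear e ha
    generalize (a : CliffordAlgebra (quad d)) = z at ha' ⊢
    induction ha' using Algebra.adjoin_induction with
    | mem x hx =>
      obtain ⟨v, hv, rfl⟩ := hx
      rw [CliffordAlgebra.star_ι]
      exact Subalgebra.neg_mem _ (Algebra.subset_adjoin ⟨v, hv, rfl⟩)
    | algebraMap r =>
      rw [CliffordAlgebra.star_algebraMap]
      exact Subalgebra.algebraMap_mem _ r
    | add x y _ _ hx hy => rw [star_add]; exact Subalgebra.add_mem _ hx hy
    | mul x y _ _ hx hy => rw [star_mul]; exact Subalgebra.mul_mem _ hy hx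

/-- The direct system of the spin groups of the quadratic form `∑ i, dᵢ xᵢ²`. -/
def spinSystem [TopologicalSpace F] (d : ℕ → F) : LimSystem where
  A := (CliffordAlgebra (quad d))ˣ
  top := dualTop (F := F)
  Idx := Piece (form (diag d) id)
  Γ := spinOfPiece d
  exhausts := Piece.Exhausts

end Spin

/-! ### The list of the classical groups -/

/-- `ℝ` as complex `1 × 1` matrices. -/
def rhoR : ℝ →+* Matrix (Fin 1) (Fin 1) ℂ := (Matrix.scalar (Fin 1)).comp Complex.ofRealHom

/-- `ℂ` as complex `1 × 1` matrices. -/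
def rhoC : ℂ →+* Matrix (Fin 1) (Fin 1) ℂ := Matrix.scalar (Fin 1)

/-- `ℍ` as complex `2 × 2` matrices; this is the inclusion of `GL(n; ℍ)` in `GL(2n; ℂ)`. -/
def rhoH : ℍ[ℝ] →+* Matrix (Fin 2) (Fin 2) ℂ where
  toFun q := !![⟨q.re, q.imI⟩, ⟨q.imJ, q.imK⟩; ⟨-q.imJ, q.imK⟩, ⟨q.re, -q.imI⟩]
  map_one' := by
    ext i j
    fin_cases i <;> fin_cases j <;> simp [Complex.ext_iff]
  map_zero' := by
    ext i j
    fin_cases i <;> fin_cases j <;> simp [Complex.ext_iff]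
  map_add' a b := by
    ext i j
    fin_cases i <;> fin_cases j <;> simp [Complex.ext_iff] <;> ring
  map_mul' a b := by
    ext i j
    fin_cases i <;> fin_cases j <;> simp [Complex.ext_iff, Matrix.mul_apply] <;>
      constructor <;> ring

/-- The classical direct limit groups.  A sequence `ε` of signs with `p` minus and `q` plus signs
(`p + q = ∞`) gives the groups of signature `(p, q)`. -/
inductive Classical
  /-- `GL(∞; ℝ)` -/
  | glR
  /-- `GL(∞; ℂ)` -/
  | glC
  /-- `GL(∞; ℍ)` -/
  | glH
  /-- `SL(∞; ℝ)` -/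
  | slR
  /-- `SL(∞; ℂ)` -/
  | slC
  /-- `SL(∞; ℍ)` -/
  | slH
  /-- `U(p, q)` -/
  | u (ε : ℕ → ℤˣ)
  /-- `SU(p, q)` -/
  | su (ε : ℕ → ℤˣ)
  /-- `SO(∞; ℂ)` -/
  | soC
  /-- `SO(p, q)` -/
  | so (ε : ℕ → ℤˣ)
  /-- `SO*(2∞)`, given by the form `∑ xₗ i ȳₗ` over the quaternions -/
  | soStar
  /-- `Spin(∞; ℂ)` -/
  | spinC
  /-- `Spin(p, q)` -/
  | spin (ε : ℕ → ℤˣ)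
  /-- `Sp(∞; ℂ)` -/
  | spC
  /-- `Sp(∞; ℝ)` -/
  | spR
  /-- `Sp(p, q)`, the quaternionic unitary group -/
  | sp (ε : ℕ → ℤˣ)

/-- The direct system of a classical group. -/
def Classical.system : Classical → LimSystem
  | glR => linearSystem rhoR (fun _ _ => 0) id false
  | glC => linearSystem rhoC (fun _ _ => 0) id false
  | glH => linearSystem rhoH (fun _ _ => 0) id false
  | slR => linearSystem rhoR (fun _ _ => 0) id true
  | slC => linearSystem rhoC (fun _ _ => 0) id true
  | slH => linearSystem rhoH (fun _ _ => 0) id true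
  | u ε => linearSystem rhoC (diag fun i => ((ε i : ℤ) : ℂ)) star false
  | su ε => linearSystem rhoC (diag fun i => ((ε i : ℤ) : ℂ)) star true
  | soC => linearSystem rhoC (diag fun _ => 1) id true
  | so ε => linearSystem rhoR (diag fun i => ((ε i : ℤ) : ℝ)) id true
  | soStar => linearSystem rhoH (diag fun _ => ⟨0, 1, 0, 0⟩) star false
  | spinC => spinSystem (F := ℂ) fun _ => 1
  | spin ε => spinSystem (F := ℝ) fun i => ((ε i : ℤ) : ℝ)
  | spC => linearSystem rhoC symplectic id false
  | spR => linearSystem rhoR symplectic id false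
  | sp ε => linearSystem rhoH (diag fun i => ((ε i : ℤ) : ℍ[ℝ])) star false

end LimGroups

end

noncomputable section

namespace LimGroups

/-! ### Coefficients -/

/-- The structure shared by `ℝ`, `ℂ` and `ℍ`: a finite-dimensional normed division algebra over
`ℝ` with a conjugation and a real part. -/
class Coeff (D : Type) [NormedDivisionRing D] [NormedAlgebra ℝ D] [StarRing D] where
  re : D →ₗ[ℝ] ℝ
  add_star : ∀ d : D, d + star d = algebraMap ℝ D (2 * re d)
  mul_star : ∀ d : D, d * star d = algebraMap ℝ D (‖d‖ ^ 2)
  re_comm : ∀ a b : D, re (a * b) = re (b * a)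
  fin : FiniteDimensional ℝ D

attribute [instance] Coeff.fin

instance {𝕜 : Type} [RCLike 𝕜] : Coeff 𝕜 where
  re := RCLike.reLm
  add_star d := by
    rw [RCLike.star_def, RCLike.add_conj, map_mul, map_ofNat]
    rfl
  mul_star d := by
    rw [RCLike.star_def, RCLike.mul_conj]
    simp
  re_comm a b := by rw [mul_comm]
  fin := inferInstance

instance : Coeff ℍ[ℝ] where
  re := { toFun := fun q => q.re, map_add' := fun _ _ => rfl, map_smul' := fun r q => by simp }
  add_star d := by
    change d + star d = ((2 * d.re : ℝ) : ℍ[ℝ])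
    ext <;> simp [two_mul]
  mul_star d := by
    rw [Quaternion.self_mul_star, Quaternion.normSq_eq_norm_mul_self, sq]
    rfl
  re_comm a b := by
    change (a * b).re = (b * a).re
    rw [Quaternion.re_mul, Quaternion.re_mul]
    ring
  fin := inferInstance

section CoeffLemmas

variable {D : Type} [NormedDivisionRing D] [NormedAlgebra ℝ D] [StarRing D] [Coeff D]

/-- The real part. -/
def re : D →ₗ[ℝ] ℝ := Coeff.re

/-- The inclusion of the real numbers in `D`. -/
abbrev oR (D : Type) [NormedDivisionRing D] [NormedAlgebra ℝ D] : ℝ →+* D := algebraMap ℝ D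

theorem oR_inj {r s : ℝ} : oR D r = oR D s ↔ r = s := (algebraMap ℝ D).injective.eq_iff

theorem add_star (d : D) : d + star d = oR D (2 * re d) := Coeff.add_star d

theorem mul_star (d : D) : d * star d = oR D (‖d‖ ^ 2) := Coeff.mul_star d

theorem re_mul_comm (a b : D) : re (a * b) = re (b * a) := Coeff.re_comm a b

theorem re_star (d : D) : re (star d) = re d := by
  have h := add_star (star d)
  rw [star_star, add_comm, add_star, oR_inj] at h
  linarith

theorem re_one : re (1 : D) = 1 := by
  have h := add_star (1 : D)
  rw [star_one, one_add_one_eq_two, ← map_ofNat (oR D) 2, oR_inj] at h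
  linarith

theorem re_oR (r : ℝ) : re (oR D r) = r := by
  have : oR D r = r • (1 : D) := Algebra.algebraMap_eq_smul_one r
  rw [this, map_smul, re_one]; simp

theorem star_oR (r : ℝ) : star (oR D r) = oR D r := by
  have h := add_star (oR D r)
  rw [re_oR, two_mul, map_add] at h
  exact add_left_cancel h

theorem norm_oR (r : ℝ) : ‖oR D r‖ = |r| := by
  simp

theorem norm_star' (d : D) : ‖star d‖ = ‖d‖ := by
  rcases eq_or_ne d 0 with rfl | h
  · simp
  have h1 := congrArg norm (mul_star d)
  rw [norm_mul, norm_oR, abs_of_nonneg (by positivity), sq] at h1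
  exact mul_left_cancel₀ (norm_ne_zero_iff.2 h) h1

theorem star_mul' (d : D) : star d * d = oR D (‖d‖ ^ 2) := by
  have := mul_star (star d)
  rwa [star_star, norm_star'] at this

theorem eq_oR_of_star {d : D} (h : star d = d) : d = oR D (re d) := by
  have h1 := add_star d
  rw [h, two_mul, map_add, ← two_mul, ← two_mul] at h1
  exact mul_left_cancel₀ (by
    rw [← map_ofNat (oR D) 2, Ne, map_eq_zero]; norm_num) h1

theorem oR_comm (r : ℝ) (d : D) : oR D r * d = d * oR D r := Algebra.commutes r d

theorem re_oR_mul (r : ℝ) (d : D) : re (oR D r * d) = r * re d := by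
  rw [← Algebra.smul_def, map_smul, smul_eq_mul]

theorem eq_zero_of_re {c : D} (h : ∀ d, re (d * c) = 0) : c = 0 := by
  have := h (star c)
  rw [star_mul', re_oR] at this
  simpa using this

theorem eq_of_re {a b : D} (h : ∀ d, re (d * a) = re (d * b)) : a = b := by
  refine sub_eq_zero.1 (eq_zero_of_re fun d => ?_)
  rw [mul_sub, map_sub, h, sub_self]

theorem re_mul_star (d : D) : re (d * star d) = ‖d‖ ^ 2 := by rw [mul_star, re_oR]

/-- Every real linear functional of `D` is `d ↦ re (d * c)`. -/
theorem exists_re_mul (f : D →ₗ[ℝ] ℝ) : ∃ c : D, ∀ d, f d = re (d * c) := by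
  let Φ : D →ₗ[ℝ] (D →ₗ[ℝ] ℝ) :=
    LinearMap.mk₂ ℝ (fun c d => re (d * c)) (by intros; simp [mul_add]) (by intros; simp)
      (by intros; simp [add_mul]) (by intros; simp)
  have hinj : Function.Injective Φ := by
    refine (injective_iff_map_eq_zero Φ).2 fun c hc => eq_zero_of_re fun d => ?_
    exact LinearMap.congr_fun hc d
  have hsurj : Function.Surjective Φ :=
    (LinearMap.injective_iff_surjective_of_finrank_eq_finrank
      (Subspace.dual_finrank_eq.symm)).1 hinj
  obtain ⟨c, hc⟩ := hsurj f
  exact ⟨c, fun d => by rw [← hc]; rfl⟩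

end CoeffLemmas

/-! ### Hermitian forms -/

section Herm

variable {D : Type} [NormedDivisionRing D] [NormedAlgebra ℝ D] [StarRing D] [Coeff D]
variable {M : Type} [AddCommGroup M] [Module D M] [Module ℝ M] [IsScalarTower ℝ D M]

theorem oR_smul (r : ℝ) (x : M) : oR D r • x = r • x := algebraMap_smul D r x

/-- Hermitian forms, linear in the first argument. -/
structure IsHerm (H : M → M → D) : Prop where
  add_left : ∀ x y z, H (x + y) z = H x z + H y z
  smul_left : ∀ (d : D) x y, H (d • x) y = d * H x y
  star_symm : ∀ x y, star (H x y) = H y x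

namespace IsHerm

variable {H : M → M → D} (hH : IsHerm H)
include hH

/-- `x ↦ H x y` as a linear map. -/
def lin (_ : IsHerm H) (y : M) (hH : IsHerm H) : M →ₗ[D] D where
  toFun x := H x y
  map_add' a b := hH.add_left a b y
  map_smul' d a := hH.smul_left d a y

theorem add_right (x y z : M) : H x (y + z) = H x y + H x z := by
  rw [← hH.star_symm, hH.add_left, star_add, hH.star_symm, hH.star_symm]

theorem smul_right (d : D) (x y : M) : H x (d • y) = H x y * star d := by
  rw [← hH.star_symm, hH.smul_left, star_mul, hH.star_symm]

theorem zero_left (y : M) : H 0 y = 0 := map_zero (hH.lin y hH)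

theorem zero_right (y : M) : H y 0 = 0 := by rw [← hH.star_symm, hH.zero_left, star_zero]

theorem neg_left (x y : M) : H (-x) y = -H x y := map_neg (hH.lin y hH) x

theorem neg_right (x y : M) : H x (-y) = -H x y := by
  rw [← hH.star_symm, hH.neg_left, star_neg, hH.star_symm]

theorem sub_left (x y z : M) : H (x - y) z = H x z - H y z := map_sub (hH.lin z hH) x y

theorem sub_right (x y z : M) : H x (y - z) = H x y - H x z := by
  rw [sub_eq_add_neg, hH.add_right, hH.neg_right, sub_eq_add_neg]

theorem rsmul_left (r : ℝ) (x y : M) : H (r • x) y = oR D r * H x y := by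
  rw [← oR_smul (D := D), hH.smul_left]

theorem rsmul_right (r : ℝ) (x y : M) : H x (r • y) = H x y * oR D r := by
  rw [← oR_smul (D := D), hH.smul_right, star_oR]

theorem sum_left {ι : Type*} (s : Finset ι) (f : ι → M) (y : M) :
    H (∑ i ∈ s, f i) y = ∑ i ∈ s, H (f i) y := map_sum (hH.lin y hH) f s

theorem sum_right {ι : Type*} (s : Finset ι) (f : ι → M) (y : M) :
    H y (∑ i ∈ s, f i) = ∑ i ∈ s, H y (f i) := by
  rw [← hH.star_symm, hH.sum_left, star_sum]
  exact Finset.sum_congr rfl fun i _ => hH.star_symm _ _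

theorem self_eq (x : M) : H x x = oR D (re (H x x)) := eq_oR_of_star (hH.star_symm x x)

theorem eq_zero_symm {x y : M} (h : H x y = 0) : H y x = 0 := by
  rw [← hH.star_symm, h, star_zero]

theorem re_symm (x y : M) : re (H x y) = re (H y x) := by rw [← hH.star_symm, re_star]

end IsHerm

/-- The Hermitian form `H` lives on the summand `U` of `M = U ⊕ C`, is positive definite on `U`, and
is adapted to the form `B` on `U`: `B x y = H x (A y)` with `A² = δ`. -/
structure Adm (B : M → M → D) (δ : ℝ) (U C : Submodule D M) (H : M → M → D) (A : M →ₗ[ℝ] M) :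
    Prop where
  herm : IsHerm H
  pos : ∀ x ∈ U, x ≠ 0 → 0 < re (H x x)
  rad : ∀ c ∈ C, ∀ y, H c y = 0
  A_mem : ∀ y, A y ∈ U
  B_eq : ∀ x ∈ U, ∀ y ∈ U, B x y = H x (A y)
  A_sq : ∀ y ∈ U, A (A y) = δ • y

namespace Adm

variable {B : M → M → D} {δ : ℝ} {U C : Submodule D M} {H : M → M → D} {A : M →ₗ[ℝ] M}
  (h : Adm B δ U C H A)
include h

theorem rad_right {c : M} (hc : c ∈ C) (y : M) : H y c = 0 := h.herm.eq_zero_symm (h.rad c hc y)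

theorem eq_zero {x : M} (hx : x ∈ U) (hxx : H x x = 0) : x = 0 := by
  by_contra hne
  have := h.pos x hx hne
  rw [hxx, map_zero] at this
  exact lt_irrefl _ this

theorem eq_of_H {x y : M} (hx : x ∈ U) (hy : y ∈ U) (hxy : ∀ z ∈ U, H z x = H z y) : x = y := by
  refine sub_eq_zero.1 (h.eq_zero (U.sub_mem hx hy) ?_)
  rw [h.herm.sub_right, hxy _ (U.sub_mem hx hy), sub_self]

theorem nonneg {x : M} (hx : x ∈ U) : 0 ≤ re (H x x) := by
  rcases eq_or_ne x 0 with rfl | hne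
  · rw [h.herm.zero_left, map_zero]
  · exact (h.pos x hx hne).le

/-- A linear map that preserves `B` and `H` commutes with `A`. -/
theorem A_comm {g : M ≃ₗ[D] M} (hg : ∀ x, x ∈ U ↔ g x ∈ U) (hB : ∀ x y, B (g x) (g y) = B x y)
    (hgH : ∀ x y, H (g x) (g y) = H x y) {y : M} (hy : y ∈ U) : A (g y) = g (A y) := by
  refine h.eq_of_H (h.A_mem _) ((hg _).1 (h.A_mem _)) fun z hz => ?_
  obtain ⟨w, rfl⟩ := g.surjective z
  rw [← h.B_eq _ hz _ ((hg _).1 hy), hB, hgH, h.B_eq _ ((hg _).2 hz) _ hy]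

theorem exists_unit {x : M} (hx : x ∈ U) (hne : x ≠ 0) :
    ∃ r : ℝ, 0 < r ∧ H (r • x) (r • x) = 1 := by
  have hp := h.pos x hx hne
  refine ⟨(Real.sqrt (re (H x x)))⁻¹, by positivity, ?_⟩
  rw [h.herm.rsmul_left, h.herm.rsmul_right, h.herm.self_eq, ← map_mul, ← map_mul,
    ← map_one (oR D), oR_inj]
  rw [re_oR]
  have := Real.mul_self_sqrt hp.le
  have h0 : Real.sqrt (re (H x x)) ≠ 0 := by positivity
  field_simp
  nlinarith

end Adm

end Herm

/-! ### The forms and the pieces -/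

section Pieces

variable {D : Type} [DivisionRing D]

theorem pair_eq {x w : V D} {N : ℕ} (hx : ∀ i, N ≤ i → x i = 0) :
    pair x w = ∑ i ∈ Finset.range N, x i * w i := by
  rw [pair, Finsupp.sum_of_support_subset (s := Finset.range N)]
  · intro i hi
    rw [Finset.mem_range]
    by_contra hN
    exact (Finsupp.mem_support_iff.1 hi) (hx i (not_lt.1 hN))
  · simp

theorem pair_eq' {x w : V D} {N : ℕ} (hw : ∀ i, N ≤ i → w i = 0) :
    pair x w = ∑ i ∈ Finset.range N, x i * w i := by
  obtain ⟨K, hK⟩ : ∃ K, ∀ i, K ≤ i → x i = 0 := by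
    refine ⟨x.support.sup id + 1, fun i hi => ?_⟩
    by_contra hne
    have := Finset.le_sup (f := id) (Finsupp.mem_support_iff.2 hne)
    simp only [id] at this
    omega
  rw [pair_eq (N := max K N) fun i hi => hK i (le_trans (le_max_left _ _) hi)]
  refine (Finset.sum_subset (Finset.range_mono (le_max_right _ _)) fun i _ hi => ?_).symm
  rw [hw i (by simpa using hi), mul_zero]

theorem exists_bound (x : V D) : ∃ N, ∀ i, N ≤ i → x i = 0 := by
  refine ⟨x.support.sup id + 1, fun i hi => ?_⟩
  by_contra hne
  have := Finset.le_sup (f := id) (Finsupp.mem_support_iff.2 hne)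
  simp only [id] at this
  omega

theorem pair_add (x y w : V D) : pair (x + y) w = pair x w + pair y w := by
  obtain ⟨N, hN⟩ := exists_bound w
  simp [pair_eq' hN, add_mul, Finset.sum_add_distrib]

theorem pair_smul (d : D) (x w : V D) : pair (d • x) w = d * pair x w := by
  obtain ⟨N, hN⟩ := exists_bound w
  simp [pair_eq' hN, Finset.mul_sum, mul_assoc]

theorem pair_single (x : V D) (j : ℕ) : pair x (Finsupp.single j 1) = x j := by
  rw [pair_eq' (N := j + 1)]
  · rw [Finset.sum_eq_single j]
    · simp
    · intro b _ hb
      simp [Ne.symm hb]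
    · simp
  · intro i hi
    rw [Finsupp.single_eq_of_ne]
    omega

/-- `x ↦ pair x w` as a linear map. -/
def pairLin (w : V D) : V D →ₗ[D] D where
  toFun x := pair x w
  map_add' x y := pair_add x y w
  map_smul' d x := pair_smul d x w

/-- The coordinates `≥ N` of `x` vanish. -/
def below (D : Type) [DivisionRing D] (N : ℕ) : Submodule D (V D) where
  carrier := {x | ∀ i, N ≤ i → x i = 0}
  add_mem' ha hb i hi := by simp [ha i hi, hb i hi]
  zero_mem' := fun i _ => rfl
  smul_mem' d x hx i hi := by simp [hx i hi]

theorem below_mono {N N' : ℕ} (h : N ≤ N') : below D N ≤ below D N' := fun _ hx i hi =>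
  hx i (h.trans hi)

theorem exists_below_of_fg {U : Submodule D (V D)} [Module.Finite D U] : ∃ N, U ≤ below D N := by
  obtain ⟨s, hs⟩ := (Submodule.fg_iff_finiteDimensional U).2 ‹_›
  choose f hf using fun x : V D => exists_bound x
  refine ⟨s.sup f, hs ▸ Submodule.span_le.2 fun x hx i hi => hf x i ?_⟩
  exact le_trans (Finset.le_sup hx) hi

theorem sum_below {x : V D} {N : ℕ} (hx : x ∈ below D N) :
    x = ∑ i ∈ Finset.range N, x i • Finsupp.single i (1 : D) := by
  ext j
  rw [Finsupp.finsetSum_apply]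
  by_cases hj : j < N
  · rw [Finset.sum_eq_single j]
    · simp
    · intro b _ hb; simp [hb]
    · simp [hj]
  · rw [hx j (not_lt.1 hj), Finset.sum_eq_zero]
    intro b hb
    have : b ≠ j := by rintro rfl; exact hj (Finset.mem_range.1 hb)
    simp [this]

end Pieces

section PieceLemmas

variable {D : Type} [DivisionRing D] {B : V D → V D → D}

/-- The order of pieces: `V₁` and `W₁` grow. -/
def Piece.Le (L L' : Piece B) : Prop := L.V₁ ≤ L'.V₁ ∧ L'.C ≤ L.C

theorem Piece.exists_bound (L : Piece B) :
    ∃ N, L.V₁ ≤ below D N ∧ ∀ x : V D, (∀ i < N, x i = 0) → x ∈ L.C := by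
  haveI := L.finite
  obtain ⟨N, hN⟩ := exists_below_of_fg (U := L.V₁)
  obtain ⟨s, hs⟩ := L.closed
  choose f hf using fun x : V D => LimGroups.exists_bound x
  refine ⟨max N (s.sup f), hN.trans (below_mono (le_max_left _ _)), fun x hx => (hs x).2 fun w hw => ?_⟩
  rw [pair_eq' (N := max N (s.sup f)) fun i hi => hf w i
    (le_trans (le_trans (Finset.le_sup hw) (le_max_right _ _)) hi)]
  exact Finset.sum_eq_zero fun i hi => by rw [hx i (Finset.mem_range.1 hi), zero_mul]

theorem Piece.Exhausts.mono {L : ℕ → Piece B} (h : Piece.Exhausts L) {m n : ℕ} (hmn : m ≤ n) :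
    (L m).Le (L n) :=
  ⟨monotone_nat_of_le_succ (f := fun n => (L n).V₁) h.1 hmn,
    antitone_nat_of_succ_le (f := fun n => (L n).C) h.2.1 hmn⟩

theorem Piece.Exhausts.eventually_mem {L : ℕ → Piece B} (h : Piece.Exhausts L)
    (F : Finset (V D)) : ∃ n, ∀ m, n ≤ m → ∀ x ∈ F, x ∈ (L m).V₁ := by
  choose f hf using h.2.2.1
  exact ⟨F.sup f, fun m hm x hx => (h.mono (le_trans (Finset.le_sup hx) hm)).1 (hf x)⟩

theorem Piece.Exhausts.cofinal {L : ℕ → Piece B} (h : Piece.Exhausts L) (P : Piece B) :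
    ∃ n, P.Le (L n) := by
  haveI := P.finite
  obtain ⟨t, ht⟩ := (Submodule.fg_iff_finiteDimensional P.V₁).2 inferInstance
  obtain ⟨s, hs⟩ := P.closed
  obtain ⟨n, hn⟩ := h.eventually_mem t
  choose f hf using h.2.2.2
  refine ⟨max n (s.sup f), ht ▸ Submodule.span_le.2 fun x hx => hn _ (le_max_left _ _) x hx,
    fun x hx => (hs x).2 fun w hw => hf w x ?_⟩
  exact (h.mono (le_trans (Finset.le_sup hw) (le_max_right _ _))).2 hx

/-- The projection of `V` on `V₁` along `C`. -/
def Piece.proj (L : Piece B) : V D →ₗ[D] V D := L.V₁.subtype ∘ₗ L.V₁.projectionOnto L.C L.isCompl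

theorem Piece.proj_mem (L : Piece B) (x : V D) : L.proj x ∈ L.V₁ := Subtype.prop _

theorem Piece.proj_of_mem (L : Piece B) {x : V D} (hx : x ∈ L.V₁) : L.proj x = x :=
  congrArg Subtype.val (Submodule.projectionOnto_apply_left L.isCompl ⟨x, hx⟩)

theorem Piece.proj_of_mem_C (L : Piece B) {x : V D} (hx : x ∈ L.C) : L.proj x = 0 :=
  congrArg Subtype.val (Submodule.projectionOnto_apply_right L.isCompl ⟨x, hx⟩)

theorem Piece.sub_proj_mem (L : Piece B) (x : V D) : x - L.proj x ∈ L.C := by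
  have : L.V₁.projectionOnto L.C L.isCompl (x - L.proj x) = 0 := by
    apply Subtype.ext
    change L.proj (x - L.proj x) = 0
    rw [map_sub, L.proj_of_mem (L.proj_mem x), sub_self]
  rwa [Submodule.projectionOnto_apply_eq_zero_iff] at this

theorem Piece.stab_iff (L : Piece B) (g : V D ≃ₗ[D] V D) (x : V D) (hg : g ∈ L.stab) :
    x ∈ L.V₁ ↔ g x ∈ L.V₁ := by
  have := hg.1 x
  constructor
  · intro h; have h2 := L.V₁.add_mem this h; rwa [sub_add_cancel] at h2
  · intro h; have h2 := L.V₁.sub_mem h this; rwa [sub_sub_cancel] at h2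

theorem Piece.stab_mono {L L' : Piece B} (h : L.Le L') : L.stab ≤ L'.stab := fun _ hg =>
  ⟨fun x => h.1 (hg.1 x), fun x hx => hg.2 x (h.2 hx)⟩

theorem Piece.stab_isBlock {L : Piece B} {N : ℕ} (h1 : L.V₁ ≤ below D N)
    (h2 : ∀ x : V D, (∀ i < N, x i = 0) → x ∈ L.C) {g : V D ≃ₗ[D] V D} (hg : g ∈ L.stab) :
    IsBlock N g :=
  ⟨fun x j hj => by have := h1 (hg.1 x) j hj; rwa [Finsupp.sub_apply, sub_eq_zero] at this,
    fun x hx => hg.2 x (h2 x hx)⟩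

end PieceLemmas

/-! ### Bounded groups of matrices preserve an inner product -/

section Averaging

open Matrix

attribute [local instance] Matrix.frobeniusNormedRing Matrix.frobeniusNormedSpace

theorem frobenius_sq {n : ℕ} (A : Matrix (Fin n) (Fin n) ℝ) : ‖A‖ ^ 2 = ∑ i, ∑ j, A i j ^ 2 := by
  rw [Matrix.frobenius_norm_def, ← Real.sqrt_eq_rpow, Real.sq_sqrt (by positivity)]
  simp

theorem frobenius_parallelogram {n : ℕ} (A B : Matrix (Fin n) (Fin n) ℝ) :
    ‖(1 / 2 : ℝ) • (A + B)‖ ^ 2 = ‖A‖ ^ 2 / 2 + ‖B‖ ^ 2 / 2 - ‖A - B‖ ^ 2 / 4 := by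
  simp only [frobenius_sq, Finset.sum_div, ← Finset.sum_add_distrib, ← Finset.sum_sub_distrib]
  refine Finset.sum_congr rfl fun i _ => Finset.sum_congr rfl fun j _ => ?_
  simp
  ring

theorem dot_mulVec_le {n : ℕ} (t : Matrix (Fin n) (Fin n) ℝ) (y : Fin n → ℝ) :
    (t *ᵥ y) ⬝ᵥ (t *ᵥ y) ≤ ‖t‖ ^ 2 * (y ⬝ᵥ y) := by
  rw [frobenius_sq, Finset.sum_mul]
  refine Finset.sum_le_sum fun i _ => ?_
  rw [← sq]
  refine (Finset.sum_mul_sq_le_sq_mul_sq Finset.univ (t i) y).trans_eq ?_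
  congr 1
  exact Finset.sum_congr rfl fun j _ => sq (y j)

/-- A bounded group of real matrices preserves an inner product. -/
theorem exists_invariant_matrix {n : ℕ} (S : Set (Matrix (Fin n) (Fin n) ℝ)) (h1 : 1 ∈ S)
    (hmul : ∀ a ∈ S, ∀ b ∈ S, a * b ∈ S) (hinv : ∀ s ∈ S, ∃ t ∈ S, t * s = 1) (R : ℝ)
    (hR : ∀ s ∈ S, ∀ i j, |s i j| ≤ R) :
    ∃ P : Matrix (Fin n) (Fin n) ℝ, Pᵀ = P ∧ (∀ x, x ≠ 0 → 0 < x ⬝ᵥ P *ᵥ x) ∧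
      ∀ s ∈ S, sᵀ * P * s = P := by
  obtain ⟨C, hC1, hC⟩ : ∃ C : ℝ, 1 ≤ C ∧ ∀ s ∈ S, ‖s‖ ≤ C := by
    refine ⟨Real.sqrt (∑ i : Fin n, ∑ j : Fin n, R ^ 2) + 1,
      le_add_of_nonneg_left (Real.sqrt_nonneg _), fun s hs => ?_⟩
    have : ‖s‖ ≤ Real.sqrt (∑ i : Fin n, ∑ j : Fin n, R ^ 2) := by
      refine Real.le_sqrt_of_sq_le ?_
      rw [frobenius_sq]
      exact Finset.sum_le_sum fun i _ => Finset.sum_le_sum fun j _ =>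
        sq_le_sq' (abs_le.1 (hR s hs i j)).1 (abs_le.1 (hR s hs i j)).2
    linarith
  have hC0 : 0 < C := by linarith
  have hact : ∀ s ∈ S, ∀ P, ‖sᵀ * P * s‖ ≤ C * ‖P‖ * C := by
    intro s hs P
    refine (norm_mul_le _ _).trans (mul_le_mul ((norm_mul_le _ _).trans ?_) (hC s hs)
      (norm_nonneg _) (by positivity))
    rw [Matrix.frobenius_norm_transpose]
    exact mul_le_mul_of_nonneg_right (hC s hs) (norm_nonneg _)
  let f : Matrix (Fin n) (Fin n) ℝ → ℝ := fun P => ⨆ s : S, ‖s.1ᵀ * P * s.1‖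
  have hbdd : ∀ P, BddAbove (Set.range fun s : S => ‖s.1ᵀ * P * s.1‖) := by
    rintro P
    refine ⟨C * ‖P‖ * C, ?_⟩
    rintro _ ⟨s, rfl⟩
    exact hact s s.2 P
  have hle : ∀ P, ∀ s ∈ S, ‖sᵀ * P * s‖ ≤ f P := fun P s hs => le_ciSup (hbdd P) ⟨s, hs⟩
  have hlsc : LowerSemicontinuous f := by
    refine lowerSemicontinuous_ciSup hbdd fun s => Continuous.lowerSemicontinuous ?_
    fun_prop
  let Ω : Set (Matrix (Fin n) (Fin n) ℝ) := {P | Pᵀ = P ∧ ∀ s ∈ S, ∀ x : Fin n → ℝ,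
    (C ^ 2)⁻¹ * (x ⬝ᵥ x) ≤ (s *ᵥ x) ⬝ᵥ P *ᵥ (s *ᵥ x)}
  have hΩ1 : (1 : Matrix (Fin n) (Fin n) ℝ) ∈ Ω := by
    refine ⟨Matrix.transpose_one, fun s hs x => ?_⟩
    obtain ⟨t, ht, hts⟩ := hinv s hs
    rw [Matrix.one_mulVec]
    have h2 := dot_mulVec_le t (s *ᵥ x)
    rw [Matrix.mulVec_mulVec, hts, Matrix.one_mulVec] at h2
    have h3 : ‖t‖ ^ 2 ≤ C ^ 2 := pow_le_pow_left₀ (norm_nonneg _) (hC t ht) 2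
    have h4 : 0 ≤ (s *ᵥ x) ⬝ᵥ (s *ᵥ x) := Finset.sum_nonneg fun i _ => mul_self_nonneg _
    rw [inv_mul_le_iff₀ (by positivity)]
    nlinarith
  have hΩclosed : IsClosed Ω := by
    have : Ω = {P | Pᵀ = P} ∩ ⋂ s ∈ S, ⋂ x : Fin n → ℝ, {P | (C ^ 2)⁻¹ * (x ⬝ᵥ x) ≤
        (s *ᵥ x) ⬝ᵥ P *ᵥ (s *ᵥ x)} := by
      ext P; simp [Ω]
    rw [this]
    refine (isClosed_eq (by fun_prop) continuous_id).inter (isClosed_biInter fun s _ =>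
      isClosed_iInter fun x => isClosed_le continuous_const ?_)
    exact (continuous_const.dotProduct (Continuous.matrix_mulVec continuous_id continuous_const))
  have hΩact : ∀ P ∈ Ω, ∀ t ∈ S, tᵀ * P * t ∈ Ω := by
    rintro P ⟨hP, hP'⟩ t ht
    refine ⟨by simp [Matrix.transpose_mul, hP, Matrix.mul_assoc], fun s hs x => ?_⟩
    refine (hP' (t * s) (hmul t ht s hs) x).trans_eq ?_
    rw [← Matrix.mulVec_mulVec, ← Matrix.mulVec_mulVec, ← Matrix.mulVec_mulVec,
      Matrix.dotProduct_mulVec (s *ᵥ x) tᵀ, Matrix.vecMul_transpose]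
  have hΩmid : ∀ P ∈ Ω, ∀ Q ∈ Ω, (1 / 2 : ℝ) • (P + Q) ∈ Ω := by
    rintro P ⟨hP, hP'⟩ Q ⟨hQ, hQ'⟩
    refine ⟨by simp [hP, hQ], fun s hs x => ?_⟩
    have a := hP' s hs x
    have b := hQ' s hs x
    rw [Matrix.smul_mulVec, Matrix.add_mulVec, dotProduct_smul, dotProduct_add, smul_eq_mul]
    linarith
  haveI : ProperSpace (Matrix (Fin n) (Fin n) ℝ) := FiniteDimensional.proper_real _
  obtain ⟨P, ⟨hPΩ, hPb⟩, hPmin⟩ := LowerSemicontinuousOn.exists_isMinOn (f := f)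
    (s := Ω ∩ Metric.closedBall 0 (f 1))
    ⟨1, hΩ1, by
      rw [mem_closedBall_zero_iff]
      simpa using hle 1 1 h1⟩
    ((isCompact_closedBall (0 : Matrix (Fin n) (Fin n) ℝ) (f 1)).inter_left hΩclosed)
    (hlsc.lowerSemicontinuousOn _)
  have hmin : ∀ Q ∈ Ω, f P ≤ f Q := by
    intro Q hQ
    by_cases hQb : Q ∈ Metric.closedBall (0 : Matrix (Fin n) (Fin n) ℝ) (f 1)
    · exact hPmin ⟨hQ, hQb⟩
    · rw [mem_closedBall_zero_iff, not_le] at hQb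
      have h2 : f P ≤ f 1 := hPmin ⟨hΩ1, by
        rw [mem_closedBall_zero_iff]
        simpa using hle 1 1 h1⟩
      have h3 := hle Q 1 h1
      simp only [Matrix.transpose_one, one_mul, mul_one] at h3
      linarith
  refine ⟨P, hPΩ.1, fun x hx => ?_, fun t ht => ?_⟩
  · have h2 := hPΩ.2 1 h1 x
    rw [Matrix.one_mulVec] at h2
    have h3 : 0 < x ⬝ᵥ x := by
      refine lt_of_le_of_ne (Finset.sum_nonneg fun i _ => mul_self_nonneg _) fun h => hx ?_
      exact dotProduct_self_eq_zero.1 h.symm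
    exact lt_of_lt_of_le (by positivity) h2
  · by_contra hne
    set Q := tᵀ * P * t with hQ
    have hQΩ := hΩact P hPΩ t ht
    have hfQ : f Q ≤ f P := by
      haveI : Nonempty S := ⟨⟨1, h1⟩⟩
      refine ciSup_le fun s => ?_
      refine le_trans (le_of_eq ?_) (hle P (t * s) (hmul t ht s s.2))
      simp [hQ, Matrix.transpose_mul, Matrix.mul_assoc]
    have hd : 0 < ‖Q - P‖ := norm_pos_iff.2 (sub_ne_zero.2 hne)
    have hf0 : 0 ≤ f P := (norm_nonneg _).trans (hle P 1 h1)
    have hkey : ∀ s ∈ S, ‖sᵀ * ((1 / 2 : ℝ) • (Q + P)) * s‖ ^ 2 ≤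
        f P ^ 2 - ‖Q - P‖ ^ 2 / (4 * (C * C) ^ 2) := by
      intro s hs
      have e : sᵀ * ((1 / 2 : ℝ) • (Q + P)) * s =
          (1 / 2 : ℝ) • (sᵀ * Q * s + sᵀ * P * s) := by
        rw [Matrix.mul_smul, Matrix.smul_mul, mul_add, add_mul]
      rw [e, frobenius_parallelogram]
      obtain ⟨u, hu, hus⟩ := hinv s hs
      have hsu : s * u = 1 := mul_eq_one_comm.1 hus
      have a1 : ‖Q - P‖ ≤ C * ‖sᵀ * Q * s - sᵀ * P * s‖ * C := by
        refine le_trans (le_of_eq ?_) (hact u hu _)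
        congr 1
        have : uᵀ * sᵀ = 1 := by rw [← Matrix.transpose_mul, hsu, Matrix.transpose_one]
        rw [← sub_mul, ← mul_sub]
        calc Q - P = (uᵀ * sᵀ) * (Q - P) * (s * u) := by rw [this, hsu, one_mul, mul_one]
          _ = _ := by simp only [Matrix.mul_assoc]
      have a2 : ‖sᵀ * Q * s‖ ^ 2 ≤ f P ^ 2 :=
        pow_le_pow_left₀ (norm_nonneg _) ((hle Q s hs).trans hfQ) 2
      have a3 : ‖sᵀ * P * s‖ ^ 2 ≤ f P ^ 2 := pow_le_pow_left₀ (norm_nonneg _) (hle P s hs) 2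
      have a4 : ‖Q - P‖ ^ 2 / (4 * (C * C) ^ 2) ≤ ‖sᵀ * Q * s - sᵀ * P * s‖ ^ 2 / 4 := by
        rw [div_le_div_iff₀ (by positivity) (by norm_num)]
        have := pow_le_pow_left₀ (norm_nonneg _) a1 2
        nlinarith
      linarith
    have hlt : f ((1 / 2 : ℝ) • (Q + P)) ≤
        Real.sqrt (f P ^ 2 - ‖Q - P‖ ^ 2 / (4 * (C * C) ^ 2)) := by
      haveI : Nonempty S := ⟨⟨1, h1⟩⟩
      exact ciSup_le fun s => Real.le_sqrt_of_sq_le (hkey s s.2)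
    have h5 := (hmin _ (hΩmid _ hQΩ _ hPΩ)).trans hlt
    have h6 : 0 < ‖Q - P‖ ^ 2 / (4 * (C * C) ^ 2) := by positivity
    rcases le_or_gt 0 (f P ^ 2 - ‖Q - P‖ ^ 2 / (4 * (C * C) ^ 2)) with h7 | h7
    · have := pow_le_pow_left₀ hf0 h5 2
      rw [Real.sq_sqrt h7] at this
      linarith
    · have := (sq_nonneg _).trans (hkey 1 h1)
      linarith

end Averaging

/-! ### The square root of a positive operator -/

section Polar

open Polynomial

theorem commute_aeval {E : Type} [AddCommGroup E] [Module ℝ E] {R S : Module.End ℝ E}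
    (h : Commute R S) (p : ℝ[X]) : Commute R (aeval S p) := by
  induction p using Polynomial.induction_on' with
  | add p q hp hq => rw [map_add]; exact hp.add_right hq
  | monomial n a =>
    rw [aeval_monomial]
    exact (Algebra.commute_algebraMap_right a R).mul_right (h.pow_right n)

/-- The positive square root of a positive definite operator commutes with everything that commutes
with the operator. -/
theorem exists_sqrt {E : Type} [NormedAddCommGroup E] [InnerProductSpace ℝ E]
    [FiniteDimensional ℝ E] (S : Module.End ℝ E) (hS : S.IsSymmetric)
    (hpos : ∀ x, x ≠ 0 → 0 < inner ℝ (S x) x) :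
    ∃ P : Module.End ℝ E, P.IsSymmetric ∧ (∀ x, x ≠ 0 → 0 < inner ℝ (P x) x) ∧ P * P = S ∧
      ∀ R, Commute R S → Commute R P := by
  classical
  let b := hS.eigenvectorBasis rfl
  let ev := hS.eigenvalues rfl
  have hb : ∀ i, S (b i) = ev i • b i := fun i => hS.apply_eigenvectorBasis rfl i
  have hev : ∀ i, 0 < ev i := by
    intro i
    have h1 := hpos (b i) (b.orthonormal.ne_zero i)
    rw [hb, inner_smul_left, real_inner_self_eq_norm_sq, b.orthonormal.1 i] at h1
    simpa using h1
  let s : Finset ℝ := Finset.univ.image ev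
  let p : ℝ[X] := Lagrange.interpolate s id Real.sqrt
  have hp : ∀ i, p.eval (ev i) = Real.sqrt (ev i) := fun i =>
    Lagrange.eval_interpolate_at_node (s := s) (v := id) Real.sqrt (Set.injOn_id _)
      (Finset.mem_image_of_mem _ (Finset.mem_univ i))
  let P : Module.End ℝ E := aeval S p
  have hP : ∀ i, P (b i) = Real.sqrt (ev i) • b i := by
    intro i
    rw [← hp i]
    exact Module.End.aeval_apply_of_hasEigenvector
      ⟨Module.End.mem_eigenspace_iff.2 (hb i), b.orthonormal.ne_zero i⟩
  have hPx : ∀ x, P x = ∑ i, Real.sqrt (ev i) • (inner ℝ (b i) x • b i) := by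
    intro x
    conv_lhs => rw [← b.sum_repr' x]
    rw [map_sum]
    refine Finset.sum_congr rfl fun i _ => ?_
    rw [map_smul, hP, smul_comm]
  have hPin : ∀ x y, inner ℝ (P x) y = ∑ i, Real.sqrt (ev i) * (inner ℝ (b i) x * inner ℝ (b i) y) := by
    intro x y
    rw [hPx, sum_inner]
    refine Finset.sum_congr rfl fun i _ => ?_
    rw [inner_smul_left, inner_smul_left]
    simp
  refine ⟨P, fun x y => ?_, fun x hx => ?_, ?_, fun R hR => commute_aeval hR p⟩
  · rw [hPin x y, real_inner_comm (P y) x, hPin y x]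
    exact Finset.sum_congr rfl fun i _ => by ring
  · rw [hPin]
    have hnn : ∀ i ∈ Finset.univ, 0 ≤ Real.sqrt (ev i) * (inner ℝ (b i) x * inner ℝ (b i) x) :=
      fun i _ => mul_nonneg (Real.sqrt_nonneg _) (mul_self_nonneg _)
    refine lt_of_le_of_ne (Finset.sum_nonneg hnn) fun h => hx ?_
    have h0 := (Finset.sum_eq_zero_iff_of_nonneg hnn).1 h.symm
    rw [← b.sum_repr' x]
    refine Finset.sum_eq_zero fun i hi => ?_
    have h1 := h0 i hi
    have h2 : Real.sqrt (ev i) ≠ 0 := (Real.sqrt_pos.2 (hev i)).ne'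
    have h3 : inner ℝ (b i) x = (0 : ℝ) := by
      simpa [h2] using h1
    rw [h3, zero_smul]
  · refine b.toBasis.ext fun i => ?_
    rw [OrthonormalBasis.coe_toBasis, Module.End.mul_apply, hP, map_smul, hP, smul_smul,
      Real.mul_self_sqrt (hev i).le, hb]

end Polar

/-! ### Existence of adapted Hermitian forms -/

section Existence

variable {D : Type} [NormedDivisionRing D] [NormedAlgebra ℝ D] [StarRing D] [Coeff D]

/-- The properties of the forms that define the classical groups. -/
structure IsForm {M : Type} [AddCommGroup M] [Module D M] (B : M → M → D) (σ : D → D) (δ : ℝ) :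
    Prop where
  add_left : ∀ x y z, B (x + y) z = B x z + B y z
  smul_left : ∀ (d : D) x y, B (d • x) y = d * B x y
  add_right : ∀ x y z, B x (y + z) = B x y + B x z
  smul_right : ∀ (d : D) x y, B x (d • y) = B x y * σ d
  invol : ∀ d, star (σ (star (σ d))) = d
  real : ∀ r : ℝ, σ (oR D r) = oR D r
  re_symm : ∀ x y, re (B y x) = δ * re (B x y)
  nondeg : δ ≠ 0 → ∀ x, (∀ y, B x y = 0) → x = 0
  delta : δ = 0 ∨ δ = 1 ∨ δ = -1
  eq_zero : δ = 0 → ∀ x y, B x y = 0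

theorem IsForm.refl {M : Type} [AddCommGroup M] [Module D M] {B : M → M → D} {σ : D → D} {δ : ℝ}
    (hB : IsForm B σ δ) {x y : M} (h : B x y = 0) : B y x = 0 :=
  eq_zero_of_re fun d => by
    rw [← hB.smul_left, hB.re_symm x, hB.smul_right, h, zero_mul, map_zero, mul_zero]

section Real

variable {E : Type} [AddCommGroup E] [Module D E] [Module ℝ E] [IsScalarTower ℝ D E]
  [FiniteDimensional ℝ E]

/-- `D`-linear maps as real linear maps. -/
abbrev toReal (g : E →ₗ[D] E) : E →ₗ[ℝ] E where
  toFun := g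
  map_add' := g.map_add
  map_smul' r x := by
    rw [← oR_smul (D := D), map_smul, oR_smul]
    rfl

/-- Multiplication with a scalar as a real linear map. -/
abbrev scal (d : D) : E →ₗ[ℝ] E where
  toFun x := d • x
  map_add' := smul_add d
  map_smul' r x := by
    rw [← oR_smul (D := D), ← oR_smul (D := D), smul_smul, smul_smul]
    exact congrArg (· • x) (oR_comm r d).symm

/-- A bounded group of `D`-linear maps preserves an inner product that is compatible with the
scalars. -/
theorem exists_invariant_inner (S : Set (E →ₗ[D] E)) (h1 : LinearMap.id ∈ S)
    (hmul : ∀ a ∈ S, ∀ b ∈ S, a ∘ₗ b ∈ S) (hinv : ∀ s ∈ S, ∃ t ∈ S, t ∘ₗ s = LinearMap.id)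
    (hbd : ∀ (f : E →ₗ[ℝ] ℝ) (x : E), ∃ R, ∀ s ∈ S, |f (s x)| ≤ R) :
    ∃ h : E →ₗ[ℝ] E →ₗ[ℝ] ℝ, (∀ x y, h x y = h y x) ∧ (∀ x, x ≠ 0 → 0 < h x x) ∧
      (∀ s ∈ S, ∀ x y, h (s x) (s y) = h x y) ∧ ∀ (d : D) x y, h (d • x) y = h x (star d • y) := by
  classical
  let b := Module.finBasis ℝ E
  let mat : (E →ₗ[ℝ] E) → Matrix _ _ ℝ := LinearMap.toMatrix b b
  let S' : Set (Matrix (Fin (Module.finrank ℝ E)) (Fin (Module.finrank ℝ E)) ℝ) :=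
    {m | ∃ s ∈ S, ∃ u : D, ‖u‖ = 1 ∧ m = mat (scal u ∘ₗ toReal s)}
  have hmm : ∀ f g, mat (f ∘ₗ g) = mat f * mat g := fun f g => LinearMap.toMatrix_comp b b b f g
  have hbd' : ∃ R, ∀ m ∈ S', ∀ i j, |m i j| ≤ R := by
    choose R hR using hbd
    have hK : ∀ i k, ∃ K, ∀ u : D, |b.coord i (u • b k)| ≤ K * ‖u‖ := by
      intro i k
      let f : D →ₗ[ℝ] ℝ :=
        { toFun := fun u => b.coord i (u • b k)
          map_add' := fun u v => by rw [add_smul, map_add]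
          map_smul' := fun r u => by
            rw [smul_assoc, map_smul]; rfl }
      exact ⟨‖LinearMap.toContinuousLinearMap f‖,
        fun u => (LinearMap.toContinuousLinearMap f).le_opNorm u⟩
    choose K hK using hK
    refine ⟨∑ i, ∑ j, ∑ k, |R (b.coord k) (b j)| * |K i k|, ?_⟩
    rintro m ⟨s, hs, u, hu, rfl⟩ i j
    have e : mat (scal u ∘ₗ toReal s) i j = ∑ k, b.coord k (s (b j)) * b.coord i (u • b k) := by
      change LinearMap.toMatrix b b _ i j = _
      rw [LinearMap.toMatrix_apply]
      change b.coord i (scal u (s (b j))) = _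
      conv_lhs => rw [← b.sum_repr (s (b j))]
      rw [map_sum, map_sum]
      refine Finset.sum_congr rfl fun k _ => ?_
      rw [map_smul, map_smul]
      rfl
    rw [e]
    have h0 : ∀ i' j', 0 ≤ ∑ k, |R (b.coord k) (b j')| * |K i' k| := fun i' j' =>
      Finset.sum_nonneg fun k _ => by positivity
    refine le_trans ?_ ((Finset.single_le_sum (f := fun j' => ∑ k, |R (b.coord k) (b j')| * |K i k|)
      (fun j' _ => h0 i j') (Finset.mem_univ j)).trans
      (Finset.single_le_sum (f := fun i' => ∑ j', ∑ k, |R (b.coord k) (b j')| * |K i' k|)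
        (fun i' _ => Finset.sum_nonneg fun j' _ => h0 i' j') (Finset.mem_univ i)))
    refine (Finset.abs_sum_le_sum_abs _ _).trans (Finset.sum_le_sum fun k _ => ?_)
    rw [abs_mul]
    refine mul_le_mul ((hR _ _ s hs).trans (le_abs_self _)) ?_ (abs_nonneg _) (abs_nonneg _)
    have := hK i k u
    rw [hu, mul_one] at this
    exact this.trans (le_abs_self _)
  obtain ⟨R, hR⟩ := hbd'
  obtain ⟨P, hPt, hPpos, hPinv⟩ := exists_invariant_matrix S'
    ⟨LinearMap.id, h1, 1, norm_one, by
      have : scal (1 : D) ∘ₗ toReal (LinearMap.id : E →ₗ[D] E) = LinearMap.id := by ext; simp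
      rw [this]
      exact (LinearMap.toMatrix_id b).symm⟩
    (by
      rintro _ ⟨s, hs, u, hu, rfl⟩ _ ⟨t, ht, v, hv, rfl⟩
      refine ⟨s ∘ₗ t, hmul s hs t ht, u * v, by rw [norm_mul, hu, hv, one_mul], ?_⟩
      rw [← hmm]
      congr 1
      ext x
      change u • s (v • t x) = (u * v) • s (t x)
      rw [map_smul, smul_smul])
    (by
      rintro _ ⟨s, hs, u, hu, rfl⟩
      obtain ⟨t, ht, hts⟩ := hinv s hs
      refine ⟨_, ⟨t, ht, u⁻¹, by rw [norm_inv, hu, inv_one], rfl⟩, ?_⟩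
      rw [← hmm, ← LinearMap.toMatrix_id b]
      congr 1
      ext x
      change u⁻¹ • t (u • s x) = x
      have : t (s x) = x := LinearMap.congr_fun hts x
      have hu0 : u ≠ 0 := by rintro rfl; simp at hu
      rw [map_smul, smul_smul, inv_mul_cancel₀ hu0, one_smul, this])
    R hR
  let h : E →ₗ[ℝ] E →ₗ[ℝ] ℝ := Matrix.toLinearMap₂ b b P
  have hh : ∀ x y, h x y = dotProduct (b.repr x) (P.mulVec (b.repr y)) := by
    intro x y
    change Matrix.toLinearMap₂ b b P x y = _
    rw [Matrix.toLinearMap₂_apply]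
    refine Finset.sum_congr rfl fun i _ => ?_
    rw [Matrix.mulVec, dotProduct, Finset.mul_sum]
    refine Finset.sum_congr rfl fun j _ => ?_
    change b.repr x i * (b.repr y j * P i j) = b.repr x i * (P i j * b.repr y j)
    ring
  have hmat : ∀ (f : E →ₗ[ℝ] E), mat f ∈ S' → ∀ x y, h (f x) (f y) = h x y := by
    intro f hf x y
    have e : ∀ z, ⇑(b.repr (f z)) = (mat f).mulVec (b.repr z) := fun z =>
      (LinearMap.toMatrix_mulVec_repr b b f z).symm
    rw [hh, hh, e, e]
    conv_rhs => rw [← hPinv _ hf]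
    rw [← Matrix.mulVec_mulVec, ← Matrix.mulVec_mulVec,
      Matrix.dotProduct_mulVec (b.repr x) (mat f).transpose, Matrix.vecMul_transpose]
  have hS : ∀ s ∈ S, ∀ x y, h (s x) (s y) = h x y := fun s hs x y =>
    hmat (toReal s) ⟨s, hs, 1, norm_one, congrArg mat (by ext; simp)⟩ x y
  have hu : ∀ u : D, ‖u‖ = 1 → ∀ x y, h (u • x) (u • y) = h x y := fun u hu x y =>
    hmat (scal u) ⟨LinearMap.id, h1, u, hu, congrArg mat (by ext; rfl)⟩ x y
  have hsymm : ∀ x y, h x y = h y x := by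
    intro x y
    rw [hh, hh, Matrix.dotProduct_mulVec, ← Matrix.mulVec_transpose, hPt, dotProduct_comm]
  refine ⟨h, hsymm, fun x hx => ?_, hS, fun d x y => ?_⟩
  · rw [hh]
    refine hPpos _ fun h0 => hx ?_
    exact b.repr.map_eq_zero_iff.1 (DFunLike.coe_injective h0)
  · rcases eq_or_ne d 0 with rfl | hd
    · simp
    have hn : ‖d‖ ≠ 0 := norm_ne_zero_iff.2 hd
    have h2 := hu (oR D (‖d‖⁻¹) * d) (by
      rw [norm_mul, norm_oR, abs_of_nonneg (by positivity), inv_mul_cancel₀ hn]) x (star d • y)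
    have hl : ∀ (r : ℝ) x y, h (r • x) y = r * h x y := fun r x y => by
      rw [h.map_smul, LinearMap.smul_apply, smul_eq_mul]
    have hr : ∀ (r : ℝ) x y, h x (r • y) = r * h x y := fun r x y => by
      rw [(h x).map_smul, smul_eq_mul]
    rw [mul_smul, mul_smul, oR_smul, oR_smul, hl, hr, smul_smul d, mul_star, oR_smul, hr] at h2
    rw [← h2]
    field_simp

variable {B : E → E → D} {σ : D → D} {δ : ℝ}

/-- Polar decomposition of a form with respect to an inner product. -/
theorem exists_polar (hB : IsForm B σ δ) (hδ : δ ≠ 0) (h : E →ₗ[ℝ] E →ₗ[ℝ] ℝ)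
    (hsymm : ∀ x y, h x y = h y x) (hpos : ∀ x, x ≠ 0 → 0 < h x x)
    (hD : ∀ (d : D) x y, h (d • x) y = h x (star d • y)) :
    ∃ (h' : E →ₗ[ℝ] E →ₗ[ℝ] ℝ) (A : E →ₗ[ℝ] E), (∀ x y, h' x y = h' y x) ∧
      (∀ x, x ≠ 0 → 0 < h' x x) ∧ (∀ (d : D) x y, h' (d • x) y = h' x (star d • y)) ∧
      (∀ x y, re (B x y) = h' x (A y)) ∧ (∀ x, A (A x) = δ • x) ∧
      ∀ g : E →ₗ[D] E, Function.Surjective g → (∀ x y, h (g x) (g y) = h x y) →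
        (∀ x y, B (g x) (g y) = B x y) → ∀ x y, h' (g x) (g y) = h' x y := by
  let core : InnerProductSpace.Core ℝ E :=
    { inner := fun x y => h x y
      conj_inner_symm := fun x y => hsymm y x
      re_inner_nonneg := fun x => by
        rcases eq_or_ne x 0 with rfl | hx
        · simp
        · exact (hpos x hx).le
      definite := fun x hx => by
        by_contra hne
        exact (hpos x hne).ne' hx
      add_left := fun x y z => by simp
      smul_left := fun x y r => by simp }
  letI : NormedAddCommGroup E := core.toNormedAddCommGroup
  letI : InnerProductSpace ℝ E := InnerProductSpace.ofCore core.toCore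
  have hin : ∀ x y : E, inner ℝ x y = h x y := fun _ _ => rfl
  have hδ2 : δ * δ = 1 := by rcases hB.delta with h | h | h <;> simp_all
  have heq : ∀ x y : E, (∀ z, h z x = h z y) → x = y := fun x y hxy =>
    ext_inner_left ℝ fun z => hxy z
  have hflip : ∀ z w : E, h.flip z w = h w z := fun _ _ => rfl
  have hinj : Function.Injective h.flip := by
    refine (injective_iff_map_eq_zero h.flip).2 fun x hx => heq x 0 fun z => ?_
    rw [← hflip, hx, map_zero]; rfl
  have hsurj : Function.Surjective h.flip :=
    (LinearMap.injective_iff_surjective_of_finrank_eq_finrank Subspace.dual_finrank_eq.symm).1 hinj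
  let Φ := LinearEquiv.ofBijective h.flip ⟨hinj, hsurj⟩
  have hΦ : ∀ y z, h z (Φ.symm y) = y z := by
    intro y z
    have : Φ (Φ.symm y) = y := Φ.apply_symm_apply y
    conv_rhs => rw [← this]
    rfl
  let Ψ : E →ₗ[ℝ] E →ₗ[ℝ] ℝ := LinearMap.mk₂ ℝ (fun y x => re (B x y))
    (by intros; rw [hB.add_right, map_add])
    (by
      intro r x y
      rw [← oR_smul (D := D), hB.smul_right, hB.real, ← oR_comm, re_oR_mul, smul_eq_mul])
    (by intros; rw [hB.add_left, map_add])
    (by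
      intro r x y
      rw [← oR_smul (D := D), hB.smul_left, re_oR_mul, smul_eq_mul])
  let A₀ : Module.End ℝ E := Φ.symm.toLinearMap ∘ₗ Ψ
  have hA₀ : ∀ x y, h x (A₀ y) = re (B x y) := fun x y => hΦ (Ψ y) x
  have hA₀s : ∀ x y, h (A₀ x) y = δ * h x (A₀ y) := by
    intro x y
    rw [hsymm, hA₀, hA₀, hB.re_symm x y]
  have hA₀0 : ∀ x, A₀ x = 0 → x = 0 := by
    intro x hx
    refine hB.nondeg hδ x fun y => hB.refl (eq_zero_of_re fun d => ?_)
    rw [← hB.smul_left, ← hA₀, hx, map_zero]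
  let S : Module.End ℝ E := δ • (A₀ * A₀)
  have hSA : ∀ x y, h (S x) y = h (A₀ x) (A₀ y) := by
    intro x y
    change h (δ • A₀ (A₀ x)) y = _
    rw [map_smul, LinearMap.smul_apply, hA₀s, smul_eq_mul, ← mul_assoc, hδ2, one_mul]
  obtain ⟨P, hPs, hPpos, hPP, hPc⟩ := exists_sqrt S
    (fun x y => by
      change h (S x) y = h x (S y)
      rw [hSA, hsymm x, hSA, hsymm])
    (fun x hx => by
      change 0 < h (S x) x
      rw [hSA]
      exact hpos _ fun h0 => hx (hA₀0 x h0))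
  have hPs' : ∀ x y, h (P x) y = h x (P y) := hPs
  have hPpos' : ∀ x, x ≠ 0 → 0 < h (P x) x := hPpos
  have hPinj : Function.Injective P := by
    refine (injective_iff_map_eq_zero P).2 fun x hx => ?_
    by_contra hne
    have := hPpos' x hne
    rw [hx, map_zero] at this
    exact lt_irrefl _ this
  let Pe := LinearEquiv.ofInjectiveEndo P hPinj
  have hPe : ∀ y, P (Pe.symm y) = y := fun y => Pe.apply_symm_apply y
  let A : E →ₗ[ℝ] E := Pe.symm.toLinearMap ∘ₗ A₀
  have hPA : ∀ y, P (A y) = A₀ y := fun y => hPe _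
  have hPA₀ : ∀ y, P (A₀ y) = A₀ (P y) := by
    have : Commute A₀ S := by
      change A₀ * (δ • (A₀ * A₀)) = (δ • (A₀ * A₀)) * A₀
      rw [mul_smul_comm, smul_mul_assoc, mul_assoc]
    exact fun y => (LinearMap.congr_fun (hPc A₀ this) y).symm
  refine ⟨h ∘ₗ P, A, fun x y => ?_, hPpos', fun d x y => ?_, fun x y => ?_, fun x => ?_,
    fun g hgs hgh hgB x y => ?_⟩
  · change h (P x) y = h (P y) x
    rw [hPs', hsymm]
  · change h (P (d • x)) y = h (P x) (star d • y)
    have e : ∀ d x, A₀ (d • x) = star (σ d) • A₀ x := by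
      intro d x
      refine heq _ _ fun z => ?_
      rw [hA₀, hB.smul_right, re_mul_comm, ← hB.smul_left, ← hA₀, hD]
    have : Commute (scal d) S := by
      refine LinearMap.ext fun x => ?_
      change d • (δ • A₀ (A₀ x)) = δ • A₀ (A₀ (d • x))
      rw [e, e, hB.invol]
      exact (scal d : E →ₗ[ℝ] E).map_smul δ _
    have e2 : P (d • x) = d • P x := (LinearMap.congr_fun (hPc _ this) x).symm
    rw [e2, hD]
  · change _ = h (P x) (A y)
    rw [hPs', hPA, hA₀]
  · have h2 : ∀ y, A₀ (A₀ y) = δ • P (P y) := by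
      intro y
      have : P (P y) = δ • A₀ (A₀ y) := LinearMap.congr_fun hPP y
      rw [this, smul_smul, hδ2, one_smul]
    apply hPinj
    apply hPinj
    rw [hPA, hPA₀, hPA, h2, map_smul, map_smul]
  · change h (P (g x)) (g y) = h (P x) y
    have e : ∀ x, A₀ (g x) = g (A₀ x) := by
      intro x
      refine heq _ _ fun z => ?_
      obtain ⟨w, rfl⟩ := hgs z
      rw [hA₀, hgB, hgh, hA₀]
    have : Commute (toReal g) S := by
      refine LinearMap.ext fun x => ?_
      change g (δ • A₀ (A₀ x)) = δ • A₀ (A₀ (g x))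
      rw [e, e]
      exact (toReal g).map_smul δ _
    have e2 : P (g x) = g (P x) := (LinearMap.congr_fun (hPc _ this) x).symm
    rw [e2, hgh]

end Real

variable {M : Type} [AddCommGroup M] [Module D M] [Module ℝ M] [IsScalarTower ℝ D M]
variable {B : M → M → D} {σ : D → D} {δ : ℝ}

/-- A bounded group of automorphisms of a form preserves an adapted Hermitian form. -/
theorem exists_adm (hB : IsForm B σ δ) {U C : Submodule D M} [Module.Finite D U]
    (hUC : IsCompl U C) (orth : ∀ x ∈ U, ∀ y ∈ C, B x y = 0) (S : Subgroup (M ≃ₗ[D] M))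
    (hSU : ∀ g ∈ S, ∀ x ∈ U, g x ∈ U) (hSB : ∀ g ∈ S, ∀ x y, B (g x) (g y) = B x y)
    {W : Type} [NormedAddCommGroup W] [NormedSpace ℝ W] [FiniteDimensional ℝ W] (c : M →ₗ[ℝ] W)
    (hc : ∀ x ∈ U, c x = 0 → x = 0) (hbd : ∀ x ∈ U, ∃ R, ∀ g ∈ S, ‖c (g x)‖ ≤ R) :
    ∃ H A, Adm B δ U C H A ∧ ∀ g ∈ S, ∀ x ∈ U, ∀ y ∈ U, H (g x) (g y) = H x y := by
  haveI : FiniteDimensional ℝ U := Module.Finite.trans D U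
  let res : S → (U →ₗ[D] U) := fun g => (g : M ≃ₗ[D] M).toLinearMap.restrict (hSU g g.2)
  have hBU : IsForm (fun x y : U => B x y) σ δ :=
    { add_left := fun x y z => hB.add_left x y z
      smul_left := fun d x y => hB.smul_left d x y
      add_right := fun x y z => hB.add_right x y z
      smul_right := fun d x y => hB.smul_right d x y
      invol := hB.invol
      real := hB.real
      re_symm := fun x y => hB.re_symm x y
      nondeg := fun hδ x hx => by
        refine Subtype.ext (hB.nondeg hδ x fun y => ?_)
        obtain ⟨u, hu, v, hv, rfl⟩ := Submodule.mem_sup.1 (hUC.sup_eq_top ▸ Submodule.mem_top (x := y))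
        rw [hB.add_right, orth x x.2 v hv, hx ⟨u, hu⟩, add_zero]
      delta := hB.delta
      eq_zero := fun hδ x y => hB.eq_zero hδ x y }
  obtain ⟨h, hsymm, hpos, hinv, hD⟩ := exists_invariant_inner (Set.range res)
    ⟨1, by ext; rfl⟩
    (by rintro _ ⟨g, rfl⟩ _ ⟨g', rfl⟩; exact ⟨g * g', by ext; rfl⟩)
    (by
      rintro _ ⟨g, rfl⟩
      refine ⟨_, ⟨g⁻¹, rfl⟩, ?_⟩
      ext x
      exact (g : M ≃ₗ[D] M).symm_apply_apply x)
    (by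
      intro f x
      let cU : U →ₗ[ℝ] W := c ∘ₗ (U.subtype.restrictScalars ℝ)
      have hcU : LinearMap.ker cU = ⊥ := by
        refine LinearMap.ker_eq_bot'.2 fun y hy => Subtype.ext (hc y y.2 hy)
      obtain ⟨r, hr⟩ := cU.exists_leftInverse_of_injective hcU
      obtain ⟨R, hR⟩ := hbd x x.2
      refine ⟨‖LinearMap.toContinuousLinearMap (f ∘ₗ r)‖ * R, ?_⟩
      rintro _ ⟨g, rfl⟩
      have e : f (res g x) = LinearMap.toContinuousLinearMap (f ∘ₗ r) (cU (res g x)) := by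
        change _ = f ((r ∘ₗ cU) (res g x))
        rw [hr]; rfl
      rw [e]
      refine ((LinearMap.toContinuousLinearMap (f ∘ₗ r)).le_opNorm _).trans ?_
      exact mul_le_mul_of_nonneg_left (hR g g.2) (norm_nonneg _))
  obtain ⟨h', A, hsymm', hpos', hD', hBA, hAA, hinv'⟩ : ∃ (h' : U →ₗ[ℝ] U →ₗ[ℝ] ℝ)
      (A : U →ₗ[ℝ] U), (∀ x y, h' x y = h' y x) ∧
      (∀ x, x ≠ 0 → 0 < h' x x) ∧ (∀ (d : D) x y, h' (d • x) y = h' x (star d • y)) ∧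
      (∀ x y : U, re (B x y) = h' x (A y)) ∧ (∀ x, A (A x) = δ • x) ∧
      ∀ g : S, ∀ x y, h' (res g x) (res g y) = h' x y := by
    by_cases hδ : δ = 0
    · refine ⟨h, 0, hsymm, hpos, hD, fun x y => ?_, fun x => ?_, fun g => hinv _ ⟨g, rfl⟩⟩
      · rw [hB.eq_zero hδ, map_zero, LinearMap.zero_apply, map_zero]
      · rw [hδ, zero_smul]; rfl
    · obtain ⟨h', A, h1, h2, h3, h4, h5, h6⟩ := exists_polar hBU hδ h hsymm hpos hD
      refine ⟨h', A, h1, h2, h3, h4, h5, fun g => h6 _ ?_ (hinv _ ⟨g, rfl⟩) fun x y => hSB g g.2 x y⟩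
      intro x
      exact ⟨⟨(g : M ≃ₗ[D] M).symm x, hSU _ (S.inv_mem g.2) x x.2⟩,
        Subtype.ext ((g : M ≃ₗ[D] M).apply_symm_apply x)⟩
  let π : M →ₗ[D] U := U.projectionOnto C hUC
  have hπU : ∀ x (hx : x ∈ U), π x = ⟨x, hx⟩ := fun x hx =>
    Submodule.projectionOnto_apply_left hUC ⟨x, hx⟩
  have hex : ∀ x y : M, ∃ c : D, ∀ d, h' (d • π x) (π y) = re (d * c) := by
    intro x y
    let f : D →ₗ[ℝ] ℝ :=
      { toFun := fun d => h' (d • π x) (π y)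
        map_add' := fun a b => by rw [add_smul, map_add, LinearMap.add_apply]
        map_smul' := fun r a => by
          rw [smul_assoc, map_smul, LinearMap.smul_apply]; rfl }
    exact exists_re_mul f
  choose H hH using hex
  refine ⟨H, (U.subtype.restrictScalars ℝ) ∘ₗ A ∘ₗ (π.restrictScalars ℝ), ⟨⟨?_, ?_, ?_⟩, ?_, ?_, ?_,
    ?_, ?_⟩, ?_⟩
  · intro x y z
    refine eq_of_re fun d => ?_
    simp only [mul_add, map_add, ← hH, smul_add, LinearMap.add_apply]
  · intro e x y
    refine eq_of_re fun d => ?_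
    rw [← hH, ← mul_assoc, ← hH, π.map_smul, smul_smul]
  · intro x y
    refine eq_of_re fun d => ?_
    rw [← hH, re_mul_comm, ← re_star, star_mul, star_star, ← hH, hD', star_star, hsymm']
  · intro x hx hne
    have := hH x x 1
    rw [one_mul, one_smul] at this
    rw [← this]
    refine hpos' _ ?_
    rw [hπU x hx]
    exact fun h0 => hne (congrArg Subtype.val h0)
  · intro c hc y
    refine eq_of_re fun d => ?_
    have : π c = 0 := Submodule.projectionOnto_apply_right hUC ⟨c, hc⟩
    rw [← hH, this, smul_zero, map_zero, mul_zero, map_zero]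
    rfl
  · intro y
    exact Subtype.prop _
  · intro x hx y hy
    refine eq_of_re fun d => ?_
    rw [← hH, ← hB.smul_left, hBA ⟨d • x, U.smul_mem d hx⟩ ⟨y, hy⟩]
    change _ = h' (d • π x) (π (A (π y)))
    rw [hπU x hx, hπU y hy, hπU _ (Subtype.prop _)]
    rfl
  · intro y hy
    change ((A (π (A (π y)))) : M) = _
    rw [hπU _ (Subtype.prop (A (π y))), hπU y hy]
    exact congrArg Subtype.val (hAA ⟨y, hy⟩)
  · intro g hg x hx y hy
    refine eq_of_re fun d => ?_
    have e : ∀ z (hz : z ∈ U), π (g z) = res ⟨g, hg⟩ ⟨z, hz⟩ := fun z hz => hπU _ (hSU g hg z hz)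
    rw [← hH, ← hH, e x hx, e y hy, ← map_smul, hinv', hπU x hx, hπU y hy]

end Existence

/-! ### Automorphisms of direct limit groups -/

/-- A homeomorphic automorphism of the ambient group that permutes the finite-dimensional groups
restricts to an automorphism of the direct limit. -/
theorem LimSystem.exists_auto (S : LimSystem) (Φ : S.A ≃* S.A) (hc : Continuous Φ)
    (hc' : Continuous Φ.symm) (τ : S.Idx ≃ S.Idx) (h : ∀ i, S.Γ (τ i) = (S.Γ i).map Φ.toMonoidHom) :
    ∃ γ : S.G ≃* S.G, @Continuous _ _ S.limTop S.limTop γ ∧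
      @Continuous _ _ S.limTop S.limTop γ.symm ∧ ∀ g, (γ g : S.A) = Φ g := by
  have key : ∀ (Φ : S.A ≃* S.A) (τ : S.Idx ≃ S.Idx) (hc : Continuous Φ)
      (h : ∀ i, S.Γ (τ i) = (S.Γ i).map Φ.toMonoidHom) (f : S.G → S.G)
      (hf : ∀ g, (f g : S.A) = Φ g), @Continuous _ _ S.limTop S.limTop f := by
    intro Φ τ hc h f hf
    refine continuous_iSup_dom.2 fun i => continuous_coinduced_dom.2 ?_
    have hmem : ∀ g : S.Γ i, Φ g ∈ S.Γ (τ i) := fun g => by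
      rw [h]; exact ⟨g, g.2, rfl⟩
    have e : f ∘ (Subgroup.inclusion (le_iSup S.Γ i) : S.Γ i → S.G) =
        (Subgroup.inclusion (le_iSup S.Γ (τ i)) : S.Γ (τ i) → S.G) ∘
          fun g : S.Γ i => (⟨Φ g, hmem g⟩ : S.Γ (τ i)) := by
      funext g
      exact Subtype.ext (hf _)
    rw [e]
    refine @Continuous.comp _ _ _ _ _ S.limTop _ _ ?_
      ((hc.comp continuous_subtype_val).subtype_mk hmem)
    exact continuous_iff_coinduced_le.2 (le_iSup (fun i => TopologicalSpace.coinduced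
      (Subgroup.inclusion (le_iSup S.Γ i) : S.Γ i → S.G) inferInstance) (τ i))
  have h' : ∀ i, S.Γ (τ.symm i) = (S.Γ i).map Φ.symm.toMonoidHom := by
    intro i
    have := h (τ.symm i)
    rw [τ.apply_symm_apply] at this
    rw [this, Subgroup.map_map]
    have e : Φ.symm.toMonoidHom.comp Φ.toMonoidHom = MonoidHom.id _ := by
      ext x; simp
    rw [e, Subgroup.map_id]
  have hG : S.G.map Φ.toMonoidHom = S.G := by
    rw [LimSystem.G, Subgroup.map_iSup]
    simp_rw [← h]
    exact τ.surjective.iSup_comp S.Γ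
  have hG1 : ∀ g : S.G, Φ g ∈ S.G := fun g => hG.le ⟨g, g.2, rfl⟩
  have hG2 : ∀ g : S.G, Φ.symm g ∈ S.G := fun g => by
    obtain ⟨x, hx, hxg⟩ : (g : S.A) ∈ S.G.map Φ.toMonoidHom := by rw [hG]; exact g.2
    rw [← hxg]
    change Φ.symm (Φ x) ∈ _
    rwa [Φ.symm_apply_apply]
  let γ : S.G ≃* S.G :=
    { toFun := fun g => ⟨Φ g, hG1 g⟩
      invFun := fun g => ⟨Φ.symm g, hG2 g⟩
      left_inv := fun g => Subtype.ext (Φ.symm_apply_apply g.1)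
      right_inv := fun g => Subtype.ext (Φ.apply_symm_apply g.1)
      map_mul' := fun a b => Subtype.ext (map_mul Φ a.1 b.1) }
  exact ⟨γ, key Φ τ hc h _ fun g => rfl, key Φ.symm τ.symm hc' h' _ fun g => rfl, fun g => rfl⟩

/-- Linear functionals are represented by Hermitian forms. -/
theorem IsHerm.exists_riesz {D : Type} [NormedDivisionRing D] [NormedAlgebra ℝ D] [StarRing D]
    [Coeff D] {M : Type} [AddCommGroup M] [Module D M] [Module ℝ M] [IsScalarTower ℝ D M]
    {H : M → M → D} (hH : IsHerm H) {U : Submodule D M} [Module.Finite D U]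
    (hpos : ∀ x ∈ U, x ≠ 0 → 0 < re (H x x)) (f : M →ₗ[D] D) :
    ∃ y ∈ U, ∀ x ∈ U, f x = H x y := by
  haveI : FiniteDimensional ℝ U := Module.Finite.trans D U
  let Φ : U →ₗ[ℝ] (U →ₗ[ℝ] ℝ) := LinearMap.mk₂ ℝ (fun y x => re (H x y))
    (by intros; simp [hH.add_right])
    (by
      intro r x y
      change re (H y (r • (x : M))) = _
      rw [hH.rsmul_right, ← oR_comm, re_oR_mul, smul_eq_mul])
    (by intros; simp [hH.add_left])
    (by
      intro r x y
      change re (H (r • (y : M)) x) = _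
      rw [hH.rsmul_left, re_oR_mul, smul_eq_mul])
  have hinj : Function.Injective Φ := by
    refine (injective_iff_map_eq_zero Φ).2 fun x hx => ?_
    by_contra hne
    have h1 : re (H x x) = 0 := LinearMap.congr_fun hx x
    exact (hpos x x.2 fun h0 => hne (Subtype.ext h0)).ne' h1
  have hsurj : Function.Surjective Φ :=
    (LinearMap.injective_iff_surjective_of_finrank_eq_finrank Subspace.dual_finrank_eq.symm).1 hinj
  obtain ⟨y, hy⟩ := hsurj (re ∘ₗ (f.restrictScalars ℝ) ∘ₗ (U.subtype.restrictScalars ℝ))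
  refine ⟨y, y.2, fun x hx => eq_of_re fun d => ?_⟩
  have h1 : re (H (d • x) y) = re (f (d • x)) := LinearMap.congr_fun hy ⟨d • x, U.smul_mem d hx⟩
  rw [← hH.smul_left, h1, map_smul, smul_eq_mul]

section Chain

variable {D : Type} [NormedDivisionRing D] [NormedAlgebra ℝ D] [StarRing D] [Coeff D]
variable {B : V D → V D → D} {σ : D → D} {δ : ℝ}
variable {A : Type} [Group A] [TopologicalSpace A]

/-- `g` preserves the form `H`. -/
def Pres (H : V D → V D → D) (g : V D ≃ₗ[D] V D) : Prop := ∀ x y, H (g x) (g y) = H x y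

theorem Pres.inv {H : V D → V D → D} {g : V D ≃ₗ[D] V D} (h : Pres H g) : Pres H g⁻¹ := by
  intro x y
  have := h (g.symm x) (g.symm y)
  rw [g.apply_symm_apply, g.apply_symm_apply] at this
  exact this.symm

theorem Pres.mul {H : V D → V D → D} {g g' : V D ≃ₗ[D] V D} (h : Pres H g) (h' : Pres H g') :
    Pres H (g * g') := fun x y => (h _ _).trans (h' x y)

theorem Piece.proj_stab (L : Piece B) {g : V D ≃ₗ[D] V D} (hg : g ∈ L.stab) (x : V D) :
    L.proj (g x) = g (L.proj x) := by
  have e : g x = g (L.proj x) + (x - L.proj x) := by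
    rw [← hg.2 _ (L.sub_proj_mem x), ← map_add, add_sub_cancel]
  rw [e, map_add, L.proj_of_mem_C (L.sub_proj_mem x), add_zero,
    L.proj_of_mem ((L.stab_iff g _ hg).1 (L.proj_mem x))]

theorem Adm.apply_proj {L : Piece B} {H : V D → V D → D} {A : V D →ₗ[ℝ] V D}
    (h : Adm B δ L.V₁ L.C H A) (x y : V D) : H x y = H (L.proj x) (L.proj y) := by
  have e1 : x = L.proj x + (x - L.proj x) := by abel
  have e2 : y = L.proj y + (y - L.proj y) := by abel
  conv_lhs => rw [e1, e2]
  rw [h.herm.add_left, h.rad _ (L.sub_proj_mem x), add_zero, h.herm.add_right,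
    h.rad_right (L.sub_proj_mem y), add_zero]

/-- It is enough to test on `V₁` whether an element of the stabilizer preserves `H`. -/
theorem Adm.pres_of {L : Piece B} {H : V D → V D → D} {A : V D →ₗ[ℝ] V D}
    (h : Adm B δ L.V₁ L.C H A) {g : V D ≃ₗ[D] V D} (hg : g ∈ L.stab)
    (hgH : ∀ x ∈ L.V₁, ∀ y ∈ L.V₁, H (g x) (g y) = H x y) : Pres H g := by
  intro x y
  rw [h.apply_proj, L.proj_stab hg, L.proj_stab hg, hgH _ (L.proj_mem x) _ (L.proj_mem y),
    ← h.apply_proj]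

/-- The finite-dimensional groups `Γ L`, together with their action on `V`. -/
structure Rep (σ : D → D) (δ : ℝ) (Γ : Piece B → Subgroup A) (ad : A → (V D ≃ₗ[D] V D)) :
    Prop where
  form : IsForm B σ δ
  mono : ∀ L L', Piece.Le L L' → Γ L ≤ Γ L'
  ad_mul : ∀ L, ∀ g ∈ Γ L, ∀ g' ∈ Γ L, ad (g * g') = ad g * ad g'
  ad_stab : ∀ L, ∀ g ∈ Γ L, ad g ∈ L.stab
  ad_B : ∀ L, ∀ g ∈ Γ L, ∀ x y, B (ad g x) (ad g y) = B x y
  ad_cont : ∀ L i j, ContinuousOn (fun g => ad g (Finsupp.single i 1) j) (Γ L : Set A)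
  compact : ∀ (L : Piece B) H A', Adm B δ L.V₁ L.C H A' → IsCompact {g | g ∈ Γ L ∧ Pres H (ad g)}

namespace Rep

variable {Γ : Piece B → Subgroup A} {ad : A → (V D ≃ₗ[D] V D)} (R : Rep σ δ Γ ad)
include R

theorem ad_one (L : Piece B) : ad 1 = 1 := by
  have := R.ad_mul L 1 (Γ L).one_mem 1 (Γ L).one_mem
  rw [mul_one] at this
  exact (mul_eq_left.1 this.symm)

theorem ad_inv (L : Piece B) {g : A} (hg : g ∈ Γ L) : ad g⁻¹ = (ad g)⁻¹ := by
  refine eq_inv_of_mul_eq_one_left ?_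
  rw [← R.ad_mul L _ ((Γ L).inv_mem hg) _ hg, inv_mul_cancel, R.ad_one L]

/-- The elements of `Γ L` that preserve `H`. -/
def stabH (L : Piece B) (H : V D → V D → D) : Subgroup A where
  carrier := {g | g ∈ Γ L ∧ Pres H (ad g)}
  one_mem' := ⟨(Γ L).one_mem, by rw [R.ad_one L]; exact fun _ _ => rfl⟩
  mul_mem' := by
    rintro a b ⟨ha, ha'⟩ ⟨hb, hb'⟩
    exact ⟨(Γ L).mul_mem ha hb, by rw [R.ad_mul L a ha b hb]; exact ha'.mul hb'⟩
  inv_mem' := by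
    rintro a ⟨ha, ha'⟩
    exact ⟨(Γ L).inv_mem ha, by rw [R.ad_inv L ha]; exact ha'.inv⟩

theorem ad_cont' (L : Piece B) (x : V D) (j : ℕ) :
    ContinuousOn (fun g => ad g x j) (Γ L : Set A) := by
  obtain ⟨N, hN⟩ := LimGroups.exists_bound x
  have : ∀ g, ad g x j = ∑ i ∈ Finset.range N, x i * ad g (Finsupp.single i 1) j := by
    intro g
    conv_lhs => rw [sum_below (N := N) (x := x) hN]
    rw [map_sum, Finsupp.finsetSum_apply]
    refine Finset.sum_congr rfl fun i _ => ?_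
    rw [map_smul]; rfl
  simp_rw [this]
  exact continuousOn_finsetSum _ fun i _ => continuousOn_const.mul (R.ad_cont L i j)

/-- A maximal compact subgroup of `Γ L` is the stabilizer of an adapted Hermitian form. -/
theorem exists_adm_of_maximal (L : Piece B) {K : Subgroup A} (hK : IsMaximalCompact (Γ L) K) :
    ∃ H A', Adm B δ L.V₁ L.C H A' ∧ K = R.stabH L H := by
  haveI := L.finite
  let S : Subgroup (V D ≃ₗ[D] V D) :=
    { carrier := {g | ∃ k ∈ K, ad k = g}
      one_mem' := ⟨1, K.one_mem, R.ad_one L⟩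
      mul_mem' := by
        rintro _ _ ⟨a, ha, rfl⟩ ⟨b, hb, rfl⟩
        exact ⟨a * b, K.mul_mem ha hb, R.ad_mul L a (hK.1 ha) b (hK.1 hb)⟩
      inv_mem' := by
        rintro _ ⟨a, ha, rfl⟩
        exact ⟨a⁻¹, K.inv_mem ha, R.ad_inv L (hK.1 ha)⟩ }
  obtain ⟨N, hN⟩ := exists_below_of_fg (U := L.V₁)
  let c : V D →ₗ[ℝ] (Fin N → D) :=
    { toFun := fun x i => x i
      map_add' := fun x y => rfl
      map_smul' := fun r x => rfl }
  obtain ⟨H, A', hA, hS⟩ := exists_adm R.form L.isCompl L.orth S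
    (by rintro _ ⟨k, hk, rfl⟩ x hx; exact (L.stab_iff _ _ (R.ad_stab L k (hK.1 hk))).1 hx)
    (by rintro _ ⟨k, hk, rfl⟩; exact R.ad_B L k (hK.1 hk)) c
    (by
      intro x hx h0
      ext i
      by_cases hi : i < N
      · exact congrFun h0 ⟨i, hi⟩
      · exact hN hx i (not_lt.1 hi))
    (by
      intro x hx
      have hcont : ContinuousOn (fun k => c (ad k x)) (K : Set A) :=
        continuousOn_pi.2 fun i => (R.ad_cont' L x i).mono hK.1
      obtain ⟨b, hb⟩ := hK.2.1.exists_bound_of_continuousOn hcont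
      exact ⟨b, by rintro _ ⟨k, hk, rfl⟩; exact hb k hk⟩)
  refine ⟨H, A', hA, (hK.2.2 (R.stabH L H) (fun g hg => hg.1) (R.compact L H A' hA) ?_).symm⟩
  intro k hk
  exact ⟨hK.1 hk, hA.pres_of (R.ad_stab L k (hK.1 hk)) (hS _ ⟨k, hk, rfl⟩)⟩

/-- An involution of `Γ L` whose fixed point group is the stabilizer of `H`. -/
structure IsInvol (L : Piece B) (H : V D → V D → D) (θ : Γ L ≃* Γ L) : Prop where
  invol : ∀ g, θ (θ g) = g
  fixed : fixedPoints θ = R.stabH L H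

end Rep

theorem mem_fixedPoints {A : Type} [Group A] {H : Subgroup A} (θ : H ≃* H) (g : A) :
    g ∈ fixedPoints θ ↔ ∃ h : g ∈ H, θ ⟨g, h⟩ = ⟨g, h⟩ := by
  constructor
  · rintro ⟨x, hx, rfl⟩
    exact ⟨x.2, hx⟩
  · rintro ⟨h, hg⟩
    exact ⟨⟨g, h⟩, hg, rfl⟩

/-- The conditions under which the Hermitian forms of the members of an expression fit together. -/
structure Rigid {Γ : Piece B → Subgroup A} {ad : A → (V D ≃ₗ[D] V D)} (R : Rep σ δ Γ ad)
    (F : Finset (V D)) : Prop where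
  nonzero : ∃ x ∈ F, x ≠ 0
  orth : ∀ (L L' : Piece B), L.Le L' → (∀ x ∈ F, x ∈ L.V₁) → ∀ H A' H₁ A₁,
    Adm B δ L.V₁ L.C H A' → Adm B δ L'.V₁ L'.C H₁ A₁ → ∀ (θ : Γ L ≃* Γ L) (θ₁ : Γ L' ≃* Γ L'),
    R.IsInvol L H θ → R.IsInvol L' H₁ θ₁ →
    (∀ (g : Γ L) (h : Γ L'), (h : A) = g → (θ₁ h : A) = θ g) →
    ∀ x ∈ L.V₁, ∀ c ∈ L.C, c ∈ L'.V₁ → H₁ x c = 0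
  unique : ∀ (L : Piece B), (∀ x ∈ F, x ∈ L.V₁) → ∀ H A' H₁ A₁,
    Adm B δ L.V₁ L.C H A' → Adm B δ L.V₁ L.C H₁ A₁ →
    (∀ g ∈ Γ L, Pres H (ad g) → Pres H₁ (ad g)) →
    ∃ c : ℝ, 0 < c ∧ ∀ x ∈ L.V₁, ∀ y ∈ L.V₁, H₁ x y = oR D c * H x y

section Step

variable {Γ : Piece B → Subgroup A} {ad : A → (V D ≃ₗ[D] V D)} {R : Rep σ δ Γ ad}
  {F : Finset (V D)} (hR : Rigid R F)

include hR in
/-- One step in the construction of the Hermitian form on `V`. -/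
theorem Rigid.step {L L' : Piece B} (hL : L.Le L') (hF : ∀ x ∈ F, x ∈ L.V₁)
    {θ : Γ L ≃* Γ L} {θ₁ : Γ L' ≃* Γ L'} (hθ : ∀ g, θ (θ g) = g) (hθ₁ : IsCartanInvolution θ₁)
    (hθθ : ∀ (g : Γ L) (h : Γ L'), (h : A) = g → (θ₁ h : A) = θ g)
    {H : V D → V D → D} {A' : V D →ₗ[ℝ] V D} (hH : Adm B δ L.V₁ L.C H A')
    (hfix : fixedPoints θ = R.stabH L H) :
    ∃ H₁ A₁, Adm B δ L'.V₁ L'.C H₁ A₁ ∧ fixedPoints θ₁ = R.stabH L' H₁ ∧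
      (∀ x ∈ L.V₁, ∀ y, H₁ x y = H x y) ∧ ∀ x ∈ L.V₁, A₁ x = A' x := by
  obtain ⟨H₁, A₁, hH₁, hfix₁⟩ := R.exists_adm_of_maximal L' hθ₁.2.2
  have horth : ∀ x ∈ L.V₁, ∀ c ∈ L.C, H₁ x c = 0 := by
    intro x hx c hc
    have e : c = L'.proj c + (c - L'.proj c) := by abel
    have h1 : L'.proj c ∈ L.C := by
      have := L.C.sub_mem hc (hL.2 (L'.sub_proj_mem c))
      rwa [sub_sub_cancel] at this
    rw [e, hH₁.herm.add_right, hH₁.rad_right (L'.sub_proj_mem c), add_zero]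
    exact hR.orth L L' hL hF H A' H₁ A₁ hH hH₁ θ θ₁ ⟨hθ, hfix⟩ ⟨hθ₁.2.1, hfix₁⟩ hθθ x hx _ h1
      (L'.proj_mem c)
  have horth' : ∀ x ∈ L.V₁, ∀ y, H₁ x (L.proj y) = H₁ x y := by
    intro x hx y
    have e : y = L.proj y + (y - L.proj y) := by abel
    conv_rhs => rw [e]
    rw [hH₁.herm.add_right, horth x hx _ (L.sub_proj_mem y), add_zero]
  have hBC : ∀ c ∈ L.C, ∀ x ∈ L.V₁, B c x = 0 := fun c hc x hx => R.form.refl (L.orth x hx c hc)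
  have hA₁L : ∀ y ∈ L.V₁, A₁ y ∈ L.V₁ := by
    intro y hy
    set c := A₁ y - L.proj (A₁ y) with hc
    have hcC : c ∈ L.C := L.sub_proj_mem _
    have hcV : c ∈ L'.V₁ := L'.V₁.sub_mem (hH₁.A_mem y) (hL.1 (L.proj_mem _))
    have h1 : H₁ c (A₁ y) = 0 := by
      rw [← hH₁.B_eq c hcV y (hL.1 hy), hBC c hcC y hy]
    have h2 : H₁ c c = 0 := by
      rw [hc, hH₁.herm.sub_right, ← hc, h1, zero_sub, neg_eq_zero]
      exact hH₁.herm.eq_zero_symm (horth _ (L.proj_mem _) c hcC)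
    have h3 := hH₁.eq_zero hcV h2
    have : A₁ y = L.proj (A₁ y) := sub_eq_zero.1 h3
    rw [this]
    exact L.proj_mem _
  have hH₂ : Adm B δ L.V₁ L.C (fun x y => H₁ (L.proj x) (L.proj y))
      (A₁ ∘ₗ (L.proj.restrictScalars ℝ)) := by
    refine ⟨⟨fun x y z => ?_, fun d x y => ?_, fun x y => hH₁.herm.star_symm _ _⟩, fun x hx hne => ?_,
      fun c hc y => ?_, fun y => hA₁L _ (L.proj_mem y), fun x hx y hy => ?_, fun y hy => ?_⟩
    · rw [map_add, hH₁.herm.add_left]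
    · rw [map_smul, hH₁.herm.smul_left]
    · rw [L.proj_of_mem hx]
      exact hH₁.pos x (hL.1 hx) hne
    · rw [L.proj_of_mem_C hc, hH₁.herm.zero_left]
    · change _ = H₁ (L.proj x) (L.proj (A₁ (L.proj y)))
      rw [L.proj_of_mem hx, L.proj_of_mem hy, L.proj_of_mem (hA₁L y hy)]
      exact hH₁.B_eq x (hL.1 hx) y (hL.1 hy)
    · change A₁ (L.proj (A₁ (L.proj y))) = _
      rw [L.proj_of_mem hy, L.proj_of_mem (hA₁L y hy)]
      exact hH₁.A_sq y (hL.1 hy)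
  obtain ⟨c, hc, hcH⟩ := hR.unique L hF H A' _ _ hH hH₂ (by
    intro g hg hgH x y
    have hgk : g ∈ fixedPoints θ := by rw [hfix]; exact ⟨hg, hgH⟩
    obtain ⟨_, hgk⟩ := (mem_fixedPoints θ g).1 hgk
    have hgk₁ : g ∈ fixedPoints θ₁ := by
      have hg' := R.mono L L' hL hg
      refine (mem_fixedPoints θ₁ g).2 ⟨hg', Subtype.ext ?_⟩
      rw [hθθ ⟨g, hg⟩ ⟨g, hg'⟩ rfl, hgk]
    rw [hfix₁] at hgk₁
    change H₁ (L.proj (ad g x)) (L.proj (ad g y)) = H₁ (L.proj x) (L.proj y)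
    rw [L.proj_stab (R.ad_stab L g hg), L.proj_stab (R.ad_stab L g hg), hgk₁.2])
  have hcH' : ∀ x ∈ L.V₁, ∀ y ∈ L.V₁, H₁ x y = oR D c * H x y := by
    intro x hx y hy
    have := hcH x hx y hy
    simp only [L.proj_of_mem hx, L.proj_of_mem hy] at this
    exact this
  have hAc : ∀ y ∈ L.V₁, A' y = c • A₁ y := by
    intro y hy
    refine hH.eq_of_H (hH.A_mem y) (L.V₁.smul_of_tower_mem c (hA₁L y hy)) fun z hz => ?_
    rw [← hH.B_eq z hz y hy, hH₁.B_eq z (hL.1 hz) y (hL.1 hy), hcH' z hz _ (hA₁L y hy),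
      hH.herm.rsmul_right, oR_comm]
  have hcδ : c * c * δ = δ := by
    obtain ⟨x, hxF, hx0⟩ := hR.nonzero
    have hx := hF x hxF
    have h1 := hH.A_sq x hx
    rw [hAc _ (hH.A_mem x), hAc x hx, map_smul, hH₁.A_sq x (hL.1 hx), smul_smul, smul_smul] at h1
    have h2 : (c * c * δ - δ) • x = 0 := by rw [sub_smul, h1, sub_self]
    rw [← oR_smul (D := D), smul_eq_zero] at h2
    rcases h2 with h2 | h2
    · rw [map_eq_zero] at h2; linarith
    · exact absurd h2 hx0
  have hH₃ : Adm B δ L'.V₁ L'.C (fun x y => oR D c⁻¹ * H₁ x y) (c • A₁) := by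
    refine ⟨⟨fun x y z => ?_, fun d x y => ?_, fun x y => ?_⟩, fun x hx hne => ?_,
      fun z hz y => ?_, fun y => ?_, fun x hx y hy => ?_, fun y hy => ?_⟩
    · rw [hH₁.herm.add_left, mul_add]
    · rw [hH₁.herm.smul_left, ← mul_assoc, oR_comm, mul_assoc]
    · rw [star_mul, star_oR, hH₁.herm.star_symm, oR_comm]
    · rw [re_oR_mul]
      exact mul_pos (inv_pos.2 hc) (hH₁.pos x hx hne)
    · rw [hH₁.rad z hz, mul_zero]
    · exact L'.V₁.smul_of_tower_mem c (hH₁.A_mem y)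
    · change _ = oR D c⁻¹ * H₁ x (c • A₁ y)
      rw [hH₁.herm.rsmul_right, ← oR_comm, ← mul_assoc, ← map_mul, inv_mul_cancel₀ hc.ne', map_one,
        one_mul, hH₁.B_eq x hx y hy]
    · change c • A₁ (c • A₁ y) = _
      rw [map_smul, hH₁.A_sq y hy, smul_smul, smul_smul, hcδ]
  refine ⟨_, _, hH₃, ?_, fun x hx y => ?_, fun x hx => (hAc x hx).symm⟩
  · rw [hfix₁]
    ext g
    refine and_congr_right fun hg => forall_congr' fun x => forall_congr' fun y => ?_
    have hne : oR D c⁻¹ ≠ 0 := by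
      rw [Ne, map_eq_zero]; exact inv_ne_zero hc.ne'
    exact ⟨fun h => congrArg _ h, fun h => mul_left_cancel₀ hne h⟩
  · change oR D c⁻¹ * H₁ x y = _
    rw [← horth' x hx, hcH' x hx _ (L.proj_mem y), ← mul_assoc, ← map_mul, inv_mul_cancel₀ hc.ne',
      map_one, one_mul, hH.apply_proj x y, L.proj_of_mem hx]

/-- The forms on `V` that arise as limits: adapted, and identifying `V` with its restricted dual. -/
structure GlobalAdm (B : V D → V D → D) (δ : ℝ) (H : V D → V D → D) (A' : V D →ₗ[ℝ] V D) :
    Prop where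
  adm : Adm B δ ⊤ ⊥ H A'
  fin : ∀ y, ∃ N, ∀ i, N ≤ i → H (Finsupp.single i 1) y = 0
  coord : ∀ j, ∃ y, ∀ x : V D, x j = H x y

include hR in
/-- A maximal lim-compact subgroup is the stabilizer of a Hermitian form on `V`. -/
theorem Rigid.exists_global
    (K : Subgroup (LimSystem.mk A (Piece B) Γ Piece.Exhausts).G)
    (hK : IsMaximalLimCompact (LimSystem.mk A (Piece B) Γ Piece.Exhausts) K) :
    ∃ H A', GlobalAdm B δ H A' ∧ ∀ g, g ∈ K ↔ Pres H (ad g.1) := by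
  obtain ⟨L, θ, hex, hθ, hθθ, hKθ⟩ := hK
  replace hex : Piece.Exhausts L := hex
  obtain ⟨n₀, hn₀⟩ := hex.eventually_mem F
  have hFn : ∀ k, ∀ x ∈ F, x ∈ (L (n₀ + k)).V₁ := fun k => hn₀ _ (Nat.le_add_right _ _)
  let Good : ℕ → (V D → V D → D) × (V D →ₗ[ℝ] V D) → Prop := fun k p =>
    Adm B δ (L (n₀ + k)).V₁ (L (n₀ + k)).C p.1 p.2 ∧
      fixedPoints (θ (n₀ + k)) = R.stabH (L (n₀ + k)) p.1
  have hbase : ∃ p, Good 0 p := by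
    obtain ⟨H, A', h1, h2⟩ := R.exists_adm_of_maximal (L (n₀ + 0)) (hθ (n₀ + 0)).2.2
    exact ⟨(H, A'), h1, h2⟩
  have hstep : ∀ k (p : {p // Good k p}), ∃ q, Good (k + 1) q ∧
      (∀ x ∈ (L (n₀ + k)).V₁, ∀ y, q.1 x y = p.1.1 x y) ∧
      ∀ x ∈ (L (n₀ + k)).V₁, q.2 x = p.1.2 x := by
    intro k p
    obtain ⟨H₁, A₁, h1, h2, h3, h4⟩ := hR.step (L := L (n₀ + k)) (L' := L (n₀ + (k + 1)))
      (hex.mono (by omega)) (hFn k) (θ := θ (n₀ + k)) (θ₁ := θ (n₀ + (k + 1)))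
      (hθ (n₀ + k)).2.1 (hθ (n₀ + (k + 1))) (hθθ (n₀ + k)) p.2.1 p.2.2
    exact ⟨(H₁, A₁), ⟨h1, h2⟩, h3, h4⟩
  choose next hnext1 hnext2 hnext3 using hstep
  let seq : ∀ k, {p // Good k p} := fun k =>
    Nat.rec ⟨hbase.choose, hbase.choose_spec⟩ (fun k p => ⟨next k p, hnext1 k p⟩) k
  have hseq1 : ∀ k, ∀ x ∈ (L (n₀ + k)).V₁, ∀ y, (seq (k + 1)).1.1 x y = (seq k).1.1 x y :=
    fun k => hnext2 k (seq k)
  have hseq2 : ∀ k, ∀ x ∈ (L (n₀ + k)).V₁, (seq (k + 1)).1.2 x = (seq k).1.2 x :=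
    fun k => hnext3 k (seq k)
  have hmono : ∀ {k l}, k ≤ l → (L (n₀ + k)).Le (L (n₀ + l)) := fun h => hex.mono (by omega)
  have hs1 : ∀ k l, k ≤ l → ∀ x ∈ (L (n₀ + k)).V₁, ∀ y, (seq l).1.1 x y = (seq k).1.1 x y := by
    intro k l hkl
    induction l, hkl using Nat.le_induction with
    | base => intro x _ y; rfl
    | succ l hkl ih =>
      intro x hx y
      rw [hseq1 l x ((hmono hkl).1 hx), ih x hx y]
  have hs2 : ∀ k l, k ≤ l → ∀ x ∈ (L (n₀ + k)).V₁, (seq l).1.2 x = (seq k).1.2 x := by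
    intro k l hkl
    induction l, hkl using Nat.le_induction with
    | base => intro x _; rfl
    | succ l hkl ih =>
      intro x hx
      rw [hseq2 l x ((hmono hkl).1 hx), ih x hx]
  have hm : ∀ x, ∃ k, x ∈ (L (n₀ + k)).V₁ := by
    intro x
    obtain ⟨n, hn⟩ := hex.2.2.1 x
    exact ⟨n, (hex.mono (Nat.le_add_left _ _)).1 hn⟩
  choose m hm using hm
  let H : V D → V D → D := fun x y => (seq (m x)).1.1 x y
  have hHk : ∀ k, ∀ x ∈ (L (n₀ + k)).V₁, ∀ y, H x y = (seq k).1.1 x y := by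
    intro k x hx y
    rcases le_total k (m x) with h | h
    · exact hs1 k _ h x hx y
    · exact (hs1 _ k h x (hm x) y).symm
  have hAk : ∀ k, ∀ x ∈ (L (n₀ + k)).V₁, (seq (m x)).1.2 x = (seq k).1.2 x := by
    intro k x hx
    rcases le_total k (m x) with h | h
    · exact hs2 k _ h x hx
    · exact (hs2 _ k h x (hm x)).symm
  have hm2 : ∀ x y, x ∈ (L (n₀ + max (m x) (m y))).V₁ ∧ y ∈ (L (n₀ + max (m x) (m y))).V₁ :=
    fun x y => ⟨(hmono (le_max_left _ _)).1 (hm x), (hmono (le_max_right _ _)).1 (hm y)⟩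
  let A' : V D →ₗ[ℝ] V D :=
    { toFun := fun x => (seq (m x)).1.2 x
      map_add' := fun x y => by
        obtain ⟨hx, hy⟩ := hm2 x y
        rw [hAk _ _ ((L _).V₁.add_mem hx hy), hAk _ _ hx, hAk _ _ hy, map_add]
      map_smul' := fun r x => by
        rw [hAk (m x) _ ((L _).V₁.smul_of_tower_mem r (hm x)), map_smul]
        rfl }
  have hA'k : ∀ k, ∀ x ∈ (L (n₀ + k)).V₁, A' x = (seq k).1.2 x := hAk
  have hadm : ∀ k, Adm B δ (L (n₀ + k)).V₁ (L (n₀ + k)).C (seq k).1.1 (seq k).1.2 :=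
    fun k => (seq k).2.1
  have hHC : ∀ k, ∀ x ∈ (L (n₀ + k)).V₁, ∀ c ∈ (L (n₀ + k)).C, H x c = 0 := by
    intro k x hx c hc
    rw [hHk k x hx, (hadm k).rad_right hc]
  have hherm : IsHerm H := by
    refine ⟨fun x y z => ?_, fun d x y => ?_, fun x y => ?_⟩
    · obtain ⟨hx, hy⟩ := hm2 x y
      rw [hHk _ _ ((L _).V₁.add_mem hx hy), hHk _ _ hx, hHk _ _ hy, (hadm _).herm.add_left]
    · rw [hHk _ _ ((L _).V₁.smul_mem d (hm x)), hHk _ _ (hm x), (hadm _).herm.smul_left]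
    · obtain ⟨hx, hy⟩ := hm2 x y
      rw [hHk _ _ hx, hHk _ _ hy, (hadm _).herm.star_symm]
  have hglob : Adm B δ ⊤ ⊥ H A' := by
    refine ⟨hherm, fun x _ hne => ?_, fun c hc y => ?_, fun y => trivial, fun x _ y _ => ?_,
      fun y _ => ?_⟩
    · exact (hadm _).pos x (hm x) hne
    · rw [(Submodule.mem_bot D).1 hc, hherm.zero_left]
    · obtain ⟨hx, hy⟩ := hm2 x y
      rw [hHk _ _ hx, hA'k _ _ hy, (hadm _).B_eq x hx y hy]
    · rw [hA'k _ _ (hm y), hA'k (m y) _ ((hadm _).A_mem _), (hadm _).A_sq y (hm y)]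
  refine ⟨H, A', ⟨hglob, fun y => ?_, fun j => ?_⟩, fun g => ?_⟩
  · obtain ⟨N, -, hN⟩ := (L (n₀ + m y)).exists_bound
    refine ⟨N, fun i hi => hherm.eq_zero_symm (hHC (m y) y (hm y) _ (hN _ fun k hk => ?_))⟩
    rw [Finsupp.single_eq_of_ne]
    omega
  · obtain ⟨n, hn⟩ := hex.2.2.2 (Finsupp.single j 1)
    obtain ⟨P, hP⟩ : ∃ P, P = L (n₀ + n) := ⟨_, rfl⟩
    have hjC : ∀ x ∈ (L (n₀ + n)).C, x j = 0 := by
      intro x hx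
      rw [← pair_single]
      exact hn x ((hex.mono (Nat.le_add_left _ _)).2 hx)
    haveI := (L (n₀ + n)).finite
    obtain ⟨y, hyU, hy⟩ := hherm.exists_riesz (U := (L (n₀ + n)).V₁)
      (fun x _ => hglob.pos x trivial) (Finsupp.lapply j)
    refine ⟨y, fun x => ?_⟩
    have e : x = (L (n₀ + n)).proj x + (x - (L (n₀ + n)).proj x) := by abel
    rw [e, Finsupp.add_apply, hjC _ ((L (n₀ + n)).sub_proj_mem x), add_zero, hherm.add_left,
      hherm.eq_zero_symm (hHC n y hyU _ ((L (n₀ + n)).sub_proj_mem x)), add_zero]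
    exact hy _ ((L _).proj_mem x)
  · have hpres : ∀ k, ∀ g ∈ Γ (L (n₀ + k)), (Pres (seq k).1.1 (ad g) ↔ Pres H (ad g)) := by
      intro k g hg
      have hst := R.ad_stab _ g hg
      constructor
      · intro h x y
        have hdec : ∀ x y, H x y = (seq k).1.1 x y + H (x - (L (n₀ + k)).proj x)
            (y - (L (n₀ + k)).proj y) := by
          intro x y
          have ex : x = (L (n₀ + k)).proj x + (x - (L (n₀ + k)).proj x) := by abel
          have ey : y = (L (n₀ + k)).proj y + (y - (L (n₀ + k)).proj y) := by abel
          conv_lhs => rw [ex, ey]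
          rw [hherm.add_left, hherm.add_right, hherm.add_right,
            hHC k _ ((L _).proj_mem x) _ ((L _).sub_proj_mem y),
            hherm.eq_zero_symm (hHC k _ ((L _).proj_mem y) _ ((L _).sub_proj_mem x)), add_zero,
            zero_add, hHk k _ ((L _).proj_mem x), (hadm k).apply_proj x y]
        have hsub : ∀ x, ad g x - (L (n₀ + k)).proj (ad g x) = x - (L (n₀ + k)).proj x := by
          intro x
          rw [(L _).proj_stab hst, ← map_sub, hst.2 _ ((L _).sub_proj_mem x)]
        rw [hdec, h, hsub, hsub, ← hdec]
      · intro h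
        refine (hadm k).pres_of hst fun x hx y hy => ?_
        rw [← hHk k _ (((L _).stab_iff _ _ hst).1 hx), h, hHk k _ hx]
    rw [hKθ]
    constructor
    · rintro ⟨n, hn⟩
      have hfixmono : ∀ l, n ≤ l → g.1 ∈ fixedPoints (θ l) := by
        intro l hl
        induction l, hl using Nat.le_induction with
        | base => exact hn
        | succ l hl ih =>
          obtain ⟨h1, h2⟩ := (mem_fixedPoints (θ l) g.1).1 ih
          have h3 : g.1 ∈ Γ (L (l + 1)) := R.mono _ _ (hex.mono (Nat.le_succ l)) h1
          refine (mem_fixedPoints (θ (l + 1)) g.1).2 ⟨h3, Subtype.ext ?_⟩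
          rw [hθθ l ⟨g.1, h1⟩ ⟨g.1, h3⟩ rfl, h2]
      have h1 := hfixmono (n₀ + n) (Nat.le_add_left _ _)
      rw [(seq n).2.2] at h1
      exact (hpres n g.1 h1.1).1 h1.2
    · intro h
      have hdir : ∃ k, g.1 ∈ Γ (L (n₀ + k)) := by
        have hle : (LimSystem.mk A (Piece B) Γ Piece.Exhausts).G ≤ ⨆ k, Γ (L (n₀ + k)) := by
          refine iSup_le fun P => ?_
          obtain ⟨n, hn⟩ := hex.cofinal P
          have hn' : P.Le (L (n₀ + n)) := ⟨hn.1.trans (hex.mono (Nat.le_add_left _ _)).1,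
            (hex.mono (Nat.le_add_left _ _)).2.trans hn.2⟩
          exact (R.mono _ _ hn').trans (le_iSup (fun k => Γ (L (n₀ + k))) n)
        refine (Subgroup.mem_iSup_of_directed ?_).1 (hle g.2)
        exact directed_of_isDirected_le fun k l hkl => R.mono _ _ (hmono hkl)
      obtain ⟨k, hk⟩ := hdir
      refine ⟨n₀ + k, ?_⟩
      rw [(seq k).2.2]
      exact ⟨hk, (hpres k g.1 hk).2 h⟩

end Step

/-- `T` preserves the restricted dual of `V`. -/
def DualPres (T : V D ≃ₗ[D] V D) : Prop := ∀ w, ∃ w', ∀ x, pair (T x) w = pair x w'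

theorem DualPres.mul {T T' : V D ≃ₗ[D] V D} (h : DualPres T) (h' : DualPres T') :
    DualPres (T * T') := by
  intro w
  obtain ⟨w₁, h₁⟩ := h w
  obtain ⟨w₂, h₂⟩ := h' w₁
  exact ⟨w₂, fun x => (h₁ _).trans (h₂ x)⟩

/-- Automorphisms of `V` that preserve everything induce automorphisms of the groups. -/
def Transport (Γ : Piece B → Subgroup A) (ad : A → (V D ≃ₗ[D] V D)) : Prop :=
  ∀ T : V D ≃ₗ[D] V D, Pres B T → DualPres T → DualPres T⁻¹ →
    ∃ (Φ : A ≃* A) (τ : Piece B ≃ Piece B), Continuous Φ ∧ Continuous Φ.symm ∧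
      (∀ L, Γ (τ L) = (Γ L).map Φ.toMonoidHom) ∧
      ∀ L, ∀ g ∈ Γ L, ad (Φ g) = T * ad g * T⁻¹

/-- All adapted Hermitian forms on `V` are equivalent. -/
def NormalForm (B : V D → V D → D) (δ : ℝ) : Prop :=
  ∃ H₀ : V D → V D → D, ∀ H A', GlobalAdm B δ H A' →
    ∃ T : V D ≃ₗ[D] V D, Pres B T ∧ DualPres T ∧ DualPres T⁻¹ ∧ ∀ x y, H (T x) (T y) = H₀ x y

theorem Rep.exists_mem {Γ : Piece B → Subgroup A} {ad : A → (V D ≃ₗ[D] V D)} (R : Rep σ δ Γ ad)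
    (L : ℕ → Piece B) (hex : Piece.Exhausts L)
    (g : (LimSystem.mk A (Piece B) Γ Piece.Exhausts).G) : ∃ n, g.1 ∈ Γ (L n) := by
  have hle : (LimSystem.mk A (Piece B) Γ Piece.Exhausts).G ≤ ⨆ k, Γ (L k) := by
    refine iSup_le fun P => ?_
    obtain ⟨n, hn⟩ := hex.cofinal P
    exact (R.mono _ _ hn).trans (le_iSup (fun k => Γ (L k)) n)
  refine (Subgroup.mem_iSup_of_directed ?_).1 (hle g.2)
  exact directed_of_isDirected_le fun k l hkl => R.mono _ _ (hex.mono hkl)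

/-- Maximal lim-compact subgroups are conjugate. -/
theorem Rigid.conjugate {Γ : Piece B → Subgroup A} {ad : A → (V D ≃ₗ[D] V D)} {R : Rep σ δ Γ ad}
    {F : Finset (V D)} (hR : Rigid R F) (hT : Transport Γ ad) (hN : NormalForm B δ)
    (K K' : Subgroup (LimSystem.mk A (Piece B) Γ Piece.Exhausts).G)
    (hK : IsMaximalLimCompact (LimSystem.mk A (Piece B) Γ Piece.Exhausts) K)
    (hK' : IsMaximalLimCompact (LimSystem.mk A (Piece B) Γ Piece.Exhausts) K') :
    ∃ γ : (LimSystem.mk A (Piece B) Γ Piece.Exhausts).G ≃*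
        (LimSystem.mk A (Piece B) Γ Piece.Exhausts).G,
      @Continuous _ _ (LimSystem.mk A (Piece B) Γ Piece.Exhausts).limTop
        (LimSystem.mk A (Piece B) Γ Piece.Exhausts).limTop γ ∧
      @Continuous _ _ (LimSystem.mk A (Piece B) Γ Piece.Exhausts).limTop
        (LimSystem.mk A (Piece B) Γ Piece.Exhausts).limTop γ.symm ∧
      K.map γ.toMonoidHom = K' := by
  obtain ⟨H, A₁, hH, hKH⟩ := hR.exists_global K hK
  obtain ⟨H', A₂, hH', hKH'⟩ := hR.exists_global K' hK'
  obtain ⟨H₀, hH₀⟩ := hN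
  obtain ⟨T₁, hB₁, hd₁, hdi₁, h₁⟩ := hH₀ H A₁ hH
  obtain ⟨T₂, hB₂, hd₂, hdi₂, h₂⟩ := hH₀ H' A₂ hH'
  have hTT : ∀ x y, H' ((T₂ * T₁⁻¹) x) ((T₂ * T₁⁻¹) y) = H x y := by
    intro x y
    change H' (T₂ (T₁.symm x)) (T₂ (T₁.symm y)) = _
    rw [h₂, ← h₁, T₁.apply_symm_apply, T₁.apply_symm_apply]
  obtain ⟨Φ, τ, hc, hc', hτ, hadΦ⟩ := hT (T₂ * T₁⁻¹) (hB₂.mul hB₁.inv) (hd₂.mul hdi₁) (by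
    rw [mul_inv_rev, inv_inv]
    exact hd₁.mul hdi₂)
  obtain ⟨γ, hγ, hγ', hγΦ⟩ := LimSystem.exists_auto (LimSystem.mk A (Piece B) Γ Piece.Exhausts)
    Φ hc hc' τ hτ
  obtain ⟨L, -, hex, -⟩ := hK
  have hiff : ∀ g, g ∈ K ↔ γ g ∈ K' := by
    intro g
    obtain ⟨n, hn⟩ := R.exists_mem L hex g
    rw [hKH, hKH', hγΦ, hadΦ _ _ hn]
    generalize T₂ * T₁⁻¹ = T at hTT
    constructor
    · intro h x y
      change H' (T (ad g.1 (T.symm x))) (T (ad g.1 (T.symm y))) = _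
      rw [hTT, h, ← hTT, T.apply_symm_apply, T.apply_symm_apply]
    · intro h x y
      have h3 : H' (T (ad g.1 (T.symm (T x)))) (T (ad g.1 (T.symm (T y)))) = H' (T x) (T y) :=
        h (T x) (T y)
      rwa [T.symm_apply_apply, T.symm_apply_apply, hTT, hTT] at h3
  refine ⟨γ, hγ, hγ', ?_⟩
  ext g
  constructor
  · rintro ⟨k, hk, rfl⟩
    exact (hiff k).1 hk
  · intro hg
    refine ⟨γ.symm g, (hiff _).2 ?_, γ.apply_symm_apply g⟩
    rwa [γ.apply_symm_apply]

end Chain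

/-! ### Forms given by matrices -/

section FormLemmas

variable {D : Type} [DivisionRing D] {h : ℕ → ℕ → D} {σ : D → D}

theorem form_eq {x y : V D} {N : ℕ} (hσ0 : σ 0 = 0) (hx : x ∈ below D N) (hy : y ∈ below D N) :
    form h σ x y = ∑ i ∈ Finset.range N, ∑ j ∈ Finset.range N, x i * h i j * σ (y j) := by
  have hs : ∀ {z : V D}, z ∈ below D N → z.support ⊆ Finset.range N := by
    intro z hz i hi
    rw [Finset.mem_range]
    by_contra hN
    exact (Finsupp.mem_support_iff.1 hi) (hz i (not_lt.1 hN))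
  rw [form, Finsupp.sum_of_support_subset _ (hs hx) _ (by simp [Finsupp.sum])]
  refine Finset.sum_congr rfl fun i _ => ?_
  rw [Finsupp.sum_of_support_subset _ (hs hy) _ (by simp [hσ0])]

theorem exists_below₂ (x y : V D) : ∃ N, x ∈ below D N ∧ y ∈ below D N := by
  obtain ⟨N, hN⟩ := exists_bound x
  obtain ⟨N', hN'⟩ := exists_bound y
  exact ⟨max N N', below_mono (le_max_left _ _) hN, below_mono (le_max_right _ _) hN'⟩

theorem form_add_left (hσ0 : σ 0 = 0) (x y z : V D) :
    form h σ (x + y) z = form h σ x z + form h σ y z := by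
  obtain ⟨N, hx, hy⟩ := exists_below₂ x y
  obtain ⟨N', hz, -⟩ := exists_below₂ z z
  have hx := below_mono (le_max_left N N') hx
  have hy := below_mono (le_max_left N N') hy
  have hz := below_mono (le_max_right N N') hz
  rw [form_eq hσ0 (Submodule.add_mem _ hx hy) hz, form_eq hσ0 hx hz, form_eq hσ0 hy hz]
  simp only [← Finset.sum_add_distrib, Finsupp.add_apply, add_mul]

theorem form_add_right (hσ0 : σ 0 = 0) (hσ : ∀ a b, σ (a + b) = σ a + σ b) (x y z : V D) :
    form h σ x (y + z) = form h σ x y + form h σ x z := by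
  obtain ⟨N, hx, hy⟩ := exists_below₂ x y
  obtain ⟨N', hz, -⟩ := exists_below₂ z z
  have hx := below_mono (le_max_left N N') hx
  have hy := below_mono (le_max_left N N') hy
  have hz := below_mono (le_max_right N N') hz
  rw [form_eq hσ0 hx (Submodule.add_mem _ hy hz), form_eq hσ0 hx hy, form_eq hσ0 hx hz]
  simp only [← Finset.sum_add_distrib, Finsupp.add_apply, hσ, mul_add]

theorem form_smul_left (hσ0 : σ 0 = 0) (d : D) (x y : V D) :
    form h σ (d • x) y = d * form h σ x y := by
  obtain ⟨N, hx, hy⟩ := exists_below₂ x y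
  rw [form_eq hσ0 (Submodule.smul_mem _ d hx) hy, form_eq hσ0 hx hy]
  simp only [Finset.mul_sum, Finsupp.smul_apply, smul_eq_mul, mul_assoc]

theorem form_smul_right (hσ0 : σ 0 = 0) (hσ : ∀ a b, σ (a * b) = σ b * σ a) (d : D) (x y : V D) :
    form h σ x (d • y) = form h σ x y * σ d := by
  obtain ⟨N, hx, hy⟩ := exists_below₂ x y
  rw [form_eq hσ0 hx (Submodule.smul_mem _ d hy), form_eq hσ0 hx hy]
  simp only [Finset.sum_mul, Finsupp.smul_apply, smul_eq_mul, hσ, mul_assoc]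

theorem form_single (hσ0 : σ 0 = 0) (i j : ℕ) (a b : D) :
    form h σ (Finsupp.single i a) (Finsupp.single j b) = a * h i j * σ b := by
  rw [form, Finsupp.sum_single_index (by simp [Finsupp.sum]),
    Finsupp.sum_single_index (by simp [hσ0])]

end FormLemmas

section NormalForms

variable {D : Type} [NormedDivisionRing D] [NormedAlgebra ℝ D] [StarRing D] [Coeff D]

/-- Two sesquilinear forms that agree on bases agree. -/
theorem sesq_ext {B B' : V D → V D → D} {σ : D → D}
    (add_left : ∀ x y z, B (x + y) z = B x z + B y z)
    (smul_left : ∀ (d : D) x y, B (d • x) y = d * B x y)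
    (add_right : ∀ x y z, B x (y + z) = B x y + B x z)
    (smul_right : ∀ (d : D) x y, B x (d • y) = B x y * σ d)
    (add_left' : ∀ x y z, B' (x + y) z = B' x z + B' y z)
    (smul_left' : ∀ (d : D) x y, B' (d • x) y = d * B' x y)
    (add_right' : ∀ x y z, B' x (y + z) = B' x y + B' x z)
    (smul_right' : ∀ (d : D) x y, B' x (d • y) = B' x y * σ d)
    (h : ∀ i j, B (Finsupp.single i 1) (Finsupp.single j 1) =
      B' (Finsupp.single i 1) (Finsupp.single j 1)) (x y : V D) : B x y = B' x y := by
  have hs : ∀ (i : ℕ) (a : D), (Finsupp.single i a : V D) = a • Finsupp.single i 1 := by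
    intro i a
    rw [Finsupp.smul_single, smul_eq_mul, mul_one]
  have z1 : ∀ y, B 0 y = 0 := fun y => by rw [← zero_smul D (0 : V D), smul_left, zero_mul]
  have z1' : ∀ y, B' 0 y = 0 := fun y => by rw [← zero_smul D (0 : V D), smul_left', zero_mul]
  have z2 : ∀ y, B y 0 = 0 := fun y => by
    have := add_right y 0 0
    rwa [add_zero, left_eq_add] at this
  have z2' : ∀ y, B' y 0 = 0 := fun y => by
    have := add_right' y 0 0
    rwa [add_zero, left_eq_add] at this
  induction x using Finsupp.induction_linear with
  | zero => rw [z1, z1']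
  | add x x' hx hx' => rw [add_left, add_left', hx, hx']
  | single i a =>
    induction y using Finsupp.induction_linear with
    | zero => rw [z2, z2']
    | add y y' hy hy' => rw [add_right, add_right', hy, hy']
    | single j b => rw [hs i, hs j, smul_left, smul_left', smul_right, smul_right', h]

/-- The standard Hermitian form on `V`. -/
def stdHerm (D : Type) [DivisionRing D] [StarRing D] : V D → V D → D := form (diag fun _ => 1) star

theorem dual_of_fin {D : Type} [DivisionRing D] (f : V D →ₗ[D] D) (N : ℕ)
    (hf : ∀ i, N ≤ i → f (Finsupp.single i 1) = 0) : ∃ w, ∀ x, f x = pair x w := by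
  classical
  let w : V D := ∑ i ∈ Finset.range N, Finsupp.single i (f (Finsupp.single i 1))
  have hw : ∀ i, w i = f (Finsupp.single i 1) := by
    intro i
    rw [Finsupp.finsetSum_apply]
    by_cases hi : i < N
    · rw [Finset.sum_eq_single i]
      · simp
      · intro b _ hb; simp [hb]
      · simp [hi]
    · rw [hf i (not_lt.1 hi), Finset.sum_eq_zero]
      intro b hb
      have : b ≠ i := by rintro rfl; exact hi (Finset.mem_range.1 hb)
      simp [this]
  refine ⟨w, fun x => ?_⟩
  obtain ⟨K, hK⟩ := exists_bound x
  rw [pair_eq (N := K) hK]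
  conv_lhs => rw [sum_below (N := K) (x := x) hK]
  rw [map_sum]
  exact Finset.sum_congr rfl fun i _ => by rw [map_smul, hw]; rfl

variable {B : V D → V D → D} {σ : D → D} {δ : ℝ} {H : V D → V D → D} {A' : V D →ₗ[ℝ] V D}

/-- An orthonormal basis with the right Gram matrix for `B` gives a standardizing map. -/
theorem GlobalAdm.exists_of_basis (hB : IsForm B σ δ) (hH : GlobalAdm B δ H A') (e : ℕ → V D)
    (he : ∀ i j, H (e i) (e j) = if i = j then 1 else 0)
    (hspan : ∀ n, Finsupp.single n 1 ∈ Submodule.span D (Set.range e))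
    (hBe : ∀ i j, B (e i) (e j) = B (Finsupp.single i 1) (Finsupp.single j 1)) :
    ∃ T : V D ≃ₗ[D] V D, Pres B T ∧ DualPres T ∧ DualPres T⁻¹ ∧
      ∀ x y, H (T x) (T y) = stdHerm D x y := by
  have hherm := hH.adm.herm
  let T₀ : V D →ₗ[D] V D := Finsupp.linearCombination D e
  have hT₀ : ∀ i, T₀ (Finsupp.single i 1) = e i := fun i => by
    simp [T₀]
  have hT₀H : ∀ x k, H (T₀ x) (e k) = x k := by
    intro x k
    induction x using Finsupp.induction_linear with
    | zero => rw [map_zero, hherm.zero_left]; rfl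
    | add x y hx hy => rw [map_add, hherm.add_left, hx, hy]; rfl
    | single i a =>
      rw [show (Finsupp.single i a : V D) = a • Finsupp.single i 1 by simp, map_smul, hT₀,
        hherm.smul_left, he]
      simp [Finsupp.single_apply]
  have hinj : Function.Injective T₀ := by
    refine (injective_iff_map_eq_zero T₀).2 fun x hx => ?_
    ext k
    rw [← hT₀H, hx, hherm.zero_left]; rfl
  have hsurj : Function.Surjective T₀ := by
    rw [← LinearMap.range_eq_top, eq_top_iff]
    intro x _
    rw [Finsupp.range_linearCombination]
    obtain ⟨N, hN⟩ := exists_bound x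
    rw [sum_below (N := N) (x := x) hN]
    exact Submodule.sum_mem _ fun i _ => Submodule.smul_mem _ _ (hspan i)
  let T : V D ≃ₗ[D] V D := LinearEquiv.ofBijective T₀ ⟨hinj, hsurj⟩
  have hT : ∀ i, T (Finsupp.single i 1) = e i := hT₀
  have hTk : ∀ x k, (T.symm x) k = H x (e k) := by
    intro x k
    conv_rhs => rw [← T.apply_symm_apply x]
    exact (hT₀H _ k).symm
  refine ⟨T, ?_, fun w => ?_, fun w => ?_, fun x y => ?_⟩
  · exact fun x y => sesq_ext (B := fun x y => B (T x) (T y)) (B' := B) (σ := σ)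
      (fun x y z => by rw [map_add, hB.add_left]) (fun d x y => by rw [map_smul, hB.smul_left])
      (fun x y z => by rw [map_add, hB.add_right]) (fun d x y => by rw [map_smul, hB.smul_right])
      hB.add_left hB.smul_left hB.add_right hB.smul_right
      (fun i j => by rw [hT, hT, hBe]) x y
  · choose y hy using hH.coord
    choose m hm using fun z : V D => exists_bound (T.symm z)
    obtain ⟨N, hN⟩ := exists_bound w
    refine dual_of_fin (pairLin w ∘ₗ T.toLinearMap) ((Finset.range N).sup fun j => m (y j))
      fun i hi => ?_
    change pair (T (Finsupp.single i 1)) w = 0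
    rw [pair_eq' hN]
    refine Finset.sum_eq_zero fun j hj => ?_
    have h1 : m (y j) ≤ i := le_trans (Finset.le_sup (f := fun j => m (y j)) hj) hi
    rw [hy, hT, hherm.eq_zero_symm (x := y j) (by rw [← hTk]; exact hm _ _ h1), zero_mul]
  · choose m hm using hH.fin
    obtain ⟨N, hN⟩ := exists_bound w
    refine dual_of_fin (pairLin w ∘ₗ T.symm.toLinearMap) ((Finset.range N).sup fun j => m (e j))
      fun i hi => ?_
    change pair (T.symm (Finsupp.single i 1)) w = 0
    rw [pair_eq' hN]
    refine Finset.sum_eq_zero fun j hj => ?_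
    have h1 : m (e j) ≤ i := le_trans (Finset.le_sup (f := fun j => m (e j)) hj) hi
    rw [hTk, hm _ _ h1, zero_mul]
  · refine sesq_ext (B := fun x y => H (T x) (T y)) (B' := stdHerm D) (σ := star)
      (fun x y z => by rw [map_add, hherm.add_left])
      (fun d x y => by rw [map_smul, hherm.smul_left])
      (fun x y z => by rw [map_add, hherm.add_right])
      (fun d x y => by rw [map_smul, hherm.smul_right])
      (form_add_left (star_zero D)) (form_smul_left (star_zero D))
      (form_add_right (star_zero D) star_add) (form_smul_right (star_zero D) star_mul)
      (fun i j => ?_) x y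
    rw [hT, hT, he, stdHerm, form_single (star_zero D), diag]
    simp

/-! ### Gram-Schmidt -/

/-- Gram-Schmidt orthogonalization for an abstract projection `p v x` of `v` to the span of `x`. -/
theorem exists_orthogonalization {M : Type} [AddCommGroup M] (p : M → M → M) (R : AddSubgroup M)
    (hadd : ∀ x y z, p (x + y) z = p x z + p y z) (hp0 : ∀ x, p x 0 = 0)
    (hpR : ∀ x ∈ R, ∀ y ∈ R, p x y ∈ R)
    (hsymm : ∀ x ∈ R, ∀ y ∈ R, p x y = 0 → p y x = 0)
    (hpp : ∀ x ∈ R, ∀ y ∈ R, ∀ z ∈ R, p y z = 0 → p (p x y) z = 0)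
    (hpid : ∀ x ∈ R, ∀ y ∈ R, p y y = y → p (p x y) y = p x y)
    (hnorm : ∀ x ∈ R, x ≠ 0 → ∃ y ∈ R, y ≠ 0 ∧ p y y = y ∧ p x y = x ∧
      ∀ z ∈ R, p x z = 0 → p y z = 0) (v : ℕ → M) (hv : ∀ n, v n ∈ R) :
    ∃ x : ℕ → M, (∀ n, x n ∈ R) ∧ (∀ n, x n ≠ 0 → p (x n) (x n) = x n) ∧
      (∀ m n, m ≠ n → p (x m) (x n) = 0) ∧ ∀ n, v n = ∑ k ∈ Finset.range (n + 1), p (v n) (x k) := by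
  classical
  have hn : ∀ x : M, ∃ y, (x = 0 → y = 0) ∧ (x ∈ R → x ≠ 0 → y ∈ R ∧ y ≠ 0 ∧ p y y = y ∧ p x y = x ∧
      ∀ z ∈ R, p x z = 0 → p y z = 0) := by
    intro x
    by_cases hx : x ∈ R ∧ x ≠ 0
    · obtain ⟨y, hy⟩ := hnorm x hx.1 hx.2
      exact ⟨y, fun h => absurd h hx.2, fun _ _ => hy⟩
    · exact ⟨0, fun _ => rfl, fun h1 h2 => absurd ⟨h1, h2⟩ hx⟩
  choose nrm hn0 hn1 using hn
  let F : ℕ → (ℕ → M) := fun n => Nat.rec (fun _ => 0)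
    (fun n f => Function.update f n (nrm (v n - ∑ k ∈ Finset.range n, p (v n) (f k)))) n
  have hF : ∀ n, F (n + 1) = Function.update (F n) n
    (nrm (v n - ∑ k ∈ Finset.range n, p (v n) (F n k))) := fun n => rfl
  let x : ℕ → M := fun n => F (n + 1) n
  have hFx : ∀ m k, k < m → F m k = x k := by
    intro m k hkm
    induction m, hkm using Nat.le_induction with
    | base => rfl
    | succ m hm ih => rw [hF, Function.update_of_ne (by omega), ih]
  have hx : ∀ n, x n = nrm (v n - ∑ k ∈ Finset.range n, p (v n) (x k)) := by
    intro n
    change F (n + 1) n = _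
    rw [hF, Function.update_self]
    congr 2
    exact Finset.sum_congr rfl fun k hk => by rw [hFx n k (Finset.mem_range.1 hk)]
  have hzero : ∀ z, p 0 z = 0 := fun z => by
    have := hadd 0 0 z
    rwa [add_zero, left_eq_add] at this
  have hsum : ∀ (s : Finset ℕ) (f : ℕ → M) z, p (∑ k ∈ s, f k) z = ∑ k ∈ s, p (f k) z := by
    intro s f z
    induction s using Finset.induction_on with
    | empty => simp [hzero]
    | insert a s ha ih => rw [Finset.sum_insert ha, Finset.sum_insert ha, hadd, ih]
  have key : ∀ n, (∀ k < n, x k ∈ R) → (∀ k < n, x k ≠ 0 → p (x k) (x k) = x k) →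
      (∀ k < n, ∀ l < n, k ≠ l → p (x k) (x l) = 0) →
      x n ∈ R ∧ (x n ≠ 0 → p (x n) (x n) = x n) ∧ (∀ l < n, p (x n) (x l) = 0) ∧
        v n = ∑ k ∈ Finset.range (n + 1), p (v n) (x k) := by
    intro n h1 h2 h3
    set w := v n - ∑ k ∈ Finset.range n, p (v n) (x k) with hw
    have hxw : x n = nrm w := hx n
    have hvw : v n = w + ∑ k ∈ Finset.range n, p (v n) (x k) := by rw [hw]; abel
    have hwR : w ∈ R := R.sub_mem (hv n) (R.sum_mem fun k hk =>
      hpR _ (hv n) _ (h1 k (Finset.mem_range.1 hk)))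
    have horth : ∀ l < n, p w (x l) = 0 := by
      intro l hl
      have e := hadd w (∑ k ∈ Finset.range n, p (v n) (x k)) (x l)
      rw [← hvw, hsum, Finset.sum_eq_single l] at e
      · have : p (p (v n) (x l)) (x l) = p (v n) (x l) := by
          by_cases h0 : x l = 0
          · rw [h0, hp0, hp0]
          · exact hpid _ (hv n) _ (h1 l hl) (h2 l hl h0)
        rw [this] at e
        exact right_eq_add.1 e
      · intro k hk hkl
        exact hpp _ (hv n) _ (h1 k (Finset.mem_range.1 hk)) _ (h1 l hl)
          (h3 k (Finset.mem_range.1 hk) l hl hkl)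
      · intro h; exact absurd (Finset.mem_range.2 hl) h
    by_cases hw0 : w = 0
    · have hx0 : x n = 0 := hxw.trans (hn0 w hw0)
      refine ⟨hx0 ▸ R.zero_mem, fun h => absurd hx0 h, fun l hl => by rw [hx0, hzero], ?_⟩
      rw [Finset.sum_range_succ, hx0, hp0, add_zero]
      conv_lhs => rw [hvw, hw0, zero_add]
    · obtain ⟨a1, a2, a3, a4, a5⟩ := hn1 w hwR hw0
      rw [← hxw] at a1 a2 a3 a4 a5
      have hxl : ∀ l < n, p (x n) (x l) = 0 := fun l hl => a5 _ (h1 l hl) (horth l hl)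
      refine ⟨a1, fun _ => a3, hxl, ?_⟩
      rw [Finset.sum_range_succ]
      have e := hadd w (∑ k ∈ Finset.range n, p (v n) (x k)) (x n)
      rw [← hvw, hsum, Finset.sum_eq_zero, add_zero, a4] at e
      · rw [e, add_comm]; exact hvw
      · intro k hk
        have hk := Finset.mem_range.1 hk
        exact hpp _ (hv n) _ (h1 k hk) _ a1 (hsymm _ a1 _ (h1 k hk) (hxl k hk))
  have all : ∀ n, (∀ k < n, x k ∈ R) ∧ (∀ k < n, x k ≠ 0 → p (x k) (x k) = x k) ∧
      (∀ k < n, ∀ l < n, k ≠ l → p (x k) (x l) = 0) := by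
    intro n
    induction n with
    | zero => exact ⟨by simp, by simp, by simp⟩
    | succ n ih =>
      obtain ⟨h1, h2, h3⟩ := ih
      obtain ⟨b1, b2, b3, -⟩ := key n h1 h2 h3
      have hlt : ∀ k, k < n + 1 → k < n ∨ k = n := fun k hk => by omega
      refine ⟨fun k hk => ?_, fun k hk => ?_, fun k hk l hl hkl => ?_⟩
      · rcases hlt k hk with h | rfl
        · exact h1 k h
        · exact b1
      · rcases hlt k hk with h | rfl
        · exact h2 k h
        · exact b2
      · rcases hlt k hk with h | rfl <;> rcases hlt l hl with h' | rfl
        · exact h3 k h l h' hkl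
        · exact hsymm _ b1 _ (h1 k h) (b3 k h)
        · exact b3 l h'
        · exact absurd rfl hkl
  refine ⟨x, fun n => (all (n + 1)).1 n (by omega), fun n => (all (n + 1)).2.1 n (by omega),
    fun m n hmn => (all (max m n + 1)).2.2 m (by omega) n (by omega) hmn, fun n => ?_⟩
  obtain ⟨h1, h2, h3⟩ := all n
  exact (key n h1 h2 h3).2.2.2

theorem IsHerm.unit_of_smul {H : V D → V D → D} {x : V D} (hx : x ≠ 0)
    (h : H x x • x = x) : H x x = 1 := by
  have : (H x x - 1) • x = 0 := by rw [sub_smul, h, one_smul, sub_self]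
  rcases smul_eq_zero.1 this with h | h
  · exact sub_eq_zero.1 h
  · exact absurd h hx

/-- Gram-Schmidt for a Hermitian form. -/
theorem Adm.exists_orthonormal (hH : Adm B δ ⊤ ⊥ H A') (R : AddSubgroup (V D))
    (hR : ∀ x ∈ R, ∀ y ∈ R, H x y • y ∈ R) (hRr : ∀ (r : ℝ), ∀ x ∈ R, r • x ∈ R) (v : ℕ → V D)
    (hv : ∀ n, v n ∈ R) :
    ∃ x : ℕ → V D, (∀ n, x n ∈ R) ∧ (∀ n, x n ≠ 0 → H (x n) (x n) = 1) ∧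
      (∀ m n, m ≠ n → H (x m) (x n) = 0) ∧ ∀ n, v n ∈ Submodule.span D (Set.range x) := by
  have hh := hH.herm
  have h0 : ∀ x y, H x y • y = 0 ↔ H x y = 0 := by
    intro x y
    rw [smul_eq_zero]
    refine ⟨fun h => h.elim id fun h => by rw [h, hh.zero_right], Or.inl⟩
  obtain ⟨x, h1, h2, h3, h4⟩ := exists_orthogonalization (fun v x => H v x • x) R
    (fun x y z => by rw [hh.add_left, add_smul]) (fun x => smul_zero _) hR
    (fun x _ y _ h => (h0 _ _).2 (hh.eq_zero_symm ((h0 _ _).1 h)))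
    (fun x _ y _ z _ h => by
      change H (H x y • y) z • z = 0
      rw [hh.smul_left, (h0 _ _).1 h, mul_zero, zero_smul])
    (fun x _ y _ h => by
      change H (H x y • y) y • y = H x y • y
      rw [hh.smul_left, mul_smul, h])
    (fun x hx hne => by
      obtain ⟨r, hr, hrx⟩ := hH.exists_unit (x := x) trivial hne
      refine ⟨r • x, hRr r x hx, smul_ne_zero hr.ne' hne, by rw [hrx, one_smul], ?_, fun z _ h => ?_⟩
      · rw [hh.rsmul_left, hh.rsmul_right, hh.self_eq, ← map_mul, ← map_mul,
          ← map_one (oR D), oR_inj] at hrx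
        have hrx' : re (H x x) * r * r = 1 := by linarith
        rw [hh.rsmul_right, hh.self_eq, ← map_mul, oR_smul, smul_smul, hrx', one_smul]
      · rw [hh.rsmul_left, mul_smul, h, smul_zero]) v hv
  refine ⟨x, h1, fun n hn => IsHerm.unit_of_smul hn (h2 n hn), fun m n hmn => (h0 _ _).1 (h3 m n hmn),
    fun n => ?_⟩
  rw [h4]
  exact Submodule.sum_mem _ fun k _ => Submodule.smul_mem _ _ (Submodule.subset_span ⟨k, rfl⟩)

theorem infinite_of_span {x : ℕ → V D}
    (h : ∀ n, Finsupp.single n 1 ∈ Submodule.span D (Set.range x)) : {n | x n ≠ 0}.Infinite := by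
  intro hfin
  have hspan : Submodule.span D (Set.range x) ≤ Submodule.span D (x '' {n | x n ≠ 0}) := by
    refine Submodule.span_le.2 ?_
    rintro _ ⟨n, rfl⟩
    by_cases hn : x n = 0
    · rw [hn]; exact Submodule.zero_mem _
    · exact Submodule.subset_span ⟨n, hn, rfl⟩
  haveI : Module.Finite D (Submodule.span D (x '' {n | x n ≠ 0})) :=
    FiniteDimensional.span_of_finite D (hfin.image x)
  obtain ⟨N, hN⟩ := exists_below_of_fg (U := Submodule.span D (x '' {n | x n ≠ 0}))
  have := hN (hspan (h N)) N le_rfl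
  rw [Finsupp.single_eq_same] at this
  exact one_ne_zero this

/-- The nonzero members of an orthogonal sequence, renumbered. -/
theorem exists_renumber {x : ℕ → V D}
    (h : ∀ n, Finsupp.single n 1 ∈ Submodule.span D (Set.range x)) :
    ∃ φ : ℕ → ℕ, Function.Injective φ ∧ (∀ n, x (φ n) ≠ 0) ∧ ∀ m, x m ≠ 0 → ∃ n, φ n = m := by
  haveI : Infinite {n | x n ≠ 0} := (infinite_of_span h).to_subtype
  classical
  let ι := Nat.Subtype.orderIsoOfNat {n | x n ≠ 0}
  refine ⟨fun n => ι n, Subtype.val_injective.comp ι.injective, fun n => (ι n).2, fun m hm => ?_⟩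
  exact ⟨ι.symm ⟨m, hm⟩, congrArg Subtype.val (ι.apply_symm_apply ⟨m, hm⟩)⟩

theorem span_renumber {x : ℕ → V D} {φ : ℕ → ℕ} (h : ∀ m, x m ≠ 0 → ∃ n, φ n = m) :
    Submodule.span D (Set.range x) ≤ Submodule.span D (Set.range (x ∘ φ)) := by
  refine Submodule.span_le.2 ?_
  rintro _ ⟨m, rfl⟩
  by_cases hm : x m = 0
  · rw [hm]; exact Submodule.zero_mem _
  · obtain ⟨n, rfl⟩ := h m hm
    exact Submodule.subset_span ⟨n, rfl⟩

end NormalForms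

/-! ### The forms of the classical groups -/

section Forms

variable {D : Type} [NormedDivisionRing D] [NormedAlgebra ℝ D] [StarRing D] [Coeff D]

theorem isForm_form {h : ℕ → ℕ → D} {σ : D → D} {δ : ℝ} (hadd : ∀ a b, σ (a + b) = σ a + σ b)
    (hmul : ∀ a b, σ (a * b) = σ b * σ a) (hinv : ∀ d, star (σ (star (σ d))) = d)
    (hreal : ∀ r : ℝ, σ (oR D r) = oR D r) (hδ : δ = 1 ∨ δ = -1)
    (hsymm : ∀ i j a b, re (b * h j i * σ a) = δ * re (a * h i j * σ b))
    (hnd : ∀ i, ∃ j, h i j ≠ 0 ∧ ∀ k, k ≠ i → h k j = 0) : IsForm (form h σ) σ δ := by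
  have hσ0 : σ 0 = 0 := by
    have := hreal 0
    rwa [map_zero] at this
  have hσ1 : σ 1 = 1 := by
    have := hreal 1
    rwa [map_one] at this
  refine ⟨form_add_left hσ0, form_smul_left hσ0, form_add_right hσ0 hadd, form_smul_right hσ0 hmul,
    hinv, hreal, fun x y => ?_, fun _ x hx => ?_, Or.inr hδ, fun h0 => ?_⟩
  · obtain ⟨N, hx, hy⟩ := exists_below₂ x y
    rw [form_eq hσ0 hx hy, form_eq hσ0 hy hx, Finset.sum_comm]
    simp only [map_sum, Finset.mul_sum]
    exact Finset.sum_congr rfl fun i _ => Finset.sum_congr rfl fun j _ => hsymm i j _ _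
  · ext i
    obtain ⟨j, h1, h2⟩ := hnd i
    obtain ⟨N, hN⟩ := exists_bound x
    have h3 := hx (Finsupp.single j 1)
    rw [form_eq (N := max N (max (i + 1) (j + 1))) hσ0 (below_mono (le_max_left _ _) hN) (by
      intro k hk
      rw [Finsupp.single_eq_of_ne]
      have := le_max_right N (max (i + 1) (j + 1))
      have := le_max_right (i + 1) (j + 1)
      omega), Finset.sum_eq_single i, Finset.sum_eq_single j] at h3
    · rw [Finsupp.single_eq_same, hσ1, mul_one] at h3
      exact (mul_eq_zero.1 h3).resolve_right h1
    · intro b _ hb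
      rw [Finsupp.single_eq_of_ne hb, hσ0, mul_zero]
    · simp
    · intro b _ hb
      refine Finset.sum_eq_zero fun k _ => ?_
      by_cases hk : k = j
      · rw [hk, h2 b hb, mul_zero, zero_mul]
      · rw [Finsupp.single_eq_of_ne hk, hσ0, mul_zero]
    · intro hi
      exact absurd (Finset.mem_range.2 (by simp)) hi
  · rcases hδ with h | h <;> rw [h] at h0 <;> norm_num at h0

theorem isForm_diag {d : ℕ → D} {σ : D → D} {δ : ℝ} (hadd : ∀ a b, σ (a + b) = σ a + σ b)
    (hmul : ∀ a b, σ (a * b) = σ b * σ a) (hinv : ∀ d, star (σ (star (σ d))) = d)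
    (hreal : ∀ r : ℝ, σ (oR D r) = oR D r) (hδ : δ = 1 ∨ δ = -1)
    (hsymm : ∀ i a b, re (b * d i * σ a) = δ * re (a * d i * σ b)) (hd : ∀ i, d i ≠ 0) :
    IsForm (form (diag d) σ) σ δ := by
  refine isForm_form hadd hmul hinv hreal hδ (fun i j a b => ?_) fun i => ⟨i, ?_, fun k hk => ?_⟩
  · by_cases hij : i = j
    · subst hij
      simpa [diag] using hsymm i a b
    · simp [diag, hij, Ne.symm hij]
  · simpa [diag] using hd i
  · simp [diag, hk]

theorem isForm_zero : IsForm (form (fun _ _ => (0 : D)) id) star 0 := by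
  have h : ∀ x y : V D, form (fun _ _ => (0 : D)) id x y = 0 := by
    intro x y
    simp [form, Finsupp.sum]
  refine ⟨?_, ?_, ?_, ?_, ?_, star_oR, ?_, fun h0 => absurd rfl h0, Or.inl rfl, fun _ => h⟩ <;>
    intros <;> simp [h]

theorem IsForm.symm_star {M : Type} [AddCommGroup M] [Module D M] {B : M → M → D} {σ : D → D}
    {δ : ℝ} (hB : IsForm B σ δ) (hσ : ∀ d, σ d = star d) (x y : M) :
    B y x = oR D δ * star (B x y) :=
  eq_of_re fun d => by
    rw [← hB.smul_left, hB.re_symm x, hB.smul_right, hσ, ← mul_assoc, ← oR_comm, mul_assoc,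
      re_oR_mul, ← re_star (B x y * star d), star_mul, star_star]

end Forms

section AdmLemmas

variable {D : Type} [NormedDivisionRing D] [NormedAlgebra ℝ D] [StarRing D] [Coeff D]
variable {M : Type} [AddCommGroup M] [Module D M] [Module ℝ M] [IsScalarTower ℝ D M]
variable {B : M → M → D} {δ : ℝ} {U C : Submodule D M} {H : M → M → D} {A : M →ₗ[ℝ] M}
  {σ : D → D} (h : Adm B δ U C H A) (hB : IsForm B σ δ)
include h hB

namespace Adm

theorem A_smul (d : D) {y : M} (hy : y ∈ U) : A (d • y) = star (σ d) • A y := by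
  refine h.eq_of_H (h.A_mem _) (U.smul_mem _ (h.A_mem _)) fun z hz => ?_
  rw [← h.B_eq z hz _ (U.smul_mem d hy), hB.smul_right, h.B_eq z hz y hy, h.herm.smul_right,
    star_star]

/-- For a (skew-)Hermitian form, `A` is self-adjoint up to the sign `δ`. -/
theorem adj_star (hσ : ∀ d, σ d = star d) {x y : M} (hx : x ∈ U) (hy : y ∈ U) :
    H (A x) y = oR D δ * H x (A y) := by
  rw [← h.herm.star_symm, ← h.B_eq y hy x hx, hB.symm_star hσ x y, star_mul, star_star, star_oR,
    ← oR_comm, h.B_eq x hx y hy]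

theorem smul_of_star (hσ : ∀ d, σ d = star d) (d : D) {y : M} (hy : y ∈ U) :
    A (d • y) = d • A y := by
  rw [h.A_smul hB d hy, hσ, star_star]

end Adm

end AdmLemmas

section Comm

variable {𝕜 : Type} [RCLike 𝕜]
variable {M : Type} [AddCommGroup M] [Module 𝕜 M] [Module ℝ M] [IsScalarTower ℝ 𝕜 M]
variable {B : M → M → 𝕜} {δ : ℝ} {U C : Submodule 𝕜 M} {H : M → M → 𝕜} {A : M →ₗ[ℝ] M}

theorem IsForm.symm_id (hB : IsForm B id δ) (x y : M) : B y x = oR 𝕜 δ * B x y :=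
  eq_of_re fun d => by
    rw [← hB.smul_left, hB.re_symm x, hB.smul_right, id, mul_left_comm, re_oR_mul, mul_comm d]

theorem Adm.adj_id (h : Adm B δ U C H A) (hB : IsForm B id δ) {x y : M} (hx : x ∈ U) (hy : y ∈ U) :
    H (A x) y = oR 𝕜 δ * star (H x (A y)) := by
  rw [← h.herm.star_symm, ← h.B_eq y hy x hx, hB.symm_id x y, star_mul, star_oR, mul_comm,
    h.B_eq x hx y hy]

end Comm

/-! ### Normal forms -/

section NormalForms

variable {D : Type} [NormedDivisionRing D] [NormedAlgebra ℝ D] [StarRing D] [Coeff D]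
variable {B : V D → V D → D} {σ : D → D} {δ : ℝ} {H : V D → V D → D} {A : V D →ₗ[ℝ] V D}

theorem Adm.exists_onb (hH : Adm B δ ⊤ ⊥ H A) (R : Submodule ℝ (V D))
    (hR : ∀ x ∈ R, ∀ y ∈ R, H x y • y ∈ R) (v : ℕ → V D)
    (hv : ∀ n, v n ∈ R) (hs : ∀ n, Finsupp.single n 1 ∈ Submodule.span D (Set.range v)) :
    ∃ e : ℕ → V D, (∀ n, e n ∈ R) ∧ (∀ i j, H (e i) (e j) = if i = j then 1 else 0) ∧
      ∀ n, Finsupp.single n 1 ∈ Submodule.span D (Set.range e) := by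
  obtain ⟨x, h1, h2, h3, h4⟩ := hH.exists_orthonormal R.toAddSubgroup hR (fun r x hx => R.smul_mem r hx) v hv
  have h5 : ∀ n, Finsupp.single n 1 ∈ Submodule.span D (Set.range x) := fun n =>
    (Submodule.span_le.2 (by rintro _ ⟨k, rfl⟩; exact h4 k)) (hs n)
  obtain ⟨φ, hφ, hφ0, hφs⟩ := exists_renumber h5
  refine ⟨x ∘ φ, fun n => h1 _, fun i j => ?_, fun n => span_renumber hφs (h5 n)⟩
  by_cases hij : i = j
  · subst hij
    rw [if_pos rfl]
    exact h2 _ (hφ0 i)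
  · rw [if_neg hij]
    exact h3 _ _ (hφ.ne hij)

theorem normalForm_zero : NormalForm (form (fun _ _ => (0 : D)) id) 0 := by
  refine ⟨stdHerm D, fun H A hH => ?_⟩
  obtain ⟨e, -, h2, h3⟩ := hH.adm.exists_onb ⊤ (fun _ _ _ _ => trivial)
    (fun n => Finsupp.single n 1) (fun _ => trivial) fun n => Submodule.subset_span ⟨n, rfl⟩
  exact hH.exists_of_basis isForm_zero e h2 h3 fun i j => by
    rw [isForm_zero.eq_zero rfl, isForm_zero.eq_zero rfl]

theorem mem_span_interleave {e : ℕ → V D} {u w : ℕ → V D} (a b : D)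
    (h : ∀ n, e n = a • u n + b • w n) (n : ℕ) :
    e n ∈ Submodule.span D (Set.range fun k => if Even k then u (k / 2) else w (k / 2)) := by
  rw [h]
  refine Submodule.add_mem _ (Submodule.smul_mem _ _ (Submodule.subset_span ⟨2 * n, ?_⟩))
    (Submodule.smul_mem _ _ (Submodule.subset_span ⟨2 * n + 1, ?_⟩))
  · simp
  · have h1 : ¬ Even (2 * n + 1) := by simp
    have h2 : (2 * n + 1) / 2 = n := by omega
    simp only [h1, if_false, h2]

theorem isForm_soC : IsForm (form (diag fun _ => (1 : ℂ)) id) id 1 :=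
  isForm_diag (fun _ _ => rfl) (fun a b => mul_comm a b) (fun d => star_star d) (fun _ => rfl)
    (Or.inl rfl) (fun i a b => by rw [one_mul, mul_one, mul_one, id, id, mul_comm])
    fun _ => one_ne_zero

theorem normalForm_soC : NormalForm (form (diag fun _ => (1 : ℂ)) id) 1 := by
  have hB := isForm_soC
  refine ⟨stdHerm ℂ, fun H A hH => ?_⟩
  have hA := hH.adm
  have hsq : ∀ y, A (A y) = y := fun y => by rw [hA.A_sq y trivial, one_smul]
  have hsm : ∀ (d : ℂ) y, A (d • y) = star d • A y := fun d y => hA.A_smul hB d trivial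
  obtain ⟨R, hR⟩ : ∃ R : Submodule ℝ (V ℂ), ∀ x, x ∈ R ↔ A x = x :=
    ⟨LinearMap.ker (A - LinearMap.id), fun x => by simp [sub_eq_zero]⟩
  have hreal : ∀ x ∈ R, ∀ y ∈ R, star (H x y) = H x y := by
    intro x hx y hy
    have := hA.adj_id hB (x := x) (y := y) trivial trivial
    rw [(hR x).1 hx, (hR y).1 hy, map_one, one_mul] at this
    exact this.symm
  have hI : -Complex.I / 2 * Complex.I = 1 / 2 := by
    rw [div_mul_eq_mul_div, neg_mul, Complex.I_mul_I, neg_neg]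
  have hs := mem_span_interleave (e := fun n => Finsupp.single n (1 : ℂ))
    (u := fun n => Finsupp.single n 1 + A (Finsupp.single n 1))
    (w := fun n => Complex.I • (Finsupp.single n 1 - A (Finsupp.single n 1)))
    (1 / 2) (-Complex.I / 2) (fun n => by
      rw [smul_smul, hI, ← smul_add, add_add_sub_cancel, ← two_smul ℂ, smul_smul]
      norm_num)
  obtain ⟨e, h1, h2, h3⟩ := hA.exists_onb R (fun x hx y hy => by
      rw [hR] at hy ⊢
      rw [hsm, hreal x hx y ((hR y).2 hy), hy]) _
    (fun k => by
      rw [hR]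
      split_ifs
      · rw [map_add, hsq, add_comm]
      · rw [hsm, map_sub, hsq, Complex.star_def, Complex.conj_I, neg_smul, ← smul_neg, neg_sub]) hs
  simp only [hR] at h1
  refine hH.exists_of_basis hB e h2 h3 fun i j => ?_
  rw [hA.B_eq _ trivial _ trivial, h1 j, h2, form_single rfl]
  simp [diag]

/-- The quaternion `i`. -/
def quatI : ℍ[ℝ] := ⟨0, 1, 0, 0⟩

/-- The quaternion `j`. -/
def quatJ : ℍ[ℝ] := ⟨0, 0, 1, 0⟩

theorem quatI_mul_self : quatI * quatI = -1 := by
  ext <;> simp [Quaternion.re_mul, Quaternion.imI_mul, Quaternion.imJ_mul, Quaternion.imK_mul] <;>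
    simp [quatI]

theorem quatJ_mul_self : quatJ * quatJ = -1 := by
  ext <;> simp [Quaternion.re_mul, Quaternion.imI_mul, Quaternion.imJ_mul, Quaternion.imK_mul] <;>
    simp [quatJ]

theorem quatI_mul_quatJ : quatI * quatJ = -(quatJ * quatI) := by
  ext <;> simp [Quaternion.re_mul, Quaternion.imI_mul, Quaternion.imJ_mul, Quaternion.imK_mul] <;>
    simp [quatI, quatJ]

theorem star_quatI : star quatI = -quatI := by
  ext <;> simp <;> simp [quatI]

theorem quatI_ne_zero : quatI ≠ 0 := fun h => by
  have := quatI_mul_self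
  rw [h, mul_zero] at this
  exact one_ne_zero (neg_eq_zero.1 this.symm)

theorem isForm_soStar : IsForm (form (diag fun _ => quatI) star) star (-1) :=
  isForm_diag star_add star_mul (fun d => by simp) star_oR (Or.inr rfl)
    (fun i a b => by
      rw [← re_star, star_mul, star_mul, star_star, star_quatI, neg_mul, mul_neg, map_neg,
        neg_one_mul, mul_assoc]) fun _ => quatI_ne_zero

theorem normalForm_soStar : NormalForm (form (diag fun _ => quatI) star) (-1) := by
  have hII := quatI_mul_self
  have hJJ := quatJ_mul_self
  have hIJ := quatI_mul_quatJ
  have hsI := star_quatI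
  have hB := isForm_soStar
  generalize quatI = I at *
  generalize quatJ = J at *
  refine ⟨stdHerm ℍ[ℝ], fun H A hH => ?_⟩
  have hA := hH.adm
  have hsq : ∀ y, A (A y) = -y := fun y => by rw [hA.A_sq y trivial, neg_one_smul]
  have hsm : ∀ (d : ℍ[ℝ]) y, A (d • y) = d • A y := fun d y =>
    hA.smul_of_star hB (fun _ => rfl) d trivial
  obtain ⟨R, hR⟩ : ∃ R : Submodule ℝ (V ℍ[ℝ]), ∀ x, x ∈ R ↔ A x = -(I • x) := by
    refine ⟨{ carrier := {x | A x = -(I • x)}, add_mem' := ?_, zero_mem' := ?_, smul_mem' := ?_ },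
      fun _ => Iff.rfl⟩
    · intro x y hx hy
      rw [Set.mem_setOf_eq] at hx hy ⊢
      rw [map_add, hx, hy, smul_add, neg_add]
    · rw [Set.mem_setOf_eq, map_zero, smul_zero, neg_zero]
    · intro r x hx
      rw [Set.mem_setOf_eq] at hx ⊢
      rw [map_smul, hx, smul_neg, smul_comm]
  have hcomm : ∀ x ∈ R, ∀ y ∈ R, I * H x y = H x y * I := by
    intro x hx y hy
    have := hA.adj_star hB (fun _ => rfl) (x := x) (y := y) trivial trivial
    rw [(hR x).1 hx, (hR y).1 hy, hA.herm.neg_left, hA.herm.neg_right,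
      hA.herm.smul_left, hA.herm.smul_right, hsI, map_neg, map_one, neg_one_mul, mul_neg,
      neg_neg, neg_inj] at this
    exact this
  have hs := mem_span_interleave (e := fun n => Finsupp.single n (1 : ℍ[ℝ]))
    (u := fun n => Finsupp.single n 1 + I • A (Finsupp.single n 1))
    (w := fun n => J • (Finsupp.single n 1 - I • A (Finsupp.single n 1)))
    (oR ℍ[ℝ] (1 / 2)) (-(oR ℍ[ℝ] (1 / 2) * J)) (fun n => by
      rw [smul_smul, neg_mul, mul_assoc, hJJ, mul_neg, neg_neg, mul_one, ← smul_add,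
        add_add_sub_cancel, oR_smul, ← two_smul ℝ, smul_smul]
      norm_num)
  obtain ⟨e, h1, h2, h3⟩ := hA.exists_onb R (fun x hx y hy => by
      have h := hcomm x hx y hy
      rw [hR] at hy ⊢
      rw [hsm, hy, smul_smul, h, smul_neg, smul_smul]) _
    (fun k => by
      rw [hR]
      split_ifs
      · rw [map_add, hsm, hsq, smul_neg, smul_add, smul_smul, hII, neg_smul, one_smul]
        abel
      · rw [hsm, map_sub, hsm, hsq, smul_smul, hIJ, neg_smul, neg_neg, mul_smul, smul_sub I,
          smul_smul I I, hII, smul_neg, neg_smul, one_smul, sub_neg_eq_add, sub_neg_eq_add,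
          add_comm]) hs
  simp only [hR] at h1
  refine hH.exists_of_basis hB e h2 h3 fun i j => ?_
  rw [hA.B_eq _ trivial _ trivial, h1 j, hA.herm.neg_right,
    hA.herm.smul_right, h2, form_single (star_zero _), hsI, star_one]
  simp [diag]

section Symplectic

variable {𝕜 : Type} [RCLike 𝕜]

theorem isForm_symplectic : IsForm (form (symplectic (D := 𝕜)) id) id (-1) := by
  refine isForm_form (fun _ _ => rfl) (fun a b => mul_comm a b) (fun d => star_star d)
    (fun _ => rfl) (Or.inr rfl) (fun i j a b => ?_) fun i => ?_
  · have : (symplectic j i : 𝕜) = -symplectic i j := by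
      simp only [symplectic]
      split_ifs with h1 h2 h2 <;> try simp
      · obtain ⟨h1, rfl⟩ := h1
        obtain ⟨h2, h3⟩ := h2
        omega
    rw [this, id, id, neg_one_mul, ← map_neg re]
    congr 1
    ring
  · by_cases hi : Even i
    · refine ⟨i + 1, by simp [symplectic, hi], fun k hk => ?_⟩
      simp only [symplectic]
      rw [if_neg, if_neg]
      · rintro ⟨h, -⟩
        exact (Nat.even_add_one.1 h) hi
      · rintro ⟨-, h⟩
        omega
    · obtain ⟨m, rfl⟩ : ∃ m, i = m + 1 := ⟨i - 1, by
        rcases i with _ | i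
        · simp at hi
        · rfl⟩
      have hm : Even m := by
        by_contra h
        exact hi (Nat.even_add_one.2 h)
      refine ⟨m, ?_, fun k hk => ?_⟩
      · simp only [symplectic]
        rw [if_neg (fun h => hi h.1), if_pos ⟨hm, trivial⟩]
        simp
      · simp only [symplectic]
        rw [if_neg, if_neg]
        · rintro ⟨-, h⟩
          exact hk h
        · rintro ⟨h, rfl⟩
          exact (Nat.even_add_one.1 hm) h

theorem normalForm_symplectic : NormalForm (form (symplectic (D := 𝕜)) id) (-1) := by
  have hB := isForm_symplectic (𝕜 := 𝕜)
  refine ⟨stdHerm 𝕜, fun H A hH => ?_⟩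
  have hA := hH.adm
  have hh := hA.herm
  have hsq : ∀ y, A (A y) = -y := fun y => by rw [hA.A_sq y trivial, neg_one_smul]
  have hsm : ∀ (d : 𝕜) y, A (d • y) = star d • A y := fun d y => hA.A_smul hB d trivial
  have hadj : ∀ x y, H (A x) y = -star (H x (A y)) := fun x y => by
    rw [hA.adj_id hB trivial trivial, map_neg, map_one, neg_one_mul]
  have hAA : ∀ x y, H (A x) (A y) = star (H x y) := fun x y => by
    rw [hadj, hsq, hh.neg_right, star_neg, neg_neg]
  have hxA : ∀ x, H x (A x) = 0 := by
    intro x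
    have := hadj x x
    rw [← hh.star_symm] at this
    have h2 := self_eq_neg.1 this
    rwa [star_eq_zero] at h2
  have hAx : ∀ x, H (A x) x = 0 := fun x => hh.eq_zero_symm (hxA x)
  let p : V 𝕜 → V 𝕜 → V 𝕜 := fun v x => H v x • x + H v (A x) • A x
  have hpz : ∀ {y z}, p y z = 0 → H y z = 0 ∧ H y (A z) = 0 := by
    intro y z h
    by_cases hz : z = 0
    · rw [hz, map_zero, hh.zero_right]; exact ⟨rfl, rfl⟩
    · have h1 : H z z ≠ 0 := fun h => hz (hA.eq_zero trivial h)
      have h2 : H (p y z) z = 0 := by rw [h, hh.zero_left]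
      have h3 : H (p y z) (A z) = 0 := by rw [h, hh.zero_left]
      simp only [p] at h2 h3
      rw [hh.add_left, hh.smul_left, hh.smul_left, hAx, mul_zero, add_zero] at h2
      rw [hh.add_left, hh.smul_left, hh.smul_left, hAA, hh.star_symm, hxA, mul_zero, zero_add] at h3
      exact ⟨(mul_eq_zero.1 h2).resolve_right h1, (mul_eq_zero.1 h3).resolve_right h1⟩
  have hpz' : ∀ {y z}, H y z = 0 → H y (A z) = 0 → p y z = 0 := by
    intro y z h1 h2
    simp only [p]
    rw [h1, h2, zero_smul, zero_smul, add_zero]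
  have hA0 : ∀ {y z}, H y z = 0 → H (A y) (A z) = 0 := by
    intro y z h; rw [hAA, h, star_zero]
  have hA1 : ∀ {y z}, H y (A z) = 0 → H (A y) z = 0 := by
    intro y z h; rw [hadj, h, star_zero, neg_zero]
  have hpself : ∀ {y}, p y y = y → y ≠ 0 → H y y = 1 := by
    intro y h hy
    simp only [p] at h
    rw [hxA, zero_smul, add_zero] at h
    exact IsHerm.unit_of_smul hy h
  obtain ⟨x, -, h2, h3, h4⟩ := exists_orthogonalization p ⊤
    (fun x y z => by
      simp only [p]
      rw [hh.add_left, hh.add_left, add_smul, add_smul]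
      abel)
    (fun x => by simp only [p]; simp)
    (fun _ _ _ _ => trivial)
    (fun x _ y _ h => by
      obtain ⟨h1, h2⟩ := hpz h
      exact hpz' (hh.eq_zero_symm h1) (hh.eq_zero_symm (hA1 h2)))
    (fun x _ y _ z _ h => by
      obtain ⟨h1, h2⟩ := hpz h
      refine hpz' ?_ ?_ <;> simp only [p] <;> rw [hh.add_left, hh.smul_left, hh.smul_left]
      · rw [h1, hA1 h2, mul_zero, mul_zero, add_zero]
      · rw [h2, hA0 h1, mul_zero, mul_zero, add_zero])
    (fun x _ y _ h => by
      by_cases hy : y = 0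
      · subst hy
        simp only [p]
        simp
      have h1 := hpself h hy
      have e1 : H (p x y) y = H x y := by
        simp only [p]
        rw [hh.add_left, hh.smul_left, hh.smul_left, h1, hAx, mul_zero, mul_one, add_zero]
      have e2 : H (p x y) (A y) = H x (A y) := by
        simp only [p]
        rw [hh.add_left, hh.smul_left, hh.smul_left, hAA, h1, hxA, mul_zero, star_one, mul_one,
          zero_add]
      change H (p x y) y • y + H (p x y) (A y) • A y = _
      rw [e1, e2])
    (fun x _ hne => by
      obtain ⟨r, hr, hrx⟩ := hH.adm.exists_unit (x := x) trivial hne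
      refine ⟨r • x, trivial, smul_ne_zero hr.ne' hne, ?_, ?_, fun z _ h => ?_⟩
      · simp only [p]
        rw [hrx, hxA, zero_smul, one_smul, add_zero]
      · simp only [p]
        rw [map_smul, hh.rsmul_right r x (A x), hxA, zero_mul, zero_smul, add_zero]
        rw [hh.rsmul_left, hh.rsmul_right, hh.self_eq, ← map_mul, ← map_mul,
          ← map_one (oR 𝕜), oR_inj] at hrx
        have hrx' : re (H x x) * r * r = 1 := by linarith
        rw [hh.rsmul_right, hh.self_eq, ← map_mul, oR_smul, smul_smul, hrx', one_smul]
      · obtain ⟨h1, h2⟩ := hpz h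
        exact hpz' (by rw [hh.rsmul_left, h1, mul_zero]) (by rw [hh.rsmul_left, h2, mul_zero]))
    (fun n => Finsupp.single n 1) (fun _ => trivial)
  have hspan2 : ∀ n, ∀ φ : ℕ → ℕ, (∀ m, x m ≠ 0 → ∃ n, φ n = m) → Finsupp.single n 1 ∈
      Submodule.span 𝕜 (Set.range fun k => if Even k then A (x (φ (k / 2))) else x (φ (k / 2))) := by
    intro n φ hφ
    rw [h4 n]
    refine Submodule.sum_mem _ fun k _ => ?_
    by_cases hk : x k = 0
    · simp only [p]
      simp [hk]
    · obtain ⟨m, rfl⟩ := hφ k hk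
      refine Submodule.add_mem _ (Submodule.smul_mem _ _ (Submodule.subset_span ⟨2 * m + 1, ?_⟩))
        (Submodule.smul_mem _ _ (Submodule.subset_span ⟨2 * m, ?_⟩))
      · have h1 : ¬ Even (2 * m + 1) := by simp
        have h2 : (2 * m + 1) / 2 = m := by omega
        simp only [h1, if_false, h2]
      · simp
  have hinf : {n | x n ≠ 0}.Infinite := by
    have := infinite_of_span (fun n => by
      exact hspan2 n id fun m _ => ⟨m, rfl⟩)
    intro hfin
    refine this ((hfin.preimage_embedding ⟨fun k => k, fun _ _ h => h⟩ |>.biUnion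
      (t := fun m => {2 * m, 2 * m + 1}) fun m _ => Set.toFinite _).subset fun k hk => ?_)
    refine Set.mem_biUnion (x := k / 2) ?_ ?_
    · change x (k / 2) ≠ 0
      intro h0
      refine hk ?_
      simp only [id]
      split_ifs
      · rw [h0, map_zero]
      · exact h0
    · simp only [Set.mem_insert_iff, Set.mem_singleton_iff]
      omega
  haveI : Infinite {n | x n ≠ 0} := hinf.to_subtype
  classical
  let ι := Nat.Subtype.orderIsoOfNat {n | x n ≠ 0}
  let φ : ℕ → ℕ := fun n => ι n
  have hφ : Function.Injective φ := Subtype.val_injective.comp ι.injective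
  have hφ0 : ∀ n, x (φ n) ≠ 0 := fun n => (ι n).2
  have hφs : ∀ m, x m ≠ 0 → ∃ n, φ n = m := fun m hm =>
    ⟨ι.symm ⟨m, hm⟩, congrArg Subtype.val (ι.apply_symm_apply ⟨m, hm⟩)⟩
  have hxx : ∀ i j, H (x (φ i)) (x (φ j)) = if i = j then 1 else 0 := by
    intro i j
    by_cases hij : i = j
    · subst hij
      rw [if_pos rfl]
      exact hpself (h2 _ (hφ0 i)) (hφ0 i)
    · rw [if_neg hij]
      exact (hpz (h3 _ _ (hφ.ne hij))).1
  have hxAx : ∀ i j, H (x (φ i)) (A (x (φ j))) = 0 := by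
    intro i j
    by_cases hij : i = j
    · subst hij
      exact hxA _
    · exact (hpz (h3 _ _ (hφ.ne hij))).2
  have hstar : ∀ P : Prop, [Decidable P] → star (if P then (1 : 𝕜) else 0) = if P then 1 else 0 := by
    intro P _
    split_ifs <;> simp
  have hhalf : ∀ {i j}, (Even i ↔ Even j) → (i / 2 = j / 2 ↔ i = j) := by
    intro i j h
    simp only [Nat.even_iff] at h
    omega
  refine hH.exists_of_basis hB
    (fun k => if Even k then A (x (φ (k / 2))) else x (φ (k / 2))) (fun i j => ?_)
    (fun n => hspan2 n φ hφs) fun i j => ?_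
  · by_cases hi : Even i <;> by_cases hj : Even j <;> simp only [hi, hj, if_true, if_false]
    · rw [hAA, hxx, hstar]
      simp only [hhalf (iff_of_true hi hj)]
    · rw [if_neg (by rintro rfl; exact hj hi)]
      exact hh.eq_zero_symm (hxAx _ _)
    · rw [if_neg (by rintro rfl; exact hi hj)]
      exact hxAx _ _
    · rw [hxx]
      simp only [hhalf (iff_of_false hi hj)]
  · rw [hA.B_eq _ trivial _ trivial, form_single rfl, one_mul, id, mul_one]
    by_cases hi : Even i <;> by_cases hj : Even j <;>
      simp only [hi, hj, if_true, if_false, symplectic, true_and, false_and]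
    · rw [hsq, hh.neg_right, hh.eq_zero_symm (hxAx _ _), neg_zero, if_neg, if_neg]
      · rintro rfl; exact (Nat.even_add_one.1 hi) hj
      · rintro rfl; exact (Nat.even_add_one.1 hj) hi
    · rw [hAA, hxx, hstar]
      simp only [Nat.even_iff] at hi hj
      have : (i / 2 = j / 2) ↔ j = i + 1 := by omega
      simp only [this]
    · rw [hsq, hh.neg_right, hxx]
      simp only [Nat.even_iff] at hi hj
      have : (i / 2 = j / 2) ↔ i = j + 1 := by omega
      simp only [this]
      split_ifs <;> simp
    · exact hxAx _ _

end Symplectic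

end NormalForms

/-! ### Sylvester's law of inertia and the forms of signature `(p, q)` -/

section Signature

variable {D : Type} [NormedDivisionRing D] [NormedAlgebra ℝ D] [StarRing D] [Coeff D]

theorem eq_zero_of_eq_neg {M : Type} [AddCommGroup M] [Module ℝ M] {a : M} (h : a = -a) : a = 0 := by
  have h2 : (2 : ℝ) • a = 0 := by
    rw [two_smul]
    nth_rw 1 [h]
    exact neg_add_cancel a
  exact (smul_eq_zero.1 h2).resolve_left two_ne_zero

/-- The diagonal form with signs `ε`. -/
abbrev signForm (D : Type) [DivisionRing D] (ε : ℕ → ℤˣ) (σ : D → D) : V D → V D → D :=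
  form (diag fun i => ((ε i : ℤ) : D)) σ

theorem sign_cast (s : ℤˣ) : ((s : ℤ) : D) = oR D ((s : ℤ) : ℝ) := (map_intCast _ _).symm

theorem sign_sq (s : ℤˣ) : ((s : ℤ) : ℝ) * ((s : ℤ) : ℝ) = 1 := by
  rcases Int.units_eq_one_or s with rfl | rfl <;> norm_num

theorem isForm_sign {σ : D → D} (hσ : ∀ d, σ d = star d) (ε : ℕ → ℤˣ) :
    IsForm (signForm D ε σ) σ 1 := by
  refine isForm_diag (fun a b => by rw [hσ, hσ, hσ, star_add])
    (fun a b => by rw [hσ, hσ, hσ, star_mul]) (fun d => by rw [hσ, hσ, star_star, star_star])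
    (fun r => by rw [hσ, star_oR]) (Or.inl rfl) (fun i a b => ?_) fun i h => ?_
  · rw [← re_star, star_mul, star_mul, hσ, hσ, star_star, one_mul, sign_cast, star_oR,
      mul_assoc]
  · rw [sign_cast, map_eq_zero] at h
    have := sign_sq (ε i)
    rw [h, zero_mul] at this
    exact zero_ne_one this

theorem encard_le_of_forall {s t : Set ℕ}
    (h : ∀ S T : Finset ℕ, (S : Set ℕ) ⊆ s → (T : Set ℕ) = t → S.card ≤ T.card) :
    s.encard ≤ t.encard := by
  by_cases ht : t.Finite
  · by_contra hlt
    push Not at hlt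
    obtain ⟨u, hu, huc⟩ := Set.exists_subset_encard_eq (Order.add_one_le_of_lt hlt)
    have hfin : u.Finite := by
      rw [← Set.encard_ne_top_iff, huc]
      simpa using ht
    have := h hfin.toFinset ht.toFinset (by simpa using hu) (by simp)
    rw [← Set.ncard_eq_toFinset_card u hfin, ← Set.ncard_eq_toFinset_card t ht] at this
    rw [← hfin.cast_ncard_eq, ← ht.cast_ncard_eq] at huc
    have : u.ncard = t.ncard + 1 := by exact_mod_cast huc
    omega
  · rw [Set.Infinite.encard_eq ht]
    exact le_top

variable {σ : D → D} (hσ : ∀ d, σ d = star d)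
include hσ

/-- If `s B ≤ 0` on the common kernel of finitely many functionals, there are at least as many of
them as members of an orthonormal system on which `s B > 0`. -/
theorem IsForm.card_le {B : V D → V D → D} {δ : ℝ} (hB : IsForm B σ δ) {S T : Finset ℕ} {s : ℝ}
    (hs : s * s = 1) {x : ℕ → V D} (hx : ∀ i ∈ S, ∀ j ∈ S, B (x i) (x j) = if i = j then oR D s else 0)
    {f : ℕ → V D →ₗ[D] D} (hf : ∀ z, (∀ k ∈ T, f k z = 0) → s * re (B z z) ≤ 0) :
    S.card ≤ T.card := by
  by_contra hlt
  push Not at hlt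
  let Φ : (S → D) →ₗ[D] (T → D) := LinearMap.pi fun k =>
    f k ∘ₗ Fintype.linearCombination D (fun i : S => x i)
  have hker := LinearMap.ker_ne_bot_of_finrank_lt (f := Φ) (by
    rw [Module.finrank_fintype_fun_eq_card, Module.finrank_fintype_fun_eq_card,
      Fintype.card_coe, Fintype.card_coe]
    exact hlt)
  obtain ⟨c, hc, hc0⟩ := (Submodule.ne_bot_iff _).1 hker
  set z := Fintype.linearCombination D (fun i : S => x i) c with hz
  have h1 := hf z fun k hk => congrFun hc ⟨k, hk⟩
  have hz' : z = ∑ i, c i • x i := Fintype.linearCombination_apply _ _ _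
  have addl : ∀ (t : Finset S) (g : S → V D) w, B (∑ i ∈ t, g i) w = ∑ i ∈ t, B (g i) w := by
    intro t g w
    exact map_sum (⟨⟨fun v => B v w, fun a b => hB.add_left a b w⟩, fun d a => hB.smul_left d a w⟩ :
      V D →ₗ[D] D) g t
  have addr : ∀ (t : Finset S) (g : S → V D) w, B w (∑ i ∈ t, g i) = ∑ i ∈ t, B w (g i) := by
    intro t g w
    exact map_sum (AddMonoidHom.mk' (fun v => B w v) fun a b => hB.add_right w a b) g t
  have h2 : B z z = ∑ i, c i * oR D s * star (c i) := by
    rw [hz', addl]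
    refine Finset.sum_congr rfl fun i _ => ?_
    rw [addr, Finset.sum_eq_single i]
    · rw [hB.smul_left, hB.smul_right, hx i i.2 i i.2, if_pos rfl, hσ, mul_assoc]
    · intro j _ hj
      rw [hB.smul_left, hB.smul_right, hx i i.2 j j.2,
        if_neg fun h => hj (Subtype.ext h).symm, zero_mul, mul_zero]
    · simp
  have h3 : s * re (B z z) = ∑ i, ‖c i‖ ^ 2 := by
    rw [h2, map_sum, Finset.mul_sum]
    refine Finset.sum_congr rfl fun i _ => ?_
    rw [← oR_comm, mul_assoc, re_oR_mul, re_mul_star, ← mul_assoc, hs, one_mul]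
  rw [h3] at h1
  have h4 : ∀ i, ‖c i‖ ^ 2 = 0 := fun i =>
    (Finset.sum_eq_zero_iff_of_nonneg (fun i _ => by positivity)).1
      (le_antisymm h1 (Finset.sum_nonneg fun i _ => by positivity)) i (Finset.mem_univ i)
  exact hc0 (funext fun i => by simpa using h4 i)

set_option maxHeartbeats 400000 in
theorem normalForm_sign (ε : ℕ → ℤˣ) : NormalForm (signForm D ε σ) 1 := by
  classical
  have hB := isForm_sign hσ ε
  have hσ0 : σ 0 = 0 := by rw [hσ, star_zero]
  refine ⟨stdHerm D, fun H A hH => ?_⟩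
  have hA := hH.adm
  have hh := hA.herm
  have hsq : ∀ y, A (A y) = y := fun y => by rw [hA.A_sq y trivial, one_smul]
  have hsm : ∀ (d : D) y, A (d • y) = d • A y := fun d y => hA.smul_of_star hB hσ d trivial
  have hadj : ∀ x y, H (A x) y = H x (A y) := fun x y => by
    rw [hA.adj_star hB hσ trivial trivial, map_one, one_mul]
  let c : ℤˣ → ℝ := fun s => ((s : ℤ) : ℝ)
  have hcc : ∀ s, c s * c s = 1 := sign_sq
  let R : ℤˣ → Submodule D (V D) := fun s =>
    { carrier := {x | A x = c s • x}
      add_mem' := fun {x y} hx hy => by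
        rw [Set.mem_setOf_eq] at hx hy ⊢
        rw [map_add, hx, hy, smul_add]
      zero_mem' := by rw [Set.mem_setOf_eq, map_zero, smul_zero]
      smul_mem' := fun d x hx => by
        rw [Set.mem_setOf_eq] at hx ⊢
        rw [hsm, hx, ← oR_smul (D := D), ← oR_smul (D := D), smul_smul, smul_smul, oR_comm] }
  have hR : ∀ s x, x ∈ R s ↔ A x = c s • x := fun _ _ => Iff.rfl
  have hneg : ∀ s, c (-s) = -c s := fun s => by simp [c]
  have horth : ∀ s x y, x ∈ R s → y ∈ R (-s) → H x y = 0 := by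
    intro s x y hx hy
    have h1 := hadj x y
    rw [(hR _ _).1 hx, (hR _ _).1 hy, hneg, hh.rsmul_left, hh.rsmul_right, ← oR_comm, map_neg,
      neg_mul] at h1
    have h2 := eq_zero_of_eq_neg h1
    refine (mul_eq_zero.1 h2).resolve_left ?_
    rw [map_eq_zero]
    intro h0
    have := hcc s
    rw [h0, zero_mul] at this
    exact zero_ne_one this
  let pr : ℤˣ → V D → V D := fun s y => (1 / 2 : ℝ) • (y + c s • A y)
  have hprR : ∀ s y, pr s y ∈ R s := by
    intro s y
    rw [hR]
    simp only [pr]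
    rw [map_smul, map_add, map_smul, hsq, smul_comm (c s), smul_add (c s), smul_smul (c s), hcc,
      one_smul, add_comm]
  have hpr : ∀ s y, y = pr s y + pr (-s) y := by
    intro s y
    simp only [pr]
    rw [hneg, ← smul_add, neg_smul, ← sub_eq_add_neg, add_add_sub_cancel, ← two_smul ℝ, smul_smul]
    norm_num
  have hGS := fun s => hA.exists_orthonormal (R s).toAddSubgroup
    (fun x _ y hy => (R s).smul_mem _ hy) (fun r x hx => (R s).smul_of_tower_mem r hx)
    (fun n => pr s (Finsupp.single n 1)) fun n => hprR s _
  choose x h1 h2 h3 h4 using hGS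
  have hprspan : ∀ s z, pr s z ∈ Submodule.span D (Set.range (x s)) := by
    intro s z
    induction z using Finsupp.induction_linear with
    | zero => simp [pr]
    | add z w hz hw =>
      have : pr s (z + w) = pr s z + pr s w := by
        simp only [pr]
        rw [map_add, smul_add (c s), ← smul_add (1 / 2 : ℝ), add_add_add_comm]
      rw [this]
      exact Submodule.add_mem _ hz hw
    | single i a =>
      have : pr s (Finsupp.single i a) = a • pr s (Finsupp.single i 1) := by
        simp only [pr]
        rw [show (Finsupp.single i a : V D) = a • Finsupp.single i 1 by simp, hsm,
          smul_comm a, smul_add a, smul_comm a]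
      rw [this]
      exact Submodule.smul_mem _ _ (h4 s i)
  have hxR : ∀ s n, x s n ∈ R s := h1
  have hle : ∀ s, {i | ε i = s}.encard ≤ {n | x s n ≠ 0}.encard := by
    intro s
    refine encard_le_of_forall fun S T hS hT => ?_
    refine hB.card_le hσ (hcc s) (x := fun i => Finsupp.single i 1)
      (f := fun k => hh.lin (x s k) hh) (fun i hi j hj => ?_) fun z hz => ?_
    · rw [signForm, form_single hσ0, hσ, star_one, one_mul, mul_one, diag]
      rw [show ε i = s from hS hi, sign_cast]
    · have hz1 : ∀ k, H z (x s k) = 0 := by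
        intro k
        by_cases hk : x s k = 0
        · rw [hk, hh.zero_right]
        · exact hz k (Finset.mem_coe.1 (hT ▸ hk))
      have hz2 : ∀ k, H (x s k) (pr s z) = 0 := by
        intro k
        have := hz1 k
        rw [hpr s z, hh.add_left, hh.eq_zero_symm (horth s _ _ (hxR s k) (hprR (-s) z)),
          add_zero] at this
        exact hh.eq_zero_symm this
      have hz3 : ∀ w ∈ Submodule.span D (Set.range (x s)), H w (pr s z) = 0 := by
        intro w hw
        induction hw using Submodule.span_induction with
        | mem w hw => obtain ⟨k, rfl⟩ := hw; exact hz2 k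
        | zero => exact hh.zero_left _
        | add w w' _ _ h h' => rw [hh.add_left, h, h', add_zero]
        | smul d w _ h => rw [hh.smul_left, h, mul_zero]
      have hz4 : pr s z = 0 := hA.eq_zero trivial (hz3 _ (hprspan s z))
      have hz5 : A z = c (-s) • z := by
        have := hprR (-s) z
        rwa [show pr (-s) z = z by conv_rhs => rw [hpr s z, hz4, zero_add], hR] at this
      rw [hA.B_eq _ trivial _ trivial, hz5, hh.rsmul_right, ← oR_comm, re_oR_mul, ← mul_assoc, hneg,
        mul_neg, hcc]
      have := hA.nonneg (x := z) trivial
      linarith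
  have hge : ∀ s, {n | x s n ≠ 0}.encard ≤ {i | ε i = s}.encard := by
    intro s
    refine encard_le_of_forall fun S T hS hT => ?_
    refine hB.card_le hσ (hcc s) (x := x s) (f := fun k => Finsupp.lapply k)
      (fun i hi j hj => ?_) fun z hz => ?_
    · rw [hA.B_eq _ trivial _ trivial, (hR _ _).1 (hxR s j), hh.rsmul_right]
      split_ifs with hij
      · subst hij
        rw [h2 s i (hS hi), one_mul]
      · rw [h3 s i j hij, zero_mul]
    · obtain ⟨N, hN⟩ := exists_bound z
      rw [signForm, form_eq (N := N) hσ0 hN hN, map_sum, Finset.mul_sum]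
      refine Finset.sum_nonpos fun i _ => ?_
      rw [map_sum, Finset.mul_sum]
      refine Finset.sum_nonpos fun j _ => ?_
      by_cases hij : i = j
      · subst hij
        rw [hσ, diag, if_pos rfl, sign_cast, ← oR_comm, mul_assoc, re_oR_mul, re_mul_star,
          ← mul_assoc]
        by_cases hi : ε i = s
        · rw [show z i = 0 from hz i (Finset.mem_coe.1 (hT ▸ hi)), norm_zero]
          simp
        · have : ε i = -s := Int.units_ne_iff_eq_neg.1 hi
          have hc : c s * ((ε i : ℤ) : ℝ) = -1 := by
            rw [this]
            change c s * c (-s) = -1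
            rw [hneg, mul_neg, hcc]
          rw [hc]
          have := sq_nonneg ‖z i‖
          linarith
      · simp [diag, hij]
  have hequiv : ∀ s, Nonempty ({i | ε i = s} ≃ {n | x s n ≠ 0}) := by
    intro s
    rw [← Cardinal.eq]
    exact Cardinal.toENat_injOn (Set.mem_Iic.2 (Cardinal.mk_le_aleph0))
      (Set.mem_Iic.2 (Cardinal.mk_le_aleph0)) (le_antisymm (hle s) (hge s))
  let φ := fun s => (hequiv s).some
  let e : ℕ → V D := fun i => x (ε i) (φ (ε i) ⟨i, rfl⟩)
  have he : ∀ s i (hi : ε i = s), e i = x s (φ s ⟨i, hi⟩) := by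
    rintro s i rfl
    rfl
  have heR : ∀ i, A (e i) = c (ε i) • e i := fun i => (hR _ _).1 (hxR _ _)
  have heH : ∀ i j, H (e i) (e j) = if i = j then 1 else 0 := by
    intro i j
    by_cases hij : ε i = ε j
    · rw [he (ε j) i hij, he (ε j) j rfl]
      split_ifs with h
      · subst h
        exact h2 _ _ (φ _ _).2
      · refine h3 _ _ _ fun h' => h ?_
        exact congrArg Subtype.val ((φ (ε j)).injective (Subtype.ext h'))
    · rw [if_neg (by rintro rfl; exact hij rfl)]
      refine horth (ε i) _ _ (hxR _ _) ?_
      rw [Int.units_ne_iff_eq_neg.1 hij, neg_neg]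
      exact hxR _ _
  refine hH.exists_of_basis hB e heH (fun n => ?_) fun i j => ?_
  · have hx : ∀ s, Submodule.span D (Set.range (x s)) ≤ Submodule.span D (Set.range e) := by
      intro s
      refine Submodule.span_le.2 ?_
      rintro _ ⟨k, rfl⟩
      by_cases hk : x s k = 0
      · rw [hk]; exact Submodule.zero_mem _
      · refine Submodule.subset_span ⟨((φ s).symm ⟨k, hk⟩ : ℕ), ?_⟩
        rw [he s _ ((φ s).symm ⟨k, hk⟩).2]
        change x s (φ s ((φ s).symm ⟨k, hk⟩)) = _
        rw [Equiv.apply_symm_apply]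
    rw [hpr 1 (Finsupp.single n 1)]
    exact Submodule.add_mem _ (hx _ (hprspan _ _)) (hx _ (hprspan _ _))
  · rw [hA.B_eq _ trivial _ trivial, heR, hh.rsmul_right, heH, signForm, form_single hσ0, hσ, star_one,
      one_mul, mul_one, diag]
    split_ifs with h
    · rw [one_mul, h, sign_cast]
    · rw [zero_mul]

end Signature

/-! ### Identity components -/

section Component

variable {A : Type} [Group A] [TopologicalSpace A]

/-- If right translations are continuous, identity components are subgroups. -/
theorem coe_idComponent (hA : ∀ a : A, Continuous fun x => x * a) (H : Subgroup A) :
    (idComponent H : Set A) = connectedComponentIn (H : Set A) 1 := by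
  set C := connectedComponentIn (H : Set A) 1 with hC
  have h1 : (1 : A) ∈ C := mem_connectedComponentIn H.one_mem
  have hCH : C ⊆ H := connectedComponentIn_subset _ _
  have hdiv : ∀ a ∈ C, ∀ b ∈ C, b * a⁻¹ ∈ C := by
    intro a ha b hb
    have hconn : IsPreconnected ((fun x => x * a⁻¹) '' C) :=
      isPreconnected_connectedComponentIn.image _ (hA _).continuousOn
    refine hconn.subset_connectedComponentIn ⟨a, ha, mul_inv_cancel a⟩ ?_ ⟨b, hb, rfl⟩
    rintro _ ⟨x, hx, rfl⟩
    exact H.mul_mem (hCH hx) (H.inv_mem (hCH ha))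
  have hinv : ∀ a ∈ C, a⁻¹ ∈ C := fun a ha => by simpa using hdiv a ha 1 h1
  let S : Subgroup A :=
    { carrier := C
      one_mem' := h1
      mul_mem' := fun {a b} ha hb => by simpa using hdiv _ (hinv b hb) a ha
      inv_mem' := fun {a} ha => hinv a ha }
  exact congrArg SetLike.coe (Subgroup.closure_eq S)

theorem idComponent_le (H : Subgroup A) : idComponent H ≤ H :=
  (Subgroup.closure_le H).2 (connectedComponentIn_subset _ _)

theorem idComponent_mono {H H' : Subgroup A} (h : H ≤ H') : idComponent H ≤ idComponent H' :=
  Subgroup.closure_mono (connectedComponentIn_mono 1 h)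

theorem map_idComponent (Φ : A ≃* A) (hc : Continuous Φ) (hc' : Continuous Φ.symm)
    (H : Subgroup A) : idComponent (H.map Φ.toMonoidHom) = (idComponent H).map Φ.toMonoidHom := by
  let e : A ≃ₜ A := ⟨Φ.toEquiv, hc, hc'⟩
  have := e.image_connectedComponentIn (s := (H : Set A)) (x := 1) H.one_mem
  rw [idComponent, idComponent, MonoidHom.map_closure]
  congr 1
  change connectedComponentIn (Φ '' (H : Set A)) 1 = Φ '' _
  change Φ '' connectedComponentIn (H : Set A) 1 = connectedComponentIn (Φ '' (H : Set A)) (Φ 1)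
    at this
  rw [this, map_one]

/-- A path in `H` that starts at `1` stays in the identity component. -/
theorem mem_idComponent_of_path {H : Subgroup A} {γ : ℝ → A} (hγ : Continuous γ) (h0 : γ 0 = 1)
    (hH : ∀ t, γ t ∈ H) (t : ℝ) : γ t ∈ idComponent H := by
  refine Subgroup.subset_closure ?_
  have : IsPreconnected (Set.range γ) := isPreconnected_range hγ
  exact this.subset_connectedComponentIn ⟨0, h0⟩ (by rintro _ ⟨s, rfl⟩; exact hH s) ⟨t, rfl⟩

variable {D : Type} [NormedDivisionRing D] [NormedAlgebra ℝ D] [StarRing D] [Coeff D]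
variable {B : V D → V D → D} {σ : D → D} {δ : ℝ}
variable {Γ : Piece B → Subgroup A} {ad : A → (V D ≃ₗ[D] V D)}

theorem Rep.connected (R : Rep σ δ Γ ad) (hA : ∀ a : A, Continuous fun x => x * a) :
    Rep σ δ (fun L => idComponent (Γ L)) ad where
  form := R.form
  mono L L' h := idComponent_mono (R.mono L L' h)
  ad_mul L g hg g' hg' := R.ad_mul L g (idComponent_le _ hg) g' (idComponent_le _ hg')
  ad_stab L g hg := R.ad_stab L g (idComponent_le _ hg)
  ad_B L g hg := R.ad_B L g (idComponent_le _ hg)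
  ad_cont L i j := (R.ad_cont L i j).mono (idComponent_le _)
  compact L H A' h := by
    have h1 := R.compact L H A' h
    have hK : {g | g ∈ Γ L ∧ Pres H (ad g)} ⊆ (Γ L : Set A) := fun g hg => hg.1
    have h2 : IsCompact ((↑) ⁻¹' {g | g ∈ Γ L ∧ Pres H (ad g)} : Set (Γ L)) := by
      rw [Subtype.isCompact_iff]
      have := Subtype.image_preimage_coe (Γ L : Set A) {g | g ∈ Γ L ∧ Pres H (ad g)}
      rw [Set.inter_eq_right.2 hK] at this
      exact (congrArg IsCompact this).mpr h1
    have h3 := (h2.inter_right (isClosed_connectedComponent (x := (1 : Γ L)))).image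
      continuous_subtype_val
    convert h3 using 1
    ext g
    have hcc : (g ∈ idComponent (Γ L)) ↔ g ∈ connectedComponentIn (Γ L : Set A) 1 := by
      rw [← coe_idComponent hA]; rfl
    rw [connectedComponentIn_eq_image (Γ L).one_mem] at hcc
    constructor
    · rintro ⟨hg, hgH⟩
      obtain ⟨x, hx, rfl⟩ := hcc.1 hg
      exact ⟨x, ⟨⟨x.2, hgH⟩, hx⟩, rfl⟩
    · rintro ⟨x, ⟨hx, hx'⟩, rfl⟩
      exact ⟨hcc.2 ⟨x, hx', rfl⟩, hx.2⟩

theorem Transport.connected (h : Transport Γ ad) : Transport (fun L => idComponent (Γ L)) ad := by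
  intro T hB hd hd'
  obtain ⟨Φ, τ, hc, hc', hτ, had⟩ := h T hB hd hd'
  refine ⟨Φ, τ, hc, hc', fun L => ?_, fun L g hg => had L g (idComponent_le _ hg)⟩
  change idComponent (Γ (τ L)) = _
  rw [hτ, map_idComponent Φ hc hc']

end Component

/-! ### Determinants -/

section Det

variable {D : Type} [DivisionRing D] {r : ℕ} (ρ : D →+* Matrix (Fin r) (Fin r) ℂ)

/-- The complex matrix of a matrix over `D`. -/
def emb {m n : ℕ} (M : Matrix (Fin m) (Fin n) D) : Matrix (Fin m × Fin r) (Fin n × Fin r) ℂ :=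
  Matrix.of fun p q => ρ (M p.1 q.1) p.2 q.2

theorem emb_mul {l m n : ℕ} (M : Matrix (Fin l) (Fin m) D) (M' : Matrix (Fin m) (Fin n) D) :
    emb ρ (M * M') = emb ρ M * emb ρ M' := by
  ext p q
  rw [Matrix.mul_apply, Fintype.sum_prod_type]
  simp only [emb, Matrix.of_apply, Matrix.mul_apply, map_sum, map_mul, Matrix.sum_apply]

theorem emb_add {m n : ℕ} (M M' : Matrix (Fin m) (Fin n) D) :
    emb ρ (M + M') = emb ρ M + emb ρ M' := by
  ext p q
  simp [emb]

theorem emb_one {n : ℕ} : emb ρ (1 : Matrix (Fin n) (Fin n) D) = 1 := by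
  ext p q
  simp only [emb, Matrix.of_apply, Matrix.one_apply, Prod.ext_iff]
  by_cases h : p.1 = q.1
  · simp [h, Matrix.one_apply]
  · simp [h]

theorem blockDet_eq (N : ℕ) (g : V D ≃ₗ[D] V D) : blockDet ρ N g = (emb ρ (block N g)).det := rfl

/-- The determinant is invariant under conjugation. -/
theorem blockDet_conj {N M : ℕ} {g T : V D ≃ₗ[D] V D} (hg : IsBlock N g)
    (hT : ∀ l < N, T (Finsupp.single l 1) ∈ below D M) :
    blockDet ρ M (T * g * T⁻¹) = blockDet ρ N g := by
  let P : Matrix (Fin M) (Fin N) D := Matrix.of fun i k => T.symm (Finsupp.single (i : ℕ) 1) k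
  let Q : Matrix (Fin N) (Fin M) D := Matrix.of fun l j => T (Finsupp.single (l : ℕ) 1) j
  let U : Matrix (Fin N) (Fin N) D := block N g - 1
  have hQP : Q * P = 1 := by
    ext l k
    have h1 : T.symm (T (Finsupp.single (l : ℕ) 1)) k = (Q * P) l k := by
      conv_lhs => rw [sum_below (hT l l.2)]
      rw [map_sum, Finsupp.finsetSum_apply, Matrix.mul_apply, Finset.sum_range]
      refine Finset.sum_congr rfl fun j _ => ?_
      rw [map_smul]
      rfl
    rw [← h1, T.symm_apply_apply, Matrix.one_apply, Finsupp.single_apply]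
    simp only [Fin.ext_iff]
  have hu : ∀ x : V D, g x - x = ∑ k : Fin N, ∑ l : Fin N, (x k * U k l) • Finsupp.single (l : ℕ) (1 : D) := by
    intro x
    have hx : g x - x = ∑ k : Fin N, x k • (g (Finsupp.single (k : ℕ) 1) - Finsupp.single (k : ℕ) 1) := by
      set y := x - ∑ k ∈ Finset.range N, x k • Finsupp.single k (1 : D) with hy
      have hgy : g y = y := hg.2 y fun i hi => by
        rw [hy, Finsupp.sub_apply, Finsupp.finsetSum_apply, Finset.sum_eq_single i]
        · simp
        · intro b _ hb; simp [hb]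
        · intro h; exact absurd (Finset.mem_range.2 hi) h
      have hx : x = y + ∑ k ∈ Finset.range N, x k • Finsupp.single k (1 : D) := by rw [hy]; abel
      have : g x - x = g (∑ k ∈ Finset.range N, x k • Finsupp.single k (1 : D)) -
          ∑ k ∈ Finset.range N, x k • Finsupp.single k (1 : D) := by
        have h2 : g x = y + g (∑ k ∈ Finset.range N, x k • Finsupp.single k (1 : D)) := by
          conv_lhs => rw [hx, map_add, hgy]
        rw [h2, sub_eq_sub_iff_add_eq_add, add_right_comm, ← hx, add_comm]
      rw [this, map_sum, ← Finset.sum_sub_distrib, Finset.sum_range]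
      exact Finset.sum_congr rfl fun k _ => by rw [map_smul, smul_sub]
    rw [hx]
    refine Finset.sum_congr rfl fun k _ => ?_
    have hk : g (Finsupp.single (k : ℕ) 1) - Finsupp.single (k : ℕ) 1 ∈ below D N := by
      intro i hi
      rw [Finsupp.sub_apply, hg.1 _ _ hi, sub_self]
    rw [sum_below hk, Finset.sum_range, Finset.smul_sum]
    refine Finset.sum_congr rfl fun l _ => ?_
    rw [smul_smul]
    congr 2
    simp only [U, Matrix.sub_apply, block, Matrix.of_apply, Matrix.one_apply, Finsupp.sub_apply,
      Finsupp.single_apply, Fin.ext_iff]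
  have hblock : block M (T * g * T⁻¹) = 1 + P * (U * Q) := by
    ext i j
    have h1 : (T * g * T⁻¹) (Finsupp.single (i : ℕ) 1) = Finsupp.single (i : ℕ) 1 +
        T (g (T.symm (Finsupp.single (i : ℕ) 1)) - T.symm (Finsupp.single (i : ℕ) 1)) := by
      rw [map_sub, T.apply_symm_apply, add_sub_cancel]
      rfl
    rw [block, Matrix.of_apply, h1, hu, Finsupp.add_apply, Matrix.add_apply, Matrix.one_apply,
      Finsupp.single_apply]
    congr 1
    · simp only [Fin.ext_iff]
    · rw [map_sum, Finsupp.finsetSum_apply, Matrix.mul_apply]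
      refine Finset.sum_congr rfl fun k _ => ?_
      rw [map_sum, Finsupp.finsetSum_apply, Matrix.mul_apply, Finset.mul_sum]
      refine Finset.sum_congr rfl fun l _ => ?_
      rw [map_smul, Finsupp.smul_apply, smul_eq_mul, mul_assoc]
      rfl
  rw [blockDet_eq, blockDet_eq, hblock, emb_add, emb_one, emb_mul, Matrix.det_one_add_mul_comm,
    ← emb_mul, Matrix.mul_assoc, hQP, Matrix.mul_one, ← emb_one ρ, ← emb_add]
  congr 2
  simp [U]

theorem blockDet_stable {N M : ℕ} {g : V D ≃ₗ[D] V D} (hg : IsBlock N g) (h : N ≤ M) :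
    blockDet ρ M g = blockDet ρ N g := by
  have := blockDet_conj ρ (T := (1 : V D ≃ₗ[D] V D)) (M := M) hg fun l hl i hi => by
    change (Finsupp.single l (1 : D)) i = 0
    rw [Finsupp.single_eq_of_ne]
    omega
  rwa [one_mul, inv_one, mul_one] at this

end Det

/-! ### The linear groups -/

section Linear

variable {D : Type} [NormedDivisionRing D] [NormedAlgebra ℝ D] [StarRing D] [Coeff D]
variable {r : ℕ} (ρ : D →+* Matrix (Fin r) (Fin r) ℂ) (h : ℕ → ℕ → D) (σ : D → D) (sp : Bool)

/-- The group of a finite-dimensional piece in a linear group. -/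
abbrev linΓ (L : Piece (form h σ)) : Subgroup (V D ≃ₗ[D] V D) := linearGroup ρ h σ sp ⊓ L.stab

variable {ρ h σ sp}

theorem mem_linΓ {L : Piece (form h σ)} {g : V D ≃ₗ[D] V D} :
    g ∈ linΓ ρ h σ sp L ↔ g ∈ L.stab ∧ Pres (form h σ) g ∧
      (sp = true → ∀ N, IsBlock N g → blockDet ρ N g = 1) := by
  constructor
  · rintro ⟨⟨h1, h2⟩, h3⟩
    refine ⟨h3, h2, fun hs N hN => ?_⟩
    obtain ⟨M, hM, hM'⟩ := (h1.and (Filter.eventually_ge_atTop N)).exists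
    rw [← blockDet_stable ρ hN hM', hM.2 hs]
  · rintro ⟨h1, h2, h3⟩
    obtain ⟨N, hN, hN'⟩ := L.exists_bound
    refine ⟨⟨?_, h2⟩, h1⟩
    filter_upwards [Filter.eventually_ge_atTop N] with M hM
    have hb : IsBlock M g := Piece.stab_isBlock (hN.trans (below_mono hM))
      (fun x hx => hN' x fun i hi => hx i (by omega)) h1
    exact ⟨hb, fun hs => h3 hs M hb⟩

/-- It suffices to look at one determinant. -/
theorem mem_linΓ_of {L : Piece (form h σ)} {g : V D ≃ₗ[D] V D} (h1 : g ∈ L.stab)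
    (h2 : Pres (form h σ) g) {N : ℕ} (hN : IsBlock N g) (h3 : sp = true → blockDet ρ N g = 1) :
    g ∈ linΓ ρ h σ sp L := by
  refine mem_linΓ.2 ⟨h1, h2, fun hs M hM => ?_⟩
  rcases le_total N M with hle | hle
  · rw [blockDet_stable ρ hN hle, h3 hs]
  · rw [← blockDet_stable ρ hM hle, h3 hs]

theorem entry_eq (g : V D ≃ₗ[D] V D) {x : V D} {N : ℕ} (hx : x ∈ below D N) (j : ℕ) :
    g x j = ∑ i ∈ Finset.range N, x i * g (Finsupp.single i 1) j := by
  conv_lhs => rw [sum_below hx]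
  rw [map_sum, Finsupp.finsetSum_apply]
  refine Finset.sum_congr rfl fun i _ => ?_
  rw [map_smul]; rfl

theorem continuous_entry (i j : ℕ) :
    @Continuous _ _ (entryTop (D := D)) _ fun g : V D ≃ₗ[D] V D => g (Finsupp.single i 1) j := by
  letI : TopologicalSpace (V D ≃ₗ[D] V D) := entryTop
  have : Continuous fun g : V D ≃ₗ[D] V D => fun i j : ℕ => g (Finsupp.single i (1 : D)) j :=
    continuous_induced_dom
  exact (continuous_apply j).comp ((continuous_apply i).comp this)

theorem continuous_entry' (x : V D) (j : ℕ) :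
    @Continuous _ _ (entryTop (D := D)) _ fun g : V D ≃ₗ[D] V D => g x j := by
  letI : TopologicalSpace (V D ≃ₗ[D] V D) := entryTop
  obtain ⟨N, hN⟩ := exists_bound x
  simp_rw [entry_eq _ (N := N) (x := x) hN]
  exact continuous_finsetSum _ fun i _ => continuous_const.mul (continuous_entry i j)

theorem continuous_to_entry {X : Type*} [TopologicalSpace X] {f : X → (V D ≃ₗ[D] V D)}
    (hf : ∀ i j, Continuous fun x => f x (Finsupp.single i 1) j) :
    @Continuous _ _ _ (entryTop (D := D)) f := by
  letI : TopologicalSpace (V D ≃ₗ[D] V D) := entryTop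
  exact continuous_induced_rng.2 (continuous_pi fun i => continuous_pi fun j => hf i j)

theorem continuous_mul_right_entry (a : V D ≃ₗ[D] V D) :
    @Continuous _ _ (entryTop (D := D)) (entryTop (D := D)) fun x : V D ≃ₗ[D] V D => x * a := by
  letI : TopologicalSpace (V D ≃ₗ[D] V D) := entryTop
  exact continuous_to_entry fun i j => continuous_entry' (a (Finsupp.single i 1)) j

theorem continuous_conj_entry {T : V D ≃ₗ[D] V D} (hT : DualPres T) :
    @Continuous _ _ (entryTop (D := D)) (entryTop (D := D))
      fun g : V D ≃ₗ[D] V D => T * g * T⁻¹ := by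
  letI : TopologicalSpace (V D ≃ₗ[D] V D) := entryTop
  refine continuous_to_entry fun i j => ?_
  obtain ⟨w, hw⟩ := hT (Finsupp.single j 1)
  obtain ⟨N, hN⟩ := exists_bound w
  have : ∀ g : V D ≃ₗ[D] V D, (T * g * T⁻¹) (Finsupp.single i 1) j =
      ∑ k ∈ Finset.range N, g (T.symm (Finsupp.single i 1)) k * w k := by
    intro g
    rw [← pair_eq' hN, ← hw, pair_single]
    rfl
  simp_rw [this]
  exact continuous_finsetSum _ fun k _ => (continuous_entry' _ k).mul continuous_const

/-- The image of a piece under an automorphism. -/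
def Piece.map {B : V D → V D → D} (L : Piece B) (T : V D ≃ₗ[D] V D) (hB : Pres B T)
    (hd : DualPres T⁻¹) : Piece B where
  V₁ := L.V₁.map T.toLinearMap
  C := L.C.map T.toLinearMap
  finite := by
    haveI := L.finite
    infer_instance
  closed := by
    classical
    obtain ⟨s, hs⟩ := L.closed
    choose f hf using hd
    refine ⟨s.image f, fun x => ?_⟩
    have h1 : x ∈ L.C.map T.toLinearMap ↔ T.symm x ∈ L.C := by
      constructor
      · rintro ⟨y, hy, rfl⟩
        change T.symm (T y) ∈ _
        rwa [T.symm_apply_apply]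
      · intro hx
        exact ⟨_, hx, T.apply_symm_apply x⟩
    rw [h1, hs]
    constructor
    · intro hx w hw
      obtain ⟨v, hv, rfl⟩ := Finset.mem_image.1 hw
      rw [← hf]
      exact hx v hv
    · intro hx w hw
      have := hx _ (Finset.mem_image_of_mem f hw)
      rwa [← hf] at this
  isCompl := by
    have := L.isCompl.map (Submodule.orderIsoMapComap T)
    exact this
  orth := by
    rintro _ ⟨x, hx, rfl⟩ _ ⟨y, hy, rfl⟩
    exact (hB x y).trans (L.orth x hx y hy)

theorem Piece.ext' {B : V D → V D → D} {L L' : Piece B} (h1 : L.V₁ = L'.V₁) (h2 : L.C = L'.C) :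
    L = L' := by
  cases L
  cases L'
  simp only at h1 h2
  subst h1 h2
  rfl

/-- The action of an automorphism on the pieces. -/
def pieceEquiv {B : V D → V D → D} (T : V D ≃ₗ[D] V D) (hB : Pres B T) (hd : DualPres T)
    (hd' : DualPres T⁻¹) : Piece B ≃ Piece B where
  toFun L := L.map T hB hd'
  invFun L := L.map T⁻¹ hB.inv (by rwa [inv_inv])
  left_inv L := by
    refine Piece.ext' ?_ ?_ <;>
      · change Submodule.map T.symm.toLinearMap (Submodule.map T.toLinearMap _) = _
        rw [← Submodule.map_comp]
        simp
  right_inv L := by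
    refine Piece.ext' ?_ ?_ <;>
      · change Submodule.map T.toLinearMap (Submodule.map T.symm.toLinearMap _) = _
        rw [← Submodule.map_comp]
        simp

theorem Piece.conj_mem_stab {B : V D → V D → D} {L : Piece B} {T : V D ≃ₗ[D] V D} {hB : Pres B T}
    {hd : DualPres T⁻¹} {g : V D ≃ₗ[D] V D} (hg : g ∈ L.stab) :
    T * g * T⁻¹ ∈ (L.map T hB hd).stab := by
  refine ⟨fun x => ⟨g (T.symm x) - T.symm x, hg.1 _, ?_⟩, ?_⟩
  · change T (g (T.symm x) - T.symm x) = T (g (T.symm x)) - x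
    rw [map_sub, T.apply_symm_apply]
  · rintro _ ⟨c, hc, rfl⟩
    change T (g (T.symm (T c))) = T c
    rw [T.symm_apply_apply, hg.2 c hc]

theorem conj_mem_linΓ {L : Piece (form h σ)} {T : V D ≃ₗ[D] V D} {hB : Pres (form h σ) T}
    {hd : DualPres T⁻¹} {g : V D ≃ₗ[D] V D} (hg : g ∈ linΓ ρ h σ sp L) :
    T * g * T⁻¹ ∈ linΓ ρ h σ sp (L.map T hB hd) := by
  obtain ⟨h1, h2, h3⟩ := mem_linΓ.1 hg
  obtain ⟨N, hN1, hN2⟩ := L.exists_bound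
  obtain ⟨M, hM1, hM2⟩ := (L.map T hB hd).exists_bound
  choose m hm using fun l => exists_bound (T (Finsupp.single l 1))
  have hst := Piece.conj_mem_stab (hB := hB) (hd := hd) h1
  refine mem_linΓ_of hst ((hB.mul h2).mul hB.inv)
    (N := max M ((Finset.range N).sup m)) (Piece.stab_isBlock (hM1.trans (below_mono (le_max_left _ _)))
      (fun x hx => hM2 x fun i hi => hx i (lt_of_lt_of_le hi (le_max_left _ _))) hst) fun hs => ?_
  have hgb := Piece.stab_isBlock hN1 hN2 h1
  rw [blockDet_conj ρ hgb, h3 hs N hgb]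
  intro l hl i hi
  exact hm l i (le_trans (le_trans (Finset.le_sup (Finset.mem_range.2 hl)) (le_max_right _ _)) hi)

theorem conj_inv_conj (T g : V D ≃ₗ[D] V D) : T * (T⁻¹ * g * T⁻¹⁻¹) * T⁻¹ = g := by group

theorem transport_linear :
    letI : TopologicalSpace (V D ≃ₗ[D] V D) := entryTop
    Transport (linΓ ρ h σ sp) (fun g => g) := by
  letI : TopologicalSpace (V D ≃ₗ[D] V D) := entryTop
  intro T hB hd hd'
  refine ⟨MulAut.conj T, pieceEquiv T hB hd hd', continuous_conj_entry hd, ?_, fun L => ?_,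
    fun L g _ => rfl⟩
  · have e : ((MulAut.conj T).symm : (V D ≃ₗ[D] V D) → _) = fun g => T⁻¹ * g * T⁻¹⁻¹ := by
      funext g
      rw [inv_inv]
      exact MulAut.conj_symm_apply T g
    rw [e]
    exact continuous_conj_entry hd'
  · ext g
    constructor
    · intro hg
      have hi : DualPres T⁻¹⁻¹ := by rwa [inv_inv]
      have h1 : (L.map T hB hd').map T⁻¹ hB.inv hi = L := (pieceEquiv T hB hd hd').left_inv L
      have hg' : g ∈ linΓ ρ h σ sp (L.map T hB hd') := hg
      have h2 := conj_mem_linΓ (hB := hB.inv) (hd := hi) hg'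
      rw [h1] at h2
      exact ⟨T⁻¹ * g * T⁻¹⁻¹, h2, conj_inv_conj T g⟩
    · rintro ⟨g, hg, rfl⟩
      exact conj_mem_linΓ (hB := hB) (hd := hd') hg

end Linear

/-! ### Compactness -/

section Bounds

variable {D : Type} [NormedDivisionRing D] [NormedAlgebra ℝ D] [StarRing D] [Coeff D]
variable {B : V D → V D → D} {δ : ℝ}

theorem Adm.norm_le {M : Type} [AddCommGroup M] [Module D M] [Module ℝ M] [IsScalarTower ℝ D M]
    {B : M → M → D} {U C : Submodule D M} {H : M → M → D} {A : M →ₗ[ℝ] M}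
    (h : Adm B δ U C H A) {x y : M} (hx : x ∈ U) (hy : y ∈ U) :
    2 * ‖H x y‖ ≤ re (H x x) + re (H y y) := by
  have hh := h.herm
  by_cases h0 : H x y = 0
  · rw [h0, norm_zero, mul_zero]
    exact add_nonneg (h.nonneg hx) (h.nonneg hy)
  set n := ‖H x y‖ with hn
  have hn0 : n ≠ 0 := norm_ne_zero_iff.2 h0
  set d : D := oR D n⁻¹ * H x y with hd
  have hdd : d * star d = 1 := by
    rw [mul_star, hd, norm_mul, norm_oR, ← hn, abs_inv, abs_norm, inv_mul_cancel₀ hn0, one_pow,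
      map_one]
  have h1 : re (H x (d • y)) = n := by
    rw [hh.smul_right, hd, star_mul, star_oR, ← mul_assoc, mul_star, ← map_mul, re_oR, ← hn]
    field_simp
  have h2 : re (H (d • y) (d • y)) = re (H y y) := by
    rw [hh.smul_left, hh.smul_right, hh.self_eq, ← mul_assoc, ← oR_comm, mul_assoc, hdd, mul_one]
  have h3 := h.nonneg (U.sub_mem hx (U.smul_mem d hy))
  rw [hh.sub_left, hh.sub_right, hh.sub_right, map_sub, map_sub, map_sub, h2,
    hh.re_symm (d • y) x, h1] at h3
  linarith

theorem Adm.exists_coord_bound {L : Piece B} {H : V D → V D → D} {A : V D →ₗ[ℝ] V D}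
    (h : Adm B δ L.V₁ L.C H A) (x : V D) (j : ℕ) :
    ∃ b : ℝ, ∀ g ∈ L.stab, Pres H g → ‖g x j‖ ≤ b := by
  haveI := L.finite
  obtain ⟨y, hy, hyj⟩ := h.herm.exists_riesz h.pos (Finsupp.lapply j)
  refine ⟨(re (H (L.proj x) (L.proj x)) + re (H y y)) / 2 + ‖(x - L.proj x) j‖, fun g hg hgH => ?_⟩
  have e : g x = g (L.proj x) + (x - L.proj x) := by
    rw [← hg.2 _ (L.sub_proj_mem x), ← map_add, add_sub_cancel]
  have hm := (L.stab_iff g _ hg).1 (L.proj_mem x)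
  rw [e, Finsupp.add_apply]
  refine (norm_add_le _ _).trans (add_le_add ?_ le_rfl)
  have h1 : g (L.proj x) j = H (g (L.proj x)) y := hyj _ hm
  have h2 := h.norm_le hm hy
  rw [hgH] at h2
  rw [h1]
  linarith

/-- The extension of a matrix to finitely supported sequences. -/
def matApply (m : ℕ → ℕ → D) (x : V D) (j : ℕ) : D := x.sum fun i a => a * m i j

theorem matApply_add (m : ℕ → ℕ → D) (x y : V D) (j : ℕ) :
    matApply m (x + y) j = matApply m x j + matApply m y j :=
  Finsupp.sum_add_index' (fun i => zero_mul _) fun i a b => add_mul _ _ _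

theorem matApply_smul (m : ℕ → ℕ → D) (d : D) (x : V D) (j : ℕ) :
    matApply m (d • x) j = d * matApply m x j := by
  rw [matApply, Finsupp.sum_smul_index' (fun i => zero_mul _), matApply, Finsupp.mul_sum]
  simp only [smul_eq_mul, mul_assoc]

theorem matApply_single (m : ℕ → ℕ → D) (i j : ℕ) : matApply m (Finsupp.single i 1) j = m i j := by
  rw [matApply, Finsupp.sum_single_index (zero_mul _), one_mul]

theorem continuous_matApply (x : V D) (j : ℕ) : Continuous fun m => matApply m x j :=
  continuous_finsetSum _ fun i _ => continuous_const.mul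
    ((continuous_apply j).comp (continuous_apply i))

/-- The matrix of a linear map. -/
def entries (g : V D ≃ₗ[D] V D) (i j : ℕ) : D := g (Finsupp.single i 1) j

theorem matApply_entries (g : V D ≃ₗ[D] V D) (x : V D) (j : ℕ) : matApply (entries g) x j = g x j := by
  induction x using Finsupp.induction_linear with
  | zero => simp [matApply]
  | add x y hx hy => rw [matApply_add, hx, hy, map_add]; rfl
  | single i a =>
    rw [show (Finsupp.single i a : V D) = a • Finsupp.single i 1 by simp, matApply_smul,
      matApply_single, map_smul]
    rfl

theorem IsHerm.eq_sum {H : V D → V D → D} (hH : IsHerm H) {N : ℕ} {x y : V D} (hx : x ∈ below D N)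
    (hy : y ∈ below D N) : H x y = ∑ i ∈ Finset.range N, ∑ j ∈ Finset.range N,
      x i * H (Finsupp.single i 1) (Finsupp.single j 1) * star (y j) := by
  conv_lhs => rw [sum_below hx, sum_below hy]
  rw [hH.sum_left]
  refine Finset.sum_congr rfl fun i _ => ?_
  rw [hH.sum_right]
  exact Finset.sum_congr rfl fun j _ => by rw [hH.smul_left, hH.smul_right, mul_assoc]

end Bounds

section Linear

variable {D : Type} [NormedDivisionRing D] [NormedAlgebra ℝ D] [StarRing D] [Coeff D]
variable {r : ℕ} {ρ : D →+* Matrix (Fin r) (Fin r) ℂ} {h : ℕ → ℕ → D} {σ σ' : D → D} {sp : Bool}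
  {δ : ℝ}

theorem continuous_star' : Continuous (star : D → D) := by
  have : (star : D → D) = fun d => oR D (2 * re d) - d := by
    funext d
    rw [← add_star, add_sub_cancel_left]
  rw [this]
  have h1 : Continuous (re : D →ₗ[ℝ] ℝ) := LinearMap.continuous_of_finiteDimensional _
  have h2 : Continuous (oR D) := continuous_algebraMap ℝ D
  exact (h2.comp (continuous_const.mul h1)).sub continuous_id

/-- The linear elements of a piece that preserve an adapted form are a compact set. -/
theorem isCompact_linear (hσ0 : σ 0 = 0) (hσc : Continuous σ) (hρ : Continuous ρ)
    (L : Piece (form h σ)) {H : V D → V D → D} {A' : V D →ₗ[ℝ] V D}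
    (hA : Adm (form h σ) δ L.V₁ L.C H A') :
    @IsCompact _ (entryTop (D := D)) {g | g ∈ linΓ ρ h σ sp L ∧ Pres H g} := by
  letI : TopologicalSpace (V D ≃ₗ[D] V D) := entryTop
  haveI := L.finite
  haveI : ProperSpace D := FiniteDimensional.proper_real D
  have hind : Topology.IsInducing (entries : (V D ≃ₗ[D] V D) → ℕ → ℕ → D) := ⟨rfl⟩
  set K := {g | g ∈ linΓ ρ h σ sp L ∧ Pres H g} with hK
  rw [hind.isCompact_iff]
  choose b hb using fun i j => hA.exists_coord_bound (Finsupp.single i 1) j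
  have hcpt : IsCompact (Set.pi Set.univ fun i => Set.pi Set.univ fun j =>
      Metric.closedBall (0 : D) (b i j) : Set (ℕ → ℕ → D)) :=
    isCompact_univ_pi fun i => isCompact_univ_pi fun j => isCompact_closedBall _ _
  have hKst : ∀ g ∈ K, g ∈ L.stab := fun g hg => (mem_linΓ.1 hg.1).1
  refine hcpt.of_isClosed_subset (isClosed_of_closure_subset fun m hm => ?_) ?_
  swap
  · rintro _ ⟨g, hg, rfl⟩ i _ j _
    rw [mem_closedBall_zero_iff]
    exact hb i j g (hKst g hg) hg.2
  have hcl : ∀ (F : (ℕ → ℕ → D) → D) (c : D), Continuous F → (∀ g ∈ K, F (entries g) = c) →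
      F m = c := by
    intro F c hF hg
    have : closure (entries '' K) ⊆ {m | F m = c} :=
      closure_minimal (by rintro _ ⟨g, h1, rfl⟩; exact hg g h1)
        (isClosed_eq hF continuous_const)
    exact this hm
  obtain ⟨N, hN1, hN2⟩ := L.exists_bound
  have hhigh : ∀ x j, N ≤ j → matApply m x j = x j := fun x j hj =>
    hcl (fun m => matApply m x j) _ (continuous_matApply x j) fun g hg => by
      rw [matApply_entries]
      exact (Piece.stab_isBlock hN1 hN2 (hKst g hg)).1 x j hj
  let G : V D →ₗ[D] V D :=
    { toFun := fun x => Finsupp.ofSupportFinite (matApply m x)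
        (((Finset.range N : Set ℕ).toFinite.union x.support.finite_toSet).subset fun j hj => by
          by_cases hjN : j < N
          · exact Or.inl (by simpa using hjN)
          · right
            rw [Function.mem_support, hhigh x j (not_lt.1 hjN)] at hj
            simpa using hj)
      map_add' := fun x y => by
        ext j
        exact matApply_add m x y j
      map_smul' := fun d x => by
        ext j
        exact matApply_smul m d x j }
  have hG : ∀ x j, G x j = matApply m x j := fun _ _ => rfl
  have hGbelow : ∀ {M x}, N ≤ M → x ∈ below D M → G x ∈ below D M := by
    intro M x hM hx j hj
    rw [hG, hhigh x j (hM.trans hj), hx j hj]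
  have hgbelow : ∀ {M x}, N ≤ M → x ∈ below D M → ∀ g ∈ K, g x ∈ below D M := by
    intro M x hM hx g hg j hj
    rw [(Piece.stab_isBlock hN1 hN2 (hKst g hg)).1 x j (hM.trans hj), hx j hj]
  have hGV : ∀ x, G x - x ∈ L.V₁ := by
    intro x
    have hb : ∀ v : V D, v ∈ below D N → ∀ j, L.proj v j =
        ∑ i ∈ Finset.range N, v i * L.proj (Finsupp.single i 1) j := by
      intro v hv j
      conv_lhs => rw [sum_below hv]
      rw [map_sum, Finsupp.finsetSum_apply]
      exact Finset.sum_congr rfl fun i _ => by rw [map_smul]; rfl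
    have h1 : ∀ j, (∑ i ∈ Finset.range N, (matApply m x i - x i) * L.proj (Finsupp.single i 1) j) -
        (matApply m x j - x j) = 0 := fun j =>
      hcl (fun m => (∑ i ∈ Finset.range N, (matApply m x i - x i) * L.proj (Finsupp.single i 1) j) -
        (matApply m x j - x j)) 0 ((continuous_finsetSum _ fun i _ =>
          ((continuous_matApply x i).sub continuous_const).mul continuous_const).sub
            ((continuous_matApply x j).sub continuous_const)) fun g hg => by
        have hmem := (hKst g hg).1 x
        have h2 := hb _ (hN1 hmem) j
        rw [L.proj_of_mem hmem] at h2
        simp only [matApply_entries]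
        rw [sub_eq_zero]
        exact h2.symm
    have h2 : L.proj (G x - x) = G x - x := by
      ext j
      rw [hb _ (fun j hj => by rw [Finsupp.sub_apply, hG, hhigh x j hj, sub_self])]
      exact sub_eq_zero.1 (h1 j)
    rw [← h2]
    exact L.proj_mem _
  have hGC : ∀ c ∈ L.C, G c = c := by
    intro c hc
    ext j
    exact hcl (fun m => matApply m c j) _ (continuous_matApply c j) fun g hg => by
      rw [matApply_entries, (hKst g hg).2 c hc]
  have hGQ : ∀ (Q : V D → V D → D) (q : ℕ → ℕ → D) (τ : D → D), Continuous τ →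
      (∀ M x y, x ∈ below D M → y ∈ below D M → Q x y =
        ∑ i ∈ Finset.range M, ∑ j ∈ Finset.range M, x i * q i j * τ (y j)) →
      (∀ g ∈ K, Pres Q g) → ∀ x y, Q (G x) (G y) = Q x y := by
    intro Q q τ hτ hQ hgQ x y
    obtain ⟨M, hx, hy⟩ := exists_below₂ x y
    have hx := below_mono (le_max_right N M) hx
    have hy := below_mono (le_max_right N M) hy
    rw [hQ _ _ _ (hGbelow (le_max_left _ _) hx) (hGbelow (le_max_left _ _) hy)]
    exact hcl (fun m => ∑ i ∈ Finset.range (max N M), ∑ j ∈ Finset.range (max N M),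
      matApply m x i * q i j * τ (matApply m y j)) _
      (continuous_finsetSum _ fun i _ => continuous_finsetSum _ fun j _ =>
        ((continuous_matApply x i).mul continuous_const).mul (hτ.comp (continuous_matApply y j)))
      fun g hg => by
        rw [← hgQ g hg x y, hQ _ _ _ (hgbelow (le_max_left _ _) hx g hg)
          (hgbelow (le_max_left _ _) hy g hg)]
        simp only [matApply_entries]
  have hGH : ∀ x y, H (G x) (G y) = H x y :=
    hGQ H _ star continuous_star' (fun M x y hx hy => hA.herm.eq_sum hx hy) fun g hg => hg.2
  have hGB : ∀ x y, form h σ (G x) (G y) = form h σ x y :=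
    hGQ (form h σ) h σ hσc (fun M x y hx hy => form_eq hσ0 hx hy) fun g hg => (mem_linΓ.1 hg.1).2.1
  have hGV1 : ∀ x ∈ L.V₁, G x ∈ L.V₁ := fun x hx => by
    have := L.V₁.add_mem (hGV x) hx
    rwa [sub_add_cancel] at this
  have hinj : Function.Injective G := by
    refine (injective_iff_map_eq_zero G).2 fun x hx => ?_
    have h1 := hGV x
    rw [hx, zero_sub] at h1
    have h2 : x ∈ L.V₁ := by simpa using h1
    refine hA.eq_zero h2 ?_
    rw [← hGH, hx, hA.herm.zero_left]
  have hsurj : Function.Surjective G := by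
    have h0 : Function.Injective (G.restrict hGV1) := fun x y hxy =>
      Subtype.ext (hinj (congrArg Subtype.val hxy))
    have h1 : Function.Surjective (G.restrict hGV1) := 
      (LinearMap.injective_iff_surjective (K := D) (V := L.V₁) (f := G.restrict hGV1)).1 h0
    intro y
    obtain ⟨x, hx⟩ := h1 ⟨L.proj y, L.proj_mem y⟩
    refine ⟨x + (y - L.proj y), ?_⟩
    have hx' : G x = L.proj y := congrArg Subtype.val hx
    rw [map_add, hx', hGC _ (L.sub_proj_mem y), add_sub_cancel]
  let g : V D ≃ₗ[D] V D := LinearEquiv.ofBijective G ⟨hinj, hsurj⟩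
  have hgG : ∀ x, g x = G x := fun _ => rfl
  have hgm : entries g = m := by
    funext i j
    exact matApply_single m i j
  have hgst : g ∈ L.stab := ⟨hGV, hGC⟩
  refine ⟨g, ⟨mem_linΓ_of hgst hGB (Piece.stab_isBlock hN1 hN2 hgst) fun hs => ?_, hGH⟩, hgm⟩
  have hdet : blockDet ρ N g = (emb ρ (Matrix.of fun i j : Fin N => m i j)).det := by
    rw [blockDet_eq, ← hgm]
    rfl
  rw [hdet]
  have hcont : Continuous fun m : ℕ → ℕ → D => (emb ρ (Matrix.of fun i j : Fin N => m i j)).det := by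
    refine Continuous.matrix_det (continuous_matrix fun p q => ?_)
    have h1 : Continuous fun m : ℕ → ℕ → D => ρ (m p.1 q.1) :=
      hρ.comp ((continuous_apply _).comp (continuous_apply _))
    exact h1.matrix_elem p.2 q.2
  have : closure (entries '' K) ⊆
      {m | (emb ρ (Matrix.of fun i j : Fin N => m i j)).det = 1} :=
    closure_minimal (by
      rintro _ ⟨g, h1, rfl⟩
      exact (mem_linΓ.1 h1.1).2.2 hs N (Piece.stab_isBlock hN1 hN2 (hKst g h1)))
      (isClosed_eq hcont continuous_const)
  exact this hm

theorem rep_linear (hB : IsForm (form h σ) σ' δ) (hσ0 : σ 0 = 0) (hσc : Continuous σ)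
    (hρ : Continuous ρ) :
    letI : TopologicalSpace (V D ≃ₗ[D] V D) := entryTop
    Rep σ' δ (linΓ ρ h σ sp) (fun g => g) := by
  letI : TopologicalSpace (V D ≃ₗ[D] V D) := entryTop
  exact
    { form := hB
      mono := fun L L' hL => inf_le_inf le_rfl (Piece.stab_mono hL)
      ad_mul := fun _ _ _ _ _ => rfl
      ad_stab := fun L g hg => hg.2
      ad_B := fun L g hg => hg.1.2
      ad_cont := fun L i j => (continuous_entry i j).continuousOn
      compact := fun L H A' hA => isCompact_linear hσ0 hσc hρ L hA }

end Linear

/-! ### Rigidity -/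

section Rigidity

variable {D : Type} [NormedDivisionRing D] [NormedAlgebra ℝ D] [StarRing D] [Coeff D]
variable {B : V D → V D → D} {σ : D → D} {δ : ℝ}
variable {A : Type} [Group A] [TopologicalSpace A]
variable {Γ : Piece B → Subgroup A} {ad : A → (V D ≃ₗ[D] V D)} {R : Rep σ δ Γ ad}

/-- The first `k` basis vectors. -/
def firstVectors (D : Type) [DivisionRing D] (k : ℕ) : Finset (V D) :=
  by classical exact (Finset.range k).image fun i => Finsupp.single i 1

theorem mem_firstVectors {k i : ℕ} (h : i < k) : (Finsupp.single i 1 : V D) ∈ firstVectors D k := by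
  classical
  exact Finset.mem_image.2 ⟨i, Finset.mem_range.2 h, rfl⟩

/-- Fewer than `k` conditions have a common nonzero solution. -/
theorem exists_perp {H : V D → V D → D} (hH : IsHerm H) {U : Submodule D (V D)} {k : ℕ}
    (hk : ∀ x ∈ firstVectors D k, x ∈ U) (y : List (V D)) (hy : y.length < k) :
    ∃ v ∈ U, v ≠ 0 ∧ ∀ w ∈ y, H v w = 0 := by
  let e : Fin k → V D := fun i => Finsupp.single (i : ℕ) 1
  let Φ : (Fin k → D) →ₗ[D] (Fin y.length → D) := LinearMap.pi fun j =>
    hH.lin (y.get j) hH ∘ₗ Fintype.linearCombination D e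
  obtain ⟨c, hc, hc0⟩ := (Submodule.ne_bot_iff _).1 (LinearMap.ker_ne_bot_of_finrank_lt (f := Φ) (by
    rw [Module.finrank_fintype_fun_eq_card, Module.finrank_fintype_fun_eq_card,
      Fintype.card_fin, Fintype.card_fin]
    exact hy))
  refine ⟨Fintype.linearCombination D e c, ?_, fun h0 => hc0 (funext fun i => ?_), fun w hw => ?_⟩
  · rw [Fintype.linearCombination_apply]
    exact Submodule.sum_mem _ fun i _ => U.smul_mem _ (hk _ (mem_firstVectors i.2))
  · have := DFunLike.congr_fun h0 (i : ℕ)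
    rw [Fintype.linearCombination_apply, Finsupp.finsetSum_apply, Finset.sum_eq_single i] at this
    · simpa [e] using this
    · intro j _ hj
      have : (j : ℕ) ≠ i := fun h => hj (Fin.ext h)
      simp [e, this]
    · simp
  · obtain ⟨j, rfl⟩ := List.mem_iff_get.1 hw
    exact congrFun hc j

/-- Two adapted forms with commuting operators are equal. -/
theorem Adm.eq_of_comm {M : Type} [AddCommGroup M] [Module D M] [Module ℝ M] [IsScalarTower ℝ D M]
    {B : M → M → D} {U C : Submodule D M} {H H₁ : M → M → D} {A A₁ : M →ₗ[ℝ] M}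
    (h : Adm B δ U C H A) (h₁ : Adm B δ U C H₁ A₁) (hδ : δ * δ = 1)
    (hcomm : ∀ x ∈ U, A (A₁ x) = A₁ (A x)) {x y : M} (hx : x ∈ U) (hy : y ∈ U) :
    H₁ x y = H x y := by
  have hN : ∀ x ∈ U, ∀ y ∈ U, H₁ x y = H x (δ • A (A₁ y)) := by
    intro x hx y hy
    have e : y = A₁ (δ • A₁ y) := by
      rw [map_smul, h₁.A_sq y hy, smul_smul, hδ, one_smul]
    conv_lhs => rw [e]
    rw [← h₁.B_eq x hx _ (U.smul_of_tower_mem δ (h₁.A_mem y)),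
      h.B_eq x hx _ (U.smul_of_tower_mem δ (h₁.A_mem y)), map_smul]
  have hfix : ∀ y ∈ U, δ • A (A₁ y) = y := by
    intro y hy
    set w := y - δ • A (A₁ y) with hw
    have hwU : w ∈ U := U.sub_mem hy (U.smul_of_tower_mem δ (h.A_mem _))
    have h2 : δ • A (A₁ (δ • A (A₁ y))) = y := by
      rw [map_smul, map_smul, smul_smul, hδ, one_smul, ← hcomm _ (h₁.A_mem y), h₁.A_sq y hy,
        map_smul, map_smul, h.A_sq y hy, smul_smul, hδ, one_smul]
    have h3 : δ • A (A₁ w) = -w := by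
      rw [hw, map_sub, map_sub, smul_sub, h2, neg_sub]
    have h4 := hN w hwU w hwU
    rw [h3, h.herm.neg_right] at h4
    have h5 := h₁.nonneg hwU
    rw [h4, map_neg] at h5
    by_contra hne
    have hw0 : w ≠ 0 := fun h0 => hne (sub_eq_zero.1 h0).symm
    have := h.pos w hwU hw0
    linarith
  rw [hN x hx y hy, hfix y hy]

/-- If `H`-orthogonal vectors of `S` are `H₁`-orthogonal, then `H₁` is a multiple of `H` on `S`. -/
theorem Adm.exists_scalar {M : Type} [AddCommGroup M] [Module D M] [Module ℝ M]
    [IsScalarTower ℝ D M] {B : M → M → D} {U C U₁ C₁ : Submodule D M} {H H₁ : M → M → D}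
    {A A₁ : M →ₗ[ℝ] M} (h : Adm B δ U C H A) (h₁ : Adm B δ U₁ C₁ H₁ A₁) (S : Submodule ℝ M)
    (hSU : ∀ x ∈ S, x ∈ U) (hSU₁ : ∀ x ∈ S, x ∈ U₁) (hS : ∀ x ∈ S, ∀ y ∈ S, H x y • y ∈ S) (hne : ∃ x ∈ S, x ≠ 0)
    (horth : ∀ x ∈ S, ∀ y ∈ S, H x y = 0 → H₁ x y = 0) :
    ∃ c : ℝ, 0 < c ∧ ∀ x ∈ S, ∀ y ∈ S, H₁ x y = oR D c * H x y := by
  have hh := h.herm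
  have hh₁ := h₁.herm
  have hunit : ∀ x ∈ S, x ≠ 0 → ∃ r : ℝ, r ≠ 0 ∧ r • x ∈ S ∧ H (r • x) (r • x) = 1 := by
    intro x hx hx0
    obtain ⟨r, hr, h1⟩ := h.exists_unit (hSU x hx) hx0
    exact ⟨r, hr.ne', S.smul_mem r hx, h1⟩
  have hpair : ∀ x ∈ S, ∀ y ∈ S, H x x = 1 → H y y = 1 → H x y = 0 → H₁ x x = H₁ y y := by
    intro x hx y hy hxx hyy hxy
    have h1 := horth (x + y) (S.add_mem hx hy) (x - y) (S.sub_mem hx hy) (by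
      rw [hh.add_left, hh.sub_right, hh.sub_right, hxx, hyy, hxy, hh.eq_zero_symm hxy]
      abel)
    rw [hh₁.add_left, hh₁.sub_right, hh₁.sub_right, horth x hx y hy hxy,
      horth y hy x hx (hh.eq_zero_symm hxy), sub_zero, zero_sub, ← sub_eq_add_neg] at h1
    exact sub_eq_zero.1 h1
  obtain ⟨x₀, hx₀, hx₀0⟩ := hne
  obtain ⟨r, -, hr, hrx⟩ := hunit x₀ hx₀ hx₀0
  set u := r • x₀ with hu
  have hu0 : u ≠ 0 := by
    intro h0
    rw [h0, hh.zero_left] at hrx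
    exact zero_ne_one hrx
  refine ⟨re (H₁ u u), h₁.pos u (hSU₁ u hr) hu0, fun x hx y hy => ?_⟩
  have huu := hh₁.self_eq u
  set c := re (H₁ u u) with hc
  have hux : ∀ x ∈ S, H₁ x x = oR D c * H x x := by
    intro x hx
    set y := x - H x u • u with hy
    have hyS : y ∈ S := S.sub_mem hx (hS x hx u hr)
    have hxy : x = H x u • u + y := by rw [hy]; abel
    have hyu : H y u = 0 := by rw [hy, hh.sub_left, hh.smul_left, hrx, mul_one, sub_self]
    have hdec : ∀ {H' : M → M → D} (hH' : IsHerm H') (d : D), H' y u = 0 →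
        H' (d • u + y) (d • u + y) = d * H' u u * star d + H' y y := by
      intro H' hH' d h0
      rw [hH'.add_left, hH'.add_right, hH'.add_right, hH'.smul_left, hH'.smul_left,
        hH'.smul_right, hH'.smul_right, h0, hH'.eq_zero_symm h0]
      simp [mul_assoc]
    have hyy : H₁ y y = oR D c * H y y := by
      by_cases hy0 : y = 0
      · rw [hy0, hh.zero_left, hh₁.zero_left, mul_zero]
      · obtain ⟨t, ht, htS, hty⟩ := hunit y hyS hy0
        have h1 := hpair (t • y) htS u hr hty hrx (by rw [hh.rsmul_left, hyu, mul_zero])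
        rw [huu, hh₁.rsmul_left, hh₁.rsmul_right] at h1
        rw [hh.rsmul_left, hh.rsmul_right] at hty
        have ht0 : oR D t ≠ 0 := by rwa [Ne, map_eq_zero]
        have h2 : oR D t * (H₁ y y * oR D t) = oR D t * (oR D c * H y y * oR D t) := by
          rw [h1, mul_assoc (oR D c), ← mul_assoc (oR D t) (oR D c), ← oR_comm c (oR D t),
            mul_assoc, hty, mul_one]
        exact mul_right_cancel₀ ht0 (mul_left_cancel₀ ht0 h2)
    rw [hxy, hdec hh _ hyu, hdec hh₁ _ (horth y hyS u hr hyu), hrx, huu, hyy, mul_add, mul_one,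
      mul_star, ← oR_comm, mul_assoc, mul_star]
  by_cases hy0 : y = 0
  · rw [hy0, hh.zero_right, hh₁.zero_right, mul_zero]
  obtain ⟨t, ht, htS, hty⟩ := hunit y hy hy0
  set w := t • y with hw
  have hyw : y = t⁻¹ • w := by rw [hw, smul_smul, inv_mul_cancel₀ ht, one_smul]
  set z := x - H x w • w with hz
  have hzS : z ∈ S := S.sub_mem hx (hS x hx w htS)
  have hzw : H z w = 0 := by rw [hz, hh.sub_left, hh.smul_left, hty, mul_one, sub_self]
  have hxz : x = H x w • w + z := by rw [hz]; abel
  have e : H₁ x w = oR D c * H x w := by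
    rw [hxz, hh₁.add_left, hh₁.smul_left, hux w htS, horth z hzS w htS hzw, add_zero,
      hh.add_left, hh.smul_left, hzw, add_zero, ← mul_assoc, ← oR_comm, mul_assoc]
  rw [hyw, hh₁.rsmul_right, hh.rsmul_right, e, mul_assoc]

/-- Fixed vectors are orthogonal to vectors that can be moved to their negatives. -/
theorem Rep.orth_of {L L' : Piece B} {H H₁ : V D → V D → D} {A₁ : V D →ₗ[ℝ] V D}
    (hL : L.Le L') (h₁ : Adm B δ L'.V₁ L'.C H₁ A₁) {θ : Γ L ≃* Γ L} {θ₁ : Γ L' ≃* Γ L'}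
    (hθ : R.IsInvol L H θ) (hθ₁ : R.IsInvol L' H₁ θ₁)
    (hθθ : ∀ (g : Γ L) (h : Γ L'), (h : A) = g → (θ₁ h : A) = θ g) {g : A} (hg : g ∈ Γ L)
    (hgH : Pres H (ad g)) : Pres H₁ (ad g) := by
  have h1 : g ∈ fixedPoints θ := by rw [hθ.fixed]; exact ⟨hg, hgH⟩
  obtain ⟨h2, h3⟩ := (mem_fixedPoints θ g).1 h1
  have h4 : g ∈ fixedPoints θ₁ := by
    refine (mem_fixedPoints θ₁ g).2 ⟨R.mono L L' hL hg, Subtype.ext ?_⟩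
    rw [hθθ ⟨g, hg⟩ ⟨g, R.mono L L' hL hg⟩ rfl, h3]
  rw [hθ₁.fixed] at h4
  exact h4.2

theorem Rep.orth_of_neg (R : Rep σ δ Γ ad) {L : Piece B} {H₁ : V D → V D → D} (hH₁ : IsHerm H₁) {g : A}
    (hg : g ∈ Γ L) (hgH : Pres H₁ (ad g)) {x c : V D} (hx : ad g (ad g x) = -x) (hc : c ∈ L.C) :
    H₁ x c = 0 := by
  have hgc : ad g c = c := (R.ad_stab L g hg).2 c hc
  have h1 : H₁ (ad g (ad g x)) c = H₁ x c := by
    conv_lhs => rw [← hgc, ← hgc]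
    rw [hgH, hgH]
  rw [hx, hH₁.neg_left] at h1
  exact eq_zero_of_eq_neg h1.symm

theorem IsHerm.orth_of_neg {H₁ : V D → V D → D} (hH₁ : IsHerm H₁) {T : V D ≃ₗ[D] V D}
    (hT : Pres H₁ T) {x c : V D} (hx : T x = -x) (hc : T c = c) : H₁ x c = 0 := by
  have h1 : H₁ (T x) (T c) = H₁ x c := hT x c
  rw [hc, hx, hH₁.neg_left] at h1
  exact eq_zero_of_eq_neg h1.symm

/-- Without a form, quarter turns suffice. -/
theorem Rep.rigid_gl (hδ : δ = 0) (hQ : ∀ L H A', Adm B δ L.V₁ L.C H A' → ∀ x ∈ L.V₁, ∀ y ∈ L.V₁,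
    H x x = 1 → H y y = 1 → H x y = 0 → ∃ g ∈ Γ L, Pres H (ad g) ∧ ad g x = y ∧ ad g y = -x) :
    Rigid R (firstVectors D 2) where
  nonzero := ⟨Finsupp.single 0 1, mem_firstVectors (by norm_num), by simp⟩
  orth := by
    intro L L' hL hF H A' H₁ A₁ h h₁ θ θ₁ hθ hθ₁ hθθ x hx c hc _
    by_cases hx0 : x = 0
    · rw [hx0, h₁.herm.zero_left]
    obtain ⟨r, hr, hrx⟩ := h.exists_unit hx hx0
    obtain ⟨v, hv, hv0, hvx⟩ := exists_perp h.herm hF [x] (by simp)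
    obtain ⟨s, hs, hsv⟩ := h.exists_unit hv hv0
    obtain ⟨g, hg, hgH, h1, h2⟩ := hQ L H A' h (r • x) (L.V₁.smul_of_tower_mem r hx) (s • v)
      (L.V₁.smul_of_tower_mem s hv) hrx hsv (by
        rw [h.herm.rsmul_left, h.herm.rsmul_right, h.herm.eq_zero_symm (hvx x (by simp)), zero_mul,
          mul_zero])
    have h3 := R.orth_of_neg h₁.herm hg (R.orth_of hL h₁ hθ hθ₁ hθθ hg hgH) (x := r • x)
      (by rw [h1, h2]) hc
    rw [h₁.herm.rsmul_left] at h3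
    refine (mul_eq_zero.1 h3).resolve_left ?_
    rw [map_eq_zero]
    exact hr.ne'
  unique := by
    intro L hF H A' H₁ A₁ h h₁ hK
    have hhom : ∀ x ∈ L.V₁, ∀ y ∈ L.V₁, H x x = 1 → H y y = 1 → H x y = 0 → re (H₁ x y) = 0 := by
      intro x hx y hy hxx hyy hxy
      obtain ⟨g, hg, hgH, h1, h2⟩ := hQ L H A' h x hx y hy hxx hyy hxy
      have h3 := hK g hg hgH x y
      rw [h1, h2, h₁.herm.neg_right] at h3
      have h4 := congrArg re h3
      rw [map_neg, h₁.herm.re_symm y x] at h4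
      linarith
    obtain ⟨c, hc, hcH⟩ := h.exists_scalar h₁ (L.V₁.restrictScalars ℝ) (fun x hx => hx)
      (fun x hx => hx)
      (fun x _ y hy => L.V₁.smul_mem _ hy)
      ⟨Finsupp.single 0 1, hF _ (mem_firstVectors (by norm_num)), by simp⟩ (by
        intro x hx y hy hxy
        by_cases hx0 : x = 0
        · rw [hx0, h₁.herm.zero_left]
        by_cases hy0 : y = 0
        · rw [hy0, h₁.herm.zero_right]
        refine eq_zero_of_re fun d => ?_
        by_cases hd : d = 0
        · rw [hd, zero_mul, map_zero]
        have hdx : d • x ∈ L.V₁ := L.V₁.smul_mem d hx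
        obtain ⟨r, hr, hrx⟩ := h.exists_unit hdx (smul_ne_zero hd hx0)
        obtain ⟨s, hs, hsy⟩ := h.exists_unit hy hy0
        have h1 := hhom _ (L.V₁.smul_of_tower_mem r hdx) _ (L.V₁.smul_of_tower_mem s hy) hrx hsy (by
          rw [h.herm.rsmul_left, h.herm.rsmul_right, h.herm.smul_left, hxy, mul_zero, zero_mul,
            mul_zero])
        rw [h₁.herm.rsmul_left, h₁.herm.rsmul_right, re_oR_mul, ← oR_comm, re_oR_mul,
          h₁.herm.smul_left] at h1
        have := (mul_eq_zero.1 ((mul_eq_zero.1 h1).resolve_left hr.ne')).resolve_left hs.ne'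
        exact this)
    exact ⟨c, hc, hcH⟩

/-- If `A` itself comes from the group, that suffices. -/
theorem Rep.rigid_of_operator (hδ : δ = -1)
    (hQ : ∀ L H A', Adm B δ L.V₁ L.C H A' → ∃ g ∈ Γ L, Pres H (ad g) ∧ ∀ x ∈ L.V₁, ad g x = A' x) :
    Rigid R (firstVectors D 1) where
  nonzero := ⟨Finsupp.single 0 1, mem_firstVectors (by norm_num), by simp⟩
  orth := by
    intro L L' hL hF H A' H₁ A₁ h h₁ θ θ₁ hθ hθ₁ hθθ x hx c hc _
    obtain ⟨g, hg, hgH, h1⟩ := hQ L H A' h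
    refine R.orth_of_neg h₁.herm hg (R.orth_of hL h₁ hθ hθ₁ hθθ hg hgH) ?_ hc
    rw [h1 x hx, h1 _ (h.A_mem x), h.A_sq x hx, hδ, neg_one_smul]
  unique := by
    intro L hF H A' H₁ A₁ h h₁ hK
    obtain ⟨g, hg, hgH, h1⟩ := hQ L H A' h
    refine ⟨1, one_pos, fun x hx y hy => ?_⟩
    rw [map_one, one_mul]
    refine h.eq_of_comm h₁ (by rw [hδ]; norm_num) (fun z hz => ?_) hx hy
    have hst := R.ad_stab L g hg
    rw [← h1 _ (h₁.A_mem z), ← h1 z hz]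
    exact (h₁.A_comm (fun w => L.stab_iff _ w hst) (R.ad_B L g hg) (hK g hg hgH) hz).symm

end Rigidity

section Comm

variable {𝕜 : Type} [RCLike 𝕜]
variable {B : V 𝕜 → V 𝕜 → 𝕜} {δ : ℝ}
variable {A : Type} [Group A] [TopologicalSpace A]
variable {Γ : Piece B → Subgroup A} {ad : A → (V 𝕜 ≃ₗ[𝕜] V 𝕜)} {R : Rep id δ Γ ad}

/-- For symplectic forms, the turns `x ↦ A x ↦ -x` suffice. -/
theorem Rep.rigid_symplectic (hδ : δ = -1) (hQ : ∀ L H A', Adm B δ L.V₁ L.C H A' → ∀ x ∈ L.V₁,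
    H x x = 1 → ∃ g ∈ Γ L, Pres H (ad g) ∧ ad g x = A' x ∧ ad g (A' x) = -x) :
    Rigid R (firstVectors 𝕜 1) where
  nonzero := ⟨Finsupp.single 0 1, mem_firstVectors (by norm_num), by simp⟩
  orth := by
    intro L L' hL hF H A' H₁ A₁ h h₁ θ θ₁ hθ hθ₁ hθθ x hx c hc _
    by_cases hx0 : x = 0
    · rw [hx0, h₁.herm.zero_left]
    obtain ⟨r, hr, hrx⟩ := h.exists_unit hx hx0
    obtain ⟨g, hg, hgH, h1, h2⟩ := hQ L H A' h (r • x) (L.V₁.smul_of_tower_mem r hx) hrx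
    have h3 := R.orth_of_neg h₁.herm hg (R.orth_of hL h₁ hθ hθ₁ hθθ hg hgH) (x := r • x)
      (by rw [h1, h2]) hc
    rw [h₁.herm.rsmul_left] at h3
    refine (mul_eq_zero.1 h3).resolve_left ?_
    rw [map_eq_zero]
    exact hr.ne'
  unique := by
    intro L hF H A' H₁ A₁ h h₁ hK
    have hB := R.form
    have hh₁ := h₁.herm
    have hre : ∀ z ∈ L.V₁, re (H₁ (A' z) z) = 0 := by
      intro z hz
      by_cases hz0 : z = 0
      · rw [hz0, hh₁.zero_right, map_zero]
      obtain ⟨r, hr, hrz⟩ := h.exists_unit hz hz0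
      obtain ⟨g, hg, hgH, h1, h2⟩ := hQ L H A' h (r • z) (L.V₁.smul_of_tower_mem r hz) hrz
      have h3 := congrArg re (hK g hg hgH (A' (r • z)) (r • z))
      rw [h1, h2, hh₁.neg_left, map_neg, hh₁.re_symm (r • z), map_smul, hh₁.rsmul_left,
        hh₁.rsmul_right, re_oR_mul, ← oR_comm, re_oR_mul] at h3
      have h4 : r * (r * re (H₁ (A' z) z)) = 0 := by linarith
      exact (mul_eq_zero.1 ((mul_eq_zero.1 h4).resolve_left hr.ne')).resolve_left hr.ne'
    have hanti : ∀ w ∈ L.V₁, ∀ z ∈ L.V₁, H₁ (A' w) z = -H₁ (A' z) w := by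
      intro w hw z hz
      have hpol : ∀ w ∈ L.V₁, re (H₁ (A' w) z) = -re (H₁ (A' z) w) := by
        intro w hw
        have h1 := hre (w + z) (L.V₁.add_mem hw hz)
        rw [map_add, hh₁.add_left, hh₁.add_right, hh₁.add_right, map_add, map_add, map_add,
          hre w hw, hre z hz] at h1
        linarith
      refine eq_of_re fun d => ?_
      have h1 := hpol (star d • w) (L.V₁.smul_mem _ hw)
      rw [h.A_smul hB _ hw, hh₁.smul_left, hh₁.smul_right, id, star_star] at h1
      rw [h1, mul_neg, map_neg, re_mul_comm]
    refine ⟨1, one_pos, fun x hx y hy => ?_⟩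
    rw [map_one, one_mul]
    refine h.eq_of_comm h₁ (by rw [hδ]; norm_num) (fun u hu => ?_) hx hy
    have hAA : ∀ x ∈ L.V₁, ∀ y ∈ L.V₁, H (A' x) (A' y) = star (H x y) := by
      intro x hx y hy
      rw [h.adj_id hB hx (h.A_mem y), h.A_sq y hy, h.herm.rsmul_right, hδ, map_neg, map_one]
      simp
    refine h₁.eq_of_H (h.A_mem _) (h₁.A_mem _) fun w hw => ?_
    have e1 : H₁ (A' (A₁ u)) w = -H u w := by
      have h1 := hanti w hw (A₁ u) (h₁.A_mem u)
      rw [← h₁.B_eq _ (h.A_mem w) u hu, h.B_eq _ (h.A_mem w) u hu, hAA w hw u hu,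
        h.herm.star_symm] at h1
      rw [h1, neg_neg]
    have e2 : H₁ (A₁ (A' u)) w = -H u w := by
      rw [h₁.adj_id hB (h.A_mem u) hw, ← h₁.B_eq _ (h.A_mem u) w hw, h.B_eq _ (h.A_mem u) w hw,
        hAA u hu w hw, star_star, hδ, map_neg, map_one, neg_one_mul]
    rw [← hh₁.star_symm, e1, ← e2, hh₁.star_symm]

end Comm

/-- For complex symmetric forms, the reflections in real planes suffice. -/
theorem Rep.rigid_soC {B : V ℂ → V ℂ → ℂ} {A : Type} [Group A] [TopologicalSpace A]
    {Γ : Piece B → Subgroup A} {ad : A → (V ℂ ≃ₗ[ℂ] V ℂ)} {R : Rep id 1 Γ ad}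
    (hQ : ∀ L H A', Adm B 1 L.V₁ L.C H A' → ∀ x ∈ L.V₁, ∀ y ∈ L.V₁,
      H x x = 1 → H y y = 1 → H x y = 0 → A' x = x → A' y = y →
      ∃ g ∈ Γ L, Pres H (ad g) ∧ ad g x = -x ∧ ∀ v, H v x = 0 → H v y = 0 → ad g v = v) :
    Rigid R (firstVectors ℂ 3) := by
  have hB := R.form
  have hsq : ∀ {L : Piece B} {H A'}, Adm B 1 L.V₁ L.C H A' → ∀ y ∈ L.V₁, A' (A' y) = y :=
    fun h y hy => by rw [h.A_sq y hy, one_smul]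
  have hsm : ∀ {L : Piece B} {H A'}, Adm B 1 L.V₁ L.C H A' → ∀ (d : ℂ), ∀ y ∈ L.V₁,
      A' (d • y) = star d • A' y := fun h d y hy => h.A_smul hB d hy
  have hdec : ∀ {L : Piece B} {H A'}, Adm B 1 L.V₁ L.C H A' → ∀ v ∈ L.V₁, ∃ x ∈ L.V₁, ∃ y ∈ L.V₁,
      A' x = x ∧ A' y = y ∧ v = x + Complex.I • y ∧
        ∀ w ∈ L.V₁, A' w = w → H v w = 0 → H x w = 0 ∧ H y w = 0 := by
    intro L H A' h v hv
    have hm : A' v ∈ L.V₁ := h.A_mem v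
    refine ⟨(1 / 2 : ℂ) • (v + A' v), L.V₁.smul_mem _ (L.V₁.add_mem hv hm),
      (-Complex.I / 2) • (v - A' v), L.V₁.smul_mem _ (L.V₁.sub_mem hv hm), ?_, ?_, ?_, ?_⟩
    · rw [hsm h _ _ (L.V₁.add_mem hv hm), map_add, hsq h v hv, add_comm]
      congr 1
      simp
    · rw [hsm h _ _ (L.V₁.sub_mem hv hm), map_sub, hsq h v hv, ← neg_sub v, smul_neg, ← neg_smul]
      congr 1
      simp [neg_div]
    · rw [smul_smul, show Complex.I * (-Complex.I / 2) = 1 / 2 by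
        rw [mul_div_assoc', mul_neg, Complex.I_mul_I, neg_neg], ← smul_add, add_add_sub_cancel,
        ← two_smul ℂ, smul_smul]
      norm_num
    · intro w hw hAw h0
      have h1 : H (A' v) w = 0 := by
        rw [h.adj_id hB hv hw, hAw, h0, star_zero, mul_zero]
      rw [h.herm.smul_left, h.herm.smul_left, h.herm.add_left, h.herm.sub_left, h0, h1]
      simp
  have hpartner : ∀ {L : Piece B} {H A'}, Adm B 1 L.V₁ L.C H A' →
      (∀ x ∈ firstVectors ℂ 3, x ∈ L.V₁) → ∀ x ∈ L.V₁, A' x = x → ∀ y ∈ L.V₁, A' y = y →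
      ∃ z ∈ L.V₁, A' z = z ∧ H z z = 1 ∧ H z x = 0 ∧ H z y = 0 := by
    intro L H A' h hF x hx hAx y hy hAy
    obtain ⟨v, hv, hv0, hvxy⟩ := exists_perp h.herm hF [x, y] (by simp)
    obtain ⟨a, ha, b, hb, hAa, hAb, hvab, hw⟩ := hdec h v hv
    have h1 := hw x hx hAx (hvxy x (by simp))
    have h2 := hw y hy hAy (hvxy y (by simp))
    have key : ∀ z ∈ L.V₁, A' z = z → z ≠ 0 → H z x = 0 → H z y = 0 →
        ∃ z ∈ L.V₁, A' z = z ∧ H z z = 1 ∧ H z x = 0 ∧ H z y = 0 := by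
      intro z hz hAz hz0 hzx hzy
      obtain ⟨r, hr, hrz⟩ := h.exists_unit hz hz0
      refine ⟨r • z, L.V₁.smul_of_tower_mem r hz, by rw [map_smul, hAz], hrz, ?_, ?_⟩
      · rw [h.herm.rsmul_left, hzx, mul_zero]
      · rw [h.herm.rsmul_left, hzy, mul_zero]
    by_cases ha0 : a = 0
    · refine key b hb hAb (fun hb0 => hv0 ?_) h1.2 h2.2
      rw [hvab, ha0, hb0, smul_zero, add_zero]
    · exact key a ha hAa ha0 h1.1 h2.1
  refine ⟨⟨Finsupp.single 0 1, mem_firstVectors (by norm_num), by simp⟩, ?_, ?_⟩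
  · intro L L' hL hF H A' H₁ A₁ h h₁ θ θ₁ hθ hθ₁ hθθ x hx c hc _
    have key : ∀ x ∈ L.V₁, A' x = x → H₁ x c = 0 := by
      intro x hx hAx
      by_cases hx0 : x = 0
      · rw [hx0, h₁.herm.zero_left]
      obtain ⟨r, hr, hrx⟩ := h.exists_unit hx hx0
      have hrV := L.V₁.smul_of_tower_mem r hx
      have hAr : A' (r • x) = r • x := by rw [map_smul, hAx]
      obtain ⟨z, hz, hAz, hzz, hzx, -⟩ := hpartner h hF _ hrV hAr _ hrV hAr
      obtain ⟨g, hg, hgH, h1, h2⟩ := hQ L H A' h _ hrV z hz hrx hzz (h.herm.eq_zero_symm hzx) hAr hAz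
      have h3 := h₁.herm.orth_of_neg (R.orth_of hL h₁ hθ hθ₁ hθθ hg hgH) h1
        ((R.ad_stab L g hg).2 c hc)
      rw [h₁.herm.rsmul_left] at h3
      refine (mul_eq_zero.1 h3).resolve_left ?_
      rw [map_eq_zero]
      exact hr.ne'
    obtain ⟨a, ha, b, hb, hAa, hAb, hvab, -⟩ := hdec h x hx
    rw [hvab, h₁.herm.add_left, h₁.herm.smul_left, key a ha hAa, key b hb hAb, mul_zero, add_zero]
  · intro L hF H A' H₁ A₁ h h₁ hK
    obtain ⟨S, hS⟩ : ∃ S : Submodule ℝ (V ℂ), ∀ x, x ∈ S ↔ x ∈ L.V₁ ∧ A' x = x :=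
      ⟨L.V₁.restrictScalars ℝ ⊓ LinearMap.ker (A' - LinearMap.id), fun x => by
        simp [sub_eq_zero]⟩
    have hreal : ∀ x ∈ S, ∀ y ∈ S, star (H x y) = H x y := by
      intro x hx y hy
      rw [hS] at hx hy
      have := h.adj_id hB hx.1 hy.1
      rw [hx.2, hy.2, map_one, one_mul] at this
      exact this.symm
    obtain ⟨c, hc, hcH⟩ := h.exists_scalar h₁ S (fun x hx => ((hS x).1 hx).1)
      (fun x hx => ((hS x).1 hx).1)
      (fun x hx y hy => by
        have h1 := hreal x hx y hy
        rw [hS] at hy ⊢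
        exact ⟨L.V₁.smul_mem _ hy.1, by rw [hsm h _ _ hy.1, h1, hy.2]⟩)
      (by
        obtain ⟨z, hz, hAz, hzz, -⟩ := hpartner h hF 0 L.V₁.zero_mem (map_zero _) 0 L.V₁.zero_mem
          (map_zero _)
        refine ⟨z, (hS z).2 ⟨hz, hAz⟩, fun h0 => ?_⟩
        rw [h0, h.herm.zero_left] at hzz
        exact zero_ne_one hzz)
      (by
        intro x hx y hy hxy
        rw [hS] at hx hy
        by_cases hx0 : x = 0
        · rw [hx0, h₁.herm.zero_left]
        obtain ⟨r, hr, hrx⟩ := h.exists_unit hx.1 hx0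
        have hrV := L.V₁.smul_of_tower_mem r hx.1
        have hAr : A' (r • x) = r • x := by rw [map_smul, hx.2]
        obtain ⟨z, hz, hAz, hzz, hzx, hzy⟩ := hpartner h hF _ hrV hAr y hy.1 hy.2
        obtain ⟨g, hg, hgH, h1, h2⟩ := hQ L H A' h _ hrV z hz hrx hzz (h.herm.eq_zero_symm hzx)
          hAr hAz
        have h3 := h₁.herm.orth_of_neg (hK g hg hgH) h1 (h2 y
          (by rw [h.herm.rsmul_right, h.herm.eq_zero_symm hxy, zero_mul])
          (h.herm.eq_zero_symm hzy))
        rw [h₁.herm.rsmul_left] at h3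
        refine (mul_eq_zero.1 h3).resolve_left ?_
        rw [map_eq_zero]
        exact hr.ne')
    refine ⟨c, hc, fun x hx y hy => ?_⟩
    obtain ⟨a, ha, b, hb, hAa, hAb, rfl, -⟩ := hdec h x hx
    obtain ⟨a', ha', b', hb', hAa', hAb', rfl, -⟩ := hdec h y hy
    simp only [h.herm.add_left, h.herm.add_right, h.herm.smul_left, h.herm.smul_right,
      h₁.herm.add_left, h₁.herm.add_right, h₁.herm.smul_left, h₁.herm.smul_right,
      hcH a ((hS a).2 ⟨ha, hAa⟩) a' ((hS a').2 ⟨ha', hAa'⟩),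
      hcH a ((hS a).2 ⟨ha, hAa⟩) b' ((hS b').2 ⟨hb', hAb'⟩),
      hcH b ((hS b).2 ⟨hb, hAb⟩) a' ((hS a').2 ⟨ha', hAa'⟩),
      hcH b ((hS b).2 ⟨hb, hAb⟩) b' ((hS b').2 ⟨hb', hAb'⟩)]
    ring

/-! ### Rigidity for forms with signs -/

section SignAdm

variable {D : Type} [NormedDivisionRing D] [NormedAlgebra ℝ D] [StarRing D] [Coeff D]
variable {M : Type} [AddCommGroup M] [Module D M] [Module ℝ M] [IsScalarTower ℝ D M]
variable {B : M → M → D} {σ : D → D} {U C : Submodule D M} {H : M → M → D} {A : M →ₗ[ℝ] M}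

/-- The map `g` changes the signs of `x` and `y` and fixes what is orthogonal to them. -/
def FlipOn (H : M → M → D) (x y : M) (g : M ≃ₗ[D] M) : Prop :=
  g x = -x ∧ g y = -y ∧ ∀ v, H v x = 0 → H v y = 0 → g v = v

namespace Adm

variable (hB : IsForm B σ 1) (hσ : ∀ d, σ d = star d) (h : Adm B 1 U C H A)
include hB hσ h

theorem A_A {y : M} (hy : y ∈ U) : A (A y) = y := by rw [h.A_sq y hy, one_smul]

theorem selfadj {x y : M} (hx : x ∈ U) (hy : y ∈ U) : H (A x) y = H x (A y) := by
  rw [h.adj_star hB hσ hx hy, map_one, one_mul]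

theorem eigen_orth {s : ℝ} (hs : s * s = 1) {x y : M} (hx : x ∈ U) (hy : y ∈ U) (hAx : A x = s • x)
    (hAy : A y = -s • y) : H x y = 0 := by
  have h1 := h.selfadj hB hσ hx hy
  rw [hAx, hAy, h.herm.rsmul_left, h.herm.rsmul_right, ← oR_comm, ← sub_eq_zero, ← sub_mul,
    ← map_sub, mul_eq_zero, map_eq_zero] at h1
  refine h1.resolve_left fun h2 => ?_
  have : s = 0 := by linarith
  rw [this] at hs
  norm_num at hs

/-- The decomposition into eigenvectors of `A`. -/
theorem exists_eigen {s : ℝ} (hs : s * s = 1) {v : M} (hv : v ∈ U) : ∃ x ∈ U, ∃ y ∈ U,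
    A x = s • x ∧ A y = -s • y ∧ v = x + y ∧
      ∀ w ∈ U, (A w = s • w ∨ A w = -s • w) → H v w = 0 → H x w = 0 ∧ H y w = 0 := by
  have hm : A v ∈ U := h.A_mem v
  refine ⟨(1 / 2 : ℝ) • (v + s • A v), U.smul_of_tower_mem _ (U.add_mem hv (U.smul_of_tower_mem s hm)),
    (1 / 2 : ℝ) • (v - s • A v), U.smul_of_tower_mem _ (U.sub_mem hv (U.smul_of_tower_mem s hm)),
    ?_, ?_, ?_, ?_⟩
  · rw [map_smul, map_add, map_smul, h.A_A hB hσ hv, smul_comm s, smul_add s, smul_smul, hs, one_smul,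
      add_comm]
  · rw [map_smul, map_sub, map_smul, h.A_A hB hσ hv, smul_comm (-s), smul_sub (-s), smul_smul,
      neg_mul, hs, neg_smul, neg_smul, one_smul, sub_neg_eq_add, add_comm, sub_eq_add_neg]
  · rw [← smul_add, add_add_sub_cancel, ← two_smul ℝ, smul_smul]
    norm_num
  · intro w hw hAw h0
    have h1 : H (A v) w = 0 := by
      rw [h.selfadj hB hσ hv hw]
      rcases hAw with hAw | hAw <;> rw [hAw, h.herm.rsmul_right, h0, zero_mul]
    rw [h.herm.rsmul_left, h.herm.rsmul_left, h.herm.add_left, h.herm.sub_left, h.herm.rsmul_left,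
      h0, h1]
    simp

/-- A vector orthogonal to fewer than `k` given eigenvectors may be taken to be an eigenvector. -/
theorem exists_unit_eigen {s : ℝ} (hs : s * s = 1) {v : M} (hv : v ∈ U) (hv0 : v ≠ 0) :
    ∃ z ∈ U, (A z = s • z ∨ A z = -s • z) ∧ H z z = 1 ∧
      ∀ w ∈ U, (A w = s • w ∨ A w = -s • w) → H v w = 0 → H z w = 0 := by
  obtain ⟨x, hx, y, hy, hAx, hAy, hxy, hw⟩ := h.exists_eigen hB hσ hs hv
  by_cases hx0 : x = 0
  · have hy0 : y ≠ 0 := fun hy0 => hv0 (by rw [hxy, hx0, hy0, add_zero])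
    obtain ⟨r, hr, h1⟩ := h.exists_unit hy hy0
    refine ⟨r • y, U.smul_of_tower_mem r hy, Or.inr ?_, h1, fun w hwU hAw h0 => ?_⟩
    · rw [map_smul, hAy, smul_comm]
    · rw [h.herm.rsmul_left, (hw w hwU hAw h0).2, mul_zero]
  · obtain ⟨r, hr, h1⟩ := h.exists_unit hx hx0
    refine ⟨r • x, U.smul_of_tower_mem r hx, Or.inl ?_, h1, fun w hwU hAw h0 => ?_⟩
    · rw [map_smul, hAx, smul_comm]
    · rw [h.herm.rsmul_left, (hw w hwU hAw h0).1, mul_zero]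

end Adm

end SignAdm

section SignRigid

variable {D : Type} [NormedDivisionRing D] [NormedAlgebra ℝ D] [StarRing D] [Coeff D]
variable {B : V D → V D → D} {σ : D → D}
variable {A : Type} [Group A] [TopologicalSpace A]
variable {Γ : Piece B → Subgroup A} {ad : A → (V D ≃ₗ[D] V D)}

/-- The groups contain the sign changes of two vectors of the same sign. -/
def HasFlips (Γ : Piece B → Subgroup A) (ad : A → (V D ≃ₗ[D] V D)) : Prop :=
  ∀ L H A', Adm B 1 L.V₁ L.C H A' → ∀ x ∈ L.V₁, ∀ y ∈ L.V₁, H x x = 1 → H y y = 1 → H x y = 0 →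
    ∀ s : ℝ, s * s = 1 → A' x = s • x → A' y = s • y → ∃ g ∈ Γ L, Pres H (ad g) ∧ FlipOn H x y (ad g)

/-- The groups contain the sign changes of two vectors of arbitrary signs. -/
def HasAllFlips (Γ : Piece B → Subgroup A) (ad : A → (V D ≃ₗ[D] V D)) : Prop :=
  ∀ L H A', Adm B 1 L.V₁ L.C H A' → ∀ x ∈ L.V₁, ∀ y ∈ L.V₁, H x x = 1 → H y y = 1 → H x y = 0 →
    (A' x = x ∨ A' x = -x) → (A' y = y ∨ A' y = -y) → ∃ g ∈ Γ L, Pres H (ad g) ∧ FlipOn H x y (ad g)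

theorem HasAllFlips.hasFlips (h : HasAllFlips Γ ad) : HasFlips Γ ad := by
  intro L H A' hA x hx y hy hxx hyy hxy s hs hAx hAy
  have : s = 1 ∨ s = -1 := mul_self_eq_one_iff.1 hs
  refine h L H A' hA x hx y hy hxx hyy hxy ?_ ?_
  · rcases this with rfl | rfl
    · exact Or.inl (by rw [hAx, one_smul])
    · exact Or.inr (by rw [hAx, neg_one_smul])
  · rcases this with rfl | rfl
    · exact Or.inl (by rw [hAy, one_smul])
    · exact Or.inr (by rw [hAy, neg_one_smul])

theorem HasFlips.unique (hB : IsForm B σ 1) (hσ : ∀ d, σ d = star d) (hQ : HasFlips Γ ad)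
    {L : Piece B} (hF : ∀ x ∈ firstVectors D 3, x ∈ L.V₁) {H H₁ : V D → V D → D}
    {A' A₁ : V D →ₗ[ℝ] V D} (h : Adm B 1 L.V₁ L.C H A') (h₁ : Adm B 1 L.V₁ L.C H₁ A₁)
    (hK : ∀ g ∈ Γ L, Pres H (ad g) → Pres H₁ (ad g)) {x y : V D} (hx : x ∈ L.V₁) (hy : y ∈ L.V₁) :
    H₁ x y = H x y := by
  have horth1 : ∀ s : ℝ, s * s = 1 → ∀ y ∈ L.V₁, ∀ w ∈ L.V₁, H y y = 1 → H w w = 1 →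
      A' y = s • y → A' w = -s • w → H₁ y w = 0 := by
    intro s hs y hy w hw hyy hww hAy hAw
    have hyw := h.eigen_orth hB hσ hs hy hw hAy hAw
    obtain ⟨v, hv, hv0, hvyw⟩ := exists_perp h.herm hF [y, w] (by simp)
    obtain ⟨z, hz, hAz, hzz, hzw⟩ := h.exists_unit_eigen hB hσ hs hv hv0
    have hzy' := hzw y hy (Or.inl hAy) (hvyw y (by simp))
    have hzw' := hzw w hw (Or.inr hAw) (hvyw w (by simp))
    rcases hAz with hAz | hAz
    · obtain ⟨g, hg, hgH, h1, -, h2⟩ := hQ L H A' h y hy z hz hyy hzz (h.herm.eq_zero_symm hzy') s hs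
        hAy hAz
      exact h₁.herm.orth_of_neg (hK g hg hgH) h1
        (h2 w (h.herm.eq_zero_symm hyw) (h.herm.eq_zero_symm hzw'))
    · obtain ⟨g, hg, hgH, h1, -, h2⟩ := hQ L H A' h w hw z hz hww hzz (h.herm.eq_zero_symm hzw') (-s)
        (by rw [neg_mul_neg, hs]) hAw hAz
      exact h₁.herm.eq_zero_symm (h₁.herm.orth_of_neg (hK g hg hgH) h1
        (h2 y hyw (h.herm.eq_zero_symm hzy')))
  have horth : ∀ s : ℝ, s * s = 1 → ∀ y ∈ L.V₁, ∀ w ∈ L.V₁, A' y = s • y → A' w = -s • w →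
      H₁ y w = 0 := by
    intro s hs y hy w hw hAy hAw
    by_cases hy0 : y = 0
    · rw [hy0, h₁.herm.zero_left]
    by_cases hw0 : w = 0
    · rw [hw0, h₁.herm.zero_right]
    obtain ⟨r, hr, hr1⟩ := h.exists_unit hy hy0
    obtain ⟨t, ht, ht1⟩ := h.exists_unit hw hw0
    have := horth1 s hs _ (L.V₁.smul_of_tower_mem r hy) _ (L.V₁.smul_of_tower_mem t hw) hr1 ht1
      (by rw [map_smul, hAy, smul_comm]) (by rw [map_smul, hAw, smul_comm])
    rw [h₁.herm.rsmul_left, h₁.herm.rsmul_right] at this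
    simpa [hr.ne', ht.ne'] using this
  have hstable : ∀ s : ℝ, s * s = 1 → ∀ w ∈ L.V₁, A' w = -s • w → A' (A₁ w) = -s • A₁ w := by
    intro s hs w hw hAw
    obtain ⟨a, ha, b, hb, hAa, hAb, hab, -⟩ := h.exists_eigen hB hσ hs (h₁.A_mem w)
    have h1 : ∀ y ∈ L.V₁, A' y = s • y → H y (A₁ w) = 0 := by
      intro y hy hAy
      have h2 := horth s hs y hy w hw hAy hAw
      have h3 := h₁.B_eq y hy (A₁ w) (h₁.A_mem w)
      rw [h₁.A_A hB hσ hw, h2, h.B_eq y hy _ (h₁.A_mem w), ← h.selfadj hB hσ hy (h₁.A_mem w), hAy,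
        h.herm.rsmul_left, mul_eq_zero, map_eq_zero] at h3
      refine h3.resolve_left fun h0 => ?_
      rw [h0] at hs
      norm_num at hs
    have h2 := h1 a ha hAa
    rw [hab, h.herm.add_right, h.eigen_orth hB hσ hs ha hb hAa hAb, add_zero] at h2
    rw [hab, h.eq_zero ha h2, zero_add, hAb]
  refine h.eq_of_comm h₁ (one_mul 1) (fun v hv => ?_) hx hy
  obtain ⟨a, ha, b, hb, hAa, hAb, hab, -⟩ := h.exists_eigen hB hσ (one_mul 1) hv
  have h1 := hstable (-1) (by norm_num) a ha (by rw [hAa, neg_neg])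
  have h2 := hstable 1 (by norm_num) b hb hAb
  rw [hab, map_add, map_add, map_add, map_add, h1, h2, hAa, hAb, map_smul, map_smul, neg_neg]

theorem HasAllFlips.rigid {R : Rep σ 1 Γ ad} (hσ : ∀ d, σ d = star d) (hQ : HasAllFlips Γ ad) :
    Rigid R (firstVectors D 3) where
  nonzero := ⟨Finsupp.single 0 1, mem_firstVectors (by norm_num), by simp⟩
  orth := by
    intro L L' hL hF H A' H₁ A₁ h h₁ θ θ₁ hθ hθ₁ hθθ x hx c hc _
    have hB := R.form
    have key : ∀ s : ℝ, s * s = 1 → ∀ x ∈ L.V₁, A' x = s • x → H₁ x c = 0 := by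
      intro s hs x hx hAx
      by_cases hx0 : x = 0
      · rw [hx0, h₁.herm.zero_left]
      obtain ⟨r, hr, hrx⟩ := h.exists_unit hx hx0
      obtain ⟨v, hv, hv0, hvx⟩ := exists_perp h.herm hF [r • x] (by simp)
      obtain ⟨z, hz, hAz, hzz, hzw⟩ := h.exists_unit_eigen hB hσ hs hv hv0
      have hAr : A' (r • x) = s • (r • x) := by rw [map_smul, hAx, smul_comm]
      have hrV := L.V₁.smul_of_tower_mem r hx
      have hs' : s = 1 ∨ s = -1 := mul_self_eq_one_iff.1 hs
      obtain ⟨g, hg, hgH, h1, -, -⟩ := hQ L H A' h _ hrV z hz hrx hzz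
        (h.herm.eq_zero_symm (hzw _ hrV (Or.inl hAr) (hvx _ (by simp))))
        (by rw [hAr]; rcases hs' with rfl | rfl <;> simp)
        (by rcases hs' with rfl | rfl <;> simpa [or_comm] using hAz)
      have h3 := h₁.herm.orth_of_neg (R.orth_of hL h₁ hθ hθ₁ hθθ hg hgH) h1
        ((R.ad_stab L g hg).2 c hc)
      rw [h₁.herm.rsmul_left, mul_eq_zero, map_eq_zero] at h3
      exact h3.resolve_left hr.ne'
    obtain ⟨a, ha, b, hb, hAa, hAb, hab, -⟩ := h.exists_eigen hB hσ (one_mul 1) hx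
    rw [hab, h₁.herm.add_left, key 1 (by norm_num) a ha hAa, key (-1) (by norm_num) b hb hAb,
      add_zero]
  unique := fun L hF H A' H₁ A₁ h h₁ hK => ⟨1, one_pos, fun x hx y hy => by
    rw [map_one, one_mul]
    exact HasFlips.unique R.form hσ (HasAllFlips.hasFlips hQ) hF h h₁ hK hx hy⟩

end SignRigid

/-! ### Rigidity for real forms with signs -/

section RealSign

variable {A : Type} [Group A] [TopologicalSpace A]
variable {B : V ℝ → V ℝ → ℝ} {Γ : Piece B → Subgroup A} {ad : A → (V ℝ ≃ₗ[ℝ] V ℝ)}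

theorem id_eq_star (d : ℝ) : id d = star d := by simp

/-- The groups contain a nontrivial boost in each plane spanned by vectors of opposite signs. -/
def HasBoosts (Γ : Piece B → Subgroup A) (ad : A → (V ℝ ≃ₗ[ℝ] V ℝ)) : Prop :=
  ∀ L H A', Adm B 1 L.V₁ L.C H A' → ∀ f ∈ L.V₁, ∀ e ∈ L.V₁, H f f = 1 → H e e = 1 →
    ∀ s : ℝ, s * s = 1 → A' f = s • f → A' e = -s • e →
      ∃ g ∈ Γ L, ad g f = (5 / 4 : ℝ) • f + (3 / 4 : ℝ) • e ∧
        ad g e = (3 / 4 : ℝ) • f + (5 / 4 : ℝ) • e ∧ ∀ v, H v f = 0 → H v e = 0 → ad g v = v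

theorem IsHerm.mul_right {M : Type} [AddCommGroup M] [Module ℝ M] {H : M → M → ℝ} (hH : IsHerm H)
    (d : ℝ) (x y : M) : H x (d • y) = d * H x y := by rw [hH.smul_right, star_trivial, mul_comm]

/-- Members of the stabilizer of `L` are determined by their values on `f`, `e` and the vectors
orthogonal to them. -/
theorem Adm.ext_plane {L : Piece B} {H : V ℝ → V ℝ → ℝ} {A' : V ℝ →ₗ[ℝ] V ℝ}
    (h : Adm B 1 L.V₁ L.C H A') {f e : V ℝ} (hf : f ∈ L.V₁) (he : e ∈ L.V₁)
    (hff : H f f = 1) (hee : H e e = 1) (hfe : H f e = 0) {g g' : V ℝ ≃ₗ[ℝ] V ℝ} (hg : g ∈ L.stab)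
    (hg' : g' ∈ L.stab) (h1 : g f = g' f) (h2 : g e = g' e)
    (h3 : ∀ v ∈ L.V₁, H v f = 0 → H v e = 0 → g v = g' v) : g = g' := by
  ext1 x
  obtain ⟨w, hw⟩ : ∃ w, w = L.proj x - H (L.proj x) f • f - H (L.proj x) e • e := ⟨_, rfl⟩
  have hwV : w ∈ L.V₁ := by
    rw [hw]
    exact L.V₁.sub_mem (L.V₁.sub_mem (L.proj_mem x) (L.V₁.smul_mem _ hf)) (L.V₁.smul_mem _ he)
  have e1 : x = H (L.proj x) f • f + H (L.proj x) e • e + w + (x - L.proj x) := by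
    rw [hw]; abel
  have hef := h.herm.eq_zero_symm hfe
  have hwf : H w f = 0 := by
    rw [hw, h.herm.sub_left, h.herm.sub_left, h.herm.smul_left, h.herm.smul_left, hff, hef]
    ring
  have hwe : H w e = 0 := by
    rw [hw, h.herm.sub_left, h.herm.sub_left, h.herm.smul_left, h.herm.smul_left, hee, hfe]
    ring
  rw [e1, map_add, map_add, map_add, map_smul, map_smul, map_add g', map_add g', map_add g',
    map_smul g', map_smul g', h1, h2, h3 w hwV hwf hwe, hg.2 _ (L.sub_proj_mem x),
    hg'.2 _ (L.sub_proj_mem x)]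

variable {R : Rep id 1 Γ ad}

/-- An involution fixing the stabilizer of `H` does not send a boost to a product of that boost
with a reflection that respects the plane of the boost. -/
theorem Rep.false_of_boost (hker : ∀ L, ∀ k ∈ Γ L, ad k = 1 → ∀ g ∈ Γ L, k * g = g * k)
    {L : Piece B} {H : V ℝ → V ℝ → ℝ} {A' : V ℝ →ₗ[ℝ] V ℝ} (h : Adm B 1 L.V₁ L.C H A')
    {θ : Γ L ≃* Γ L} (hθ : R.IsInvol L H θ) {f e : V ℝ} (hf : f ∈ L.V₁) (he : e ∈ L.V₁)
    (hff : H f f = 1) (hee : H e e = 1) (hfe : H f e = 0) (a : Γ L)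
    (haf : ad a f = (5 / 4 : ℝ) • f + (3 / 4 : ℝ) • e)
    (hae : ad a e = (3 / 4 : ℝ) • f + (5 / 4 : ℝ) • e)
    (hav : ∀ v, H v f = 0 → H v e = 0 → ad a v = v)
    (P : V ℝ ≃ₗ[ℝ] V ℝ) (hP : ∀ x, P (ad (θ a) x) = ad a x)
    (hPy : P (f + (1 / 3 : ℝ) • e) = f + (1 / 3 : ℝ) • e)
    (hPq : P (f + (3 : ℝ) • e) = f + (3 : ℝ) • e ∨ P (f + (3 : ℝ) • e) = -(f + (3 : ℝ) • e))
    (hPz : ∀ v ∈ L.V₁, H v f = 0 → H v e = 0 → P v = v ∨ P v = -v) : False := by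
  have hef := h.herm.eq_zero_symm hfe
  have hfix : ∀ k : Γ L, Pres H (ad k) → θ k = k := by
    intro k hk
    have : (k : A) ∈ fixedPoints θ := by
      rw [hθ.fixed]
      exact ⟨k.2, hk⟩
    obtain ⟨hk', h1⟩ := (mem_fixedPoints θ _).1 this
    exact h1
  have hfix' : ∀ k : Γ L, θ k = k → Pres H (ad k) := by
    intro k hk
    have : (k : A) ∈ fixedPoints θ := (mem_fixedPoints θ _).2 ⟨k.2, hk⟩
    rw [hθ.fixed] at this
    exact this.2
  have hone : ∀ k : Γ L, ad k = 1 → θ k = k := fun k hk => hfix k (by rw [hk]; exact fun _ _ => rfl)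
  have hmul : ∀ k k' : Γ L, ad (k * k' : Γ L) = ad k * ad k' := fun k k' =>
    R.ad_mul L k k.2 k' k'.2
  have hst : ∀ k : Γ L, ad k ∈ L.stab := fun k => R.ad_stab L k k.2
  have hu : ad (a * a : Γ L) f = (17 / 8 : ℝ) • f + (15 / 8 : ℝ) • e := by
    rw [hmul, LinearEquiv.mul_apply, haf, map_add, map_smul, map_smul, haf, hae]
    module
  have hu' : ad (a * a : Γ L) e = (15 / 8 : ℝ) • f + (17 / 8 : ℝ) • e := by
    rw [hmul, LinearEquiv.mul_apply, hae, map_add, map_smul, map_smul, haf, hae]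
    module
  have huv : ∀ v, H v f = 0 → H v e = 0 → ad (a * a : Γ L) v = v := by
    intro v h1 h2
    rw [hmul, LinearEquiv.mul_apply, hav v h1 h2, hav v h1 h2]
  have hbv : ∀ v ∈ L.V₁, H v f = 0 → H v e = 0 → ad (θ a * θ a : Γ L) v = v := by
    intro v hv h1 h2
    rw [hmul, LinearEquiv.mul_apply]
    have h3 := hP v
    rw [hav v h1 h2] at h3
    rcases hPz v hv h1 h2 with h4 | h4
    · have : ad (θ a) v = v := P.injective (by rw [h3, h4])
      rw [this, this]
    · have : ad (θ a) v = -v := P.injective (by rw [h3, map_neg, h4, neg_neg])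
      rw [this, map_neg, this, neg_neg]
  have ef : f = (9 / 8 : ℝ) • (f + (1 / 3 : ℝ) • e) - (1 / 8 : ℝ) • (f + (3 : ℝ) • e) := by module
  have ee : e = (3 / 8 : ℝ) • (f + (3 : ℝ) • e) - (3 / 8 : ℝ) • (f + (1 / 3 : ℝ) • e) := by module
  rcases hPq with hPq | hPq
  · have hPf : P f = f := by
      conv_lhs => rw [ef]
      rw [map_sub, map_smul, map_smul, hPy, hPq, ← ef]
    have hPe : P e = e := by
      conv_lhs => rw [ee]
      rw [map_sub, map_smul, map_smul, hPy, hPq, ← ee]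
    have hbf : ad (θ a) f = ad a f := P.injective (by
      rw [hP, haf, map_add, map_smul, map_smul, hPf, hPe])
    have hbe : ad (θ a) e = ad a e := P.injective (by
      rw [hP, hae, map_add, map_smul, map_smul, hPf, hPe])
    have hsq : ad (θ a * θ a : Γ L) = ad (a * a : Γ L) := by
      refine h.ext_plane hf he hff hee hfe (hst _) (hst _) ?_ ?_ fun v hv h1 h2 => ?_
      · rw [hu, hmul, LinearEquiv.mul_apply, hbf, haf, map_add, map_smul, map_smul, hbf, hbe, haf, hae]
        module
      · rw [hu', hmul, LinearEquiv.mul_apply, hbe, hae, map_add, map_smul, map_smul, hbf, hbe, haf, hae]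
        module
      · rw [hbv v hv h1 h2, huv v h1 h2]
    obtain ⟨u, hu0⟩ : ∃ u, u = a * a := ⟨_, rfl⟩
    obtain ⟨w, hw0⟩ : ∃ w, w = θ u := ⟨_, rfl⟩
    rw [← map_mul, ← hu0, ← hw0] at hsq
    rw [← hu0] at hu hu'
    obtain ⟨z, hz⟩ : ∃ z, z = w * u⁻¹ := ⟨_, rfl⟩
    have hz1 : ad z = 1 := by
      rw [hz, hmul, hsq, ← hmul, mul_inv_cancel]
      exact R.ad_one L
    have hzw : w = z * u := by rw [hz, inv_mul_cancel_right]
    have hzu : u = z * w := by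
      have := hθ.invol u
      rw [← hw0, hzw, map_mul, hone z hz1, ← hw0] at this
      exact this.symm
    have hzz : z * z = 1 := by
      have h1 : z * z * w = w := by rw [mul_assoc, ← hzu, ← hzw]
      exact mul_eq_right.1 h1
    have hcomm : ∀ k : Γ L, z * k = k * z := fun k => Subtype.ext (hker L z z.2 hz1 k k.2)
    have huu : θ (u * u) = u * u := by
      rw [map_mul, ← hw0, hzw, mul_assoc, ← mul_assoc u z u, ← hcomm u, mul_assoc, ← mul_assoc z z,
        hzz, one_mul]
    have hH := hfix' _ huu f f
    rw [hmul, LinearEquiv.mul_apply, hu, map_add, map_smul, map_smul, hu, hu', hff] at hH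
    simp only [h.herm.add_left, h.herm.add_right, h.herm.smul_left, h.herm.mul_right, smul_add, hff,
      hee, hfe, hef] at hH
    norm_num at hH
  · have hPf : P f = (5 / 4 : ℝ) • f + (3 / 4 : ℝ) • e := by
      conv_lhs => rw [ef]
      rw [map_sub, map_smul, map_smul, hPy, hPq]
      module
    have hPe : P e = (-3 / 4 : ℝ) • f + (-5 / 4 : ℝ) • e := by
      conv_lhs => rw [ee]
      rw [map_sub, map_smul, map_smul, hPy, hPq]
      module
    have hbf : ad (θ a) f = f := P.injective (by rw [hP, haf, hPf])
    have hbe : ad (θ a) e = -e := P.injective (by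
      rw [hP, hae, map_neg, hPe]
      module)
    have hsq : ad (θ (a * a)) = 1 := by
      rw [map_mul]
      refine h.ext_plane hf he hff hee hfe (hst _) (Subgroup.one_mem _) ?_ ?_ fun v hv h1 h2 => ?_
      · rw [hmul, LinearEquiv.mul_apply, hbf, hbf]; rfl
      · rw [hmul, LinearEquiv.mul_apply, hbe, map_neg, hbe, neg_neg]; rfl
      · rw [hbv v hv h1 h2]; rfl
    have h1 := hone _ hsq
    rw [hθ.invol] at h1
    have h2 : H (ad (a * a : Γ L) f) f = 1 := by rw [h1, hsq]; exact hff
    rw [hu, h.herm.add_left, h.herm.smul_left, h.herm.smul_left, hff, hef] at h2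
    norm_num at h2

end RealSign

section RealSign

variable {A : Type} [Group A] [TopologicalSpace A]
variable {B : V ℝ → V ℝ → ℝ} {Γ : Piece B → Subgroup A} {ad : A → (V ℝ ≃ₗ[ℝ] V ℝ)}

section Eigen

variable {U C : Submodule ℝ (V ℝ)} {H : V ℝ → V ℝ → ℝ} {A' : V ℝ →ₗ[ℝ] V ℝ}
variable (hB : IsForm B id 1) (h : Adm B 1 U C H A') {s : ℝ} (hs : s * s = 1)
include hB h

theorem Adm.B_symm {x y : V ℝ} : B x y = B y x := by
  rw [hB.symm_star id_eq_star y x, star_trivial, map_one, one_mul]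

theorem Adm.B_eigen {t : ℝ} {z w : V ℝ} (hz : z ∈ U) (hw : w ∈ U) (hAw : A' w = t • w) :
    B z w = t * H z w := by
  rw [h.B_eq z hz w hw, hAw, h.herm.mul_right]

include hs

/-- If `f` spans an eigenspace, its orthogonal complement is the other eigenspace. -/
theorem Adm.neg_eigen {f : V ℝ} (hf : f ∈ U) (hAf : A' f = s • f)
    (hno : ¬∃ z ∈ U, A' z = s • z ∧ H z z = 1 ∧ H z f = 0) {z : V ℝ} (hz : z ∈ U)
    (hzf : H z f = 0) : A' z = -s • z := by
  obtain ⟨x, hx, y, hy, hAx, hAy, hxy, hw⟩ := h.exists_eigen hB id_eq_star hs hz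
  by_cases hx0 : x = 0
  · rw [hxy, hx0, zero_add, hAy]
  · obtain ⟨r, hr, hr1⟩ := h.exists_unit hx hx0
    refine absurd ⟨r • x, U.smul_mem r hx, by rw [map_smul, hAx, smul_comm], hr1, ?_⟩ hno
    rw [h.herm.smul_left, (hw f hf (Or.inl hAf) hzf).1, mul_zero]

/-- If `f` spans an eigenspace, then `B` determines `H`. -/
theorem Adm.H_eq {f : V ℝ} (hf : f ∈ U) (hAf : A' f = s • f) (hff : H f f = 1)
    (hneg : ∀ z ∈ U, H z f = 0 → A' z = -s • z) {x y : V ℝ} (hx : x ∈ U) (hy : y ∈ U) :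
    H x y = -s * B x y + 2 * (B x f * B y f) := by
  have hn : y - H y f • f ∈ U := U.sub_mem hy (U.smul_mem _ hf)
  have h1 := hneg _ hn (by rw [h.herm.sub_left, h.herm.smul_left, hff, mul_one, sub_self])
  have h2 : A' y = -s • y + (2 * s * H y f) • f := by
    have : y = (y - H y f • f) + H y f • f := by abel
    conv_lhs => rw [this]
    rw [map_add, h1, map_smul, hAf]
    module
  rw [h.B_eq x hx y hy, h2, h.herm.add_right, h.herm.mul_right, h.herm.mul_right,
    h.B_eigen hB hx hf hAf, h.B_eigen hB hy hf hAf]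
  linear_combination -(H x y + 2 * H y f * H x f - 2 * H x f * H y f - 0) * hs + 0 * hs

end Eigen

variable {R : Rep id 1 Γ ad}

theorem HasFlips.orth_eigen (hQ : HasFlips Γ ad) {L L' : Piece B} (hL : L.Le L')
    {H H₁ : V ℝ → V ℝ → ℝ} {A' A₁ : V ℝ →ₗ[ℝ] V ℝ}
    (h : Adm B 1 L.V₁ L.C H A') (h₁ : Adm B 1 L'.V₁ L'.C H₁ A₁)
    {θ : Γ L ≃* Γ L} {θ₁ : Γ L' ≃* Γ L'}
    (hθ : R.IsInvol L H θ) (hθ₁ : R.IsInvol L' H₁ θ₁)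
    (hθθ : ∀ (g : Γ L) (h : Γ L'), (h : A) = g → (θ₁ h : A) = θ g) {s : ℝ} (hs : s * s = 1)
    {x z w : V ℝ} (hx : x ∈ L.V₁) (hz : z ∈ L.V₁) (hz0 : z ≠ 0) (hzx : H z x = 0)
    (hAx : A' x = s • x) (hAz : A' z = s • z) (hw : w ∈ L.C ∨ H w x = 0 ∧ H w z = 0) :
    H₁ x w = 0 := by
  by_cases hx0 : x = 0
  · rw [hx0, h₁.herm.zero_left]
  obtain ⟨r, hr, hrx⟩ := h.exists_unit hx hx0
  obtain ⟨t, ht, htz⟩ := h.exists_unit hz hz0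
  obtain ⟨g, hg, hgH, h1, h2, h3⟩ := hQ L H A' h _ (L.V₁.smul_mem r hx) _ (L.V₁.smul_mem t hz)
    hrx htz (by rw [h.herm.smul_left, h.herm.mul_right, h.herm.eq_zero_symm hzx, mul_zero, mul_zero])
    s hs (by rw [map_smul, hAx, smul_comm]) (by rw [map_smul, hAz, smul_comm])
  have h4 := h₁.herm.orth_of_neg (R.orth_of hL h₁ hθ hθ₁ hθθ hg hgH) h1 (c := w) (by
    rcases hw with hw | ⟨hw, hw'⟩
    · exact (R.ad_stab L g hg).2 w hw
    · exact h3 w (by rw [h.herm.mul_right, hw, mul_zero]) (by rw [h.herm.mul_right, hw', mul_zero]))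
  rw [h₁.herm.smul_left] at h4
  exact (mul_eq_zero.1 h4).resolve_left hr.ne'

/-- On the larger eigenspace both forms agree. -/
theorem HasFlips.eigen_of_unique (hQ : HasFlips Γ ad) {L L' : Piece B} (hL : L.Le L')
    (hF : ∀ x ∈ firstVectors ℝ 4, x ∈ L.V₁)
    {H H₁ : V ℝ → V ℝ → ℝ} {A' A₁ : V ℝ →ₗ[ℝ] V ℝ}
    (h : Adm B 1 L.V₁ L.C H A') (h₁ : Adm B 1 L'.V₁ L'.C H₁ A₁)
    {θ : Γ L ≃* Γ L} {θ₁ : Γ L' ≃* Γ L'}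
    (hθ : R.IsInvol L H θ) (hθ₁ : R.IsInvol L' H₁ θ₁)
    (hθθ : ∀ (g : Γ L) (h : Γ L'), (h : A) = g → (θ₁ h : A) = θ g) {s : ℝ} (hs : s * s = 1)
    {f : V ℝ} (hf : f ∈ L.V₁) (hAf : A' f = s • f) (hff : H f f = 1)
    (hneg : ∀ z ∈ L.V₁, H z f = 0 → A' z = -s • z) {x : V ℝ} (hx : x ∈ L.V₁) (hxf : H x f = 0) :
    A₁ x = -s • x ∧ H₁ x x = H x x := by
  have hB := R.form
  have hs' : -s * -s = 1 := by rw [neg_mul_neg, hs]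
  have horth : ∀ x ∈ L.V₁, H x f = 0 → ∀ w, (w ∈ L.C ∨ w ∈ L.V₁ ∧ H w x = 0) → H₁ x w = 0 := by
    intro x hx hxf w hw
    have hlen : ([f, x, L.proj w] : List (V ℝ)).length < 4 := by simp
    obtain ⟨z, hz, hz0, hzz⟩ := exists_perp h.herm hF [f, x, L.proj w] hlen
    refine hQ.orth_eigen hL h h₁ hθ hθ₁ hθθ hs' hx hz hz0 (hzz x (by simp)) (hneg x hx hxf)
      (hneg z hz (hzz f (by simp))) (hw.imp id fun hw => ⟨hw.2, ?_⟩)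
    have := hzz (L.proj w) (by simp)
    rw [L.proj_of_mem hw.1] at this
    exact h.herm.eq_zero_symm this
  obtain ⟨S, hS⟩ : ∃ S : Submodule ℝ (V ℝ), ∀ x, x ∈ S ↔ x ∈ L.V₁ ∧ H x f = 0 :=
    ⟨L.V₁ ⊓ LinearMap.ker (h.herm.lin f h.herm), fun x => by
      rw [Submodule.mem_inf, LinearMap.mem_ker]; rfl⟩
  obtain ⟨e, he, he0, hef⟩ := exists_perp h.herm hF [f] (by simp)
  have hscal : ∃ c : ℝ, 0 < c ∧ ∀ x ∈ S, ∀ y ∈ S, H₁ x y = oR ℝ c * H x y :=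
    h.exists_scalar h₁ S (fun x hx => ((hS x).1 hx).1) (fun x hx => hL.1 ((hS x).1 hx).1)
      (fun x _ y hy => S.smul_mem _ hy) ⟨e, (hS e).2 ⟨he, hef f (by simp)⟩, he0⟩
      fun x hx y hy hxy => horth x ((hS x).1 hx).1 ((hS x).1 hx).2 y
        (Or.inr ⟨((hS y).1 hy).1, h.herm.eq_zero_symm hxy⟩)
  obtain ⟨c, hc, hcH⟩ := hscal
  have hA : ∀ x ∈ S, A₁ x = (-s * c⁻¹) • x := by
    intro x hxS
    obtain ⟨hx, hxf⟩ := (hS x).1 hxS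
    refine h₁.eq_of_H (h₁.A_mem x) (L'.V₁.smul_mem _ (hL.1 hx)) fun z hz => ?_
    rw [← h₁.B_eq z hz x (hL.1 hx), h₁.herm.mul_right]
    obtain ⟨n, hn⟩ : ∃ n, n = L.proj z - H (L.proj z) f • f := ⟨_, rfl⟩
    have hnV : n ∈ L.V₁ := by
      rw [hn]; exact L.V₁.sub_mem (L.proj_mem z) (L.V₁.smul_mem _ hf)
    have hnf : H n f = 0 := by
      rw [hn, h.herm.sub_left, h.herm.smul_left, hff, mul_one, sub_self]
    have hz' : z = H (L.proj z) f • f + n + (z - L.proj z) := by rw [hn]; abel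
    have hfx : H f x = 0 := h.herm.eq_zero_symm hxf
    have e1 : H₁ z x = c * H n x := by
      rw [hz', h₁.herm.add_left, h₁.herm.add_left, h₁.herm.smul_left,
        h₁.herm.eq_zero_symm (horth x hx hxf f (Or.inr ⟨hf, hfx⟩)),
        h₁.herm.eq_zero_symm (horth x hx hxf _ (Or.inl (L.sub_proj_mem z))),
        hcH n ((hS n).2 ⟨hnV, hnf⟩) x hxS, Algebra.algebraMap_self_apply]
      ring
    have e2 : B z x = -s * H n x := by
      rw [hz', hB.add_left, hB.add_left, hB.smul_left, h.B_eigen hB hf hx (hneg x hx hxf), hfx,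
        h.B_eigen hB hnV hx (hneg x hx hxf), hB.refl (L.orth x hx _ (L.sub_proj_mem z))]
      ring
    rw [e1, e2]
    field_simp
  have hc1 : c = 1 := by
    have heS := (hS e).2 ⟨he, hef f (by simp)⟩
    have h1 := h₁.A_A hB id_eq_star (hL.1 he)
    rw [hA e heS, map_smul, hA e heS, smul_smul] at h1
    have h2 : (-s * c⁻¹ * (-s * c⁻¹) - 1) • e = 0 := by rw [sub_smul, h1, one_smul, sub_self]
    have h3 := (smul_eq_zero.1 h2).resolve_right he0
    have h4 : c⁻¹ * c⁻¹ = 1 := by linear_combination h3 - c⁻¹ * c⁻¹ * hs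
    have h5 : 0 < c⁻¹ := inv_pos.2 hc
    have h6 : c⁻¹ = 1 := by nlinarith
    rw [← inv_inv c, h6, inv_one]
  have hxS := (hS x).2 ⟨hx, hxf⟩
  rw [hA x hxS, hcH x hxS x hxS, hc1]
  simp

/-- The exceptional case: an eigenspace of dimension one stays orthogonal to `C`. -/
theorem HasFlips.orth_exceptional (hQ : HasFlips Γ ad) (hb : HasBoosts Γ ad)
    (hker : ∀ L, ∀ k ∈ Γ L, ad k = 1 → ∀ g ∈ Γ L, k * g = g * k) {L L' : Piece B} (hL : L.Le L')
    (hF : ∀ x ∈ firstVectors ℝ 4, x ∈ L.V₁)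
    {H H₁ : V ℝ → V ℝ → ℝ} {A' A₁ : V ℝ →ₗ[ℝ] V ℝ}
    (h : Adm B 1 L.V₁ L.C H A') (h₁ : Adm B 1 L'.V₁ L'.C H₁ A₁)
    {θ : Γ L ≃* Γ L} {θ₁ : Γ L' ≃* Γ L'}
    (hθ : R.IsInvol L H θ) (hθ₁ : R.IsInvol L' H₁ θ₁)
    (hθθ : ∀ (g : Γ L) (h : Γ L'), (h : A) = g → (θ₁ h : A) = θ g) {s : ℝ} (hs : s * s = 1)
    {f : V ℝ} (hf : f ∈ L.V₁) (hAf : A' f = s • f) (hff : H f f = 1)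
    (hno : ¬∃ z ∈ L.V₁, A' z = s • z ∧ H z z = 1 ∧ H z f = 0)
    (hno₁ : ¬∃ x ∈ L'.V₁, ∃ y ∈ L'.V₁, H₁ x x = 1 ∧ H₁ y y = 1 ∧ H₁ x y = 0 ∧
      A₁ x = s • x ∧ A₁ y = s • y) {c : V ℝ} (hc : c ∈ L.C) (hcV : c ∈ L'.V₁) : H₁ f c = 0 := by
  have hB := R.form
  have hs0 : s ≠ 0 := fun h0 => by rw [h0] at hs; norm_num at hs
  have hs' : -s * -s = 1 := by rw [neg_mul_neg, hs]
  have hneg : ∀ z ∈ L.V₁, H z f = 0 → A' z = -s • z := fun z hz hzf =>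
    h.neg_eigen hB hs hf hAf hno hz hzf
  have hN : ∀ z ∈ L.V₁, H z f = 0 → A₁ z = -s • z ∧ H₁ z z = H z z := fun z hz hzf =>
    hQ.eigen_of_unique hL hF h h₁ hθ hθ₁ hθθ hs hf hAf hff hneg hz hzf
  have hBff : B f f = s := by rw [h.B_eigen hB hf hf hAf, hff, mul_one]
  have hf0 : f ≠ 0 := fun h0 => by rw [h0, h.herm.zero_left] at hff; norm_num at hff
  have hfneg : A₁ f ≠ -s • f := by
    intro h0
    have h1 := h₁.B_eigen hB (hL.1 hf) (hL.1 hf) h0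
    have h2 := h₁.pos f (hL.1 hf) hf0
    rw [hBff] at h1
    have h3 : H₁ f f = -1 := by linear_combination s * h1 - (H₁ f f + 1) * hs
    rw [h3, map_neg, re_one] at h2
    norm_num at h2
  obtain ⟨f', hf'V, hAf', hf'1⟩ : ∃ f' ∈ L'.V₁, A₁ f' = s • f' ∧ H₁ f' f' = 1 := by
    obtain ⟨a, ha, b, hb, hAa, hAb, hab, -⟩ := h₁.exists_eigen hB id_eq_star hs (hL.1 hf)
    have ha0 : a ≠ 0 := fun h0 => hfneg (by rw [hab, h0, zero_add, hAb])
    obtain ⟨r, hr, hr1⟩ := h₁.exists_unit ha ha0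
    exact ⟨r • a, L'.V₁.smul_mem r ha, by rw [map_smul, hAa, smul_comm], hr1⟩
  have hneg₁ : ∀ z ∈ L'.V₁, B z f' = 0 → A₁ z = -s • z := fun z hz hzf =>
    h₁.neg_eigen hB hs hf'V hAf' (fun ⟨w, hw, hAw, hww, hwf⟩ =>
      hno₁ ⟨w, hw, f', hf'V, hww, hf'1, hwf, hAw, hAf'⟩) hz (by
        rw [h₁.B_eigen hB hz hf'V hAf'] at hzf
        exact (mul_eq_zero.1 hzf).resolve_left hs0)
  have hBneg : ∀ z ∈ L'.V₁, A₁ z = -s • z → B z f' = 0 := fun z hz hAz => by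
    rw [h₁.B_eigen hB hz hf'V hAf', h₁.herm.eq_zero_symm
      (h₁.eigen_orth hB id_eq_star hs hf'V hz hAf' hAz), mul_zero]
  have hBC : ∀ x ∈ L.C, ∀ y ∈ L.V₁, B x y = 0 := fun x hx y hy => hB.refl (L.orth y hy x hx)
  -- the new eigenvector
  obtain ⟨α, c', hc'C, hc'V, hfα⟩ : ∃ (α : ℝ) (c' : V ℝ), c' ∈ L.C ∧ c' ∈ L'.V₁ ∧
      f' = α • f + c' := by
    obtain ⟨v, hv⟩ : ∃ v, v = L.proj f' - H (L.proj f') f • f := ⟨_, rfl⟩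
    have hvV : v ∈ L.V₁ := by rw [hv]; exact L.V₁.sub_mem (L.proj_mem _) (L.V₁.smul_mem _ hf)
    have hvf : H v f = 0 := by rw [hv, h.herm.sub_left, h.herm.smul_left, hff, mul_one, sub_self]
    have hf'v : f' = H (L.proj f') f • f + v + (f' - L.proj f') := by rw [hv]; abel
    have h1 := hBneg v (hL.1 hvV) (hN v hvV hvf).1
    rw [h.B_symm hB, hf'v, hB.add_left, hB.add_left, hB.smul_left, hBC _ (L.sub_proj_mem _) v hvV,
      h.B_eigen hB hf hvV (hneg v hvV hvf), h.B_eigen hB hvV hvV (hneg v hvV hvf),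
      h.herm.eq_zero_symm hvf] at h1
    have h2 : H v v = 0 := by
      have : -s * H v v = 0 := by linear_combination h1
      exact (mul_eq_zero.1 this).resolve_left (neg_ne_zero.2 hs0)
    have hv0 := h.eq_zero hvV h2
    refine ⟨H (L.proj f') f, f' - L.proj f', L.sub_proj_mem _, L'.V₁.sub_mem hf'V (hL.1 (L.proj_mem _)), ?_⟩
    rw [hv0, add_zero] at hf'v
    exact hf'v
  by_cases hc'0 : c' = 0
  · rw [hc'0, add_zero] at hfα
    have hα0 : α ≠ 0 := by
      rintro rfl
      rw [hfα, zero_smul, h₁.herm.zero_left] at hf'1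
      norm_num at hf'1
    have h1 := h₁.B_eigen hB hcV hf'V hAf'
    rw [hfα, h₁.herm.mul_right, h.B_symm hB, hB.smul_left, L.orth f hf c hc, mul_zero] at h1
    have h2 := (mul_eq_zero.1 ((mul_eq_zero.1 h1.symm).resolve_left hs0)).resolve_left hα0
    exact h₁.herm.eq_zero_symm h2
  exfalso
  obtain ⟨γ, hγ⟩ : ∃ γ, γ = B c' c' := ⟨_, rfl⟩
  have hBc'f' : B c' f' = γ := by
    rw [hfα, hB.add_right, hB.smul_right, hBC c' hc'C f hf, zero_mul, zero_add, hγ]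
  have hγ0 : γ ≠ 0 := by
    intro h0
    rw [h0] at hBc'f'
    have h1 := h₁.B_eigen hB hc'V hc'V (hneg₁ c' hc'V hBc'f')
    rw [← hγ, h0] at h1
    exact hc'0 (h₁.eq_zero hc'V ((mul_eq_zero.1 h1.symm).resolve_left (neg_ne_zero.2 hs0)))
  have hα0 : α ≠ 0 := by
    rintro rfl
    refine hfneg (hneg₁ f (hL.1 hf) ?_)
    rw [hfα, zero_smul, zero_add, L.orth f hf c' hc'C]
  obtain ⟨e₀, he₀, he₀0, he₀f⟩ := exists_perp h.herm hF [f] (by simp)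
  obtain ⟨ρ, hρ, hee⟩ := h.exists_unit he₀ he₀0
  obtain ⟨e, he_def⟩ : ∃ e, e = ρ • e₀ := ⟨_, rfl⟩
  rw [← he_def] at hee
  have he : e ∈ L.V₁ := by rw [he_def]; exact L.V₁.smul_mem _ he₀
  have hef : H e f = 0 := by rw [he_def, h.herm.smul_left, he₀f f (by simp), mul_zero]
  have hfe := h.herm.eq_zero_symm hef
  have hAe := hneg e he hef
  obtain ⟨g, hg, hgf, hge, hgv⟩ := hb L H A' h f hf e he hff hee s hs hAf hAe
  obtain ⟨a, ha⟩ : ∃ a : Γ L, a = ⟨g, hg⟩ := ⟨_, rfl⟩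
  have hag : (a : A) = g := by rw [ha]
  obtain ⟨P, hPdef⟩ : ∃ P, P = ad g * (ad (θ a))⁻¹ := ⟨_, rfl⟩
  have hP : ∀ x, P (ad (θ a) x) = ad g x := fun x => by
    rw [hPdef]
    change ad g ((ad (θ a)).symm (ad (θ a) x)) = _
    rw [LinearEquiv.symm_apply_apply]
  have hPst : P ∈ L.stab := by
    rw [hPdef]
    exact L.stab.mul_mem (R.ad_stab L g hg) (L.stab.inv_mem (R.ad_stab L _ (θ a).2))
  have hPB : ∀ x y, B (P x) (P y) = B x y := by
    have h1 : Pres B (ad g) := R.ad_B L g hg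
    have h2 : Pres B (ad (θ a)) := R.ad_B L _ (θ a).2
    rw [hPdef]
    exact h1.mul h2.inv
  have hPV : ∀ x ∈ L.V₁, P x ∈ L.V₁ := fun x hx => (L.stab_iff P x hPst).1 hx
  have hstar : ∀ k : Γ L', ad k f' = f' → θ₁ k = k := by
    intro k hk
    have hpres : Pres H₁ (ad k) := by
      have hst := R.ad_stab L' k k.2
      refine h₁.pres_of hst fun x hx y hy => ?_
      have hB' := R.ad_B L' k k.2
      have hneg' : ∀ z ∈ L'.V₁, H₁ z f' = 0 → A₁ z = -s • z := fun z hz hzf => hneg₁ z hz (by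
        rw [h₁.B_eigen hB hz hf'V hAf', hzf, mul_zero])
      rw [h₁.H_eq hB hs hf'V hAf' hf'1 hneg' ((L'.stab_iff _ _ hst).1 hx)
        ((L'.stab_iff _ _ hst).1 hy), h₁.H_eq hB hs hf'V hAf' hf'1 hneg' hx hy]
      have e1 : ∀ w, B (ad k w) f' = B w f' := fun w => by
        conv_lhs => rw [← hk]
        exact hB' w f'
      rw [hB', e1, e1]
    have : (k : A) ∈ fixedPoints θ₁ := by
      rw [hθ₁.fixed]
      exact ⟨k.2, hpres⟩
    obtain ⟨_, h1⟩ := (mem_fixedPoints θ₁ _).1 this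
    exact h1
  obtain ⟨y, hy⟩ : ∃ y, y = γ • (f + (1 / 3 : ℝ) • e) - (s * α) • c' := ⟨_, rfl⟩
  have hfeV : f + (1 / 3 : ℝ) • e ∈ L.V₁ := L.V₁.add_mem hf (L.V₁.smul_mem _ he)
  have hyV : y ∈ L'.V₁ := by
    rw [hy]
    exact L'.V₁.sub_mem (L'.V₁.smul_mem _ (hL.1 hfeV)) (L'.V₁.smul_mem _ hc'V)
  have hBef : B e f = 0 := by rw [h.B_eigen hB he hf hAf, hef, mul_zero]
  have hBfe : B f e = 0 := hB.refl hBef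
  have hBee : B e e = -s := by rw [h.B_eigen hB he he hAe, hee, mul_one]
  have hBfc : B f c' = 0 := L.orth f hf c' hc'C
  have hBec : B e c' = 0 := L.orth e he c' hc'C
  have hsubl : ∀ x y z, B (x - y) z = B x z - B y z := fun x y z => by
    have := hB.add_left (x - y) y z
    rw [sub_add_cancel] at this
    linarith
  have hsr : ∀ (d : ℝ) x y, B x (d • y) = d * B x y := fun d x y => by
    rw [hB.smul_right, id, mul_comm]
  have hByf' : B y f' = 0 := by
    rw [hy, hfα]
    simp only [hsubl, hB.add_left, hB.smul_left, hB.add_right, hsr, hBef, hBfe, hBff, hBee, hBfc,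
      hBec, hB.refl hBfc, hB.refl hBec, ← hγ]
    ring
  have hgf' : ad g f' = α • ((5 / 4 : ℝ) • f + (3 / 4 : ℝ) • e) + c' := by
    rw [hfα, map_add, map_smul, hgf, (R.ad_stab L g hg).2 c' hc'C]
  have hByg : B y (ad g f') = 0 := by
    rw [hgf', hy]
    simp only [hsubl, hB.add_left, hB.smul_left, hB.add_right, hsr, hBef, hBfe, hBff, hBee, hBfc,
      hBec, hB.refl hBfc, hB.refl hBec, ← hγ]
    ring
  have hAy := hneg₁ y hyV hByf'
  have hH₁ : ∀ w ∈ L'.V₁, ∀ x ∈ L'.V₁, A₁ x = -s • x → B x w = 0 → H₁ w x = 0 := by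
    intro w hw x hx hAx h0
    have h1 := h₁.B_eigen hB hw hx hAx
    rw [h.B_symm hB, h0] at h1
    exact (mul_eq_zero.1 h1.symm).resolve_left (neg_ne_zero.2 hs0)
  have hC0 : ∀ x ∈ L.V₁, ∀ t : ℝ, x = t • c' → t = 0 := by
    intro x hx t hxt
    by_contra ht
    refine hc'0 ?_
    have h1 : c' ∈ L.V₁ := by
      have := L.V₁.smul_mem t⁻¹ hx
      rwa [hxt, smul_smul, inv_mul_cancel₀ ht, one_smul] at this
    exact Submodule.disjoint_def.1 L.isCompl.disjoint c' h1 hc'C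
  have hy0 : y ≠ 0 := by
    intro h0
    have h1 := hC0 _ (L.V₁.smul_mem γ hfeV) (s * α) (by rw [← sub_eq_zero, ← hy, h0])
    exact mul_ne_zero hs0 hα0 h1
  obtain ⟨t, ht, hyy⟩ := h₁.exists_unit hyV hy0
  have key : ∀ z ∈ L.V₁, H z f = 0 → H z e = 0 → H z z = 1 →
      (P z = z ∨ P z = -z) ∧ P (f + (1 / 3 : ℝ) • e) = f + (1 / 3 : ℝ) • e := by
    intro z hz hzf hze hzz
    obtain ⟨hAz, hzz'⟩ := hN z hz hzf
    rw [hzz] at hzz'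
    have hAz' := hneg z hz hzf
    have hBfz : B f z = 0 := by
      rw [h.B_eigen hB hf hz hAz', h.herm.eq_zero_symm hzf, mul_zero]
    have hBez : B e z = 0 := by
      rw [h.B_eigen hB he hz hAz', h.herm.eq_zero_symm hze, mul_zero]
    have hBcz : B c' z = 0 := hBC c' hc'C z hz
    have hBzz : B z z = -s := by rw [h.B_eigen hB hz hz hAz', hzz, mul_one]
    have hByz : B y z = 0 := by
      rw [hy]
      simp only [hsubl, hB.add_left, hB.smul_left, hBfz, hBez, hBcz]
      ring
    have hyz : H₁ y z = 0 := hH₁ y hyV z (hL.1 hz) hAz (hB.refl hByz)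
    obtain ⟨r, hr, hrH, hry, hrz, hrv⟩ := hQ L' H₁ A₁ h₁ _ (L'.V₁.smul_mem t hyV) z (hL.1 hz) hyy
      hzz' (by rw [h₁.herm.smul_left, hyz, mul_zero]) (-s) hs' (by rw [map_smul, hAy, smul_comm]) hAz
    have hry' : ad r y = -y := by
      rw [map_smul, ← smul_neg] at hry
      exact smul_right_injective _ ht.ne' hry
    have hrv' : ∀ v, H₁ v y = 0 → H₁ v z = 0 → ad r v = v := fun v h1 h2 =>
      hrv v (by rw [h₁.herm.mul_right, h1, mul_zero]) h2
    have hgL' : g ∈ Γ L' := R.mono L L' hL hg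
    have hθL' : (θ a : A) ∈ Γ L' := R.mono L L' hL (θ a).2
    have hgV : ad g f' ∈ L'.V₁ := (L'.stab_iff _ _ (R.ad_stab L' g hgL')).1 hf'V
    have hrg : ad r (ad g f') = ad g f' := by
      refine hrv' _ (hH₁ _ hgV y hyV hAy hByg) (hH₁ _ hgV z (hL.1 hz) hAz (hB.refl ?_))
      rw [hgf']
      simp only [hB.add_left, hB.smul_left, hBfz, hBez, hBcz]
      ring
    have hrr : θ₁ ⟨r, hr⟩ = ⟨r, hr⟩ := by
      refine hstar _ (hrv' _ (hH₁ _ hf'V y hyV hAy hByf') (hH₁ _ hf'V z (hL.1 hz) hAz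
        (hBneg z (hL.1 hz) hAz)))
    have hk := hstar (⟨g, hgL'⟩⁻¹ * ⟨r, hr⟩ * ⟨g, hgL'⟩) (by
      change ad (g⁻¹ * r * g) f' = f'
      rw [R.ad_mul L' _ ((Γ L').mul_mem ((Γ L').inv_mem hgL') hr) _ hgL',
        R.ad_mul L' _ ((Γ L').inv_mem hgL') _ hr, R.ad_inv L' hgL']
      change (ad g).symm (ad r (ad g f')) = f'
      rw [hrg, LinearEquiv.symm_apply_apply])
    have hθg : θ₁ ⟨g, hgL'⟩ = ⟨θ a, hθL'⟩ := Subtype.ext (hθθ a ⟨g, hgL'⟩ hag.symm)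
    rw [map_mul, map_mul, map_inv, hrr, hθg] at hk
    have hcomm : ∀ x, ad r (P x) = P (ad r x) := by
      have h1 : (θ a : A)⁻¹ * r * θ a = g⁻¹ * r * g := congrArg Subtype.val hk
      have h2 : r * (g * (θ a : A)⁻¹) = g * (θ a : A)⁻¹ * r := by
        calc r * (g * (θ a : A)⁻¹) = g * (g⁻¹ * r * g) * (θ a : A)⁻¹ := by group
          _ = g * (θ a : A)⁻¹ * r := by rw [← h1]; group
      have hinv := (Γ L').inv_mem hθL'
      have hpm := (Γ L').mul_mem hgL' hinv
      have h3 : ad (g * (θ a : A)⁻¹) = P := by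
        rw [R.ad_mul L' _ hgL' _ hinv, R.ad_inv L' hθL', hPdef]
      have h4 : ad r * P = P * ad r := by
        rw [← h3, ← R.ad_mul L' _ hr _ hpm, h2, R.ad_mul L' _ hpm _ hr]
      exact fun x => LinearEquiv.congr_fun h4 x
    have hspan : ∀ w, ad r w = -w → ∃ μ ν : ℝ, w = μ • y + ν • z := by
      intro w hw
      obtain ⟨n, hn⟩ : ∃ n, n = w - H₁ w (t • y) • (t • y) - H₁ w z • z := ⟨_, rfl⟩
      have hyz' : H₁ (t • y) z = 0 := by rw [h₁.herm.smul_left, hyz, mul_zero]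
      have h1 : ad r n = n := by
        refine hrv n ?_ ?_
        · rw [hn, h₁.herm.sub_left, h₁.herm.sub_left, h₁.herm.smul_left, hyy, h₁.herm.smul_left,
            h₁.herm.eq_zero_symm hyz']
          ring
        · rw [hn, h₁.herm.sub_left, h₁.herm.sub_left, h₁.herm.smul_left, hyz', h₁.herm.smul_left,
            hzz']
          ring
      have h2 : ad r n = -n := by
        rw [hn, map_sub, map_sub, hw, map_smul, map_smul, map_smul, hry', hrz]
        module
      have h3 : n = 0 := eq_zero_of_eq_neg (h1.symm.trans h2)
      refine ⟨H₁ w (t • y) * t, H₁ w z, ?_⟩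
      rw [h3] at hn
      rw [← smul_smul]
      have h4 := hn.symm
      rw [sub_sub, sub_eq_zero] at h4
      exact h4
    obtain ⟨μ, ν, hμν⟩ := hspan (P z) (by rw [hcomm, hrz, map_neg])
    have hμ : μ = 0 := by
      have h1 := hC0 (μ • (γ • (f + (1 / 3 : ℝ) • e)) + ν • z - P z)
        (L.V₁.sub_mem (L.V₁.add_mem (L.V₁.smul_mem _ (L.V₁.smul_mem _ hfeV)) (L.V₁.smul_mem _ hz))
          (hPV z hz)) (μ * (s * α)) (by rw [hμν, hy]; module)
      exact (mul_eq_zero.1 h1).resolve_right (mul_ne_zero hs0 hα0)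
    rw [hμ, zero_smul, zero_add] at hμν
    have hν : ν * ν = 1 := by
      have h1 := hPB z z
      rw [hμν, hB.smul_left, hsr, hBzz] at h1
      have h2 : (ν * ν - 1) * s = 0 := by linear_combination -h1
      linarith [(mul_eq_zero.1 h2).resolve_right hs0]
    obtain ⟨μ', ν', hμν'⟩ := hspan (P y) (by rw [hcomm, hry', map_neg])
    have hPc : P c' = c' := hPst.2 c' hc'C
    have hPy : P y = γ • P (f + (1 / 3 : ℝ) • e) - (s * α) • c' := by
      rw [hy, map_sub, map_smul, map_smul, hPc]
    have hμ' : μ' = 1 := by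
      have h1 := hC0 (γ • P (f + (1 / 3 : ℝ) • e) - μ' • (γ • (f + (1 / 3 : ℝ) • e)) - ν' • z)
        (L.V₁.sub_mem (L.V₁.sub_mem (L.V₁.smul_mem _ (hPV _ hfeV)) (L.V₁.smul_mem _
          (L.V₁.smul_mem _ hfeV))) (L.V₁.smul_mem _ hz)) ((1 - μ') * (s * α)) (by
            have h2 : γ • P (f + (1 / 3 : ℝ) • e) = μ' • y + ν' • z + (s * α) • c' := by
              rw [← hμν', hPy]; abel
            rw [h2, hy]
            module)
      linarith [(mul_eq_zero.1 h1).resolve_right (mul_ne_zero hs0 hα0)]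
    have hPu : γ • P (f + (1 / 3 : ℝ) • e) = γ • (f + (1 / 3 : ℝ) • e) + ν' • z := by
      have h2 : γ • P (f + (1 / 3 : ℝ) • e) = μ' • y + ν' • z + (s * α) • c' := by
        rw [← hμν', hPy]; abel
      rw [h2, hμ', hy]
      module
    have hν' : ν' = 0 := by
      have h1 := hPB (γ • (f + (1 / 3 : ℝ) • e)) z
      rw [map_smul, hPu, hμν] at h1
      simp only [hB.add_left, hB.smul_left, hsr, hBfz, hBez, hBzz] at h1
      have h2 : ν' * s = 0 := by linear_combination -ν * h1 - ν' * s * hν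
      exact (mul_eq_zero.1 h2).resolve_right hs0
    refine ⟨?_, ?_⟩
    · rcases mul_self_eq_one_iff.1 hν with h1 | h1
      · left; rw [hμν, h1, one_smul]
      · right; rw [hμν, h1, neg_one_smul]
    · rw [hν', zero_smul, add_zero] at hPu
      exact smul_right_injective _ hγ0 hPu
  have hPz : ∀ v ∈ L.V₁, H v f = 0 → H v e = 0 → P v = v ∨ P v = -v := by
    intro v hv hvf hve
    by_cases hv0 : v = 0
    · left; rw [hv0, map_zero]
    obtain ⟨q, hq, hq1⟩ := h.exists_unit hv hv0
    have h1 := (key (q • v) (L.V₁.smul_mem q hv) (by rw [h.herm.smul_left, hvf, mul_zero])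
      (by rw [h.herm.smul_left, hve, mul_zero]) hq1).1
    rw [map_smul, ← smul_neg] at h1
    exact h1.imp (fun h => smul_right_injective _ hq.ne' h) fun h => smul_right_injective _ hq.ne' h
  have hPy : P (f + (1 / 3 : ℝ) • e) = f + (1 / 3 : ℝ) • e := by
    obtain ⟨v, hv, hv0, hvfe⟩ := exists_perp h.herm hF [f, e] (by simp)
    obtain ⟨q, hq, hq1⟩ := h.exists_unit hv hv0
    exact (key (q • v) (L.V₁.smul_mem q hv) (by rw [h.herm.smul_left, hvfe f (by simp), mul_zero])
      (by rw [h.herm.smul_left, hvfe e (by simp), mul_zero]) hq1).2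
  have hPq : P (f + (3 : ℝ) • e) = f + (3 : ℝ) • e ∨ P (f + (3 : ℝ) • e) = -(f + (3 : ℝ) • e) := by
    have hqV : f + (3 : ℝ) • e ∈ L.V₁ := L.V₁.add_mem hf (L.V₁.smul_mem _ he)
    obtain ⟨w, hw⟩ : ∃ w, w = P (f + (3 : ℝ) • e) := ⟨_, rfl⟩
    have hwV : w ∈ L.V₁ := by rw [hw]; exact hPV _ hqV
    obtain ⟨n, hn⟩ : ∃ n, n = w - H w f • f - H w e • e := ⟨_, rfl⟩
    have hnV : n ∈ L.V₁ := by
      rw [hn]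
      exact L.V₁.sub_mem (L.V₁.sub_mem hwV (L.V₁.smul_mem _ hf)) (L.V₁.smul_mem _ he)
    have hnf : H n f = 0 := by
      rw [hn, h.herm.sub_left, h.herm.sub_left, h.herm.smul_left, h.herm.smul_left, hff, hef]
      ring
    have hne : H n e = 0 := by
      rw [hn, h.herm.sub_left, h.herm.sub_left, h.herm.smul_left, h.herm.smul_left, hee, hfe]
      ring
    have hwn : w = H w f • f + H w e • e + n := by rw [hn]; abel
    have hAn := hneg n hnV hnf
    have hBfn : B f n = 0 := by rw [h.B_eigen hB hf hnV hAn, h.herm.eq_zero_symm hnf, mul_zero]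
    have hBen : B e n = 0 := by rw [h.B_eigen hB he hnV hAn, h.herm.eq_zero_symm hne, mul_zero]
    have hn0 : n = 0 := by
      have h1 : B w n = 0 := by
        have h2 := hPB (f + (3 : ℝ) • e) n
        rw [← hw, hB.add_left, hB.smul_left, hBfn, hBen] at h2
        rcases hPz n hnV hnf hne with h3 | h3
        · rw [h3] at h2; rw [h2]; ring
        · rw [h3, ← neg_one_smul ℝ n, hsr] at h2; linarith
      rw [hwn, hB.add_left, hB.add_left, hB.smul_left, hB.smul_left, hBfn, hBen,
        h.B_eigen hB hnV hnV hAn] at h1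
      refine h.eq_zero hnV ?_
      have h2 : s * H n n = 0 := by linear_combination -h1
      exact (mul_eq_zero.1 h2).resolve_left hs0
    obtain ⟨β, hβ⟩ : ∃ β, β = H w f := ⟨_, rfl⟩
    obtain ⟨η, hη⟩ : ∃ η, η = H w e := ⟨_, rfl⟩
    rw [hn0, add_zero, ← hβ, ← hη] at hwn
    have hη3 : η = 3 * β := by
      have h2 := hPB (f + (3 : ℝ) • e) (f + (1 / 3 : ℝ) • e)
      rw [hPy, ← hw, hwn] at h2
      simp only [hB.add_left, hB.smul_left, hB.add_right, hsr, hBff, hBee, hBef, hBfe] at h2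
      have h3 : s * (η - 3 * β) = 0 := by linear_combination -3 * h2
      linarith [(mul_eq_zero.1 h3).resolve_left hs0]
    have hβ1 : β * β = 1 := by
      have h2 := hPB (f + (3 : ℝ) • e) (f + (3 : ℝ) • e)
      rw [← hw, hwn, hη3] at h2
      simp only [hB.add_left, hB.smul_left, hB.add_right, hsr, hBff, hBee, hBef, hBfe] at h2
      have h3 : s * (β * β - 1) = 0 := by linear_combination (-1 / 8) * h2
      linarith [(mul_eq_zero.1 h3).resolve_left hs0]
    rw [← hw, hwn, hη3]
    rcases mul_self_eq_one_iff.1 hβ1 with h1 | h1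
    · left; rw [h1]; module
    · right; rw [h1]; module
  exact Rep.false_of_boost hker h hθ hf he hff hee hfe a (by rw [hag, hgf]) (by rw [hag, hge])
    (by rw [hag]; exact hgv) P (by rw [hag]; exact hP) hPy hPq hPz

end RealSign

section SignReal

variable {A : Type} [Group A] [TopologicalSpace A] {ε : ℕ → ℤˣ}

theorem signForm_self (x : V ℝ) :
    signForm ℝ ε id x x = x.sum fun i a => ((ε i : ℤ) : ℝ) * (a * a) := by
  classical
  unfold signForm form
  refine Finsupp.sum_congr fun i hi => ?_
  rw [Finsupp.sum, Finset.sum_eq_single i]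
  · rw [diag, if_pos rfl, id]; ring
  · intro j _ hj
    rw [diag, if_neg (Ne.symm hj)]; ring
  · intro h
    exact absurd hi h

theorem sign_mul_nonneg (s : ℤˣ) {x : V ℝ} (hx : ∀ i, ε i = -s → x i = 0) :
    0 ≤ ((s : ℤ) : ℝ) * signForm ℝ ε id x x := by
  rw [signForm_self, Finsupp.sum, Finset.mul_sum]
  refine Finset.sum_nonneg fun i _ => ?_
  by_cases h : ε i = -s
  · rw [hx i h]; simp
  · have : ε i = s := by
      rcases Int.units_eq_one_or s with rfl | rfl <;> rcases Int.units_eq_one_or (ε i) with h1 | h1 <;>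
        simp_all
    rw [this, ← mul_assoc, sign_sq, one_mul]
    exact mul_self_nonneg _

/-- Two indices with sign `s`, if they exist. -/
theorem exists_index_pair (s : ℤˣ) : ∃ F : Finset ℕ,
    (∃ i ∈ F, ∃ j ∈ F, i ≠ j ∧ ε i = s ∧ ε j = s) ∨ ∀ i j, ε i = s → ε j = s → i = j := by
  by_cases h : ∃ i j, i ≠ j ∧ ε i = s ∧ ε j = s
  · obtain ⟨i, j, hij, hi, hj⟩ := h
    exact ⟨{i, j}, Or.inl ⟨i, by simp, j, by simp, hij, hi, hj⟩⟩
  · push Not at h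
    exact ⟨∅, Or.inr fun i j hi hj => by
      by_contra hij
      exact h i j hij hi hj⟩

variable {Γ : Piece (signForm ℝ ε id) → Subgroup A} {ad : A → (V ℝ ≃ₗ[ℝ] V ℝ)}

theorem exists_ker {x y : V ℝ} (f : V ℝ →ₗ[ℝ] ℝ) : ∃ a b : ℝ, (a ≠ 0 ∨ b ≠ 0) ∧ f (a • x + b • y) = 0 := by
  by_cases h : f x = 0
  · exact ⟨1, 0, Or.inl one_ne_zero, by simp [h]⟩
  · exact ⟨-f y, f x, Or.inr h, by simp; ring⟩

theorem HasFlips.rigid_sign {R : Rep id 1 Γ ad} (hQ : HasFlips Γ ad) (hb : HasBoosts Γ ad)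
    (hker : ∀ L, ∀ k ∈ Γ L, ad k = 1 → ∀ g ∈ Γ L, k * g = g * k) : ∃ F, Rigid R F := by
  classical
  obtain ⟨F₁, hF₁⟩ := exists_index_pair (ε := ε) 1
  obtain ⟨F₂, hF₂⟩ := exists_index_pair (ε := ε) (-1)
  have hB := R.form
  -- the one-dimensional eigenspaces stay one-dimensional
  have hdim : ∀ (u : ℤˣ) (F₀ : Finset ℕ),
      ((∃ i ∈ F₀, ∃ j ∈ F₀, i ≠ j ∧ ε i = u ∧ ε j = u) ∨ ∀ i j, ε i = u → ε j = u → i = j) →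
      ∀ L L' : Piece (signForm ℝ ε id), (∀ i ∈ F₀, (Finsupp.single i 1 : V ℝ) ∈ L.V₁) →
      ∀ H A' H₁ A₁, Adm (signForm ℝ ε id) 1 L.V₁ L.C H A' →
      Adm (signForm ℝ ε id) 1 L'.V₁ L'.C H₁ A₁ → ∀ f ∈ L.V₁, A' f = ((u : ℤ) : ℝ) • f → H f f = 1 →
      (¬∃ z ∈ L.V₁, A' z = ((u : ℤ) : ℝ) • z ∧ H z z = 1 ∧ H z f = 0) →
      ¬∃ x ∈ L'.V₁, ∃ y ∈ L'.V₁, H₁ x x = 1 ∧ H₁ y y = 1 ∧ H₁ x y = 0 ∧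
        A₁ x = ((u : ℤ) : ℝ) • x ∧ A₁ y = ((u : ℤ) : ℝ) • y := by
    rintro u F₀ hF₀ L L' hL H A' H₁ A₁ h h₁ f hf hAf hff hno ⟨x, hx, y, hy, hxx, hyy, hxy, hAx, hAy⟩
    have hs := sign_sq u
    rcases hF₀ with ⟨i, hi, j, hj, hij, hεi, hεj⟩ | huniq
    · obtain ⟨a, b, hab, h0⟩ := exists_ker (x := Finsupp.single i 1) (y := Finsupp.single j 1)
        (h.herm.lin f h.herm)
      obtain ⟨v, hv⟩ : ∃ v : V ℝ, v = a • Finsupp.single i 1 + b • Finsupp.single j 1 := ⟨_, rfl⟩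
      have hvV : v ∈ L.V₁ := by
        rw [hv]
        exact L.V₁.add_mem (L.V₁.smul_mem _ (hL i hi)) (L.V₁.smul_mem _ (hL j hj))
      have hv0 : v ≠ 0 := by
        intro hv0
        rw [hv] at hv0
        have h1 := DFunLike.congr_fun hv0 i
        have h2 := DFunLike.congr_fun hv0 j
        simp [hij, hij.symm] at h1 h2
        rcases hab with h3 | h3
        · exact h3 h1
        · exact h3 h2
      have hneg := h.neg_eigen hB hs hf hAf hno hvV (by rw [hv]; exact h0)
      have h1 := h.B_eigen hB hvV hvV hneg
      have h2 : 0 ≤ ((u : ℤ) : ℝ) * signForm ℝ ε id v v := by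
        refine sign_mul_nonneg u fun k hk => ?_
        have e1 : i ≠ k := fun e => by
          rw [← e, hεi] at hk
          revert hk
          rcases Int.units_eq_one_or u with rfl | rfl <;> decide
        have e2 : j ≠ k := fun e => by
          rw [← e, hεj] at hk
          revert hk
          rcases Int.units_eq_one_or u with rfl | rfl <;> decide
        rw [hv]
        simp [e1, e2]
      have h3 : 0 < H v v := h.pos v hvV hv0
      rw [h1] at h2
      nlinarith
    · have hz : ∃ v ∈ L'.V₁, v ≠ 0 ∧ A₁ v = ((u : ℤ) : ℝ) • v ∧ ∀ i, ε i = u → v i = 0 := by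
        have hcomb : ∀ a b : ℝ, (a ≠ 0 ∨ b ≠ 0) → a • x + b • y ∈ L'.V₁ ∧ a • x + b • y ≠ 0 ∧
            A₁ (a • x + b • y) = ((u : ℤ) : ℝ) • (a • x + b • y) := by
          intro a b hab
          refine ⟨L'.V₁.add_mem (L'.V₁.smul_mem _ hx) (L'.V₁.smul_mem _ hy), fun h0 => ?_, ?_⟩
          · have e1 : H₁ (a • x + b • y) x = a := by
              rw [h₁.herm.add_left, h₁.herm.smul_left, h₁.herm.smul_left, hxx,
                h₁.herm.eq_zero_symm hxy]
              ring
            have e2 : H₁ (a • x + b • y) y = b := by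
              rw [h₁.herm.add_left, h₁.herm.smul_left, h₁.herm.smul_left, hyy, hxy]
              ring
            rw [h0, h₁.herm.zero_left] at e1 e2
            rcases hab with h3 | h3
            · exact h3 e1.symm
            · exact h3 e2.symm
          · rw [map_add, map_smul, map_smul, hAx, hAy]
            module
        by_cases hex : ∃ i, ε i = u
        · obtain ⟨i, hi⟩ := hex
          obtain ⟨a, b, hab, h0⟩ := exists_ker (x := x) (y := y) (Finsupp.lapply i)
          obtain ⟨h1, h2, h3⟩ := hcomb a b hab
          refine ⟨_, h1, h2, h3, fun k hk => ?_⟩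
          rw [huniq k i hk hi]
          exact h0
        · obtain ⟨h1, h2, h3⟩ := hcomb 1 0 (Or.inl one_ne_zero)
          exact ⟨_, h1, h2, h3, fun k hk => absurd ⟨k, hk⟩ hex⟩
      obtain ⟨v, hvV, hv0, hAv, hvi⟩ := hz
      have h1 := h₁.B_eigen hB hvV hvV hAv
      have h2 : 0 ≤ (((-u : ℤˣ) : ℤ) : ℝ) * signForm ℝ ε id v v :=
        sign_mul_nonneg (-u) fun k hk => hvi k (by rw [hk, neg_neg])
      have h3 : 0 < H₁ v v := h₁.pos v hvV hv0
      rw [h1] at h2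
      push_cast at h2
      nlinarith
  refine ⟨firstVectors ℝ 4 ∪ (F₁ ∪ F₂).image fun i => Finsupp.single i 1, ⟨Finsupp.single 0 1,
    Finset.mem_union_left _ (mem_firstVectors (by norm_num)), by simp⟩, ?_, ?_⟩
  · intro L L' hL hF H A' H₁ A₁ h h₁ θ θ₁ hθ hθ₁ hθθ x hx c hc hcV
    have hF4 : ∀ x ∈ firstVectors ℝ 4, x ∈ L.V₁ := fun x hx => hF x (Finset.mem_union_left _ hx)
    have key : ∀ (u : ℤˣ) (F₀ : Finset ℕ),
        ((∃ i ∈ F₀, ∃ j ∈ F₀, i ≠ j ∧ ε i = u ∧ ε j = u) ∨ ∀ i j, ε i = u → ε j = u → i = j) →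
        (∀ i ∈ F₀, (Finsupp.single i 1 : V ℝ) ∈ L.V₁) → ∀ x ∈ L.V₁, A' x = ((u : ℤ) : ℝ) • x →
        H₁ x c = 0 := by
      intro u F₀ hF₀ hFL x hx hAx
      have hs := sign_sq u
      by_cases hx0 : x = 0
      · rw [hx0, h₁.herm.zero_left]
      obtain ⟨r, hr, hr1⟩ := h.exists_unit hx hx0
      have hrV := L.V₁.smul_mem r hx
      have hAr : A' (r • x) = ((u : ℤ) : ℝ) • (r • x) := by rw [map_smul, hAx, smul_comm]
      have hrc : H₁ (r • x) c = 0 := by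
        by_cases hz : ∃ z ∈ L.V₁, A' z = ((u : ℤ) : ℝ) • z ∧ H z z = 1 ∧ H z (r • x) = 0
        · obtain ⟨z, hzV, hAz, hzz, hzx⟩ := hz
          exact hQ.orth_eigen hL h h₁ hθ hθ₁ hθθ hs hrV hzV (fun h0 => by
            rw [h0, h.herm.zero_left] at hzz; norm_num at hzz) hzx hAr hAz (Or.inl hc)
        · exact hQ.orth_exceptional hb hker hL hF4 h h₁ hθ hθ₁ hθθ hs hrV hAr hr1 hz
            (hdim u F₀ hF₀ L L' hFL H A' H₁ A₁ h h₁ _ hrV hAr hr1 hz) hc hcV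
      rw [h₁.herm.smul_left] at hrc
      exact (mul_eq_zero.1 hrc).resolve_left hr.ne'
    have hFi : ∀ i ∈ F₁ ∪ F₂, (Finsupp.single i 1 : V ℝ) ∈ L.V₁ := fun i hi =>
      hF _ (Finset.mem_union_right _ (Finset.mem_image_of_mem _ hi))
    obtain ⟨a, ha, b, hb', hAa, hAb, hab, -⟩ := h.exists_eigen hB id_eq_star (one_mul 1) hx
    rw [hab, h₁.herm.add_left,
      key 1 F₁ hF₁ (fun i hi => hFi i (Finset.mem_union_left _ hi)) a ha (by simpa using hAa),
      key (-1) F₂ hF₂ (fun i hi => hFi i (Finset.mem_union_right _ hi)) b hb' (by simpa using hAb),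
      add_zero]
  · intro L hF H A' H₁ A₁ h h₁ hK
    refine ⟨1, one_pos, fun x hx y hy => ?_⟩
    rw [map_one, one_mul]
    refine hQ.unique hB id_eq_star (fun x hx => ?_) h h₁ hK hx hy
    obtain ⟨i, hi, rfl⟩ := Finset.mem_image.1 hx
    exact hF _ (Finset.mem_union_left _ (mem_firstVectors
      ((Finset.mem_range.1 hi).trans (by norm_num))))

end SignReal

/-! ### One-parameter groups -/

/-- Trigonometric (`κ = -1`) or hyperbolic (`κ = 1`) functions. -/
structure TurnFun (κ : ℝ) (c s : ℝ → ℝ) : Prop where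
  sq : κ * κ = 1
  c_add : ∀ a b, c (a + b) = c a * c b + κ * (s a * s b)
  s_add : ∀ a b, s (a + b) = s a * c b + c a * s b
  c_zero : c 0 = 1
  s_zero : s 0 = 0
  c_neg : ∀ a, c (-a) = c a
  s_neg : ∀ a, s (-a) = -s a
  c_cont : Continuous c
  s_cont : Continuous s

theorem turnFun_trig : TurnFun (-1) Real.cos Real.sin where
  sq := by norm_num
  c_add a b := by rw [Real.cos_add]; ring
  s_add := Real.sin_add
  c_zero := Real.cos_zero
  s_zero := Real.sin_zero
  c_neg := Real.cos_neg
  s_neg := Real.sin_neg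
  c_cont := Real.continuous_cos
  s_cont := Real.continuous_sin

theorem turnFun_hyp : TurnFun 1 Real.cosh Real.sinh where
  sq := by norm_num
  c_add a b := by rw [Real.cosh_add]; ring
  s_add := Real.sinh_add
  c_zero := Real.cosh_zero
  s_zero := Real.sinh_zero
  c_neg := Real.cosh_neg
  s_neg := Real.sinh_neg
  c_cont := Real.continuous_cosh
  s_cont := Real.continuous_sinh

section OneParam

variable {D : Type} [NormedDivisionRing D] [NormedAlgebra ℝ D] [StarRing D] [Coeff D]
variable {κ : ℝ} {c s : ℝ → ℝ} (hcs : TurnFun κ c s) {J : V D →ₗ[D] V D}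
  (hJ : ∀ x, J (J (J x)) = κ • J x)

theorem real_smul_comm (d : D) (r : ℝ) (x : V D) : d • r • x = r • d • x := by
  rw [← oR_smul (D := D), ← oR_smul (D := D), smul_smul, smul_smul, oR_comm]

theorem map_rsmul (J : V D →ₗ[D] V D) (r : ℝ) (x : V D) : J (r • x) = r • J x := by
  rw [← oR_smul (D := D), map_smul, oR_smul]

/-- The value at `t` of the one-parameter group generated by `J`. -/
def oneParamFun (κ : ℝ) (c s : ℝ → ℝ) (J : V D →ₗ[D] V D) (t : ℝ) (x : V D) : V D :=
  x + s t • J x + (κ * (c t - 1)) • J (J x)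

include hcs hJ in
theorem oneParamFun_add (a b : ℝ) (x : V D) :
    oneParamFun κ c s J (a + b) x = oneParamFun κ c s J a (oneParamFun κ c s J b x) := by
  have h := hcs.sq
  simp only [oneParamFun, map_add, map_rsmul, hJ, hcs.c_add, hcs.s_add]
  match_scalars
  · ring
  · linear_combination -(s a * (c b - 1) + s b * (c a - 1)) * h
  · linear_combination (s a * s b - κ * (c a - 1) * (c b - 1)) * h

/-- The one-parameter group generated by `J`. -/
def oneParam (t : ℝ) : V D ≃ₗ[D] V D where
  toFun := oneParamFun κ c s J t
  map_add' x y := by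
    simp only [oneParamFun, map_add, smul_add]
    abel
  map_smul' d x := by
    simp only [oneParamFun, map_smul, smul_add, RingHom.id_apply, real_smul_comm]
  invFun := oneParamFun κ c s J (-t)
  left_inv x := by
    rw [← oneParamFun_add hcs hJ, neg_add_cancel]
    simp [oneParamFun, hcs.c_zero, hcs.s_zero]
  right_inv x := by
    rw [← oneParamFun_add hcs hJ, add_neg_cancel]
    simp [oneParamFun, hcs.c_zero, hcs.s_zero]

theorem oneParam_apply (t : ℝ) (x : V D) :
    oneParam hcs hJ t x = x + s t • J x + (κ * (c t - 1)) • J (J x) := rfl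

theorem oneParam_zero : oneParam hcs hJ 0 = 1 := by
  ext1 x
  rw [oneParam_apply, hcs.c_zero, hcs.s_zero, sub_self, mul_zero, zero_smul, zero_smul, add_zero,
    add_zero]
  rfl

theorem oneParam_add (a b : ℝ) : oneParam hcs hJ (a + b) = oneParam hcs hJ a * oneParam hcs hJ b :=
  LinearEquiv.ext (oneParamFun_add hcs hJ a b)

theorem oneParam_mem_stab {B : V D → V D → D} {L : Piece B} (h1 : ∀ x, J x ∈ L.V₁)
    (h2 : ∀ x ∈ L.C, J x = 0) (t : ℝ) : oneParam hcs hJ t ∈ L.stab := by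
  refine ⟨fun x => ?_, fun x hx => ?_⟩
  · rw [oneParam_apply, add_assoc, add_sub_cancel_left]
    exact L.V₁.add_mem (L.V₁.smul_of_tower_mem _ (h1 _)) (L.V₁.smul_of_tower_mem _ (h1 _))
  · rw [oneParam_apply, h2 x hx, map_zero, smul_zero, smul_zero, add_zero, add_zero]

theorem oneParam_pres {F : V D → V D → D} (hl : ∀ x y z, F (x + y) z = F x z + F y z)
    (hr : ∀ x y z, F x (y + z) = F x y + F x z) (hsl : ∀ (r : ℝ) x y, F (r • x) y = oR D r * F x y)
    (hsr : ∀ (r : ℝ) x y, F x (r • y) = oR D r * F x y) (hF : ∀ x y, F (J x) y = -F x (J y)) (t : ℝ) :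
    Pres F (oneParam hcs hJ t) := by
  have key : ∀ x y, F (oneParam hcs hJ t x) y = F x (oneParam hcs hJ (-t) y) := by
    intro x y
    rw [oneParam_apply, oneParam_apply, hl, hl, hr, hr, hsl, hsl, hsr, hsr, hF, hF, hF, neg_neg,
      hcs.c_neg, hcs.s_neg, map_neg, mul_neg, neg_mul]
  intro x y
  rw [key]
  change F x ((oneParam hcs hJ t).symm (oneParam hcs hJ t y)) = _
  rw [LinearEquiv.symm_apply_apply]

theorem oneParam_continuous (x : V D) (j : ℕ) : Continuous fun t => oneParam hcs hJ t x j := by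
  have h1 := hcs.c_cont
  have h2 := hcs.s_cont
  have : ∀ t, oneParam hcs hJ t x j = x j + s t • J x j + (κ * (c t - 1)) • J (J x) j := fun t => rfl
  simp_rw [this]
  fun_prop

/-- A one-parameter group that is inverted by conjugation lies in the connected linear group. -/
theorem oneParam_mem {r : ℕ} {ρ : D →+* Matrix (Fin r) (Fin r) ℂ} {h : ℕ → ℕ → D} {σ : D → D}
    {sp : Bool} {L : Piece (form h σ)} (h1 : ∀ x, J x ∈ L.V₁) (h2 : ∀ x ∈ L.C, J x = 0)
    (hF : ∀ t, Pres (form h σ) (oneParam hcs hJ t))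
    (hS : sp = true → ∃ S ∈ L.stab, ∀ x, S (J x) = -J (S x)) (t : ℝ) :
    letI : TopologicalSpace (V D ≃ₗ[D] V D) := entryTop
    oneParam hcs hJ t ∈ idComponent (linΓ ρ h σ sp L) := by
  letI : TopologicalSpace (V D ≃ₗ[D] V D) := entryTop
  refine mem_idComponent_of_path (γ := oneParam hcs hJ)
    (continuous_to_entry fun i j => oneParam_continuous hcs hJ _ j) (oneParam_zero hcs hJ)
    (fun t => ?_) t
  obtain ⟨N, hN1, hN2⟩ := L.exists_bound
  have hblock : ∀ g ∈ L.stab, IsBlock N g := fun g hg => Piece.stab_isBlock hN1 hN2 hg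
  have hst : ∀ t, oneParam hcs hJ t ∈ L.stab := oneParam_mem_stab hcs hJ h1 h2
  refine mem_linΓ_of (hst t) (hF t) (hblock _ (hst t)) fun hs => ?_
  obtain ⟨S, hSL, hSJ⟩ := hS hs
  have hconj : ∀ t, S * oneParam hcs hJ t = oneParam hcs hJ (-t) * S := by
    intro t
    ext1 x
    change S (oneParam hcs hJ t x) = oneParam hcs hJ (-t) (S x)
    rw [oneParam_apply, oneParam_apply, map_add, map_add, hcs.c_neg, hcs.s_neg]
    have e1 : ∀ (r : ℝ) (x : V D), S (r • x) = r • S x := map_rsmul S.toLinearMap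
    rw [e1, e1, hSJ, hSJ, hSJ, map_neg, neg_neg, smul_neg, neg_smul]
  have hdS : blockDet ρ N S ≠ 0 := by
    intro h0
    have h3 := blockDet_mul ρ S⁻¹ S (hblock S hSL)
    rw [inv_mul_cancel, blockDet_one, h0, zero_mul] at h3
    exact one_ne_zero h3
  have hdet : ∀ t, blockDet ρ N (oneParam hcs hJ t) * blockDet ρ N (oneParam hcs hJ t) = 1 := by
    intro t
    have h3 := blockDet_mul ρ S (oneParam hcs hJ t) (hblock _ (hst t))
    rw [hconj, blockDet_mul ρ _ S (hblock S hSL), mul_comm] at h3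
    have h4 := mul_right_cancel₀ hdS h3
    have h5 := blockDet_mul ρ (oneParam hcs hJ (-t)) (oneParam hcs hJ t) (hblock _ (hst t))
    rw [← oneParam_add, neg_add_cancel, oneParam_zero, blockDet_one, h4] at h5
    exact h5.symm
  have h6 := blockDet_mul ρ (oneParam hcs hJ (t / 2)) (oneParam hcs hJ (t / 2)) (hblock _ (hst _))
  rw [← oneParam_add, add_halves, hdet] at h6
  exact h6

end OneParam

/-! ### Generators of the classical groups -/

section Generators

variable {D : Type} [NormedDivisionRing D] [NormedAlgebra ℝ D] [StarRing D] [Coeff D]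
variable {κ : ℝ} {c s : ℝ → ℝ} (hcs : TurnFun κ c s) {J : V D →ₗ[D] V D}
  (hJ : ∀ x, J (J (J x)) = κ • J x)

theorem oneParam_pres_herm {H : V D → V D → D} (hH : IsHerm H) (h : ∀ x y, H (J x) y = -H x (J y))
    (t : ℝ) : Pres H (oneParam hcs hJ t) :=
  oneParam_pres hcs hJ hH.add_left hH.add_right (fun r x y => hH.rsmul_left r x y)
    (fun r x y => by rw [hH.rsmul_right, oR_comm]) h t

theorem oneParam_pres_form {B : V D → V D → D} {σ : D → D} {δ : ℝ} (hB : IsForm B σ δ)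
    (h : ∀ x y, B (J x) y = -B x (J y)) (t : ℝ) : Pres B (oneParam hcs hJ t) :=
  oneParam_pres hcs hJ hB.add_left hB.add_right
    (fun r x y => by rw [← oR_smul (D := D), hB.smul_left])
    (fun r x y => by rw [← oR_smul (D := D), hB.smul_right, hB.real, oR_comm]) h t

section Vectors

variable {H : V D → V D → D} (hH : IsHerm H)

/-- The map `v ↦ H(v, x) a y + H(v, y) b x`. -/
def planeMap (a b : D) (x y x' y' : V D) : V D →ₗ[D] V D :=
  LinearMap.toSpanSingleton D _ (a • x') ∘ₗ hH.lin x hH +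
    LinearMap.toSpanSingleton D _ (b • y') ∘ₗ hH.lin y hH

theorem planeMap_apply (a b : D) (x y x' y' v : V D) :
    planeMap hH a b x y x' y' v = (H v x * a) • x' + (H v y * b) • y' := by
  rw [mul_smul, mul_smul]
  rfl

/-- The infinitesimal rotation from `x` to `y`. -/
abbrev rotMap (x y : V D) : V D →ₗ[D] V D := planeMap hH 1 (-1) x y y x

/-- The infinitesimal boost in the plane of `x` and `y`. -/
abbrev boostMap (x y : V D) : V D →ₗ[D] V D := planeMap hH 1 1 x y y x

/-- The infinitesimal diagonal torus element, for a square root `ι` of `-1`. -/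
abbrev torusMap (ι : D) (x y : V D) : V D →ₗ[D] V D := planeMap hH ι (-ι) x y x y

theorem planeMap_mem {B : V D → V D → D} {L : Piece B} {a b : D} {x y x' y' : V D}
    (hx : x' ∈ L.V₁) (hy : y' ∈ L.V₁) (v : V D) : planeMap hH a b x y x' y' v ∈ L.V₁ := by
  rw [planeMap_apply]
  exact L.V₁.add_mem (L.V₁.smul_mem _ hx) (L.V₁.smul_mem _ hy)

theorem planeMap_C {B : V D → V D → D} {δ : ℝ} {L : Piece B} {A' : V D →ₗ[ℝ] V D}
    (h : Adm B δ L.V₁ L.C H A') (hH : IsHerm H) {a b : D} {x y x' y' : V D} {v : V D}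
    (hv : v ∈ L.C) : planeMap hH a b x y x' y' v = 0 := by
  rw [planeMap_apply, h.rad v hv, h.rad v hv, zero_mul, zero_mul, zero_smul, zero_smul, add_zero]

variable {x y : V D} (hxx : H x x = 1) (hyy : H y y = 1) (hxy : H x y = 0)
include hxx hyy hxy

theorem planeMap_swap_left (a b : D) : planeMap hH a b x y y x x = a • y := by
  rw [planeMap_apply, hxx, hxy, one_mul, zero_mul, zero_smul, add_zero]

theorem planeMap_swap_right (a b : D) : planeMap hH a b x y y x y = b • x := by
  rw [planeMap_apply, hyy, hH.eq_zero_symm hxy, one_mul, zero_mul, zero_smul, zero_add]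

theorem planeMap_left (a b : D) : planeMap hH a b x y x y x = a • x := by
  rw [planeMap_apply, hxx, hxy, one_mul, zero_mul, zero_smul, add_zero]

theorem planeMap_right (a b : D) : planeMap hH a b x y x y y = b • y := by
  rw [planeMap_apply, hyy, hH.eq_zero_symm hxy, one_mul, zero_mul, zero_smul, zero_add]

theorem rotMap_cube (v : V D) : rotMap hH x y (rotMap hH x y (rotMap hH x y v)) =
    (-1 : ℝ) • rotMap hH x y v := by
  have h1 := planeMap_swap_left hH hxx hyy hxy 1 (-1)
  have h2 := planeMap_swap_right hH hxx hyy hxy 1 (-1)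
  rw [planeMap_apply hH 1 (-1) x y y x v]
  simp only [map_add, map_smul, h1, h2, one_smul, neg_smul, map_neg, smul_neg, neg_neg, mul_one,
    mul_neg, neg_add]

theorem boostMap_cube (v : V D) : boostMap hH x y (boostMap hH x y (boostMap hH x y v)) =
    (1 : ℝ) • boostMap hH x y v := by
  have h1 := planeMap_swap_left hH hxx hyy hxy 1 1
  have h2 := planeMap_swap_right hH hxx hyy hxy 1 1
  rw [planeMap_apply hH 1 1 x y y x v]
  simp only [map_add, map_smul, h1, h2, one_smul, mul_one]

theorem torusMap_cube {ι : D} (hι : ι * ι = -1) (v : V D) :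
    torusMap hH ι x y (torusMap hH ι x y (torusMap hH ι x y v)) =
      (-1 : ℝ) • torusMap hH ι x y v := by
  have h1 := planeMap_left hH hxx hyy hxy ι (-ι)
  have h2 := planeMap_right hH hxx hyy hxy ι (-ι)
  rw [planeMap_apply hH ι (-ι) x y x y v]
  simp only [map_add, map_smul, h1, h2, one_smul, neg_smul, map_neg, smul_neg, neg_neg, mul_one,
    mul_neg, neg_add, smul_smul, mul_assoc, hι]

theorem rotMap_sq (v : V D) : rotMap hH x y (rotMap hH x y v) = -(H v x • x + H v y • y) := by
  rw [planeMap_apply hH 1 (-1) x y y x v]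
  simp only [map_add, map_smul, planeMap_swap_left hH hxx hyy hxy 1 (-1),
    planeMap_swap_right hH hxx hyy hxy 1 (-1), one_smul, neg_smul, map_neg, smul_neg, neg_neg, mul_one,
    mul_neg, neg_add]

theorem torusMap_sq {ι : D} (hι : ι * ι = -1) (v : V D) :
    torusMap hH ι x y (torusMap hH ι x y v) = -(H v x • x + H v y • y) := by
  rw [planeMap_apply hH ι (-ι) x y x y v]
  simp only [map_add, map_smul, planeMap_left hH hxx hyy hxy ι (-ι),
    planeMap_right hH hxx hyy hxy ι (-ι), one_smul, neg_smul, map_neg, smul_neg, neg_neg, mul_one,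
    mul_neg, neg_add, smul_smul, mul_assoc, hι]

/-- A half turn is a sign change. -/
theorem oneParam_pi (hH : IsHerm H) {J : V D →ₗ[D] V D} (hJ : ∀ x, J (J (J x)) = (-1 : ℝ) • J x)
    (h2 : ∀ v, J (J v) = -(H v x • x + H v y • y)) :
    FlipOn H x y (oneParam turnFun_trig hJ Real.pi) := by
  have key : ∀ v, oneParam turnFun_trig hJ Real.pi v = v - (2 : ℝ) • (H v x • x + H v y • y) := by
    intro v
    rw [oneParam_apply, Real.sin_pi, Real.cos_pi, h2, zero_smul, add_zero,
      show (-1 : ℝ) * (-1 - 1) = 2 by norm_num, smul_neg, sub_eq_add_neg]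
  refine ⟨?_, ?_, fun v h1 h2 => ?_⟩
  · rw [key, hxx, hxy, one_smul, zero_smul, add_zero, two_smul]; abel
  · rw [key, hyy, hH.eq_zero_symm hxy, one_smul, zero_smul, zero_add, two_smul]; abel
  · rw [key, h1, h2, zero_smul, zero_smul, add_zero, smul_zero, sub_zero]

/-- A quarter turn. -/
theorem oneParam_pi_div_two (hJ : ∀ v, rotMap hH x y (rotMap hH x y (rotMap hH x y v)) =
    (-1 : ℝ) • rotMap hH x y v) :
    oneParam turnFun_trig hJ (Real.pi / 2) x = y ∧ oneParam turnFun_trig hJ (Real.pi / 2) y = -x := by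
  constructor
  · rw [oneParam_apply, Real.sin_pi_div_two, Real.cos_pi_div_two, rotMap_sq hH hxx hyy hxy,
      planeMap_swap_left hH hxx hyy hxy, hxx, hxy]
    simp
  · rw [oneParam_apply, Real.sin_pi_div_two, Real.cos_pi_div_two, rotMap_sq hH hxx hyy hxy,
      planeMap_swap_right hH hxx hyy hxy, hyy, hH.eq_zero_symm hxy]
    simp

omit hyy hxy in
/-- The orthogonal reflection in `x`. -/
def orthRefl : V D ≃ₗ[D] V D :=
  LinearEquiv.ofInvolutive (LinearMap.id - LinearMap.toSpanSingleton D _ ((2 : D) • x) ∘ₗ hH.lin x hH)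
    (fun v => by
      change (v - H v x • (2 : D) • x) - H (v - H v x • (2 : D) • x) x • (2 : D) • x = v
      rw [hH.sub_left, hH.smul_left, hH.smul_left, hxx, mul_one, mul_two, sub_smul, add_smul]
      abel)

omit hyy hxy in
theorem orthRefl_apply (v : V D) : orthRefl hH hxx v = v - (H v x * 2) • x := by
  rw [mul_smul]
  rfl

omit hyy hxy in
theorem orthRefl_mem {B : V D → V D → D} {δ : ℝ} {L : Piece B} {A' : V D →ₗ[ℝ] V D}
    (h : Adm B δ L.V₁ L.C H A') (hx : x ∈ L.V₁) : orthRefl hH hxx ∈ L.stab := by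
  refine ⟨fun v => ?_, fun v hv => ?_⟩
  · rw [orthRefl_apply, sub_sub_cancel_left]
    exact L.V₁.neg_mem (L.V₁.smul_mem _ hx)
  · rw [orthRefl_apply, h.rad v hv, zero_mul, zero_smul, sub_zero]

theorem orthRefl_planeMap (a b : D) (v : V D) :
    orthRefl hH hxx (planeMap hH a b x y y x v) = -planeMap hH a b x y y x (orthRefl hH hxx v) := by
  rw [orthRefl_apply, orthRefl_apply, map_sub, map_smul, planeMap_swap_left hH hxx hyy hxy,
    planeMap_apply, hH.add_left, hH.smul_left, hH.smul_left, hxx, hH.eq_zero_symm hxy, mul_zero,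
    zero_add, mul_one, mul_two, mul_two, add_smul, add_smul, smul_smul]
  abel

omit hxx hyy hxy in
theorem rotMap_skew (v w : V D) : H (rotMap hH x y v) w = -H v (rotMap hH x y w) := by
  rw [planeMap_apply, planeMap_apply, hH.add_left, hH.add_right, hH.smul_left, hH.smul_left,
    hH.smul_right, hH.smul_right]
  simp only [mul_one, mul_neg, star_neg, hH.star_symm, neg_mul]
  abel

omit hxx hyy hxy in
theorem torusMap_skew {ι : D} (hι : star ι = -ι) (v w : V D) :
    H (torusMap hH ι x y v) w = -H v (torusMap hH ι x y w) := by
  rw [planeMap_apply, planeMap_apply, hH.add_left, hH.add_right, hH.smul_left, hH.smul_left,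
    hH.smul_right, hH.smul_right]
  simp only [mul_neg, star_neg, star_mul, hH.star_symm, neg_mul, hι, neg_neg, mul_assoc]
  abel

/-- The reflection that exchanges `x` and `y`. -/
theorem exists_swap {B : V D → V D → D} {δ : ℝ} {L : Piece B} {A' : V D →ₗ[ℝ] V D}
    (h : Adm B δ L.V₁ L.C H A') (hx : x ∈ L.V₁) (hy : y ∈ L.V₁) (ι : D) :
    ∃ S ∈ L.stab, ∀ v, S (torusMap hH ι x y v) = -torusMap hH ι x y (S v) := by
  have hyx := hH.eq_zero_symm hxy
  have e : ∀ v, LinearMap.toSpanSingleton D _ (x - y) (hH.lin (x - y) hH v) =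
      H v x • (x - y) - H v y • (x - y) := fun v => by
    change H v (x - y) • (x - y) = _
    rw [hH.sub_right, sub_smul]
  let S : V D ≃ₗ[D] V D := LinearEquiv.ofInvolutive
    (LinearMap.id - LinearMap.toSpanSingleton D _ (x - y) ∘ₗ hH.lin (x - y) hH) (fun v => by
      change (v - H v (x - y) • (x - y)) -
        H (v - H v (x - y) • (x - y)) (x - y) • (x - y) = v
      have h2 : H (x - y) (x - y) = 2 := by
        rw [hH.sub_left, hH.sub_right, hH.sub_right, hxx, hyy, hxy, hyx]
        norm_num
      rw [hH.sub_left v, hH.smul_left, h2, mul_two, sub_smul, add_smul]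
      abel)
  have hS : ∀ v, S v = v - (H v x • (x - y) - H v y • (x - y)) := fun v => by rw [← e]; rfl
  refine ⟨S, ⟨fun v => ?_, fun v hv => ?_⟩, fun v => ?_⟩
  · rw [hS, sub_sub_cancel_left]
    exact L.V₁.neg_mem (L.V₁.sub_mem (L.V₁.smul_mem _ (L.V₁.sub_mem hx hy))
      (L.V₁.smul_mem _ (L.V₁.sub_mem hx hy)))
  · rw [hS, h.rad v hv, h.rad v hv, zero_smul, sub_self, sub_zero]
  · have hSx : S x = y := by rw [hS, hxx, hxy, one_smul, zero_smul]; abel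
    have hSy : S y = x := by rw [hS, hyy, hyx, one_smul, zero_smul]; abel
    have h1 : H (S v) x = H v y := by
      rw [hS]
      simp only [hH.sub_left, hH.smul_left, hxx, hyx]
      noncomm_ring
    have h2 : H (S v) y = H v x := by
      rw [hS]
      simp only [hH.sub_left, hH.smul_left, hyy, hxy]
      noncomm_ring
    rw [planeMap_apply, planeMap_apply, map_add, map_smul, map_smul, hSx, hSy, h1, h2, mul_neg,
      mul_neg, neg_smul, neg_smul]
    abel

end Vectors

end Generators

section Eigenvectors

variable {D : Type} [NormedDivisionRing D] [NormedAlgebra ℝ D] [StarRing D] [Coeff D]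
variable {B : V D → V D → D} {σ : D → D} {δ : ℝ} {L : Piece B} {H : V D → V D → D}
  {A' : V D →ₗ[ℝ] V D}

/-- The equation for `B` on vectors outside `V₁`. -/
theorem Adm.B_eq_left (hB : IsForm B σ δ) (h : Adm B δ L.V₁ L.C H A') (v : V D) {y : V D}
    (hy : y ∈ L.V₁) : B v y = H v (A' y) := by
  have e : v = L.proj v + (v - L.proj v) := by abel
  rw [e, hB.add_left, h.herm.add_left, h.B_eq _ (L.proj_mem v) y hy,
    hB.refl (L.orth y hy _ (L.sub_proj_mem v)), h.rad _ (L.sub_proj_mem v)]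

theorem Adm.B_eigen_left (hB : IsForm B σ δ) (h : Adm B δ L.V₁ L.C H A') {t : ℝ} {y : V D}
    (hy : y ∈ L.V₁) (hAy : A' y = t • y) (v : V D) : B v y = oR D t * H v y := by
  rw [h.B_eq_left hB v hy, hAy, h.herm.rsmul_right, oR_comm]

theorem Adm.B_eigen_right (hσ : ∀ d, σ d = star d) (hB : IsForm B σ 1) (h : Adm B 1 L.V₁ L.C H A')
    {t : ℝ} {y : V D} (hy : y ∈ L.V₁) (hAy : A' y = t • y) (v : V D) : B y v = oR D t * H y v := by
  rw [hB.symm_star hσ v y, map_one, one_mul, h.B_eigen_left hB hy hAy, star_mul, star_oR,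
    h.herm.star_symm, oR_comm]

end Eigenvectors

section NoForm

variable {D : Type} [NormedDivisionRing D] [NormedAlgebra ℝ D] [StarRing D] [Coeff D]
variable {r : ℕ} {ρ : D →+* Matrix (Fin r) (Fin r) ℂ} {sp : Bool}

theorem exists_quarter_turn (L : Piece (form (fun _ _ => (0 : D)) id)) (H : V D → V D → D)
    (A' : V D →ₗ[ℝ] V D) (h : Adm (form (fun _ _ => (0 : D)) id) 0 L.V₁ L.C H A')
    (x : V D) (hx : x ∈ L.V₁) (y : V D) (hy : y ∈ L.V₁) (hxx : H x x = 1) (hyy : H y y = 1)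
    (hxy : H x y = 0) :
    letI : TopologicalSpace (V D ≃ₗ[D] V D) := entryTop
    ∃ g ∈ idComponent (linΓ ρ (fun _ _ => 0) id sp L), Pres H g ∧ g x = y ∧ g y = -x := by
  have hH := h.herm
  have hJ := rotMap_cube hH hxx hyy hxy
  refine ⟨oneParam turnFun_trig hJ (Real.pi / 2), oneParam_mem turnFun_trig hJ
    (planeMap_mem hH hy hx) (fun v hv => planeMap_C h hH hv) (fun t x y => ?_) (fun _ =>
      ⟨orthRefl hH hxx, orthRefl_mem hH hxx h hx, orthRefl_planeMap hH hxx hyy hxy _ _⟩) _,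
    oneParam_pres_herm turnFun_trig hJ hH (rotMap_skew hH) _, oneParam_pi_div_two hH hxx hyy hxy hJ⟩
  rw [isForm_zero.eq_zero rfl, isForm_zero.eq_zero rfl]

end NoForm

section Unitary

variable {D : Type} [NormedDivisionRing D] [NormedAlgebra ℝ D] [StarRing D] [Coeff D]
variable {r : ℕ} {ρ : D →+* Matrix (Fin r) (Fin r) ℂ} {sp : Bool} {d : ℕ → ℕ → D} {σ : D → D}

/-- In unitary groups, sign changes of two vectors come from a torus. -/
theorem hasAllFlips_linear (hσ : ∀ d, σ d = star d) (hB : IsForm (form d σ) σ 1) {ι : D}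
    (hι : ι * ι = -1) (hι' : star ι = -ι) :
    letI : TopologicalSpace (V D ≃ₗ[D] V D) := entryTop
    HasAllFlips (fun L => idComponent (linΓ ρ d σ sp L)) (fun g => g) := by
  intro L H A' h x hx y hy hxx hyy hxy hAx hAy
  have hH := h.herm
  have hJ := torusMap_cube hH hxx hyy hxy hι
  obtain ⟨s, hAx⟩ : ∃ s : ℝ, A' x = s • x := by
    rcases hAx with h1 | h1
    · exact ⟨1, by rw [h1, one_smul]⟩
    · exact ⟨-1, by rw [h1, neg_one_smul]⟩
  obtain ⟨t, hAy⟩ : ∃ t : ℝ, A' y = t • y := by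
    rcases hAy with h1 | h1
    · exact ⟨1, by rw [h1, one_smul]⟩
    · exact ⟨-1, by rw [h1, neg_one_smul]⟩
  refine ⟨oneParam turnFun_trig hJ Real.pi, oneParam_mem turnFun_trig hJ
    (planeMap_mem hH hx hy) (fun v hv => planeMap_C h hH hv)
    (oneParam_pres_form turnFun_trig hJ hB fun v w => ?_)
    (fun _ => exists_swap hH hxx hyy hxy h hx hy ι) _,
    oneParam_pres_herm turnFun_trig hJ hH (torusMap_skew hH hι') _,
    oneParam_pi hxx hyy hxy hH hJ (torusMap_sq hH hxx hyy hxy hι)⟩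
  rw [planeMap_apply, planeMap_apply, hB.add_left, hB.add_right, hB.smul_left, hB.smul_left,
    hB.smul_right, hB.smul_right, h.B_eigen_left hB hx hAx, h.B_eigen_left hB hy hAy,
    h.B_eigen_right hσ hB hx hAx, h.B_eigen_right hσ hB hy hAy, hσ, hσ]
  simp only [mul_neg, star_neg, star_mul, hH.star_symm, neg_mul, hι', neg_neg, oR_comm, mul_assoc]
  abel

end Unitary

section Orthogonal

variable {𝕜 : Type} [RCLike 𝕜]
variable {r : ℕ} {ρ : 𝕜 →+* Matrix (Fin r) (Fin r) ℂ} {sp : Bool} {d : ℕ → ℕ → 𝕜}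

/-- A rotation in the plane of two vectors on which `B` is a multiple of `H`. -/
theorem exists_flip_linear {δ : ℝ} (hB : IsForm (form d id) id 1) {L : Piece (form d id)}
    {H : V 𝕜 → V 𝕜 → 𝕜} {A' : V 𝕜 →ₗ[ℝ] V 𝕜} (h : Adm (form d id) 1 L.V₁ L.C H A') {x : V 𝕜}
    (hx : x ∈ L.V₁) {y : V 𝕜} (hy : y ∈ L.V₁) (hxx : H x x = 1) (hyy : H y y = 1) (hxy : H x y = 0)
    {s : ℝ} (hs : s * s = 1) (hAx : A' x = s • x) (hAy : A' y = s • y) :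
    letI : TopologicalSpace (V 𝕜 ≃ₗ[𝕜] V 𝕜) := entryTop
    ∃ g ∈ idComponent (linΓ ρ d id sp L), Pres H g ∧ FlipOn H x y g := by
  have hH := h.herm
  have hJ := rotMap_cube hH hxx hyy hxy
  refine ⟨oneParam turnFun_trig hJ Real.pi, oneParam_mem turnFun_trig hJ
    (planeMap_mem hH hy hx) (fun v hv => planeMap_C h hH hv)
    (oneParam_pres_form turnFun_trig hJ hB fun v w => ?_) (fun _ =>
      ⟨orthRefl hH hxx, orthRefl_mem hH hxx h hx, orthRefl_planeMap hH hxx hyy hxy _ _⟩) _,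
    oneParam_pres_herm turnFun_trig hJ hH (rotMap_skew hH) _,
    oneParam_pi hxx hyy hxy hH hJ (rotMap_sq hH hxx hyy hxy)⟩
  have e : ∀ z ∈ L.V₁, A' z = s • z → ∀ u, H u z = oR 𝕜 s * form d id u z := by
    intro z hz hAz u
    rw [h.B_eigen_left hB hz hAz, ← mul_assoc, ← map_mul, hs, map_one, one_mul]
  rw [planeMap_apply, planeMap_apply, e x hx hAx, e x hx hAx, e y hy hAy, e y hy hAy, hB.add_left,
    hB.add_right, hB.smul_left, hB.smul_left, hB.smul_right, hB.smul_right, hB.symm_id x w,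
    hB.symm_id y w, map_one]
  simp only [id]
  ring

theorem exists_boost_linear {d : ℕ → ℕ → ℝ} {ρ : ℝ →+* Matrix (Fin r) (Fin r) ℂ}
    (hB : IsForm (form d id) id 1) :
    letI : TopologicalSpace (V ℝ ≃ₗ[ℝ] V ℝ) := entryTop
    HasBoosts (fun L => idComponent (linΓ ρ d id sp L)) (fun g => g) := by
  intro L H A' h f hf e he hff hee s hs hAf hAe
  have hH := h.herm
  have hfe := h.eigen_orth hB id_eq_star hs hf he hAf hAe
  have hJ := boostMap_cube hH hff hee hfe
  have hsq : ∀ v, boostMap hH f e (boostMap hH f e v) = H v f • f + H v e • e := by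
    intro v
    rw [planeMap_apply hH 1 1 f e e f v]
    simp only [map_add, map_smul, planeMap_swap_left hH hff hee hfe 1 1,
      planeMap_swap_right hH hff hee hfe 1 1, one_smul, mul_one]
  have hc : Real.cosh (Real.log 2) = 5 / 4 := by
    rw [Real.cosh_log (by norm_num)]; norm_num
  have hs' : Real.sinh (Real.log 2) = 3 / 4 := by
    rw [Real.sinh_log (by norm_num)]; norm_num
  have key : ∀ v, oneParam turnFun_hyp hJ (Real.log 2) v =
      v + (3 / 4 : ℝ) • boostMap hH f e v + (1 / 4 : ℝ) • (H v f • f + H v e • e) := by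
    intro v
    rw [oneParam_apply, hsq, hc, hs']
    norm_num
  refine ⟨oneParam turnFun_hyp hJ (Real.log 2), oneParam_mem turnFun_hyp hJ
    (planeMap_mem hH he hf) (fun v hv => planeMap_C h hH hv)
    (oneParam_pres_form turnFun_hyp hJ hB fun v w => ?_) (fun _ =>
      ⟨orthRefl hH hff, orthRefl_mem hH hff h hf, orthRefl_planeMap hH hff hee hfe _ _⟩) _,
      ?_, ?_, fun v h1 h2 => ?_⟩
  · have e1 : ∀ u, H u f = s * form d id u f := by
      intro u
      rw [h.B_eigen_left hB hf hAf, Algebra.algebraMap_self_apply, ← mul_assoc, hs, one_mul]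
    have e2 : ∀ u, H u e = -s * form d id u e := by
      intro u
      rw [h.B_eigen_left hB he hAe, Algebra.algebraMap_self_apply, ← mul_assoc, neg_mul_neg, hs,
        one_mul]
    rw [planeMap_apply, planeMap_apply, e1, e1, e2, e2, hB.add_left, hB.add_right, hB.smul_left,
      hB.smul_left, hB.smul_right, hB.smul_right, hB.symm_id f w, hB.symm_id e w, map_one]
    simp only [id]
    ring
  · rw [key, planeMap_swap_left hH hff hee hfe, hff, hfe]
    module
  · rw [key, planeMap_swap_right hH hff hee hfe, hee, h.herm.eq_zero_symm hfe]
    module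
  · rw [key, planeMap_apply, h1, h2]
    simp

/-- For symplectic forms, the turn from `x` to `A x`. -/
theorem exists_symplectic_turn (hB : IsForm (form d id) id (-1)) (L : Piece (form d id))
    (H : V 𝕜 → V 𝕜 → 𝕜) (A' : V 𝕜 →ₗ[ℝ] V 𝕜) (h : Adm (form d id) (-1) L.V₁ L.C H A') (x : V 𝕜)
    (hx : x ∈ L.V₁) (hxx : H x x = 1) :
    letI : TopologicalSpace (V 𝕜 ≃ₗ[𝕜] V 𝕜) := entryTop
    ∃ g ∈ idComponent (linΓ ρ d id false L), Pres H g ∧ g x = A' x ∧ g (A' x) = -x := by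
  have hH := h.herm
  have hy := h.A_mem x
  have hAA : A' (A' x) = -x := by rw [h.A_sq x hx, neg_one_smul]
  have hBxx : form d id x x = 0 := by
    have := hB.symm_id x x
    rw [map_neg, map_one, neg_one_mul] at this
    exact eq_zero_of_eq_neg this
  have hxy : H x (A' x) = 0 := by rw [← h.B_eq x hx x hx, hBxx]
  have hyy : H (A' x) (A' x) = 1 := by
    rw [h.adj_id hB hx hy, hAA, hH.neg_right, hxx, map_neg, map_one, star_neg, star_one, neg_mul_neg,
      one_mul]
  have hJ := rotMap_cube hH hxx hyy hxy
  refine ⟨oneParam turnFun_trig hJ (Real.pi / 2), oneParam_mem turnFun_trig hJ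
    (planeMap_mem hH hy hx) (fun v hv => planeMap_C h hH hv)
    (oneParam_pres_form turnFun_trig hJ hB fun v w => ?_) (fun h0 => by cases h0) _,
    oneParam_pres_herm turnFun_trig hJ hH (rotMap_skew hH) _, oneParam_pi_div_two hH hxx hyy hxy hJ⟩
  have e1 : ∀ u, H u (A' x) = form d id u x := fun u => (h.B_eq_left hB u hx).symm
  have e2 : ∀ u, H u x = -form d id u (A' x) := fun u => by
    rw [h.B_eq_left hB u hy, hAA, hH.neg_right, neg_neg]
  rw [planeMap_apply, planeMap_apply, e1, e1, e2, e2, hB.add_left, hB.add_right, hB.smul_left,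
    hB.smul_left, hB.smul_right, hB.smul_right, hB.symm_id x w, hB.symm_id (A' x) w, map_neg, map_one]
  simp only [id]
  ring

end Orthogonal

section Operator

variable {D : Type} [NormedDivisionRing D] [NormedAlgebra ℝ D] [StarRing D] [Coeff D]
variable {r : ℕ} {ρ : D →+* Matrix (Fin r) (Fin r) ℂ} {d : ℕ → ℕ → D} {σ : D → D}

/-- For skew-Hermitian forms, `A` lies in the group. -/
theorem exists_operator (hσ : ∀ d, σ d = star d) (hB : IsForm (form d σ) σ (-1))
    (L : Piece (form d σ)) (H : V D → V D → D) (A' : V D →ₗ[ℝ] V D)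
    (h : Adm (form d σ) (-1) L.V₁ L.C H A') :
    letI : TopologicalSpace (V D ≃ₗ[D] V D) := entryTop
    ∃ g ∈ idComponent (linΓ ρ d σ false L), Pres H g ∧ ∀ x ∈ L.V₁, g x = A' x := by
  have hH := h.herm
  let J : V D →ₗ[D] V D :=
    { toFun := fun x => A' (L.proj x)
      map_add' := fun x y => by rw [map_add, map_add]
      map_smul' := fun a x => by
        rw [map_smul, h.smul_of_star hB hσ a (L.proj_mem x), RingHom.id_apply] }
  have hJA : ∀ x ∈ L.V₁, J x = A' x := fun x hx => by
    change A' (L.proj x) = _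
    rw [L.proj_of_mem hx]
  have hJm : ∀ x, J x ∈ L.V₁ := fun x => h.A_mem _
  have hJJ : ∀ x, J (J x) = -L.proj x := fun x => by
    rw [hJA _ (hJm x)]
    change A' (A' (L.proj x)) = _
    rw [h.A_sq _ (L.proj_mem x), neg_one_smul]
  have hJ : ∀ x, J (J (J x)) = (-1 : ℝ) • J x := fun x => by
    rw [hJJ (J x), L.proj_of_mem (hJm x), neg_one_smul]
  have hskew : ∀ x y, H (J x) y = -H x (J y) := by
    intro x y
    rw [h.apply_proj (J x), h.apply_proj x (J y), L.proj_of_mem (hJm x), L.proj_of_mem (hJm y)]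
    change H (A' (L.proj x)) _ = -H _ (A' (L.proj y))
    rw [h.adj_star hB hσ (L.proj_mem x) (L.proj_mem y), map_neg, map_one, neg_one_mul]
  have hBJ : ∀ x y, form d σ x (J y) = -H x (L.proj y) := fun x y => by
    rw [h.B_eq_left hB x (hJm y), ← hJA _ (hJm y), hJJ, hH.neg_right]
  refine ⟨oneParam turnFun_trig hJ (Real.pi / 2), oneParam_mem turnFun_trig hJ
    hJm (fun v hv => ?_) (oneParam_pres_form turnFun_trig hJ hB fun v w => ?_)
    (fun h0 => by cases h0) _, oneParam_pres_herm turnFun_trig hJ hH hskew _, fun x hx => ?_⟩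
  · change A' (L.proj v) = 0
    rw [L.proj_of_mem_C hv, map_zero]
  · rw [hB.symm_star hσ w (J v), hBJ, hBJ, map_neg, map_one, star_neg, neg_mul_neg, one_mul, neg_neg,
      hH.star_symm, h.apply_proj v, h.apply_proj (L.proj v), L.proj_of_mem (L.proj_mem v),
      L.proj_of_mem (L.proj_mem w)]
  · rw [oneParam_apply, Real.sin_pi_div_two, Real.cos_pi_div_two, hJJ, L.proj_of_mem hx, hJA x hx]
    norm_num

end Operator

/-! ### The linear groups -/

/-- Maximal lim-compact subgroups are conjugate. -/
def LimSystem.Conj (S : LimSystem) : Prop :=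
  ∀ K K' : Subgroup S.G, IsMaximalLimCompact S K → IsMaximalLimCompact S K' →
    ∃ γ : S.G ≃* S.G,
      @Continuous _ _ S.limTop S.limTop γ ∧ @Continuous _ _ S.limTop S.limTop γ.symm ∧
        K.map γ.toMonoidHom = K'

section Linear

variable {D : Type} [NormedDivisionRing D] [NormedAlgebra ℝ D] [StarRing D] [Coeff D]
variable {r : ℕ} {ρ : D →+* Matrix (Fin r) (Fin r) ℂ} {h : ℕ → ℕ → D} {σ σ' : D → D} {δ : ℝ}
  {sp : Bool}

attribute [local instance] entryTop

/-- It suffices to prove rigidity for groups between the linear groups and their identity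
components. -/
theorem conj_linear (hB : IsForm (form h σ) σ' δ) (hσ0 : σ 0 = 0) (hσc : Continuous σ)
    (hρ : Continuous ρ) (hN : NormalForm (form h σ) δ)
    (hR : letI : TopologicalSpace (V D ≃ₗ[D] V D) := entryTop
      ∀ Γ : Piece (form h σ) → Subgroup (V D ≃ₗ[D] V D),
        (∀ L, idComponent (linΓ ρ h σ sp L) ≤ Γ L) → ∀ R : Rep σ' δ Γ (fun g => g), ∃ F, Rigid R F) :
    (linearSystem ρ h σ sp).Conj ∧ (linearSystem ρ h σ sp).connected.Conj := by
  letI : TopologicalSpace (V D ≃ₗ[D] V D) := entryTop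
  have R := rep_linear (sp := sp) hB hσ0 hσc hρ
  have T := transport_linear (ρ := ρ) (h := h) (σ := σ) (sp := sp)
  constructor
  · obtain ⟨F, hF⟩ := hR _ (fun L => idComponent_le _) R
    exact hF.conjugate T hN
  · obtain ⟨F, hF⟩ := hR _ (fun L => le_rfl) (R.connected continuous_mul_right_entry)
    exact hF.conjugate (Transport.connected T) hN

theorem conj_gl (hρ : Continuous ρ) : (linearSystem ρ (fun _ _ => 0) id sp).Conj ∧
    (linearSystem ρ (fun _ _ => 0) id sp).connected.Conj :=
  conj_linear isForm_zero rfl continuous_id hρ normalForm_zero fun Γ hΓ R =>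
    ⟨_, Rep.rigid_gl rfl fun L H A' hA x hx y hy hxx hyy hxy => by
      obtain ⟨g, hg, h1⟩ := exists_quarter_turn (ρ := ρ) (sp := sp) L H A' hA x hx y hy hxx hyy hxy
      exact ⟨g, hΓ L hg, h1⟩⟩

theorem conj_unitary (hρ : Continuous ρ) (hσ : ∀ d, σ d = star d) (ε : ℕ → ℤˣ) {ι : D}
    (hι : ι * ι = -1) (hι' : star ι = -ι) :
    (linearSystem ρ (diag fun i => ((ε i : ℤ) : D)) σ sp).Conj ∧
      (linearSystem ρ (diag fun i => ((ε i : ℤ) : D)) σ sp).connected.Conj := by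
  have hB := isForm_sign hσ ε
  have hσc : Continuous σ := by
    have : σ = star := funext hσ
    rw [this]
    exact continuous_star'
  refine conj_linear hB (by rw [hσ, star_zero]) hσc hρ (normalForm_sign hσ ε) fun Γ hΓ R =>
    ⟨_, HasAllFlips.rigid hσ ?_⟩
  intro L H A' hA x hx y hy hxx hyy hxy hAx hAy
  obtain ⟨g, hg, h1⟩ := hasAllFlips_linear (ρ := ρ) (sp := sp) hσ hB hι hι' L H A' hA x hx y hy
    hxx hyy hxy hAx hAy
  exact ⟨g, hΓ L hg, h1⟩

theorem conj_symplectic {𝕜 : Type} [RCLike 𝕜] {ρ : 𝕜 →+* Matrix (Fin r) (Fin r) ℂ}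
    (hρ : Continuous ρ) : (linearSystem ρ symplectic id false).Conj ∧
    (linearSystem ρ symplectic id false).connected.Conj :=
  conj_linear isForm_symplectic rfl continuous_id hρ normalForm_symplectic fun Γ hΓ R =>
    ⟨_, Rep.rigid_symplectic rfl fun L H A' hA x hx hxx => by
      obtain ⟨g, hg, h1⟩ := exists_symplectic_turn (ρ := ρ) isForm_symplectic L H A' hA x hx hxx
      exact ⟨g, hΓ L hg, h1⟩⟩

theorem conj_soStar {ρ : ℍ[ℝ] →+* Matrix (Fin r) (Fin r) ℂ} (hρ : Continuous ρ) :
    (linearSystem ρ (diag fun _ => quatI) star false).Conj ∧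
    (linearSystem ρ (diag fun _ => quatI) star false).connected.Conj :=
  conj_linear isForm_soStar (star_zero _) continuous_star' hρ normalForm_soStar fun Γ hΓ R =>
    ⟨_, Rep.rigid_of_operator rfl fun L H A' hA => by
      obtain ⟨g, hg, h1⟩ := exists_operator (ρ := ρ) (fun _ => rfl) isForm_soStar L H A' hA
      exact ⟨g, hΓ L hg, h1⟩⟩

theorem rigid_of_flips_soC {A : Type} [Group A] [TopologicalSpace A]
    {B : V ℂ → V ℂ → ℂ} {Γ : Piece B → Subgroup A} {ad : A → (V ℂ ≃ₗ[ℂ] V ℂ)} (R : Rep id 1 Γ ad)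
    (hQ : HasFlips Γ ad) : ∃ F, Rigid R F :=
  ⟨_, Rep.rigid_soC fun L H A' hA x hx y hy hxx hyy hxy hAx hAy => by
    obtain ⟨g, hg, h1, h2, -, h3⟩ := hQ L H A' hA x hx y hy hxx hyy hxy 1 (one_mul 1)
      (by rw [hAx, one_smul]) (by rw [hAy, one_smul])
    exact ⟨g, hg, h1, h2, h3⟩⟩

theorem conj_soC {ρ : ℂ →+* Matrix (Fin r) (Fin r) ℂ} (hρ : Continuous ρ) :
    (linearSystem ρ (diag fun _ => 1) id sp).Conj ∧
    (linearSystem ρ (diag fun _ => 1) id sp).connected.Conj :=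
  conj_linear isForm_soC rfl continuous_id hρ normalForm_soC fun Γ hΓ R =>
    rigid_of_flips_soC R fun L H A' hA x hx y hy hxx hyy hxy s hs hAx hAy => by
      obtain ⟨g, hg, h1⟩ := exists_flip_linear (ρ := ρ) (sp := sp) (δ := 1) isForm_soC hA hx hy hxx
        hyy hxy hs hAx hAy
      exact ⟨g, hΓ L hg, h1⟩

theorem conj_so {ρ : ℝ →+* Matrix (Fin r) (Fin r) ℂ} (hρ : Continuous ρ) (ε : ℕ → ℤˣ) :
    (linearSystem ρ (diag fun i => ((ε i : ℤ) : ℝ)) id sp).Conj ∧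
    (linearSystem ρ (diag fun i => ((ε i : ℤ) : ℝ)) id sp).connected.Conj := by
  have hB := isForm_sign id_eq_star ε
  refine conj_linear hB rfl continuous_id hρ (normalForm_sign id_eq_star ε) fun Γ hΓ R =>
    HasFlips.rigid_sign ?_ ?_ fun L k _ hk g _ => by
      have : k = 1 := hk
      rw [this, one_mul, mul_one]
  · intro L H A' hA x hx y hy hxx hyy hxy s hs hAx hAy
    obtain ⟨g, hg, h1⟩ := exists_flip_linear (ρ := ρ) (sp := sp) (δ := 1) hB hA hx hy hxx hyy hxy hs
      hAx hAy
    exact ⟨g, hΓ L hg, h1⟩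
  · intro L H A' hA f hf e he hff hee s hs hAf hAe
    obtain ⟨g, hg, h1⟩ := exists_boost_linear (ρ := ρ) (sp := sp) hB L H A' hA f hf e he hff hee s hs
      hAf hAe
    exact ⟨g, hΓ L hg, h1⟩

end Linear

theorem continuous_rhoR : Continuous rhoR := by
  refine continuous_matrix fun i j => ?_
  change Continuous fun x : ℝ => Matrix.scalar (Fin 1) (x : ℂ) i j
  have : i = j := Subsingleton.elim _ _
  subst this
  simpa using Complex.continuous_ofReal

theorem continuous_rhoC : Continuous rhoC := by
  refine continuous_matrix fun i j => ?_
  change Continuous fun x : ℂ => Matrix.scalar (Fin 1) x i j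
  have : i = j := Subsingleton.elim _ _
  subst this
  simpa using continuous_id'

theorem continuous_rhoH : Continuous rhoH := by
  have h (f g : ℍ[ℝ] → ℝ) (hf : Continuous f) (hg : Continuous g) :
      Continuous fun q => (⟨f q, g q⟩ : ℂ) := by
    have : (fun q => (⟨f q, g q⟩ : ℂ)) = fun q => (f q : ℂ) + (g q : ℂ) * Complex.I := by
      ext q
      exact Complex.mk_eq_add_mul_I _ _
    rw [this]
    exact (Complex.continuous_ofReal.comp hf).add ((Complex.continuous_ofReal.comp hg).mul
      continuous_const)
  have h1 := Quaternion.continuous_re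
  have h2 := Quaternion.continuous_imI
  have h3 := Quaternion.continuous_imJ
  have h4 := Quaternion.continuous_imK
  refine continuous_matrix fun i j => ?_
  fin_cases i <;> fin_cases j
  · exact h _ _ h1 h2
  · exact h _ _ h3 h4
  · exact h _ _ h3.neg h4
  · exact h _ _ h1 h2.neg

/-! ### The Clifford algebra -/

open CliffordAlgebra (ι involute reverse)

section Clifford

variable {𝕜 : Type} [RCLike 𝕜] {d : ℕ → 𝕜}

/-- The subalgebra of the Clifford algebra generated by a set of vectors. -/
abbrev cliffAdjoin (d : ℕ → 𝕜) (s : Set (V 𝕜)) : Subalgebra 𝕜 (CliffordAlgebra (quad d)) :=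
  Algebra.adjoin 𝕜 (ι (quad d) '' s)

instance invertibleTwo : Invertible (2 : 𝕜) := invertibleOfNonzero two_ne_zero

/-- A linear left inverse of the embedding of the vectors. -/
def vecPart (d : ℕ → 𝕜) : CliffordAlgebra (quad d) →ₗ[𝕜] V 𝕜 :=
  ExteriorAlgebra.ιInv ∘ₗ (CliffordAlgebra.equivExterior (quad d)).toLinearMap

theorem vecPart_ι (v : V 𝕜) : vecPart d (ι (quad d) v) = v := by
  have : CliffordAlgebra.equivExterior (quad d) (ι (quad d) v) = ExteriorAlgebra.ι 𝕜 v :=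
    CliffordAlgebra.changeForm_ι
      CliffordAlgebra.changeForm.associated_neg_proof v
  change ExteriorAlgebra.ιInv (CliffordAlgebra.equivExterior (quad d) (ι (quad d) v)) = v
  rw [this]
  exact ExteriorAlgebra.ι_leftInverse v

theorem ι_inj {v w : V 𝕜} (h : ι (quad d) v = ι (quad d) w) : v = w := by
  rw [← vecPart_ι (d := d) v, h, vecPart_ι]

theorem algebraMap_cliff_inj {a b : 𝕜} (h : algebraMap 𝕜 (CliffordAlgebra (quad d)) a =
    algebraMap 𝕜 (CliffordAlgebra (quad d)) b) : a = b :=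
  (algebraMap 𝕜 (CliffordAlgebra (quad d))).injective h

theorem quad_apply (x : V 𝕜) : quad d x = form (diag d) id x x := by
  simp only [quad, form, diag, LinearMap.BilinMap.toQuadraticMap_apply,
    Finsupp.linearCombination_apply, Finsupp.sum, LinearMap.sum_apply, LinearMap.smul_apply,
    Finsupp.lapply_apply, smul_eq_mul, id]
  refine Finset.sum_congr rfl fun i hi => ?_
  rw [Finset.sum_eq_single_of_mem i hi fun j _ hj => by simp [Ne.symm hj]]
  simp [mul_assoc]

variable (hB : IsForm (form (diag d) id) id 1)
include hB

theorem form_symm (x y : V 𝕜) : form (diag d) id y x = form (diag d) id x y := by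
  rw [hB.symm_id x y, map_one, one_mul]

theorem ι_anticomm (x y : V 𝕜) : ι (quad d) x * ι (quad d) y + ι (quad d) y * ι (quad d) x =
    algebraMap 𝕜 _ (2 * form (diag d) id x y) := by
  rw [CliffordAlgebra.ι_mul_ι_add_swap, QuadraticMap.polar, quad_apply, quad_apply, quad_apply,
    hB.add_left, hB.add_right, hB.add_right, form_symm hB x y]
  congr 1
  ring

/-- Vectors orthogonal to `s` commute with the algebra generated by `s`, up to a sign. -/
theorem ι_mul_of_orth {s : Set (V 𝕜)} {c : V 𝕜} (hc : ∀ x ∈ s, form (diag d) id c x = 0)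
    {z : CliffordAlgebra (quad d)} (hz : z ∈ cliffAdjoin d s) :
    ι (quad d) c * z = involute z * ι (quad d) c := by
  induction hz using Algebra.adjoin_induction with
  | mem x hx =>
    obtain ⟨v, hv, rfl⟩ := hx
    rw [CliffordAlgebra.involute_ι, neg_mul, ← add_eq_zero_iff_eq_neg, ι_anticomm hB, hc v hv,
      mul_zero, map_zero]
  | algebraMap r => rw [AlgHom.commutes, Algebra.commutes]
  | add x y _ _ hx hy => rw [mul_add, hx, hy, map_add, add_mul]
  | mul x y _ _ hx hy => rw [← mul_assoc, hx, mul_assoc, hy, ← mul_assoc, map_mul]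

omit hB in
theorem involute_mem_adjoin {s : Set (V 𝕜)} {z : CliffordAlgebra (quad d)}
    (hz : z ∈ cliffAdjoin d s) : involute z ∈ cliffAdjoin d s := by
  induction hz using Algebra.adjoin_induction with
  | mem x hx =>
    obtain ⟨v, hv, rfl⟩ := hx
    rw [CliffordAlgebra.involute_ι]
    exact Subalgebra.neg_mem _ (Algebra.subset_adjoin ⟨v, hv, rfl⟩)
  | algebraMap r => rw [AlgHom.commutes]; exact Subalgebra.algebraMap_mem _ r
  | add x y _ _ hx hy => rw [map_add]; exact Subalgebra.add_mem _ hx hy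
  | mul x y _ _ hx hy => rw [map_mul]; exact Subalgebra.mul_mem _ hx hy

theorem ι_sq_form (x : V 𝕜) : ι (quad d) x * ι (quad d) x =
    algebraMap 𝕜 _ (form (diag d) id x x) := by rw [CliffordAlgebra.ι_sq_scalar, quad_apply]

/-- The algebra generated by an orthogonal system of vectors, recursively. -/
theorem exists_add_ι_mul {x : V 𝕜} {s : Set (V 𝕜)} (hx : ∀ y ∈ s, form (diag d) id x y = 0)
    {z : CliffordAlgebra (quad d)} (hz : z ∈ cliffAdjoin d (insert x s)) :
    ∃ a ∈ cliffAdjoin d s, ∃ b ∈ cliffAdjoin d s, z = a + ι (quad d) x * b := by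
  induction hz using Algebra.adjoin_induction with
  | mem w hw =>
    obtain ⟨v, rfl | hv, rfl⟩ := hw
    · exact ⟨0, Subalgebra.zero_mem _, 1, Subalgebra.one_mem _, by rw [zero_add, mul_one]⟩
    · exact ⟨_, Algebra.subset_adjoin ⟨v, hv, rfl⟩, 0, Subalgebra.zero_mem _,
        by rw [mul_zero, add_zero]⟩
  | algebraMap r =>
    exact ⟨_, Subalgebra.algebraMap_mem _ r, 0, Subalgebra.zero_mem _, by rw [mul_zero, add_zero]⟩
  | add w z _ _ hw hz =>
    obtain ⟨a, ha, b, hb, rfl⟩ := hw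
    obtain ⟨a', ha', b', hb', rfl⟩ := hz
    exact ⟨_, Subalgebra.add_mem _ ha ha', _, Subalgebra.add_mem _ hb hb', by rw [mul_add]; abel⟩
  | mul w z _ _ hw hz =>
    obtain ⟨a, ha, b, hb, rfl⟩ := hw
    obtain ⟨a', ha', b', hb', rfl⟩ := hz
    have ea : a * ι (quad d) x = ι (quad d) x * involute a := by
      rw [ι_mul_of_orth hB hx (involute_mem_adjoin ha), CliffordAlgebra.involute_involute]
    have eb : b * ι (quad d) x = ι (quad d) x * involute b := by
      rw [ι_mul_of_orth hB hx (involute_mem_adjoin hb), CliffordAlgebra.involute_involute]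
    refine ⟨a * a' + algebraMap 𝕜 _ (form (diag d) id x x) * (involute b * b'),
      Subalgebra.add_mem _ (Subalgebra.mul_mem _ ha ha') (Subalgebra.mul_mem _
        (Subalgebra.algebraMap_mem _ _) (Subalgebra.mul_mem _ (involute_mem_adjoin hb) hb')),
      b * a' + involute a * b', Subalgebra.add_mem _ (Subalgebra.mul_mem _ hb ha')
        (Subalgebra.mul_mem _ (involute_mem_adjoin ha) hb'), ?_⟩
    rw [← ι_sq_form hB]
    have e1 : a * (ι (quad d) x * b') = ι (quad d) x * (involute a * b') := by
      rw [← mul_assoc, ea, mul_assoc]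
    have e2 : ι (quad d) x * b * (ι (quad d) x * b') =
        ι (quad d) x * ι (quad d) x * (involute b * b') := by
      rw [mul_assoc, ← mul_assoc b, eb]
      simp only [mul_assoc]
    rw [add_mul, mul_add, mul_add, e1, e2, mul_add]
    simp only [mul_assoc]
    abel

/-- Orthogonality of a list of vectors. -/
def Ortho (d : ℕ → 𝕜) (l : List (V 𝕜)) : Prop :=
  l.Pairwise (fun x y => form (diag d) id x y = 0) ∧ ∀ x ∈ l, form (diag d) id x x ≠ 0

omit hB in
theorem setOf_mem_cons (x : V 𝕜) (l : List (V 𝕜)) : {y | y ∈ x :: l} = insert x {y | y ∈ l} := by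
  ext y
  simp

omit hB in
theorem Ortho.cons {x : V 𝕜} {l : List (V 𝕜)} (h : Ortho d (x :: l)) :
    (∀ y ∈ {y | y ∈ l}, form (diag d) id x y = 0) ∧ form (diag d) id x x ≠ 0 ∧ Ortho d l :=
  ⟨(List.pairwise_cons.1 h.1).1, h.2 x (by simp), (List.pairwise_cons.1 h.1).2,
    fun y hy => h.2 y (by simp [hy])⟩

/-- The twisted center of the algebra generated by an orthogonal system consists of scalars. -/
theorem scalar_of_twisted_comm (l : List (V 𝕜)) (hl : Ortho d l) {z : CliffordAlgebra (quad d)}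
    (hz : z ∈ cliffAdjoin d {x | x ∈ l})
    (hc : ∀ x ∈ l, ι (quad d) x * z = involute z * ι (quad d) x) : ∃ c : 𝕜, z = algebraMap 𝕜 _ c := by
  induction l generalizing z with
  | nil =>
    have : {x : V 𝕜 | x ∈ ([] : List (V 𝕜))} = ∅ := by ext; simp
    rw [this, cliffAdjoin, Set.image_empty, Algebra.adjoin_empty, Algebra.mem_bot] at hz
    obtain ⟨c, hc⟩ := hz
    exact ⟨c, hc.symm⟩
  | cons x l ih =>
    obtain ⟨h1, h2, h3⟩ := hl.cons
    rw [setOf_mem_cons] at hz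
    obtain ⟨a, ha, b, hb, rfl⟩ := exists_add_ι_mul hB h1 hz
    have hx := hc x (by simp)
    rw [map_add, map_mul, CliffordAlgebra.involute_ι, mul_add, add_mul, ← ι_mul_of_orth hB h1 ha,
      add_right_inj, neg_mul, neg_mul, mul_assoc, ← ι_mul_of_orth hB h1 hb, eq_neg_iff_add_eq_zero,
      ← mul_assoc, ι_sq_form hB, ← two_smul 𝕜, ← Algebra.smul_def, smul_smul, smul_eq_zero,
      mul_eq_zero] at hx
    have hb0 : b = 0 := hx.resolve_left (not_or.2 ⟨two_ne_zero, h2⟩)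
    subst hb0
    rw [mul_zero, add_zero] at hc ⊢
    exact ih h3 ha fun y hy => hc y (by simp [hy])

theorem finite_cliffAdjoin (l : List (V 𝕜)) (hl : Ortho d l) :
    Module.Finite 𝕜 (cliffAdjoin d {x | x ∈ l}) := by
  suffices ∃ W : Submodule 𝕜 (CliffordAlgebra (quad d)), Module.Finite 𝕜 W ∧
      ∀ z ∈ cliffAdjoin d {x | x ∈ l}, z ∈ W by
    obtain ⟨W, hW, hle⟩ := this
    exact Submodule.finiteDimensional_of_le
      (show Subalgebra.toSubmodule (cliffAdjoin d {x | x ∈ l}) ≤ W from hle)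
  induction l with
  | nil =>
    refine ⟨𝕜 ∙ 1, inferInstance, fun z hz => ?_⟩
    obtain ⟨c, rfl⟩ := scalar_of_twisted_comm hB [] hl hz (by simp)
    exact Submodule.mem_span_singleton.2 ⟨c, (Algebra.algebraMap_eq_smul_one c).symm⟩
  | cons x l ih =>
    obtain ⟨h1, h2, h3⟩ := hl.cons
    obtain ⟨W, hW, hle⟩ := ih h3
    refine ⟨W ⊔ W.map (LinearMap.mulLeft 𝕜 (ι (quad d) x)), inferInstance, fun z hz => ?_⟩
    rw [setOf_mem_cons] at hz
    obtain ⟨a, ha, b, hb, rfl⟩ := exists_add_ι_mul hB h1 hz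
    exact Submodule.add_mem_sup (hle a ha) ⟨b, hle b hb, rfl⟩

end Clifford

section SpinAd

variable {𝕜 : Type} [RCLike 𝕜] {d : ℕ → 𝕜}

/-- The action of an element of a spin group on the vectors. -/
def spinAd (d : ℕ → 𝕜) (u : (CliffordAlgebra (quad d))ˣ) : V 𝕜 ≃ₗ[𝕜] V 𝕜 :=
  @dite _ (∃ T : V 𝕜 ≃ₗ[𝕜] V 𝕜, ∀ v, (u : CliffordAlgebra (quad d)) * ι (quad d) v =
    ι (quad d) (T v) * u) (_root_.Classical.propDecidable _) (fun h => h.choose) fun _ => 1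

theorem ι_conj_inj (u : (CliffordAlgebra (quad d))ˣ) {v w : V 𝕜}
    (h : ι (quad d) v * u = ι (quad d) w * (u : CliffordAlgebra (quad d))) : v = w :=
  ι_inj (u.isUnit.mul_right_cancel h)

theorem spinAd_spec {u : (CliffordAlgebra (quad d))ˣ}
    (hu : (u : CliffordAlgebra (quad d)) ∈ spinGroup (quad d)) (v : V 𝕜) :
    (u : CliffordAlgebra (quad d)) * ι (quad d) v = ι (quad d) (spinAd d u v) * u := by
  have key : ∃ T : V 𝕜 ≃ₗ[𝕜] V 𝕜, ∀ v, (u : CliffordAlgebra (quad d)) * ι (quad d) v =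
      ι (quad d) (T v) * u := by
    let f : (CliffordAlgebra (quad d))ˣ → V 𝕜 →ₗ[𝕜] V 𝕜 := fun u =>
      vecPart d ∘ₗ LinearMap.mulLeft 𝕜 (u : CliffordAlgebra (quad d)) ∘ₗ
        LinearMap.mulRight 𝕜 ((u⁻¹ : (CliffordAlgebra (quad d))ˣ) : CliffordAlgebra (quad d)) ∘ₗ
          ι (quad d)
    have hf : ∀ u ∈ lipschitzGroup (quad d), ∀ v, (u : CliffordAlgebra (quad d)) * ι (quad d) v =
        ι (quad d) (f u v) * u := by
      intro u hu v
      obtain ⟨w, hw⟩ := lipschitzGroup.conjAct_smul_ι_mem_range_ι hu v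
      rw [ConjAct.units_smul_def, ConjAct.ofConjAct_toConjAct] at hw
      have : f u v = w := by
        change vecPart d (u * (ι (quad d) v * ((u⁻¹ : (CliffordAlgebra (quad d))ˣ) : _))) = w
        rw [← mul_assoc, ← hw, vecPart_ι]
      rw [this, hw, Units.inv_mul_cancel_right]
    have hu' := spinGroup.units_mem_lipschitzGroup hu
    have hinv : ∀ u ∈ lipschitzGroup (quad d), ∀ v, f u (f u⁻¹ v) = v := by
      intro u hu v
      apply ι_conj_inj u
      have h1 := congrArg (fun z => (u : CliffordAlgebra (quad d)) * (z * u)) (hf u⁻¹ (inv_mem hu) v)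
      simp only [Units.inv_mul_cancel_right, mul_assoc, Units.mul_inv_cancel_left] at h1
      rw [← hf u hu, h1, Units.inv_mul, mul_one]
    refine ⟨LinearEquiv.ofLinear (f u) (f u⁻¹) (LinearMap.ext fun v => hinv u hu' v)
      (LinearMap.ext fun v => ?_), hf u hu'⟩
    have := hinv u⁻¹ (inv_mem hu') v
    rwa [inv_inv] at this
  rw [spinAd, dif_pos key]
  exact key.choose_spec v

theorem spinAd_eq {u : (CliffordAlgebra (quad d))ˣ}
    (hu : (u : CliffordAlgebra (quad d)) ∈ spinGroup (quad d)) {v w : V 𝕜}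
    (h : (u : CliffordAlgebra (quad d)) * ι (quad d) v = ι (quad d) w * u) : spinAd d u v = w :=
  ι_conj_inj u (by rw [← spinAd_spec hu, h])

theorem mem_spinOfPiece {L : Piece (form (diag d) id)} {u : (CliffordAlgebra (quad d))ˣ} :
    u ∈ spinOfPiece d L ↔ (u : CliffordAlgebra (quad d)) ∈ spinGroup (quad d) ∧
      (u : CliffordAlgebra (quad d)) ∈ cliffAdjoin d L.V₁ := Iff.rfl

variable (hB : IsForm (form (diag d) id) id 1)
include hB

theorem spinAd_form {u : (CliffordAlgebra (quad d))ˣ}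
    (hu : (u : CliffordAlgebra (quad d)) ∈ spinGroup (quad d)) (x y : V 𝕜) :
    form (diag d) id (spinAd d u x) (spinAd d u y) = form (diag d) id x y := by
  refine mul_left_cancel₀ (two_ne_zero' 𝕜) (algebraMap_cliff_inj (d := d) (u.isUnit.mul_right_cancel ?_))
  have h : ∀ a b, ι (quad d) (spinAd d u a) * ι (quad d) (spinAd d u b) * u =
      u * (ι (quad d) a * ι (quad d) b) := by
    intro a b
    rw [mul_assoc, ← spinAd_spec hu, ← mul_assoc, ← spinAd_spec hu, mul_assoc]
  rw [← ι_anticomm hB, ← ι_anticomm hB, add_mul, h, h, ← mul_add, ι_anticomm hB, Algebra.commutes]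

theorem spinAd_stab {L : Piece (form (diag d) id)} {u : (CliffordAlgebra (quad d))ˣ}
    (hu : u ∈ spinOfPiece d L) : spinAd d u ∈ L.stab := by
  have hC : ∀ c ∈ L.C, spinAd d u c = c := fun c hc => spinAd_eq hu.1 <| by
    rw [ι_mul_of_orth hB (fun x hx => (form_symm hB x c).trans (L.orth x hx c hc)) hu.2,
      spinGroup.involute_eq hu.1]
  refine ⟨fun x => ?_, hC⟩
  have hx : spinAd d u x - x = spinAd d u (L.proj x) - L.proj x := by
    have := hC _ (L.sub_proj_mem x)
    rw [map_sub] at this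
    exact sub_eq_sub_iff_sub_eq_sub.2 this
  rw [hx]
  refine L.V₁.sub_mem ?_ (L.proj_mem x)
  have hy := L.proj_mem x
  set y := L.proj x
  set w := spinAd d u y with hw
  have h0 : w - L.proj w = 0 := by
    refine hB.nondeg one_ne_zero _ fun z => ?_
    have hwc := L.sub_proj_mem w
    have e : z = L.proj z + (z - L.proj z) := by abel
    have e1 : form (diag d) id w (z - L.proj z) = 0 := by
      have := spinAd_form hB hu.1 y (z - L.proj z)
      rwa [hC _ (L.sub_proj_mem z), L.orth y hy _ (L.sub_proj_mem z)] at this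
    have e2 : form (diag d) id (w - L.proj w) (z - L.proj z) = 0 := by
      have h1 := hB.add_left (w - L.proj w) (L.proj w) (z - L.proj z)
      rwa [sub_add_cancel, e1, L.orth _ (L.proj_mem w) _ (L.sub_proj_mem z), add_zero, eq_comm] at h1
    rw [e, hB.add_right, form_symm hB, L.orth _ (L.proj_mem z) _ hwc, e2, add_zero]
  rw [sub_eq_zero.1 h0]
  exact L.proj_mem w

/-- The kernel of the action of a spin group is central. -/
theorem spin_ker_central {L : Piece (form (diag d) id)} {l : List (V 𝕜)} (hl : Ortho d l)
    (hlL : cliffAdjoin d {x | x ∈ l} = cliffAdjoin d L.V₁) {k : (CliffordAlgebra (quad d))ˣ}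
    (hk : k ∈ spinOfPiece d L) (h1 : spinAd d k = 1) (g : (CliffordAlgebra (quad d))ˣ) :
    k * g = g * k := by
  obtain ⟨c, hc⟩ := scalar_of_twisted_comm hB l hl (hlL.symm ▸ (mem_spinOfPiece.1 hk).2) fun x hx => by
    rw [spinGroup.involute_eq hk.1, spinAd_spec hk.1, h1]
    rfl
  refine Units.ext ?_
  rw [Units.val_mul, Units.val_mul, hc, Algebra.commutes]

end SpinAd

section Products

variable {𝕜 : Type} [RCLike 𝕜] {d : ℕ → 𝕜}

/-- The reflection in the hyperplane orthogonal to `x`. -/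
def refl (d : ℕ → 𝕜) (x v : V 𝕜) : V 𝕜 :=
  v - (2 * form (diag d) id x v / form (diag d) id x x) • x

/-- A product of reflections. -/
def refls (d : ℕ → 𝕜) (l : List (V 𝕜)) (v : V 𝕜) : V 𝕜 := l.foldr (refl d) v

/-- The product of vectors in the Clifford algebra. -/
def vprod (d : ℕ → 𝕜) (l : List (V 𝕜)) : CliffordAlgebra (quad d) := (l.map (ι (quad d))).prod

/-- The product of the squares of vectors. -/
def qprod (d : ℕ → 𝕜) (l : List (V 𝕜)) : 𝕜 := (l.map fun x => form (diag d) id x x).prod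

theorem vprod_cons (x : V 𝕜) (l : List (V 𝕜)) : vprod d (x :: l) = ι (quad d) x * vprod d l := by
  simp [vprod]

theorem vprod_mem {s : Set (V 𝕜)} {l : List (V 𝕜)} (h : ∀ x ∈ l, x ∈ s) :
    vprod d l ∈ cliffAdjoin d s := by
  refine Subalgebra.list_prod_mem _ fun z hz => ?_
  obtain ⟨x, hx, rfl⟩ := List.mem_map.1 hz
  exact Algebra.subset_adjoin ⟨x, h x hx, rfl⟩

theorem involute_vprod (l : List (V 𝕜)) : involute (vprod d l) = (-1 : 𝕜) ^ l.length • vprod d l :=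
  CliffordAlgebra.involute_prod_map_ι l

variable (hB : IsForm (form (diag d) id) id 1)
include hB

theorem vprod_mul_ι {l : List (V 𝕜)} (hl : qprod d l ≠ 0) (v : V 𝕜) :
    vprod d l * ι (quad d) v = (-1 : 𝕜) ^ l.length • (ι (quad d) (refls d l v) * vprod d l) := by
  induction l with
  | nil => simp [vprod, refls]
  | cons x l ih =>
    have h2 : form (diag d) id x x ≠ 0 ∧ qprod d l ≠ 0 := by
      rw [qprod, List.map_cons, List.prod_cons] at hl
      exact mul_ne_zero_iff.1 hl
    have key : ∀ w, ι (quad d) x * ι (quad d) w =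
        -(ι (quad d) (refl d x w) * ι (quad d) x) := by
      intro w
      rw [refl, map_sub, map_smul, sub_mul, smul_mul_assoc, ι_sq_form hB, Algebra.smul_def,
        ← map_mul (algebraMap 𝕜 _), div_mul_cancel₀ _ h2.1, ← ι_anticomm hB]
      abel
    rw [vprod_cons, mul_assoc, ih h2.2, mul_smul_comm, ← mul_assoc, key, List.length_cons, pow_succ,
      mul_neg_one, neg_smul, neg_mul, smul_neg, mul_assoc]
    rfl

theorem reverse_mul_vprod (l : List (V 𝕜)) :
    reverse (vprod d l) * vprod d l = algebraMap 𝕜 _ (qprod d l) := by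
  induction l with
  | nil => simp [vprod, qprod]
  | cons x l ih =>
    rw [vprod_cons, CliffordAlgebra.reverse.map_mul, CliffordAlgebra.reverse_ι, mul_assoc,
      ← mul_assoc (ι (quad d) x), ι_sq_form hB, Algebra.left_comm, ih, ← map_mul, qprod, qprod,
      List.map_cons, List.prod_cons]

/-- Multiples of even products of vectors lie in the spin group if they are normalized. -/
theorem exists_spin {L : Piece (form (diag d) id)} {l : List (V 𝕜)} (hl : ∀ x ∈ l, x ∈ L.V₁)
    (he : Even l.length) {b : 𝕜} (hq : b ^ 2 * qprod d l = 1) : ∃ u ∈ spinOfPiece d L,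
      (u : CliffordAlgebra (quad d)) = b • vprod d l ∧ ∀ v, spinAd d u v = refls d l v := by
  have h1 : ∀ l : List (V 𝕜), qprod d l ≠ 0 →
      ∃ u ∈ lipschitzGroup (quad d), (u : CliffordAlgebra (quad d)) = vprod d l := by
    intro l
    induction l with
    | nil => exact fun _ => ⟨1, one_mem _, by simp [vprod]⟩
    | cons x l ih =>
      intro hl
      rw [qprod, List.map_cons, List.prod_cons] at hl
      obtain ⟨hx, hl⟩ := mul_ne_zero_iff.1 hl
      obtain ⟨u, hu, hul⟩ := ih hl
      let w : (CliffordAlgebra (quad d))ˣ :=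
        ⟨ι (quad d) x, (form (diag d) id x x)⁻¹ • ι (quad d) x, by
          rw [mul_smul_comm, ι_sq_form hB, Algebra.smul_def, ← map_mul, inv_mul_cancel₀ hx, map_one],
          by rw [smul_mul_assoc, ι_sq_form hB, Algebra.smul_def, ← map_mul, inv_mul_cancel₀ hx,
            map_one]⟩
      exact ⟨w * u, mul_mem (Subgroup.subset_closure ⟨x, rfl⟩) hu, by
        rw [vprod_cons, Units.val_mul, hul]⟩
  have hq0 : b ≠ 0 ∧ qprod d l ≠ 0 := by
    constructor <;> rintro h0 <;> simp [h0] at hq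
  obtain ⟨x₀, hx₀⟩ : ∃ x : V 𝕜, form (diag d) id x x ≠ 0 := by
    by_contra! h
    have : (Finsupp.single 0 1 : V 𝕜) = 0 := hB.nondeg one_ne_zero _ fun y => by
      have h2 := h (Finsupp.single 0 1 + y)
      rw [hB.add_left, hB.add_right, hB.add_right, h, h, form_symm hB, zero_add, add_zero,
        ← two_mul, mul_eq_zero] at h2
      rw [form_symm hB]
      exact h2.resolve_left two_ne_zero
    simp at this
  obtain ⟨u, hu, hul⟩ := h1 ((b / form (diag d) id x₀ x₀) • x₀ :: x₀ :: l) (by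
    simp only [qprod, List.map_cons, List.prod_cons, hB.smul_left, hB.smul_right]
    have := hq0.2
    simp only [qprod] at this
    simp [hq0.1, hx₀, this])
  rw [vprod_cons, vprod_cons, map_smul, smul_mul_assoc, ← mul_assoc, ι_sq_form hB, ← Algebra.smul_def,
    smul_smul, div_mul_cancel₀ _ hx₀] at hul
  have hs : star (b • vprod d l) * (b • vprod d l) = 1 := by
    rw [CliffordAlgebra.star_smul, CliffordAlgebra.star_def, involute_vprod, he.neg_one_pow, one_smul,
      smul_mul_assoc, mul_smul_comm, reverse_mul_vprod hB, smul_smul, ← pow_two, Algebra.smul_def,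
      ← map_mul, hq, map_one]
  have hev : vprod d l ∈ CliffordAlgebra.even (quad d) := by
    have := SetLike.list_prod_map_mem_graded (A := CliffordAlgebra.evenOdd (quad d)) l (fun _ => 1)
      (ι (quad d)) fun x _ => CliffordAlgebra.ι_mem_evenOdd_one _ x
    have e : (l.map fun _ => (1 : ZMod 2)).sum = 0 := by
      rw [List.map_const', List.sum_replicate, nsmul_one]
      exact (ZMod.natCast_eq_zero_iff_even).2 he
    rwa [e] at this
  have hsp : (u : CliffordAlgebra (quad d)) ∈ spinGroup (quad d) := by
    refine ⟨pinGroup.units_mem_iff.2 ⟨hu, ?_, ?_⟩, by rw [hul]; exact Subalgebra.smul_mem _ hev b⟩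
    · rw [hul, hs]
    · rw [← hul] at hs
      rw [← Units.inv_eq_of_mul_eq_one_left hs, Units.mul_inv]
  refine ⟨u, ⟨hsp, by rw [hul]; exact Subalgebra.smul_mem _ (vprod_mem hl) b⟩, hul,
    fun v => spinAd_eq hsp ?_⟩
  rw [hul, smul_mul_assoc, vprod_mul_ι hB hq0.2, he.neg_one_pow, one_smul, mul_smul_comm]

end Products

section FinCont

variable {𝕜 : Type} [RCLike 𝕜] {X : Type} [TopologicalSpace X]

/-- Continuous maps to a finite-dimensional subspace of a vector space without a topology. -/
inductive FinCont {E : Type} [AddCommGroup E] [Module 𝕜 E] : (X → E) → Prop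
  | smul (f : X → 𝕜) (hf : Continuous f) (b : E) : FinCont fun x => f x • b
  | add (f g : X → E) (hf : FinCont f) (hg : FinCont g) : FinCont fun x => f x + g x

namespace FinCont

variable {E E' : Type} [AddCommGroup E] [Module 𝕜 E] [AddCommGroup E'] [Module 𝕜 E']

theorem const (b : E) : FinCont (𝕜 := 𝕜) fun _ : X => b := by
  simpa using FinCont.smul (fun _ : X => (1 : 𝕜)) continuous_const b

theorem sum {ι : Type} (s : Finset ι) {f : ι → X → E} (hf : ∀ i ∈ s, FinCont (𝕜 := 𝕜) (f i)) :
    FinCont (𝕜 := 𝕜) fun x => ∑ i ∈ s, f i x := by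
  classical
  induction s using Finset.induction_on with
  | empty => exact const 0
  | insert i s hi ih =>
    simp only [Finset.sum_insert hi]
    exact add _ _ (hf i (by simp)) (ih fun j hj => hf j (by simp [hj]))

theorem map {f : X → E} (hf : FinCont (𝕜 := 𝕜) f) (φ : E →ₗ[𝕜] E') :
    FinCont (𝕜 := 𝕜) fun x => φ (f x) := by
  induction hf with
  | smul f hf b => simpa using smul f hf (φ b)
  | add f g _ _ hf hg => simpa using add _ _ hf hg

theorem comp {Y : Type} [TopologicalSpace Y] {f : X → E} (hf : FinCont (𝕜 := 𝕜) f) {g : Y → X}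
    (hg : Continuous g) : FinCont (𝕜 := 𝕜) fun y => f (g y) := by
  induction hf with
  | smul f hf b => exact smul _ (hf.comp hg) b
  | add f f' _ _ hf hf' => exact add _ _ hf hf'

theorem continuous {f : X → E} (hf : FinCont (𝕜 := 𝕜) f) (φ : E →ₗ[𝕜] 𝕜) :
    Continuous fun x => φ (f x) := by
  induction hf with
  | smul f hf b => simp only [map_smul]; exact hf.smul continuous_const
  | add f g _ _ hf hg => simp only [map_add]; exact Continuous.add hf hg

theorem isClosed_eq {f : X → E} (hf : FinCont (𝕜 := 𝕜) f) (b : E) : IsClosed {x | f x = b} := by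
  have : {x | f x = b} = ⋂ φ : Module.Dual 𝕜 E, {x | φ (f x) = φ b} := by
    ext x
    simp only [Set.mem_setOf_eq, Set.mem_iInter]
    refine ⟨fun h φ => by rw [h], fun h => sub_eq_zero.1 ?_⟩
    exact (Module.forall_dual_apply_eq_zero_iff 𝕜 _).1 fun φ => by rw [map_sub, h, sub_self]
  rw [this]
  exact isClosed_iInter fun φ => _root_.isClosed_eq (hf.continuous φ) continuous_const

theorem mul {R : Type} [Ring R] [Algebra 𝕜 R] {f g : X → R} (hf : FinCont (𝕜 := 𝕜) f)
    (hg : FinCont (𝕜 := 𝕜) g) : FinCont (𝕜 := 𝕜) fun x => f x * g x := by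
  induction hf with
  | smul f hf b =>
    induction hg with
    | smul g hg c => simpa [smul_smul, mul_comm] using smul _ (hf.mul hg) (b * c)
    | add g g' _ _ hg hg' => simpa [mul_add] using add _ _ hg hg'
  | add f f' _ _ hf hf' => simpa [add_mul] using add _ _ hf hf'

theorem vprod {d : ℕ → 𝕜} {k : ℕ} {f : Fin k → X → V 𝕜} (hf : ∀ i, FinCont (𝕜 := 𝕜) (f i)) :
    FinCont (𝕜 := 𝕜) fun x => LimGroups.vprod d (List.ofFn fun i => f i x) := by
  induction k with
  | zero => simpa using const _
  | succ k ih =>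
    simp only [List.ofFn_succ, vprod_cons]
    exact ((hf 0).map (ι (quad d))).mul (ih fun i => hf i.succ)

end FinCont

end FinCont

section DualTop

variable {𝕜 : Type} [RCLike 𝕜] {E : Type} [Ring E] [Algebra 𝕜 E]

theorem continuous_dual (f : Module.Dual 𝕜 E) :
    @Continuous _ _ (dualTop (F := 𝕜)) _ fun u : Eˣ => f (u : E) :=
  continuous_iInf_dom (i := f) continuous_induced_dom

theorem continuous_to_dual {X : Type} [TopologicalSpace X] {g : X → Eˣ}
    (hg : ∀ f : Module.Dual 𝕜 E, Continuous fun x => f (g x : E)) :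
    @Continuous _ _ _ (dualTop (F := 𝕜)) g :=
  continuous_iInf_rng.2 fun f => continuous_induced_rng.2 (hg f)

theorem FinCont.continuous_units {X : Type} [TopologicalSpace X] {f : X → E}
    (hf : FinCont (𝕜 := 𝕜) f) {g : X → Eˣ} (hg : ∀ x, (g x : E) = f x) :
    @Continuous _ _ _ (dualTop (F := 𝕜)) g :=
  continuous_to_dual fun φ => by
    simp only [hg]
    exact hf.continuous φ

theorem continuous_mul_right_dual (a : Eˣ) :
    @Continuous _ _ (dualTop (F := 𝕜)) (dualTop (F := 𝕜)) fun x : Eˣ => x * a := by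
  letI : TopologicalSpace Eˣ := dualTop (F := 𝕜)
  exact continuous_to_dual fun f => continuous_dual (f ∘ₗ LinearMap.mulRight 𝕜 (a : E))

/-- The inclusion of a set of units that lies in a finite-dimensional subspace. -/
theorem FinCont.subtype (W : Submodule 𝕜 E) [FiniteDimensional 𝕜 W] (s : Set Eˣ)
    (hs : ∀ u ∈ s, (u : E) ∈ W) :
    letI : TopologicalSpace Eˣ := dualTop (F := 𝕜)
    FinCont (𝕜 := 𝕜) fun u : s => ((u : Eˣ) : E) := by
  letI : TopologicalSpace Eˣ := dualTop (F := 𝕜)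
  let b := Module.finBasis 𝕜 W
  choose f hf using fun k => LinearMap.exists_extend (b.coord k)
  have : (fun u : s => ((u : Eˣ) : E)) = fun u : s => ∑ k, f k ((u : Eˣ) : E) • (b k : E) := by
    funext u
    have h1 := congrArg Subtype.val (b.sum_repr ⟨_, hs u u.2⟩)
    rw [Submodule.coe_sum] at h1
    refine h1.symm.trans (Finset.sum_congr rfl fun k _ => ?_)
    have h2 := LinearMap.congr_fun (hf k) ⟨_, hs u u.2⟩
    change f k ((u : Eˣ) : E) = _ at h2
    rw [h2]
    rfl
  rw [this]
  exact sum _ fun k _ => smul _ ((continuous_dual (f k)).comp continuous_subtype_val) _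

end DualTop

section Eigenbasis

variable {𝕜 : Type} [RCLike 𝕜] {d : ℕ → 𝕜} {L : Piece (form (diag d) id)} {H : V 𝕜 → V 𝕜 → 𝕜}
  {A' : V 𝕜 →ₗ[ℝ] V 𝕜}

/-- Normalized eigenvectors of the operator that relates the two forms. -/
def Eigen (L : Piece (form (diag d) id)) (H : V 𝕜 → V 𝕜 → 𝕜) (A' : V 𝕜 →ₗ[ℝ] V 𝕜) (x : V 𝕜) :
    Prop := x ∈ L.V₁ ∧ H x x = 1 ∧ (A' x = x ∨ A' x = -x)

theorem Eigen.exists_sign {x : V 𝕜} (hx : Eigen L H A' x) : ∃ s : ℝ, s * s = 1 ∧ A' x = s • x := by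
  rcases hx.2.2 with h | h
  · exact ⟨1, one_mul 1, by rw [h, one_smul]⟩
  · exact ⟨-1, by norm_num, by rw [h, neg_one_smul]⟩

theorem Eigen.of_sign {x : V 𝕜} (hx : x ∈ L.V₁) (hxx : H x x = 1) {s : ℝ} (hs : s * s = 1)
    (hA : A' x = s • x) : Eigen L H A' x := by
  refine ⟨hx, hxx, ?_⟩
  rcases mul_self_eq_one_iff.1 hs with rfl | rfl
  · exact Or.inl (by rw [hA, one_smul])
  · exact Or.inr (by rw [hA, neg_one_smul])

variable (hB : IsForm (form (diag d) id) id 1)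
include hB

theorem Piece.exists_adm (L : Piece (form (diag d) id)) :
    ∃ H A', Adm (form (diag d) id) 1 L.V₁ L.C H A' := by
  haveI := L.finite
  obtain ⟨N, hN⟩ := exists_below_of_fg (U := L.V₁)
  let c : V 𝕜 →ₗ[ℝ] (Fin N → 𝕜) :=
    { toFun := fun x i => x i
      map_add' := fun x y => rfl
      map_smul' := fun r x => rfl }
  obtain ⟨H, A', hA, -⟩ := LimGroups.exists_adm hB L.isCompl L.orth ⊥
    (by intro g hg x hx; rw [Subgroup.mem_bot.1 hg]; exact hx)
    (by intro g hg x y; rw [Subgroup.mem_bot.1 hg]; rfl) c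
    (by
      intro x hx h0
      ext i
      by_cases hi : i < N
      · exact congrFun h0 ⟨i, hi⟩
      · exact hN hx i (not_lt.1 hi))
    (fun x hx => ⟨‖c x‖, by intro g hg; rw [Subgroup.mem_bot.1 hg]; rfl⟩)
  exact ⟨H, A', hA⟩

variable (hA : Adm (form (diag d) id) 1 L.V₁ L.C H A')
include hA

theorem herm_A_left {v x : V 𝕜} (hv : v ∈ L.V₁) (hx : x ∈ L.V₁) {s : ℝ} (hAx : A' x = s • x) :
    H (A' v) x = oR 𝕜 s * star (H v x) := by
  rw [hA.adj_id hB hv hx, map_one, one_mul, hAx, hA.herm.rsmul_right, star_mul, star_oR]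

theorem exists_eigenbasis : ∃ l : List (V 𝕜), (∀ x ∈ l, Eigen L H A' x) ∧
    l.Pairwise (fun x y => H x y = 0) ∧ L.V₁ = Submodule.span 𝕜 {x | x ∈ l} := by
  haveI := L.finite
  suffices key : ∀ (n : ℕ) (U : Submodule 𝕜 (V 𝕜)), U ≤ L.V₁ → (∀ x ∈ U, A' x ∈ U) →
      Module.finrank 𝕜 U ≤ n → ∃ l : List (V 𝕜), (∀ x ∈ l, x ∈ U ∧ Eigen L H A' x) ∧
        l.Pairwise (fun x y => H x y = 0) ∧ U ≤ Submodule.span 𝕜 {x | x ∈ l} by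
    obtain ⟨l, h1, h2, h3⟩ := key _ L.V₁ le_rfl (fun x _ => hA.A_mem x) le_rfl
    exact ⟨l, fun x hx => (h1 x hx).2, h2, le_antisymm h3
      (Submodule.span_le.2 fun x hx => (h1 x hx).1)⟩
  intro n
  induction n with
  | zero =>
    intro U hU _ hn
    haveI := Submodule.finiteDimensional_of_le hU
    refine ⟨[], by simp, List.Pairwise.nil, ?_⟩
    rw [Submodule.finrank_eq_zero.1 (Nat.le_zero.1 hn)]
    exact bot_le
  | succ n ih =>
    intro U hU hUA hn
    haveI := Submodule.finiteDimensional_of_le hU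
    by_cases h0 : U = ⊥
    · exact ⟨[], by simp, List.Pairwise.nil, h0 ▸ bot_le⟩
    obtain ⟨v, hv, hv0⟩ := Submodule.exists_mem_ne_zero_of_ne_bot h0
    obtain ⟨w, hw, hw0, s, hs, hAw⟩ : ∃ w ∈ U, w ≠ 0 ∧ ∃ s : ℝ, s * s = 1 ∧ A' w = s • w := by
      by_cases h1 : v + A' v = 0
      · exact ⟨v, hv, hv0, -1, by norm_num, by rw [neg_one_smul]; exact eq_neg_of_add_eq_zero_right h1⟩
      · refine ⟨v + A' v, U.add_mem hv (hUA v hv), h1, 1, one_mul 1, ?_⟩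
        rw [map_add, hA.A_sq v (hU hv), one_smul, one_smul, add_comm]
    obtain ⟨r, hr, hxx⟩ := hA.exists_unit (hU hw) hw0
    set x := r • w with hxdef
    have hx : x ∈ U := U.smul_of_tower_mem r hw
    have hAx : A' x = s • x := by rw [hxdef, map_smul, hAw, smul_comm]
    let U' : Submodule 𝕜 (V 𝕜) := U ⊓ LinearMap.ker (hA.herm.lin x hA.herm)
    have hmem : ∀ z, z ∈ U' ↔ z ∈ U ∧ H z x = 0 := fun z => Iff.rfl
    have hlt : U' < U := by
      refine lt_of_le_of_ne inf_le_left fun h => ?_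
      have := ((hmem x).1 (h.symm ▸ hx)).2
      rw [hxx] at this
      exact one_ne_zero this
    obtain ⟨l, h1, h2, h3⟩ := ih U' (inf_le_left.trans hU)
      (fun z hz => (hmem _).2 ⟨hUA z hz.1, by
        rw [herm_A_left hB hA (hU hz.1) (hU hx) hAx, ((hmem z).1 hz).2, star_zero, mul_zero]⟩)
      (Nat.lt_succ_iff.1 (lt_of_lt_of_le (Submodule.finrank_lt_finrank_of_lt hlt) hn))
    refine ⟨x :: l, ?_, List.pairwise_cons.2 ⟨fun y hy =>
      hA.herm.eq_zero_symm ((hmem y).1 (h1 y hy).1).2, h2⟩, fun z hz => ?_⟩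
    · intro y hy
      rcases List.mem_cons.1 hy with rfl | hy
      · exact ⟨hx, Eigen.of_sign (hU hx) hxx hs hAx⟩
      · exact ⟨(h1 y hy).1.1, (h1 y hy).2⟩
    · have hz' : z - H z x • x ∈ U' := (hmem _).2 ⟨U.sub_mem hz (U.smul_mem _ hx), by
        rw [hA.herm.sub_left, hA.herm.smul_left, hxx, mul_one, sub_self]⟩
      have := Submodule.add_mem _ (Submodule.span_mono (s := {y | y ∈ l}) (t := {y | y ∈ x :: l})
        (fun y hy => List.mem_cons_of_mem x hy) (h3 hz'))
        (Submodule.smul_mem _ (H z x) (Submodule.subset_span (s := {y | y ∈ x :: l}) (a := x) (by simp)))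
      rwa [sub_add_cancel] at this

theorem Eigen.form_left {x : V 𝕜} (hx : Eigen L H A' x) :
    ∃ s : ℝ, s * s = 1 ∧ A' x = s • x ∧ ∀ v, form (diag d) id x v = oR 𝕜 s * H v x := by
  obtain ⟨s, hs, hAx⟩ := hx.exists_sign
  exact ⟨s, hs, hAx, fun v => by rw [form_symm hB, hA.B_eigen_left hB hx.1 hAx]⟩

theorem ortho_eigen {l : List (V 𝕜)} (h1 : ∀ x ∈ l, Eigen L H A' x)
    (h2 : l.Pairwise fun x y => H x y = 0) : Ortho d l := by
  refine ⟨h2.imp_of_mem fun {x y} hx _ hxy => ?_, fun x hx => ?_⟩ <;>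
    obtain ⟨s, hs, -, h3⟩ := (h1 x hx).form_left hB hA
  · rw [h3, hA.herm.eq_zero_symm hxy, mul_zero]
  · rw [h3, (h1 x hx).2.1, mul_one, ← map_zero (oR 𝕜), Ne, oR_inj]
    rintro rfl
    norm_num at hs

omit hA in
theorem cliffAdjoin_span (l : List (V 𝕜)) (h : L.V₁ = Submodule.span 𝕜 {x | x ∈ l}) :
    cliffAdjoin d {x | x ∈ l} = cliffAdjoin d L.V₁ := by
  rw [h, cliffAdjoin, cliffAdjoin, ← Submodule.map_coe, Submodule.map_span, Algebra.adjoin_span]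

omit hA in
/-- Each piece has an orthogonal system. -/
theorem Piece.exists_ortho (L : Piece (form (diag d) id)) :
    ∃ l, Ortho d l ∧ cliffAdjoin d {x | x ∈ l} = cliffAdjoin d L.V₁ := by
  obtain ⟨H, A', hA⟩ := L.exists_adm hB
  obtain ⟨l, h1, h2, h3⟩ := exists_eigenbasis hB hA
  exact ⟨l, ortho_eigen hB hA h1 h2, cliffAdjoin_span hB l h3⟩

end Eigenbasis

section Reflections

variable {𝕜 : Type} [RCLike 𝕜] {d : ℕ → 𝕜} {L : Piece (form (diag d) id)} {H : V 𝕜 → V 𝕜 → 𝕜}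
  {A' : V 𝕜 →ₗ[ℝ] V 𝕜} (hB : IsForm (form (diag d) id) id 1)
  (hA : Adm (form (diag d) id) 1 L.V₁ L.C H A')
include hB hA

theorem Eigen.refl_eq {x : V 𝕜} (hx : Eigen L H A' x) (v : V 𝕜) :
    refl d x v = v - (2 * H v x) • x := by
  obtain ⟨s, hs, -, h⟩ := hx.form_left hB hA
  have hs0 : oR 𝕜 s ≠ 0 := by
    rw [← map_zero (oR 𝕜), Ne, oR_inj]
    rintro rfl
    norm_num at hs
  rw [refl, h, h, hx.2.1, mul_one, mul_left_comm, mul_div_cancel_left₀ _ hs0]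

theorem Eigen.refl_mem {x v : V 𝕜} (hx : Eigen L H A' x) (hv : v ∈ L.V₁) : refl d x v ∈ L.V₁ := by
  rw [hx.refl_eq hB hA]
  exact L.V₁.sub_mem hv (L.V₁.smul_mem _ hx.1)

theorem Eigen.refl_herm {x : V 𝕜} (hx : Eigen L H A' x) (v w : V 𝕜) :
    H (refl d x v) (refl d x w) = H v w := by
  have h2 : star (2 : 𝕜) = 2 := by rw [RCLike.star_def]; exact RCLike.conj_ofNat 2
  rw [hx.refl_eq hB hA, hx.refl_eq hB hA, hA.herm.sub_left, hA.herm.sub_right, hA.herm.sub_right,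
    hA.herm.smul_left, hA.herm.smul_left, hA.herm.smul_right, hA.herm.smul_right, hx.2.1, star_mul,
    hA.herm.star_symm, h2]
  ring

theorem Eigen.refl_A {x v : V 𝕜} (hx : Eigen L H A' x) (hv : v ∈ L.V₁) :
    A' (refl d x v) = refl d x (A' v) := by
  have h2 : star (2 : 𝕜) = 2 := by rw [RCLike.star_def]; exact RCLike.conj_ofNat 2
  obtain ⟨s, hs, hAx⟩ := hx.exists_sign
  rw [hx.refl_eq hB hA, hx.refl_eq hB hA, map_sub, hA.A_smul hB _ hx.1, hAx, ← oR_smul (D := 𝕜),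
    smul_smul, herm_A_left hB hA hv hx.1 hAx, id, star_mul, h2]
  congr 2
  ring

theorem refls_props {m : List (V 𝕜)} (hm : ∀ x ∈ m, Eigen L H A' x) :
    (∀ v ∈ L.V₁, refls d m v ∈ L.V₁) ∧ (∀ v w, H (refls d m v) (refls d m w) = H v w) ∧
      ∀ v ∈ L.V₁, A' (refls d m v) = refls d m (A' v) := by
  induction m with
  | nil => exact ⟨fun v hv => hv, fun _ _ => rfl, fun _ _ => rfl⟩
  | cons x m ih =>
    obtain ⟨h1, h2, h3⟩ := ih fun y hy => hm y (by simp [hy])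
    have hx := hm x (by simp)
    refine ⟨fun v hv => hx.refl_mem hB hA (h1 v hv), fun v w =>
      (hx.refl_herm hB hA _ _).trans (h2 v w), fun v hv => ?_⟩
    change A' (refl d x (refls d m v)) = refl d x (refls d m (A' v))
    rw [hx.refl_A hB hA (h1 v hv), h3 v hv]

/-- Isometries for both forms are products of reflections in common eigenvectors. -/
theorem exists_refls {T : V 𝕜 ≃ₗ[𝕜] V 𝕜} (hTV : ∀ v ∈ L.V₁, T v ∈ L.V₁) (hTH : Pres H T)
    (hTA : ∀ v ∈ L.V₁, A' (T v) = T (A' v)) (l : List (V 𝕜)) (hl : ∀ x ∈ l, Eigen L H A' x)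
    (ho : l.Pairwise fun x y => H x y = 0) :
    ∃ m : List (V 𝕜), (∀ x ∈ m, Eigen L H A' x) ∧ m.length ≤ l.length ∧
      ∀ x ∈ l, refls d m (T x) = x := by
  induction l with
  | nil => exact ⟨[], by simp, le_rfl, by simp⟩
  | cons e l ih =>
    obtain ⟨m, h1, h2, h3⟩ := ih (fun x hx => hl x (by simp [hx])) (List.pairwise_cons.1 ho).2
    obtain ⟨hmV, hmH, hmA⟩ := refls_props hB hA h1
    have he := hl e (by simp)
    obtain ⟨s, hs, hAe⟩ := he.exists_sign
    set w := refls d m (T e) with hw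
    have hwV : w ∈ L.V₁ := hmV _ (hTV e he.1)
    have hww : H w w = 1 := by rw [hw, hmH, hTH, he.2.1]
    have hAw : A' w = s • w := by
      rw [hw, hmA _ (hTV e he.1), hTA e he.1, hAe, ← oR_smul (D := 𝕜), map_smul, ← oR_smul (D := 𝕜)]
      have hlin : ∀ (m : List (V 𝕜)) (c : 𝕜) (v : V 𝕜), refls d m (c • v) = c • refls d m v := by
        intro m c v
        induction m with
        | nil => rfl
        | cons x m ih =>
          change refl d x (refls d m (c • v)) = c • refl d x (refls d m v)
          rw [ih, refl, refl, hB.smul_right, smul_sub, smul_smul, id]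
          congr 2
          ring
      exact hlin m _ _
    have hwl : ∀ y ∈ l, H w y = 0 := by
      intro y hy
      rw [← h3 y hy, hw, hmH, hTH]
      exact (List.pairwise_cons.1 ho).1 y hy
    by_cases hwe : w = e
    · refine ⟨m, h1, h2.trans (by simp), fun x hx => ?_⟩
      rcases List.mem_cons.1 hx with rfl | hx
      · exact hwe
      · exact h3 x hx
    have hne : w - e ≠ 0 := sub_ne_zero.2 hwe
    have hmem : w - e ∈ L.V₁ := L.V₁.sub_mem hwV he.1
    obtain ⟨r, hr, hxx⟩ := hA.exists_unit hmem hne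
    set x := r • (w - e) with hxdef
    have hx : Eigen L H A' x := Eigen.of_sign (L.V₁.smul_of_tower_mem r hmem) hxx hs (by
      rw [hxdef, map_smul, map_sub, hAw, hAe, ← smul_sub, smul_comm])
    have hreal : H e w = H w e := by
      have h4 := herm_A_left hB hA hwV he.1 hAe
      rw [hAw, hA.herm.rsmul_left, hA.herm.star_symm] at h4
      have hs0 : oR 𝕜 s ≠ 0 := by
        rw [← map_zero (oR 𝕜), Ne, oR_inj]
        rintro rfl
        norm_num at hs
      exact (mul_left_cancel₀ hs0 h4).symm
    refine ⟨x :: m, ?_, by simpa using h2, fun y hy => ?_⟩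
    · intro y hy
      rcases List.mem_cons.1 hy with rfl | hy
      · exact hx
      · exact h1 y hy
    change refl d x (refls d m (T y)) = y
    rw [hx.refl_eq hB hA]
    rcases List.mem_cons.1 hy with rfl | hy
    · rw [← hw]
      have hc : 2 * H w x * oR 𝕜 r = 1 := by
        rw [← hxx, hxdef, hA.herm.rsmul_right, hA.herm.rsmul_left, hA.herm.rsmul_right,
          hA.herm.sub_right, hA.herm.sub_left, hA.herm.sub_right, hA.herm.sub_right, hww, he.2.1,
          hreal]
        ring
      have h5 : (2 * H w x) • x = (2 * H w x * oR 𝕜 r) • (w - y) := by rw [mul_smul _ (oR 𝕜 r), oR_smul]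
      rw [h5, hc, one_smul, sub_sub_cancel]
    · rw [h3 y hy]
      have : H y x = 0 := by
        rw [hxdef, hA.herm.rsmul_right, hA.herm.sub_right, hA.herm.eq_zero_symm (hwl y hy),
          hA.herm.eq_zero_symm ((List.pairwise_cons.1 ho).1 y hy), sub_zero, zero_mul]
      rw [this, mul_zero, zero_smul, sub_zero]

theorem norm_qprod {m : List (V 𝕜)} (hm : ∀ x ∈ m, Eigen L H A' x) : ‖qprod d m‖ = 1 := by
  induction m with
  | nil => simp [qprod]
  | cons x m ih =>
    have hx := hm x (by simp)
    obtain ⟨s, hs, -, h⟩ := hx.form_left hB hA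
    have h1 := ih fun y hy => hm y (by simp [hy])
    rw [qprod] at h1
    rw [qprod, List.map_cons, List.prod_cons, norm_mul, h1, h, hx.2.1, mul_one, mul_one, norm_oR]
    rcases mul_self_eq_one_iff.1 hs with rfl | rfl <;> simp

/-- Members of a spin group that preserve `H` are products of eigenvectors. -/
theorem spin_eq_smul_vprod {l : List (V 𝕜)} (hl : ∀ x ∈ l, Eigen L H A' x)
    (ho : l.Pairwise fun x y => H x y = 0) (hlL : L.V₁ = Submodule.span 𝕜 {x | x ∈ l})
    {u : (CliffordAlgebra (quad d))ˣ} (hu : u ∈ spinOfPiece d L) (huH : Pres H (spinAd d u)) :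
    ∃ (m : List (V 𝕜)) (b : 𝕜), (∀ x ∈ m, Eigen L H A' x) ∧ m.length ≤ l.length ∧ Even m.length ∧
      ‖b‖ = 1 ∧ b ^ 2 * qprod d m = 1 ∧ (u : CliffordAlgebra (quad d)) = b • vprod d m := by
  have hst := spinAd_stab hB hu
  obtain ⟨m, h1, h2, h3⟩ := exists_refls hB hA (fun v hv => (L.stab_iff _ v hst).1 hv) huH
    (fun v hv => hA.A_comm (fun x => L.stab_iff _ x hst) (spinAd_form hB hu.1) huH hv) l hl ho
  have hq := norm_qprod hB hA h1
  have hq0 : qprod d m ≠ 0 := norm_ne_zero_iff.1 (by rw [hq]; exact one_ne_zero)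
  have hui := spinGroup.involute_eq hu.1
  obtain ⟨c, hc⟩ := scalar_of_twisted_comm hB l (ortho_eigen hB hA hl ho)
    (z := vprod d m * u) (by
      rw [cliffAdjoin_span hB l hlL]
      exact Subalgebra.mul_mem _ (vprod_mem fun x hx => (h1 x hx).1) hu.2) fun x hx => by
    rw [map_mul, involute_vprod, hui, smul_mul_assoc, smul_mul_assoc, mul_assoc (vprod d m),
      spinAd_spec hu.1, ← mul_assoc (vprod d m), vprod_mul_ι hB hq0, h3 x hx, smul_mul_assoc, smul_smul,
      ← mul_pow, neg_one_mul, neg_neg, one_pow, one_smul, mul_assoc]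
  have hu1 : (u : CliffordAlgebra (quad d)) = ((qprod d m)⁻¹ * c) • vprod d m.reverse := by
    have h4 : reverse (vprod d m) = vprod d m.reverse := by
      rw [vprod, CliffordAlgebra.reverse_prod_map_ι, vprod, List.map_reverse]
    have h5 := congrArg (fun z => reverse (vprod d m) * z) hc
    rw [← mul_assoc, reverse_mul_vprod hB, ← Algebra.smul_def, ← Algebra.commutes, ← Algebra.smul_def, h4]
      at h5
    rw [mul_smul, ← h5, smul_smul, inv_mul_cancel₀ hq0, one_smul]
  set b := (qprod d m)⁻¹ * c
  have hr : ∀ x ∈ m.reverse, Eigen L H A' x := fun x hx => h1 x (List.mem_reverse.1 hx)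
  have hnt : (u : CliffordAlgebra (quad d)) ≠ 0 := u.ne_zero
  have hev : Even m.reverse.length := by
    by_contra hodd
    rw [hu1, map_smul, involute_vprod, (Nat.not_even_iff_odd.1 hodd).neg_one_pow, neg_one_smul, smul_neg,
      ← hu1, neg_eq_iff_add_eq_zero, ← two_smul 𝕜] at hui
    exact hnt ((smul_eq_zero.1 hui).resolve_left two_ne_zero)
  have hbq : b ^ 2 * qprod d m.reverse = 1 := by
    have h4 := spinGroup.star_mul_self_of_mem hu.1
    rw [hu1, CliffordAlgebra.star_smul, CliffordAlgebra.star_def, involute_vprod, hev.neg_one_pow,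
      one_smul, smul_mul_assoc, mul_smul_comm, reverse_mul_vprod hB, smul_smul, ← pow_two,
      Algebra.smul_def, ← map_mul] at h4
    exact algebraMap_cliff_inj (d := d) (h4.trans (map_one _).symm)
  refine ⟨m.reverse, b, hr, by simpa using h2, hev, ?_, hbq, hu1⟩
  have h4 := congrArg norm hbq
  rw [norm_mul, norm_pow, norm_qprod hB hA hr, mul_one, norm_one] at h4
  exact (pow_eq_one_iff_of_nonneg (norm_nonneg b) two_ne_zero).1 h4

end Reflections

section SpinRep

variable {𝕜 : Type} [RCLike 𝕜] {d : ℕ → 𝕜}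

/-- The topology of the spin groups. -/
@[reducible] def spinTop (d : ℕ → 𝕜) : TopologicalSpace (CliffordAlgebra (quad d))ˣ :=
  dualTop (F := 𝕜)

attribute [local instance] spinTop

variable (hB : IsForm (form (diag d) id) id 1)
include hB

theorem isCompact_eigen {L : Piece (form (diag d) id)} {H : V 𝕜 → V 𝕜 → 𝕜} {A' : V 𝕜 →ₗ[ℝ] V 𝕜}
    (hA : Adm (form (diag d) id) 1 L.V₁ L.C H A') {l : List (V 𝕜)} (hl : ∀ x ∈ l, Eigen L H A' x)
    (ho : l.Pairwise fun x y => H x y = 0) :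
    IsCompact {c : Fin l.length → 𝕜 | Eigen L H A' (Fintype.linearCombination 𝕜 l.get c)} := by
  set E := Fintype.linearCombination 𝕜 l.get with hE
  have hEV : ∀ c, E c ∈ L.V₁ := fun c => by
    rw [hE, Fintype.linearCombination_apply]
    exact L.V₁.sum_mem fun i _ => L.V₁.smul_mem _ (hl _ (l.get_mem i)).1
  have hij : ∀ i j, H (l.get i) (l.get j) = if i = j then 1 else 0 := by
    intro i j
    split_ifs with h
    · rw [h]; exact (hl _ (l.get_mem j)).2.1
    · have := List.pairwise_iff_get.1 ho
      rcases lt_or_gt_of_ne h with h | h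
      · exact this i j h
      · exact hA.herm.eq_zero_symm (this j i h)
  have hH : ∀ c, H (E c) (E c) = 1 ↔ ∑ i, ‖c i‖ ^ 2 = 1 := by
    intro c
    have : H (E c) (E c) = oR 𝕜 (∑ i, ‖c i‖ ^ 2) := by
      rw [hE, Fintype.linearCombination_apply, hA.herm.sum_left, map_sum]
      refine Finset.sum_congr rfl fun i _ => ?_
      rw [hA.herm.smul_left, hA.herm.sum_right, Finset.sum_eq_single i]
      · rw [hA.herm.smul_right, hij, if_pos rfl, one_mul, mul_star]
      · intro j _ hj
        rw [hA.herm.smul_right, hij, if_neg (Ne.symm hj), zero_mul]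
      · simp
    rw [this, ← map_one (oR 𝕜), oR_inj]
  have hcl : ∀ φ : (Fin l.length → 𝕜) →ₗ[ℝ] V 𝕜, IsClosed {c | φ c = 0} := fun φ =>
    (LinearMap.ker φ).closed_of_finiteDimensional
  have e : {c | Eigen L H A' (E c)} = {c | ∑ i, ‖c i‖ ^ 2 = 1} ∩
      ({c | (A' ∘ₗ E.restrictScalars ℝ - E.restrictScalars ℝ) c = 0} ∪
        {c | (A' ∘ₗ E.restrictScalars ℝ + E.restrictScalars ℝ) c = 0}) := by
    ext c
    simp only [Eigen, Set.mem_setOf_eq, Set.mem_inter_iff, Set.mem_union, hEV c, true_and, hH]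
    refine and_congr_right fun _ => or_congr ?_ ?_
    · exact sub_eq_zero.symm
    · exact (add_eq_zero_iff_eq_neg).symm
  rw [e]
  refine Metric.isCompact_of_isClosed_isBounded (IsClosed.inter (isClosed_eq (by fun_prop)
    continuous_const) ((hcl _).union (hcl _))) ?_
  refine (Metric.isBounded_closedBall (x := 0) (r := 1)).subset fun c hc => ?_
  rw [mem_closedBall_zero_iff, pi_norm_le_iff_of_nonneg zero_le_one]
  intro i
  have h1 : ‖c i‖ ^ 2 ≤ ∑ i, ‖c i‖ ^ 2 :=
    Finset.single_le_sum (f := fun i => ‖c i‖ ^ 2) (fun i _ => by positivity) (Finset.mem_univ i)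
  rw [hc.1] at h1
  exact (sq_le_one_iff₀ (norm_nonneg _)).1 h1

theorem isCompact_spin {L : Piece (form (diag d) id)} {H : V 𝕜 → V 𝕜 → 𝕜} {A' : V 𝕜 →ₗ[ℝ] V 𝕜}
    (hA : Adm (form (diag d) id) 1 L.V₁ L.C H A') :
    IsCompact {u | u ∈ spinOfPiece d L ∧ Pres H (spinAd d u)} := by
  obtain ⟨l, hl, ho, hlL⟩ := exists_eigenbasis hB hA
  have hS := isCompact_eigen hB hA hl ho
  set E := Fintype.linearCombination 𝕜 l.get with hE
  set S := {c : Fin l.length → 𝕜 | Eigen L H A' (E c)}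
  have hsurj : ∀ x ∈ L.V₁, ∃ c, E c = x := by
    intro x hx
    rw [hlL, ← Set.range_list_get, ← Fintype.range_linearCombination] at hx
    exact hx
  let vec : ∀ {k : ℕ}, (Fin k → Fin l.length → 𝕜) → List (V 𝕜) := fun c => List.ofFn fun i => E (c i)
  let z : ∀ {k : ℕ}, 𝕜 × (Fin k → Fin l.length → 𝕜) → CliffordAlgebra (quad d) :=
    fun p => p.1 • vprod d (vec p.2)
  have hz : ∀ k, FinCont (𝕜 := 𝕜) (z (k := k)) := by
    intro k
    have h1 : ∀ i : Fin k, FinCont (𝕜 := 𝕜) fun p : 𝕜 × (Fin k → Fin l.length → 𝕜) => E (p.2 i) := by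
      intro i
      simp only [hE, Fintype.linearCombination_apply]
      exact FinCont.sum _ fun j _ => FinCont.smul _ (by fun_prop) _
    have h2 := (FinCont.smul (E := CliffordAlgebra (quad d))
      (fun p : 𝕜 × (Fin k → Fin l.length → 𝕜) => p.1) continuous_fst 1).mul
      (FinCont.vprod (d := d) h1)
    simpa only [smul_one_mul] using h2
  let P : ∀ k : ℕ, Set (𝕜 × (Fin k → Fin l.length → 𝕜)) := fun k =>
    (Metric.sphere 0 1 ×ˢ Set.univ.pi fun _ => S) ∩ {p | reverse (z p) * z p = 1}
  have hrev : ∀ {k} (p : 𝕜 × (Fin k → Fin l.length → 𝕜)), reverse (z p) * z p = 1 ↔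
      p.1 ^ 2 * qprod d (vec p.2) = 1 := by
    intro k p
    change reverse (p.1 • vprod d (vec p.2)) * (p.1 • vprod d (vec p.2)) = 1 ↔ _
    rw [map_smul, smul_mul_assoc, mul_smul_comm, reverse_mul_vprod hB, smul_smul, ← pow_two,
      Algebra.smul_def, ← map_mul, ← map_one (algebraMap 𝕜 _)]
    exact ⟨algebraMap_cliff_inj, fun h => by rw [h]⟩
  let C : ℕ → Set (CliffordAlgebra (quad d))ˣ := fun k =>
    {u | (u ∈ spinOfPiece d L ∧ Pres H (spinAd d u)) ∧ ∃ p ∈ P k, (u : CliffordAlgebra (quad d)) = z p}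
  have hC : ∀ k, Even k → IsCompact (C k) := by
    intro k hk
    have hP : IsCompact (P k) := ((isCompact_sphere 0 1).prod (isCompact_univ_pi fun _ => hS)).inter_right
      ((((hz k).map reverse).mul (hz k)).isClosed_eq 1)
    have hex : ∀ p : P k, ∃ u : (CliffordAlgebra (quad d))ˣ,
        (u ∈ spinOfPiece d L ∧ Pres H (spinAd d u)) ∧ (u : CliffordAlgebra (quad d)) = z p.1 := by
      rintro ⟨p, hp, hpz⟩
      have hv : ∀ x ∈ vec p.2, Eigen L H A' x := by
        intro x hx
        obtain ⟨i, rfl⟩ := (List.mem_ofFn' _ _).1 hx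
        exact hp.2 i (Set.mem_univ i)
      obtain ⟨u, hu, hup, had⟩ := exists_spin hB (fun x hx => (hv x hx).1)
        (by rwa [List.length_ofFn]) ((hrev p).1 hpz)
      refine ⟨u, ⟨hu, fun v w => ?_⟩, hup⟩
      rw [had, had, (refls_props hB hA hv).2.1]
    choose g hg using hex
    haveI := isCompact_iff_compactSpace.1 hP
    have hgc : Continuous g := FinCont.continuous_units (f := fun p : P k => z p.1)
      ((hz k).comp continuous_subtype_val) fun p => (hg p).2
    convert! isCompact_range hgc
    ext u
    constructor
    · rintro ⟨-, p, hp, hup⟩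
      exact ⟨⟨p, hp⟩, Units.ext ((hg _).2.trans hup.symm)⟩
    · rintro ⟨p, rfl⟩
      exact ⟨(hg p).1, p.1, p.2, (hg p).2⟩
  suffices hU : {u | u ∈ spinOfPiece d L ∧ Pres H (spinAd d u)} =
      ⋃ k ∈ (Finset.range (l.length + 1)).filter Even, C k by
    rw [hU]
    exact Finset.isCompact_biUnion _ fun k hk => hC k (Finset.mem_filter.1 hk).2
  refine Set.Subset.antisymm (fun u hu => Set.mem_iUnion₂.2 ?_)
    (Set.iUnion₂_subset fun k _ u hu => hu.1)
  obtain ⟨m, b, h1, h2, h3, h4, h5, h6⟩ := spin_eq_smul_vprod hB hA hl ho hlL hu.1 hu.2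
  choose f hf using hsurj
  have hvec : vec (fun i : Fin m.length => f (m.get i) (h1 _ (m.get_mem i)).1) = m := by
    change List.ofFn (fun i => E _) = m
    simp only [hf]
    exact List.ofFn_get m
  have hzu : (u : CliffordAlgebra (quad d)) =
      z (b, fun i : Fin m.length => f (m.get i) (h1 _ (m.get_mem i)).1) := by
    rw [h6]
    change _ = b • vprod d (vec _)
    rw [hvec]
  refine ⟨m.length, Finset.mem_filter.2 ⟨Finset.mem_range.2 (Nat.lt_succ_of_le h2), h3⟩, hu, _,
    ⟨⟨mem_sphere_zero_iff_norm.2 h4, fun i _ => ?_⟩, ?_⟩, hzu⟩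
  · change Eigen L H A' (E _)
    rw [hf]
    exact h1 _ (m.get_mem i)
  · refine (hrev _).2 ?_
    rw [hvec]
    exact h5

theorem spinAd_cont (L : Piece (form (diag d) id)) (i j : ℕ) :
    ContinuousOn (fun u => spinAd d u (Finsupp.single i 1) j)
      (spinOfPiece d L : Set (CliffordAlgebra (quad d))ˣ) := by
  obtain ⟨l, hl, hlL⟩ := L.exists_ortho hB
  haveI : FiniteDimensional 𝕜 (Subalgebra.toSubmodule (cliffAdjoin d L.V₁)) := by
    rw [← hlL]
    exact finite_cliffAdjoin hB l hl
  rw [continuousOn_iff_continuous_restrict]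
  have h1 := FinCont.subtype (Subalgebra.toSubmodule (cliffAdjoin d L.V₁))
    (spinOfPiece d L : Set (CliffordAlgebra (quad d))ˣ) fun u hu => hu.2
  have h2 := (h1.mul (FinCont.const (ι (quad d) (Finsupp.single i 1)))).mul
    (h1.map (reverse ∘ₗ involute.toLinearMap))
  refine (h2.continuous (Finsupp.lapply j ∘ₗ vecPart d)).congr fun u => ?_
  have h3 : (u.1 : CliffordAlgebra (quad d)) * ι (quad d) (Finsupp.single i 1) *
      star (u.1 : CliffordAlgebra (quad d)) = ι (quad d) (spinAd d u.1 (Finsupp.single i 1)) := by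
    rw [spinAd_spec u.2.1, mul_assoc, spinGroup.mul_star_self_of_mem u.2.1, mul_one]
  exact DFunLike.congr_fun ((congrArg (vecPart d) h3).trans (vecPart_ι _)) j

theorem rep_spin : Rep id 1 (spinOfPiece d) (spinAd d) where
  form := hB
  mono L L' h u hu := ⟨hu.1, Algebra.adjoin_mono (Set.image_mono h.1) hu.2⟩
  ad_mul L g hg g' hg' := LinearEquiv.ext fun v => spinAd_eq (mul_mem hg.1 hg'.1) <| by
    rw [Units.val_mul, mul_assoc, spinAd_spec hg'.1, ← mul_assoc, spinAd_spec hg.1, mul_assoc]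
    rfl
  ad_stab L g hg := spinAd_stab hB hg
  ad_B L g hg := spinAd_form hB hg.1
  ad_cont L i j := spinAd_cont hB L i j
  compact L H A' hA := isCompact_spin hB hA

end SpinRep

section SpinTransport

variable {𝕜 : Type} [RCLike 𝕜] {d : ℕ → 𝕜}

attribute [local instance] spinTop

section Map

variable {φ : CliffordAlgebra (quad d) ≃ₐ[𝕜] CliffordAlgebra (quad d)} {T : V 𝕜 ≃ₗ[𝕜] V 𝕜}
  (hφ : ∀ v, φ (ι (quad d) v) = ι (quad d) (T v))
include hφ

theorem cliffMap_star (z : CliffordAlgebra (quad d)) : φ (star z) = star (φ z) := by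
  induction z using CliffordAlgebra.induction with
  | algebraMap r =>
    rw [CliffordAlgebra.star_algebraMap, AlgEquiv.commutes, CliffordAlgebra.star_algebraMap]
  | ι v => rw [CliffordAlgebra.star_ι, map_neg, hφ, CliffordAlgebra.star_ι]
  | mul a b ha hb => rw [star_mul, map_mul, ha, hb, map_mul, star_mul]
  | add a b ha hb => rw [star_add, map_add, ha, hb, map_add, star_add]

theorem cliffMap_mem {L : Piece (form (diag d) id)} {hT : Pres (form (diag d) id) T}
    {hd : DualPres T⁻¹} {u : (CliffordAlgebra (quad d))ˣ} (hu : u ∈ spinOfPiece d L) :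
    Units.mapEquiv φ.toMulEquiv u ∈ spinOfPiece d (L.map T hT hd) := by
  have h1 : lipschitzGroup (quad d) ≤
      (lipschitzGroup (quad d)).comap (Units.mapEquiv φ.toMulEquiv).toMonoidHom := by
    rw [lipschitzGroup, Subgroup.closure_le]
    rintro w ⟨v, hv⟩
    refine Subgroup.subset_closure ⟨T v, ?_⟩
    change _ = φ (w : CliffordAlgebra (quad d))
    rw [← hφ, hv]
  have h2 : ∀ z ∈ CliffordAlgebra.evenOdd (quad d) 0, φ z ∈ CliffordAlgebra.evenOdd (quad d) 0 := by
    intro z hz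
    induction z, hz using CliffordAlgebra.even_induction with
    | algebraMap r =>
      rw [AlgEquiv.commutes]
      exact Subalgebra.algebraMap_mem (CliffordAlgebra.even (quad d)) r
    | add _ _ _ _ ha hb => rw [map_add]; exact Submodule.add_mem _ ha hb
    | ι_mul_ι_mul a b z hz ih =>
      rw [map_mul, map_mul, hφ, hφ]
      exact Subalgebra.mul_mem (CliffordAlgebra.even (quad d))
        (CliffordAlgebra.ι_mul_ι_mem_evenOdd_zero _ _ _) ih
  have h3 : cliffAdjoin d L.V₁ ≤ (cliffAdjoin d (L.map T hT hd).V₁).comap φ.toAlgHom := by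
    refine Algebra.adjoin_le ?_
    rintro _ ⟨v, hv, rfl⟩
    change φ (ι (quad d) v) ∈ cliffAdjoin d (L.map T hT hd).V₁
    rw [hφ]
    exact Algebra.subset_adjoin ⟨T v, ⟨v, hv, rfl⟩, rfl⟩
  refine ⟨⟨pinGroup.units_mem_iff.2 ⟨h1 (spinGroup.units_mem_lipschitzGroup hu.1), ?_, ?_⟩,
    h2 _ hu.1.2⟩, h3 hu.2⟩
  · change star (φ (u : CliffordAlgebra (quad d))) * φ (u : CliffordAlgebra (quad d)) = 1
    rw [← cliffMap_star hφ, ← map_mul, spinGroup.star_mul_self_of_mem hu.1, map_one]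
  · change φ (u : CliffordAlgebra (quad d)) * star (φ (u : CliffordAlgebra (quad d))) = 1
    rw [← cliffMap_star hφ, ← map_mul, spinGroup.mul_star_self_of_mem hu.1, map_one]

omit hφ in
theorem continuous_cliffMap : Continuous (Units.mapEquiv φ.toMulEquiv) :=
  continuous_to_dual fun f => continuous_dual (f ∘ₗ φ.toLinearMap)

end Map

theorem transport_spin : Transport (spinOfPiece d) (spinAd d) := by
  intro T hT hd hd'
  let e : (quad d).IsometryEquiv (quad d) :=
    { T with map_app' := fun v => by rw [quad_apply, quad_apply]; exact hT v v }
  let φ := CliffordAlgebra.equivOfIsometry e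
  have hφ : ∀ v, φ (ι (quad d) v) = ι (quad d) (T v) := fun v => CliffordAlgebra.map_apply_ι _ v
  have hφ' : ∀ v, φ.symm (ι (quad d) v) = ι (quad d) (T⁻¹ v) := fun v => by
    rw [AlgEquiv.symm_apply_eq, hφ]
    exact congrArg _ (T.apply_symm_apply v).symm
  refine ⟨Units.mapEquiv φ.toMulEquiv, pieceEquiv T hT hd hd', continuous_cliffMap,
    continuous_cliffMap (φ := φ.symm), fun L => ?_, fun L g hg => ?_⟩
  · ext u
    constructor
    · intro hu
      have hi : DualPres T⁻¹⁻¹ := by rwa [inv_inv]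
      have h1 : (L.map T hT hd').map T⁻¹ hT.inv hi = L := (pieceEquiv T hT hd hd').left_inv L
      have h2 := cliffMap_mem hφ' (L := L.map T hT hd') (hT := hT.inv) (hd := hi) hu
      rw [h1] at h2
      exact ⟨_, h2, (Units.mapEquiv φ.toMulEquiv).apply_symm_apply u⟩
    · rintro ⟨u, hu, rfl⟩
      exact cliffMap_mem hφ (hT := hT) (hd := hd') hu
  · refine LinearEquiv.ext fun v => spinAd_eq (cliffMap_mem hφ (hT := hT) (hd := hd') hg).1 ?_
    change φ _ * _ = ι (quad d) (T (spinAd d g (T.symm v))) * φ _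
    rw [← hφ, ← map_mul, ← spinAd_spec hg.1, map_mul, hφ, T.apply_symm_apply]

/-- It suffices to prove rigidity for groups between the spin groups and their identity
components. -/
theorem conj_spin (hB : IsForm (form (diag d) id) id 1) (hN : NormalForm (form (diag d) id) 1)
    (hR : ∀ Γ : Piece (form (diag d) id) → Subgroup (CliffordAlgebra (quad d))ˣ,
      (∀ L, idComponent (spinOfPiece d L) ≤ Γ L) → (∀ L, Γ L ≤ spinOfPiece d L) →
        ∀ R : Rep id 1 Γ (spinAd d), ∃ F, Rigid R F) :
    (spinSystem d).Conj ∧ (spinSystem d).connected.Conj := by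
  have R := rep_spin hB
  have T := transport_spin (d := d)
  constructor
  · obtain ⟨F, hF⟩ := hR _ (fun L => idComponent_le _) (fun L => le_rfl) R
    exact hF.conjugate T hN
  · obtain ⟨F, hF⟩ := hR _ (fun L => le_rfl) (fun L => idComponent_le _)
      (R.connected continuous_mul_right_dual)
    exact hF.conjugate (Transport.connected T) hN

end SpinTransport

section SpinFlips

variable {𝕜 : Type} [RCLike 𝕜] {d : ℕ → 𝕜} (hB : IsForm (form (diag d) id) id 1)
include hB

attribute [local instance] spinTop

/-- Elements of the spin groups on a path in a plane. -/
theorem exists_spin_path {L : Piece (form (diag d) id)} {H : V 𝕜 → V 𝕜 → 𝕜} {A' : V 𝕜 →ₗ[ℝ] V 𝕜}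
    (hA : Adm (form (diag d) id) 1 L.V₁ L.C H A') {x y : V 𝕜} (hx : x ∈ L.V₁) (hy : y ∈ L.V₁)
    (hxx : H x x = 1) (hyy : H y y = 1) (hxy : H x y = 0) {s s' : ℝ} (hs : s * s = 1)
    (hAx : A' x = s • x) (hAy : A' y = s' • y) {f g : ℝ → ℝ} (hf : Continuous f)
    (hg : Continuous g) (hfg : ∀ t, f t ^ 2 * s + g t ^ 2 * s' = s) (hf0 : f 0 = s) (hg0 : g 0 = 0)
    (t : ℝ) : ∃ u ∈ idComponent (spinOfPiece d L), ∀ (v : V 𝕜) (k : 𝕜),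
      k = oR 𝕜 (f t) * H v x + oR 𝕜 (s * s' * g t) * H v y →
        spinAd d u v = v - (2 * k) • (f t • x + g t • y) - (2 * (H v x - 2 * k * oR 𝕜 (f t))) • x := by
  set w : ℝ → V 𝕜 := fun t => oR 𝕜 (f t) • x + oR 𝕜 (g t) • y with hw
  have hyx := hA.herm.eq_zero_symm hxy
  have hxE : Eigen L H A' x := Eigen.of_sign hx hxx hs hAx
  have hBx : ∀ v, form (diag d) id x v = oR 𝕜 s * H v x := fun v => by
    rw [form_symm hB, hA.B_eigen_left hB hx hAx]
  have hBy : ∀ v, form (diag d) id y v = oR 𝕜 s' * H v y := fun v => by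
    rw [form_symm hB, hA.B_eigen_left hB hy hAy]
  have hBw : ∀ t v, form (diag d) id (w t) v =
      oR 𝕜 (f t) * (oR 𝕜 s * H v x) + oR 𝕜 (g t) * (oR 𝕜 s' * H v y) := fun t v => by
    rw [hw, hB.add_left, hB.smul_left, hB.smul_left, hBx, hBy]
  have hww : ∀ t, form (diag d) id (w t) (w t) = oR 𝕜 s := fun t => by
    rw [hBw, hw]
    simp only
    rw [hA.herm.add_left, hA.herm.add_left, hA.herm.smul_left, hA.herm.smul_left, hA.herm.smul_left,
      hA.herm.smul_left, hxx, hyy, hxy, hyx]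
    have := congrArg (oR 𝕜) (hfg t)
    simp only [map_add, map_mul, map_pow] at this
    linear_combination this
  have hsp : ∀ t, ∃ u ∈ spinOfPiece d L, (u : CliffordAlgebra (quad d)) =
      (1 : 𝕜) • vprod d [x, w t] ∧ ∀ v, spinAd d u v = refls d [x, w t] v := fun t => by
    refine exists_spin hB ?_ even_two ?_
    · intro z hz
      rcases List.mem_pair.1 hz with rfl | rfl
      · exact hx
      · exact L.V₁.add_mem (L.V₁.smul_mem _ hx) (L.V₁.smul_mem _ hy)
    · simp only [qprod, List.map_cons, List.map_nil, List.prod_cons, List.prod_nil, hww, hBx, hxx,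
        mul_one, one_pow, one_mul]
      rw [← map_mul, hs, map_one]
  choose u hu huw had using hsp
  have hv : ∀ t, vprod d [x, w t] = ι (quad d) x * ι (quad d) (w t) := fun t => by simp [vprod]
  have hc : Continuous u := by
    have h1 : FinCont (𝕜 := 𝕜) w :=
      (FinCont.smul _ ((RCLike.continuous_ofReal).comp hf) x).add _ _
        (FinCont.smul _ ((RCLike.continuous_ofReal).comp hg) y)
    exact ((FinCont.const (ι (quad d) x)).mul (h1.map (ι (quad d)))).continuous_units fun t => by
      rw [huw, one_smul, hv]
  have h0 : u 0 = 1 := by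
    refine Units.ext ?_
    rw [huw, one_smul, hv, hw]
    simp only
    rw [hf0, hg0, map_zero, zero_smul, add_zero, map_smul, mul_smul_comm, ι_sq_form hB, hBx, hxx,
      mul_one, Algebra.smul_def, ← map_mul, ← map_mul, hs, map_one, map_one]
    rfl
  refine ⟨u t, mem_idComponent_of_path hc h0 hu t, fun v k hk => ?_⟩
  have hs0 : oR 𝕜 s * oR 𝕜 s = 1 := by rw [← map_mul, hs, map_one]
  have hs1 : oR 𝕜 s ≠ 0 := left_ne_zero_of_mul_eq_one hs0
  have hk' : 2 * form (diag d) id (w t) v / oR 𝕜 s = 2 * k := by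
    rw [hBw, hk, div_eq_iff hs1]
    simp only [map_mul]
    linear_combination (-2 * oR 𝕜 s' * oR 𝕜 (g t) * H v y) * hs0
  have hwx : H (w t) x = oR 𝕜 (f t) := by
    rw [hw]
    simp only
    rw [hA.herm.add_left, hA.herm.smul_left, hA.herm.smul_left, hxx, hyx, mul_zero, add_zero, mul_one]
  rw [had]
  change refl d x (refl d (w t) v) = _
  rw [hxE.refl_eq hB hA, refl, hww, hk', hA.herm.sub_left, hA.herm.smul_left, hwx, hw]
  simp only [oR_smul]

theorem hasFlips_spin : HasFlips (fun L => idComponent (spinOfPiece d L)) (spinAd d) := by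
  intro L H A' hA x hx y hy hxx hyy hxy s hs hAx hAy
  obtain ⟨u, hu, had⟩ := exists_spin_path hB hA hx hy hxx hyy hxy hs hAx hAy
    (f := fun t => s * Real.cos t) (g := fun t => s * Real.sin t) (by fun_prop) (by fun_prop)
    (fun t => by
      have := Real.cos_sq_add_sin_sq t
      linear_combination (s * s * s) * this + s * hs) (by simp) (by simp) (Real.pi / 2)
  have hyx := hA.herm.eq_zero_symm hxy
  have key : ∀ v, spinAd d u v = v - (2 * H v y) • y - (2 * H v x) • x := by
    intro v
    rw [had v _ rfl]
    simp only [Real.cos_pi_div_two, Real.sin_pi_div_two, mul_zero, map_zero, zero_mul, zero_add,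
      mul_one, zero_smul, sub_zero, hs, one_mul]
    rw [← oR_smul (D := 𝕜) s y, smul_smul]
    have : oR 𝕜 s * oR 𝕜 s = 1 := by rw [← map_mul, hs, map_one]
    congr 3
    linear_combination (2 * H v y) * this
  refine ⟨u, hu, ?_, ?_, ?_, fun v h1 h2 => ?_⟩
  · have h3 : ∀ v, spinAd d u v = refl d x (refl d y v) := fun v => by
      rw [(Eigen.of_sign hx hxx hs hAx).refl_eq hB hA, (Eigen.of_sign hy hyy hs hAy).refl_eq hB hA, key,
        hA.herm.sub_left, hA.herm.smul_left, hyx, mul_zero, sub_zero]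
    intro v w
    rw [h3, h3, (Eigen.of_sign hx hxx hs hAx).refl_herm hB hA,
      (Eigen.of_sign hy hyy hs hAy).refl_herm hB hA]
  · rw [key, hxx, hxy, mul_zero, zero_smul, sub_zero, mul_one, two_smul]
    abel
  · rw [key, hyy, hyx, mul_zero, zero_smul, sub_zero, mul_one, two_smul]
    abel
  · rw [key, h1, h2, mul_zero, zero_smul, zero_smul, sub_zero, sub_zero]

omit hB in
theorem hasBoosts_spin {d : ℕ → ℝ} (hB : IsForm (form (diag d) id) id 1) :
    HasBoosts (fun L => idComponent (spinOfPiece d L)) (spinAd d) := by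
  intro L H A' hA x hx y hy hxx hyy s hs hAx hAy
  have hxy := hA.eigen_orth hB id_eq_star hs hx hy hAx hAy
  have hyx := hA.herm.eq_zero_symm hxy
  obtain ⟨u, hu, had⟩ := exists_spin_path hB hA hx hy hxx hyy hxy hs hAx hAy
    (f := fun t => s * Real.sqrt (1 + t ^ 2)) (g := fun t => t) (by fun_prop) (by fun_prop)
    (fun t => by
      have := Real.sq_sqrt (show 0 ≤ 1 + t ^ 2 by positivity)
      linear_combination (s * s * s) * this + (s * (1 + t ^ 2)) * hs) (by simp) rfl
      (-s * Real.sqrt (1 / 8))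
  have h8 := Real.sq_sqrt (show (0 : ℝ) ≤ 1 / 8 by norm_num)
  have h9 : Real.sqrt (1 + (-s * Real.sqrt (1 / 8)) ^ 2) = 3 * Real.sqrt (1 / 8) := by
    rw [Real.sqrt_eq_iff_mul_self_eq (by positivity) (by positivity)]
    linear_combination (s * s - 9) * h8 + (1 / 8) * hs
  simp only [h9] at had
  set r := Real.sqrt (1 / 8)
  have hr : ∀ a : ℝ, oR ℝ a = a := fun _ => rfl
  refine ⟨u, hu, ?_, ?_, fun v h1 h2 => ?_⟩
  · rw [had x _ rfl, hxx, hxy]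
    simp only [hr]
    match_scalars
    · linear_combination (36 * s * s * 2 / 4) * h8 + 9 / 4 * hs
    · linear_combination (6 * s * s) * h8 + 3 / 4 * hs
  · rw [had y _ rfl, hyy, hyx]
    simp only [hr]
    match_scalars
    · linear_combination (2 * s ^ 4) * h8 + (1 / 4 * (s * s + 1)) * hs
    · linear_combination (6 * s ^ 4) * h8 + (3 / 4 * (s * s + 1)) * hs
  · rw [had v _ rfl, h1, h2]
    simp

end SpinFlips

section SpinConj

attribute [local instance] spinTop

theorem conj_spinC : (spinSystem (F := ℂ) fun _ => 1).Conj ∧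
    (spinSystem (F := ℂ) fun _ => 1).connected.Conj :=
  conj_spin isForm_soC normalForm_soC fun Γ hΓ _ R =>
    rigid_of_flips_soC R fun L H A' hA x hx y hy hxx hyy hxy s hs hAx hAy => by
      obtain ⟨g, hg, h1⟩ := hasFlips_spin isForm_soC L H A' hA x hx y hy hxx hyy hxy s hs hAx hAy
      exact ⟨g, hΓ L hg, h1⟩

theorem conj_spinR (ε : ℕ → ℤˣ) : (spinSystem (F := ℝ) fun i => ((ε i : ℤ) : ℝ)).Conj ∧
    (spinSystem (F := ℝ) fun i => ((ε i : ℤ) : ℝ)).connected.Conj := by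
  have hB := isForm_sign id_eq_star ε
  refine conj_spin hB (normalForm_sign id_eq_star ε) fun Γ hΓ hΓ' R =>
    HasFlips.rigid_sign ?_ ?_ fun L k hk h1 g _ => ?_
  · intro L H A' hA x hx y hy hxx hyy hxy s hs hAx hAy
    obtain ⟨g, hg, h1⟩ := hasFlips_spin hB L H A' hA x hx y hy hxx hyy hxy s hs hAx hAy
    exact ⟨g, hΓ L hg, h1⟩
  · intro L H A' hA f hf e he hff hee s hs hAf hAe
    obtain ⟨g, hg, h1⟩ := hasBoosts_spin hB L H A' hA f hf e he hff hee s hs hAf hAe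
    exact ⟨g, hΓ L hg, h1⟩
  · obtain ⟨l, hl, hlL⟩ := L.exists_ortho hB
    exact spin_ker_central hB hl hlL (hΓ' L hk) h1 g

end SpinConj

end LimGroups

end

open LimGroups in
/-- Any two maximal lim-compact subgroups of a classical direct limit group `G` are conjugate under
the group of automorphisms of the topological group `G`.  Here `G = lim Gₙ`, where the `Gₙ` are
the classical groups in the list or, alternatively, their identity components. -/
theorem lemma3p2 (c : LimGroups.Classical) (S : LimGroups.LimSystem)
    (hS : S = c.system ∨ S = c.system.connected)
    (K K' : Subgroup S.G)
    (hK : IsMaximalLimCompact S K) (hK' : IsMaximalLimCompact S K') :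
    ∃ γ : S.G ≃* S.G,
      @Continuous _ _ S.limTop S.limTop γ ∧ @Continuous _ _ S.limTop S.limTop γ.symm ∧
        K.map γ.toMonoidHom = K' := by
  have key : c.system.Conj ∧ c.system.connected.Conj := by
    cases c with
    | glR => exact conj_gl continuous_rhoR
    | glC => exact conj_gl continuous_rhoC
    | glH => exact conj_gl continuous_rhoH
    | slR => exact conj_gl continuous_rhoR
    | slC => exact conj_gl continuous_rhoC
    | slH => exact conj_gl continuous_rhoH
    | u ε => exact conj_unitary continuous_rhoC (fun _ => rfl) ε Complex.I_mul_I Complex.conj_I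
    | su ε => exact conj_unitary continuous_rhoC (fun _ => rfl) ε Complex.I_mul_I Complex.conj_I
    | soC => exact conj_soC continuous_rhoC
    | so ε => exact conj_so continuous_rhoR ε
    | soStar => exact conj_soStar continuous_rhoH
    | spinC => exact conj_spinC
    | spin ε => exact conj_spinR ε
    | spC => exact conj_symplectic continuous_rhoC
    | spR => exact conj_symplectic continuous_rhoR
    | sp ε => exact conj_unitary continuous_rhoH (fun _ => rfl) ε quatI_mul_self star_quatI
  rcases hS with rfl | rfl
  · exact key.1 K K' hK hK'
  · exact key.2 K K' hK hK'
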